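/- Let $\alpha:R\to A$ and $\beta:S\to B$ be homomorphisms of unital associative (not necessarily commutative) rings; $A$-modules and $B$-modules are regarded as $R$-modules and $S$-modules through $\alpha$ and $\beta$. Let $T$ be a $B$-$A$ bimodule which is a progenerator (finitely generated projective generator) as a right $A$-module, and such that $B=\mathrm{End}_A(T)$, i.e. the map $B\to \mathrm{End}_A(T)$, $b\mapsto [x\mapsto bx]$, is an isomorphism. **Definitions.** A *formal dual* of $T$ is an $A$-$B$ bimodule $\widehat T$ with an $A$-bimodule map $\mathrm{ev}:\widehat T\otimes_S T\to A$ and a $B$-bimodule map $\widehat{\mathrm{ev}}:T\otimes_R\widehat T\to B$ such that $\widehat{\mathrm{ev}}(x\otimes\hat x)\,y=x\,\mathrm{ev}(\hat x\otimes y)$ and $\hat x\,\widehat{\mathrm{ev}}(x\otimes\hat y)=\mathrm{ev}(\hat x\otimes x)\,\hat y$ for all $x,y\in T$, $\hat x,\hat y\in\widehat T$. $T$ is a *bimodule herd* if it has a formal dual $\widehat T$ (its *pen*) and an $S$-$R$ bimodule map $\gamma:T\to T\otimes_R\widehat T\otimes_S T$ (a *shepherd*) such that, for all $x\in T$, $(\widehat{\mathrm{ev}}\otimes_S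 T)(\gamma(x))=1_B\otimes_S x$ in $B\otimes_S T$, $(T\otimes_R\mathrm{ev})(\gamma(x))=x\otimes_R 1_A$ in $T\otimes_R A$, and $(\gamma\otimes_R\widehat T\otimes_S T)\circ\gamma=(T\otimes_R\widehat T\otimes_S\gamma)\circ\gamma$. The herd is *tame* if moreover $\mathrm{ev}$ and $\widehat{\mathrm{ev}}$ are surjective and $T$ is faithfully flat as a right $R$-module and as a left $S$-module. A *right entwining* over $R$ of $A$ with an $R$-coring $C$ (coproduct $\Delta_C$, counit $\varepsilon_C$) is an $R$-bimodule map $\psi:C\otimes_R A\to A\otimes_R C$ such that, with $\mu$ the multiplication of $A$, $\psi\circ(C\otimes\mu)=(\mu\otimes C)\circ(A\otimes\psi)\circ(\psi\otimes A)$, $\psi(c\otimes 1)=1\otimes c$, $(A\otimes\Delta_C)\circ\psi=(\psi\otimes C)\circ(C\otimes\psi)\circ(\Delta_C\otimes A)$ and $(A\otimes\varepsilon_C)\circ\psi=\varepsilon_C\otimes A$. Then $A\otimes_R C$ is an $A$-coring with right action $(a\otimes c)a'=a\,\psi(c\otimes a')$, coproduct $A\otimes_R\Delta_C$ and counit $A\otimes_R\varepsilon_C$.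 *Left entwinings* $\varphi:B\otimes_S D\to D\otimes_S B$ over $S$ of $B$ with an $S$-coring $D$, and the associated $B$-coring $D\otimes_S B$, are defined symmetrically. For an $A$-coring $\mathcal C$, $T$ is a *right Galois comodule over $\mathcal C$ with $S=\mathrm{End}^{\mathcal C}(T)$* if $T$ is a right $\mathcal C$-comodule (with the given right $A$-action), finitely generated and projective as a right $A$-module, $s\mapsto[x\mapsto \beta(s)x]$ is a bijection of $S$ onto the ring of right $\mathcal C$-comodule endomorphisms of $T$, and the map $\mathrm{Hom}_A(T,A)\otimes_S T\to\mathcal C$, $f\otimes x\mapsto \sum f(x_{(0)})x_{(1)}$, is bijective. Symmetrically, for a $B$-coring $\mathcal D$, $T$ is a *left Galois comodule over $\mathcal D$ with $R=\mathrm{End}^{\mathcal D}(T)$* if $T$ is a left $\mathcal D$-comodule (with the given left $B$-action), finitely generated and projective as a left $B$-module, $r\mapsto[x\mapsto x\alpha(r)]$ is a bijection of $R$ onto the set of left $\mathcal D$-comodule endomorphisms of $T$, and $T\otimes_R{}_B\mathrm{Hom}(T,B)\to\mathcal D$, $x\otimes f\mapsto\sum x_{(-1)}f(x_{(0)})$,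 is bijective. **Theorem.** Assume that either (i) $A$ is a faithfully flat right $R$-module and $B$ is a faithfully flat left $S$-module, or (ii) $\alpha$ and $\beta$ are split extensions, i.e. there are an $R$-bimodule map $\pi_\alpha:A\to R$ with $\pi_\alpha\circ\alpha=\mathrm{id}_R$ and an $S$-bimodule map $\pi_\beta:B\to S$ with $\pi_\beta\circ\beta=\mathrm{id}_S$. Then the following statements are equivalent: (a) $T$ is a bimodule herd. (b) There exist an $R$-coring $C$ and a right entwining $\psi:C\otimes_R A\to A\otimes_R C$ over $R$ such that $T$ is a right Galois comodule over the $A$-coring $\mathcal C=A\otimes_R C$ with $S=\mathrm{End}^{\mathcal C}(T)$. (c) There exist an $S$-coring $D$ and a left entwining $\varphi:B\otimes_S D\to D\otimes_S B$ over $S$ such that $T$ is a left Galois comodule over the $B$-coring $\mathcal D=D\otimes_S B$ with $R=\mathrm{End}^{\mathcal D}(T)$. Moreover, under hypothesis (i) these are also equivalent to: (a') $T$ is a tame bimodule herd. -/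

import Mathlib

open MulOpposite

universe u

namespace BimodHerd

/-! ### Tensor products over a noncommutative ring

Right modules over `P` are modules over `Pᵐᵒᵖ`; `op p • m` is `m p`. A `P`-`Q` bimodule is a left
`P`-module and right `Q`-module with `SMulCommClass P Qᵐᵒᵖ M`. Modules over `P` are regarded as
modules over `R` through a ring map `φ : R →+* P`, which is an explicit argument. -/

section Tensor

/-- The relations `(m φ(r)) ⊗ n = m ⊗ (ψ(r) n)`. -/
def BTensor.rel {R P Q : Type*} [Ring R] [Ring P] [Ring Q] (φ : R →+* P) (ψ : R →+* Q)
    (M N : Type*) [AddCommGroup M] [Module Pᵐᵒᵖ M] [AddCommGroup N] [Module Q N] :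
    AddSubgroup (TensorProduct ℤ M N) :=
  AddSubgroup.closure {z | ∃ (r : R) (m : M) (n : N),
    z = TensorProduct.tmul ℤ (op (φ r) • m) n - TensorProduct.tmul ℤ m (ψ r • n)}

/-- `M ⊗_R N`, where the right `P`-module `M` is a right `R`-module through `φ : R →+* P` and the
left `Q`-module `N` is a left `R`-module through `ψ : R →+* Q`. -/
def BTensor {R P Q : Type*} [Ring R] [Ring P] [Ring Q] (φ : R →+* P) (ψ : R →+* Q)
    (M N : Type*) [AddCommGroup M] [Module Pᵐᵒᵖ M] [AddCommGroup N] [Module Q N] : Type _ :=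
  TensorProduct ℤ M N ⧸ BTensor.rel φ ψ M N

namespace BTensor

variable {R P Q : Type*} [Ring R] [Ring P] [Ring Q] (φ : R →+* P) (ψ : R →+* Q)
  {M N : Type*} [AddCommGroup M] [Module Pᵐᵒᵖ M] [AddCommGroup N] [Module Q N]

instance addCommGroup : AddCommGroup (BTensor φ ψ M N) :=
  inferInstanceAs (AddCommGroup (TensorProduct ℤ M N ⧸ BTensor.rel φ ψ M N))

/-- The projection `M ⊗_ℤ N → M ⊗_R N`. -/
def proj : TensorProduct ℤ M N →+ BTensor φ ψ M N :=
  QuotientAddGroup.mk' (BTensor.rel φ ψ M N)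

/-- The pure tensor `m ⊗ n`. -/
def tmul (m : M) (n : N) : BTensor φ ψ M N :=
  proj φ ψ (TensorProduct.tmul ℤ m n)

theorem add_tmul (m m' : M) (n : N) :
    tmul φ ψ (m + m') n = tmul φ ψ m n + tmul φ ψ m' n := by
  unfold tmul; rw [TensorProduct.add_tmul, map_add]

theorem tmul_add (m : M) (n n' : N) :
    tmul φ ψ m (n + n') = tmul φ ψ m n + tmul φ ψ m n' := by
  unfold tmul; rw [TensorProduct.tmul_add, map_add]

theorem smul_tmul (r : R) (m : M) (n : N) :
    tmul φ ψ (op (φ r) • m) n = tmul φ ψ m (ψ r • n) := by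
  unfold tmul
  rw [← sub_eq_zero, ← map_sub (proj φ ψ (M := M) (N := N))]
  exact (QuotientAddGroup.eq_zero_iff _).2 (AddSubgroup.subset_closure ⟨r, m, n, rfl⟩)

theorem zero_tmul (n : N) : tmul φ ψ (0 : M) n = 0 := by
  unfold tmul; rw [TensorProduct.zero_tmul, map_zero]

theorem tmul_zero (m : M) : tmul φ ψ m (0 : N) = 0 := by
  unfold tmul; rw [TensorProduct.tmul_zero, map_zero]

variable {φ ψ}

theorem induction_on {p : BTensor φ ψ M N → Prop} (z : BTensor φ ψ M N) (zero : p 0)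
    (tmul : ∀ m n, p (tmul φ ψ m n)) (add : ∀ x y, p x → p y → p (x + y)) : p z := by
  obtain ⟨z, rfl⟩ := QuotientAddGroup.mk'_surjective _ z
  induction z using TensorProduct.induction_on with
  | zero => exact zero
  | tmul m n => exact tmul m n
  | add x y hx hy => exact add _ _ hx hy

/-- A biadditive function as a map `M →+ N →+ G`. -/
def biadd {M N G : Type*} [AddCommGroup M] [AddCommGroup N] [AddCommGroup G] (f : M → N → G)
    (h₁ : ∀ m m' n, f (m + m') n = f m n + f m' n)
    (h₂ : ∀ m n n', f m (n + n') = f m n + f m n') : M →+ N →+ G :=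
  AddMonoidHom.mk' (fun m => AddMonoidHom.mk' (f m) (h₂ m))
    (fun m m' => by ext n; exact h₁ m m' n)

@[simp] theorem biadd_apply {M N G : Type*} [AddCommGroup M] [AddCommGroup N] [AddCommGroup G]
    (f : M → N → G) (h₁ : ∀ m m' n, f (m + m') n = f m n + f m' n)
    (h₂ : ∀ m n n', f m (n + n') = f m n + f m n') (m : M) (n : N) :
    biadd f h₁ h₂ m n = f m n := rfl

/-- The additive map out of `M ⊗_R N` given by an `R`-balanced biadditive map. -/
def lift {G : Type*} [AddCommGroup G] (f : M →+ N →+ G)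
    (hf : ∀ r m n, f (op (φ r) • m) n = f m (ψ r • n)) : BTensor φ ψ M N →+ G :=
  QuotientAddGroup.lift (BTensor.rel φ ψ M N)
    (TensorProduct.liftAddHom f fun r m n => by simp)
    (by
      rw [BTensor.rel, AddSubgroup.closure_le]
      rintro _ ⟨r, m, n, rfl⟩
      simp [AddMonoidHom.mem_ker, hf])

@[simp] theorem lift_tmul {G : Type*} [AddCommGroup G] (f : M →+ N →+ G)
    (hf : ∀ r m n, f (op (φ r) • m) n = f m (ψ r • n)) (m : M) (n : N) :
    lift f hf (tmul φ ψ m n) = f m n := rfl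

theorem hom_ext {G : Type*} [AddCommGroup G] {f g : BTensor φ ψ M N →+ G}
    (h : ∀ m n, f (tmul φ ψ m n) = g (tmul φ ψ m n)) : f = g := by
  ext z
  induction z using induction_on with
  | zero => simp
  | tmul m n => exact h m n
  | add x y hx hy => simp [hx, hy]

variable (φ ψ) in
/-- The biadditive map `(m, n) ↦ m ⊗ n`. -/
def mk : M →+ N →+ BTensor φ ψ M N :=
  biadd (tmul φ ψ) (add_tmul φ ψ) (tmul_add φ ψ)

@[simp] theorem mk_apply (m : M) (n : N) : mk φ ψ m n = tmul φ ψ m n := rfl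

variable {P' Q' : Type*} [Ring P'] [Ring Q'] {φ' : R →+* P'} {ψ' : R →+* Q'}
  {M' N' : Type*} [AddCommGroup M'] [Module P'ᵐᵒᵖ M'] [AddCommGroup N'] [Module Q' N']

/-- `f ⊗_R g` for additive maps `f`, `g` that are `R`-linear on the side that is tensored. -/
def map (f : M →+ M') (g : N →+ N') (hf : ∀ r m, f (op (φ r) • m) = op (φ' r) • f m)
    (hg : ∀ r n, g (ψ r • n) = ψ' r • g n) : BTensor φ ψ M N →+ BTensor φ' ψ' M' N' :=
  lift (biadd (fun m n => tmul φ' ψ' (f m) (g n)) (fun m m' n => by simp [add_tmul])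
    (fun m n n' => by simp [tmul_add])) (fun r m n => by simp [hf, hg, smul_tmul])

@[simp] theorem map_tmul (f : M →+ M') (g : N →+ N')
    (hf : ∀ r m, f (op (φ r) • m) = op (φ' r) • f m)
    (hg : ∀ r n, g (ψ r • n) = ψ' r • g n) (m : M) (n : N) :
    map f g hf hg (tmul φ ψ m n) = tmul φ' ψ' (f m) (g n) := rfl

variable (φ') in
/-- `f ⊗_R N` for an additive map `f : M → M'` that is right `R`-linear. -/
def mapL (f : M →+ M') (hf : ∀ r m, f (op (φ r) • m) = op (φ' r) • f m) :
    BTensor φ ψ M N →+ BTensor φ' ψ M' N :=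
  map f (AddMonoidHom.id N) hf (fun _ _ => rfl)

@[simp] theorem mapL_tmul (f : M →+ M') (hf : ∀ r m, f (op (φ r) • m) = op (φ' r) • f m)
    (m : M) (n : N) : mapL φ' f hf (tmul φ ψ m n) = tmul φ' ψ (f m) n := rfl

variable (ψ') in
/-- `M ⊗_R g` for an additive map `g : N → N'` that is left `R`-linear. -/
def mapR (g : N →+ N') (hg : ∀ r n, g (ψ r • n) = ψ' r • g n) :
    BTensor φ ψ M N →+ BTensor φ ψ' M N' :=
  map (AddMonoidHom.id M) g (fun _ _ => rfl) hg

@[simp] theorem mapR_tmul (g : N →+ N') (hg : ∀ r n, g (ψ r • n) = ψ' r • g n)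
    (m : M) (n : N) : mapR ψ' g hg (tmul φ ψ m n) = tmul φ ψ' m (g n) := rfl

/-- A left action on the first factor acts on the tensor product. -/
def lsmulHom {L : Type*} [Ring L] [Module L M] [SMulCommClass L Pᵐᵒᵖ M] (l : L) : BTensor φ ψ M N →+ BTensor φ ψ M N :=
  map (AddMonoidHom.mk' (fun m : M => l • m) (smul_add l)) (AddMonoidHom.id N)
    (fun r m => smul_comm l (op (φ r)) m) (fun _ _ => rfl)

theorem lsmulHom_tmul {L : Type*} [Ring L] [Module L M] [SMulCommClass L Pᵐᵒᵖ M] (l : L) (m : M) (n : N) :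
    lsmulHom l (tmul φ ψ m n) = tmul φ ψ (l • m) n := rfl

/-- A left action on the first factor acts on the tensor product. -/
instance leftModule {L : Type*} [Ring L] [Module L M] [SMulCommClass L Pᵐᵒᵖ M] :
    Module L (BTensor φ ψ M N) where
  smul l := lsmulHom l
  one_smul z := by
    change lsmulHom _ z = z
    induction z using induction_on with
    | zero => exact map_zero _
    | tmul m n => simp [lsmulHom_tmul]
    | add x y hx hy => rw [map_add, hx, hy]
  mul_smul l l' z := by
    change lsmulHom _ z = lsmulHom _ (lsmulHom _ z)
    induction z using induction_on with
    | zero => simp only [map_zero]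
    | tmul m n => simp [lsmulHom_tmul, mul_smul]
    | add x y hx hy => simp only [map_add, hx, hy]
  smul_zero l := map_zero _
  smul_add l := map_add _
  add_smul l l' z := by
    change lsmulHom _ z = lsmulHom _ z + lsmulHom _ z
    induction z using induction_on with
    | zero => simp only [map_zero, add_zero]
    | tmul m n => simp [lsmulHom_tmul, add_smul, add_tmul]
    | add x y hx hy => simp only [map_add, hx, hy]; abel
  zero_smul z := by
    change lsmulHom _ z = 0
    induction z using induction_on with
    | zero => exact map_zero _
    | tmul m n => simp [lsmulHom_tmul, zero_tmul]
    | add x y hx hy => simp only [map_add, hx, hy, add_zero]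

/-- A right action on the second factor acts on the tensor product. -/
def rsmulHom {K : Type*} [Ring K] [Module Kᵐᵒᵖ N] [SMulCommClass Q Kᵐᵒᵖ N] (k : Kᵐᵒᵖ) : BTensor φ ψ M N →+ BTensor φ ψ M N :=
  map (AddMonoidHom.id M) (AddMonoidHom.mk' (fun n : N => k • n) (smul_add k))
    (fun _ _ => rfl) (fun r n => (smul_comm (ψ r) k n).symm)

theorem rsmulHom_tmul {K : Type*} [Ring K] [Module Kᵐᵒᵖ N] [SMulCommClass Q Kᵐᵒᵖ N] (k : Kᵐᵒᵖ) (m : M) (n : N) :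
    rsmulHom k (tmul φ ψ m n) = tmul φ ψ m (k • n) := rfl

/-- A right action on the second factor acts on the tensor product. -/
instance rightModule {K : Type*} [Ring K] [Module Kᵐᵒᵖ N] [SMulCommClass Q Kᵐᵒᵖ N] :
    Module Kᵐᵒᵖ (BTensor φ ψ M N) where
  smul l := rsmulHom l
  one_smul z := by
    change rsmulHom _ z = z
    induction z using induction_on with
    | zero => exact map_zero _
    | tmul m n => simp [rsmulHom_tmul]
    | add x y hx hy => rw [map_add, hx, hy]
  mul_smul l l' z := by
    change rsmulHom _ z = rsmulHom _ (rsmulHom _ z)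
    induction z using induction_on with
    | zero => simp only [map_zero]
    | tmul m n => simp [rsmulHom_tmul, mul_smul]
    | add x y hx hy => simp only [map_add, hx, hy]
  smul_zero l := map_zero _
  smul_add l := map_add _
  add_smul l l' z := by
    change rsmulHom _ z = rsmulHom _ z + rsmulHom _ z
    induction z using induction_on with
    | zero => simp only [map_zero, add_zero]
    | tmul m n => simp [rsmulHom_tmul, add_smul, tmul_add]
    | add x y hx hy => simp only [map_add, hx, hy]; abel
  zero_smul z := by
    change rsmulHom _ z = 0
    induction z using induction_on with
    | zero => exact map_zero _
    | tmul m n => simp [rsmulHom_tmul, tmul_zero]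
    | add x y hx hy => simp only [map_add, hx, hy, add_zero]

@[simp] theorem lsmul_tmul {L : Type*} [Ring L] [Module L M] [SMulCommClass L Pᵐᵒᵖ M]
    (l : L) (m : M) (n : N) : l • tmul φ ψ m n = tmul φ ψ (l • m) n := rfl

@[simp] theorem rsmul_tmul {K : Type*} [Ring K] [Module Kᵐᵒᵖ N] [SMulCommClass Q Kᵐᵒᵖ N]
    (k : K) (m : M) (n : N) : op k • tmul φ ψ m n = tmul φ ψ m (op k • n) := rfl

instance bimodule {L K : Type*} [Ring L] [Module L M] [SMulCommClass L Pᵐᵒᵖ M]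
    [Ring K] [Module Kᵐᵒᵖ N] [SMulCommClass Q Kᵐᵒᵖ N] :
    SMulCommClass L Kᵐᵒᵖ (BTensor φ ψ M N) where
  smul_comm l k z := by
    induction k using MulOpposite.rec' with | _ k =>
    induction z using induction_on with
    | zero => simp
    | tmul m n => simp
    | add x y hx hy => simp only [smul_add, hx, hy]

end BTensor

namespace BTensor

variable {R P Q : Type*} [Ring R] [Ring P] [Ring Q]
  {M N : Type*} [AddCommGroup M] [Module Pᵐᵒᵖ M] [AddCommGroup N] [Module Q N]

/-- The multiplication `Q ⊗_R N → N`, `q ⊗ n ↦ q n`; more generally `P ⊗_R N → N`,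
`p ⊗ n ↦ σ(p) n`, for `σ : P →+* Q` such that `σ ∘ φ = ψ`. -/
def lact {φ : R →+* P} {ψ : R →+* Q} (σ : P →+* Q) (h : ∀ r, σ (φ r) = ψ r) :
    BTensor φ ψ P N →+ N :=
  lift (AddMonoidHom.mk' (fun p => DistribSMul.toAddMonoidHom N (σ p))
      (fun p p' => by ext n; simp [add_smul]))
    (fun r p n => by simp [mul_smul, h])

@[simp] theorem lact_tmul {φ : R →+* P} {ψ : R →+* Q} (σ : P →+* Q) (h : ∀ r, σ (φ r) = ψ r)
    (p : P) (n : N) : lact σ h (tmul φ ψ p n) = σ p • n := rfl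

/-- The multiplication `M ⊗_R P → M`, `m ⊗ p ↦ m p`; more generally `M ⊗_R Q → M`,
`m ⊗ q ↦ m σ(q)`, for `σ : Q →+* P` such that `σ ∘ ψ = φ`. -/
def ract {φ : R →+* P} {ψ : R →+* Q} (σ : Q →+* P) (h : ∀ r, σ (ψ r) = φ r) :
    BTensor φ ψ M Q →+ M :=
  lift (AddMonoidHom.flip (AddMonoidHom.mk' (fun q => DistribSMul.toAddMonoidHom M (op (σ q)))
      (fun p p' => by ext n; simp [add_smul])))
    (fun r p n => by simp [mul_smul, h])

@[simp] theorem ract_tmul {φ : R →+* P} {ψ : R →+* Q} (σ : Q →+* P) (h : ∀ r, σ (ψ r) = φ r)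
    (m : M) (q : Q) : ract σ h (tmul φ ψ m q) = op (σ q) • m := rfl

end BTensor

namespace BTensor

variable {R₁ R₂ P₁ Q₁ P₂ Q₂ : Type*} [Ring R₁] [Ring R₂] [Ring P₁] [Ring Q₁] [Ring P₂] [Ring Q₂]
  {φ₁ : R₁ →+* P₁} {ψ₁ : R₁ →+* Q₁} {φ₂ : R₂ →+* P₂} {ψ₂ : R₂ →+* Q₂}
  {M N K : Type*} [AddCommGroup M] [Module P₁ᵐᵒᵖ M]
  [AddCommGroup N] [Module Q₁ N] [Module P₂ᵐᵒᵖ N] [SMulCommClass Q₁ P₂ᵐᵒᵖ N]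
  [AddCommGroup K] [Module Q₂ K]

variable (φ₁ ψ₁ φ₂ ψ₂) in
/-- `(m ⊗ n) ↦ m ⊗ (n ⊗ k)` -/
def assocAux (k : K) : BTensor φ₁ ψ₁ M N →+ BTensor φ₁ ψ₁ M (BTensor φ₂ ψ₂ N K) :=
  mapR ψ₁ ((mk φ₂ ψ₂).flip k) (fun r n => by simp)

@[simp] theorem assocAux_tmul (k : K) (m : M) (n : N) :
    assocAux φ₁ ψ₁ φ₂ ψ₂ k (tmul φ₁ ψ₁ m n) = tmul φ₁ ψ₁ m (tmul φ₂ ψ₂ n k) := rfl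

/-- `(M ⊗ N) ⊗ K → M ⊗ (N ⊗ K)` -/
def assocHom : BTensor φ₂ ψ₂ (BTensor φ₁ ψ₁ M N) K →+ BTensor φ₁ ψ₁ M (BTensor φ₂ ψ₂ N K) :=
  lift
    (biadd (fun z k => assocAux φ₁ ψ₁ φ₂ ψ₂ k z) (fun z z' k => map_add _ z z')
      (fun z k k' => by
        induction z using induction_on with
        | zero => simp
        | tmul m n => simp [tmul_add]
        | add x y hx hy => simp only [map_add, hx, hy]; abel))
    (fun r z k => by
      induction z using induction_on with
      | zero => simp
      | tmul m n => simp [smul_tmul]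
      | add x y hx hy =>
        simp only [biadd_apply] at hx hy ⊢
        simp only [smul_add, map_add, hx, hy])

variable (φ₁ ψ₁ φ₂ ψ₂) in
/-- `(n ⊗ k) ↦ (m ⊗ n) ⊗ k` -/
def assocInvAux (m : M) : BTensor φ₂ ψ₂ N K →+ BTensor φ₂ ψ₂ (BTensor φ₁ ψ₁ M N) K :=
  mapL φ₂ (mk φ₁ ψ₁ m) (fun r n => by simp)

@[simp] theorem assocInvAux_tmul (m : M) (n : N) (k : K) :
    assocInvAux φ₁ ψ₁ φ₂ ψ₂ m (tmul φ₂ ψ₂ n k) = tmul φ₂ ψ₂ (tmul φ₁ ψ₁ m n) k := rfl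

/-- `M ⊗ (N ⊗ K) → (M ⊗ N) ⊗ K` -/
def assocInv : BTensor φ₁ ψ₁ M (BTensor φ₂ ψ₂ N K) →+ BTensor φ₂ ψ₂ (BTensor φ₁ ψ₁ M N) K :=
  lift
    (biadd (fun m z => assocInvAux φ₁ ψ₁ φ₂ ψ₂ m z)
      (fun m m' z => by
        induction z using induction_on with
        | zero => simp
        | tmul n k => simp [add_tmul]
        | add x y hx hy => simp only [map_add, hx, hy]; abel)
      (fun m z z' => map_add _ z z'))
    (fun r m z => by
      induction z using induction_on with
      | zero => simp
      | tmul n k => simp [smul_tmul]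
      | add x y hx hy =>
        simp only [biadd_apply] at hx hy ⊢
        simp only [smul_add, map_add, hx, hy])

/-- The associativity isomorphism `(M ⊗ N) ⊗ K ≃ M ⊗ (N ⊗ K)`. -/
def assoc : BTensor φ₂ ψ₂ (BTensor φ₁ ψ₁ M N) K ≃+ BTensor φ₁ ψ₁ M (BTensor φ₂ ψ₂ N K) :=
  AddMonoidHom.toAddEquiv assocHom assocInv
    (hom_ext fun z k => by
      induction z using induction_on with
      | zero => simp [zero_tmul]
      | tmul m n => rfl
      | add x y hx hy => simp only [add_tmul, map_add, hx, hy])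
    (hom_ext fun m z => by
      induction z using induction_on with
      | zero => simp [tmul_zero]
      | tmul m n => rfl
      | add x y hx hy => simp only [tmul_add, map_add, hx, hy])

@[simp] theorem assoc_tmul (m : M) (n : N) (k : K) :
    assoc (tmul φ₂ ψ₂ (tmul φ₁ ψ₁ m n) k) = tmul φ₁ ψ₁ m (tmul φ₂ ψ₂ n k) := rfl

@[simp] theorem assoc_symm_tmul (m : M) (n : N) (k : K) :
    assoc.symm (tmul φ₁ ψ₁ m (tmul φ₂ ψ₂ n k)) = tmul φ₂ ψ₂ (tmul φ₁ ψ₁ m n) k := rfl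

end BTensor

end Tensor

/-! ### Corings and comodules -/

open BTensor

/-- An `R`-coring structure on an `R`-bimodule `C`. -/
structure Coring (R C : Type*) [Ring R] [AddCommGroup C] [Module R C] [Module Rᵐᵒᵖ C]
    [SMulCommClass R Rᵐᵒᵖ C] where
  comul : C →+ BTensor (RingHom.id R) (RingHom.id R) C C
  comul_lsmul : ∀ (r : R) (c : C), comul (r • c) = r • comul c
  comul_rsmul : ∀ (r : R) (c : C), comul (op r • c) = op r • comul c
  counit : C →+ R
  counit_lsmul : ∀ (r : R) (c : C), counit (r • c) = r • counit c
  counit_rsmul : ∀ (r : R) (c : C), counit (op r • c) = op r • counit c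
  coassoc : ∀ c : C, assoc (mapL (RingHom.id R) comul comul_rsmul (comul c)) =
    mapR (RingHom.id R) comul comul_lsmul (comul c)
  lcounit : ∀ c : C, lact (φ := RingHom.id R) (ψ := RingHom.id R) (RingHom.id R) (fun _ => rfl)
    (mapL (RingHom.id R) counit counit_rsmul (comul c)) = c
  rcounit : ∀ c : C, ract (φ := RingHom.id R) (ψ := RingHom.id R) (RingHom.id R) (fun _ => rfl)
    (mapR (RingHom.id R) counit counit_lsmul (comul c)) = c

/-- A right comodule structure over a coring `K` on a right `A`-module `T`. -/
structure RightComodule {A C : Type*} [Ring A] [AddCommGroup C] [Module A C] [Module Aᵐᵒᵖ C]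
    [SMulCommClass A Aᵐᵒᵖ C] (K : Coring A C) (T : Type*) [AddCommGroup T] [Module Aᵐᵒᵖ T] where
  coact : T →+ BTensor (RingHom.id A) (RingHom.id A) T C
  coact_rsmul : ∀ (a : A) (x : T), coact (op a • x) = op a • coact x
  coassoc : ∀ x : T, assoc (mapL (RingHom.id A) coact coact_rsmul (coact x)) =
    mapR (RingHom.id A) K.comul K.comul_lsmul (coact x)
  counit : ∀ x : T, ract (RingHom.id A) (fun _ => rfl)
    (mapR (RingHom.id A) K.counit K.counit_lsmul (coact x)) = x

/-- A left comodule structure over a coring `K` on a left `B`-module `T`. -/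
structure LeftComodule {B D : Type*} [Ring B] [AddCommGroup D] [Module B D] [Module Bᵐᵒᵖ D]
    [SMulCommClass B Bᵐᵒᵖ D] (K : Coring B D) (T : Type*) [AddCommGroup T] [Module B T] where
  coact : T →+ BTensor (RingHom.id B) (RingHom.id B) D T
  coact_lsmul : ∀ (b : B) (x : T), coact (b • x) = b • coact x
  coassoc : ∀ x : T, assoc (mapL (RingHom.id B) K.comul K.comul_rsmul (coact x)) =
    mapR (RingHom.id B) coact coact_lsmul (coact x)
  counit : ∀ x : T, lact (RingHom.id B) (fun _ => rfl)
    (mapL (RingHom.id B) K.counit K.counit_rsmul (coact x)) = x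

/-- The dual `T^* = Hom_A(T, A)` of a right `A`-module. -/
def RDual (A T : Type*) [Ring A] [AddCommGroup T] [Module Aᵐᵒᵖ T] : Type _ := T →ₗ[Aᵐᵒᵖ] A

/-- The dual `^*T = Hom_B(T, B)` of a left `B`-module. -/
def LDual (B T : Type*) [Ring B] [AddCommGroup T] [Module B T] : Type _ := T →ₗ[B] B

section Duals

variable {A B T : Type*} [Ring A] [Ring B] [AddCommGroup T]

/-- Left multiplication by `b`, as a right linear endomorphism. -/
def lmulEnd (A : Type*) [Ring A] [Module Aᵐᵒᵖ T] [Module B T] [SMulCommClass B Aᵐᵒᵖ T] (b : B) :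
    T →ₗ[Aᵐᵒᵖ] T where
  toFun x := b • x
  map_add' := smul_add b
  map_smul' a x := smul_comm b a x

/-- Right multiplication by `a`, as a left linear endomorphism. -/
def rmulEnd (B : Type*) [Ring B] [Module Aᵐᵒᵖ T] [Module B T] [SMulCommClass B Aᵐᵒᵖ T] (a : A) :
    T →ₗ[B] T where
  toFun x := op a • x
  map_add' := smul_add (op a)
  map_smul' b x := (smul_comm b (op a) x).symm

instance [Module Aᵐᵒᵖ T] : AddCommGroup (RDual A T) := inferInstanceAs (AddCommGroup (T →ₗ[Aᵐᵒᵖ] A))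

instance [Module Aᵐᵒᵖ T] : FunLike (RDual A T) T A := inferInstanceAs (FunLike (T →ₗ[Aᵐᵒᵖ] A) T A)

instance [Module Aᵐᵒᵖ T] : LinearMapClass (RDual A T) Aᵐᵒᵖ T A :=
  inferInstanceAs (LinearMapClass (T →ₗ[Aᵐᵒᵖ] A) Aᵐᵒᵖ T A)

instance [Module B T] : AddCommGroup (LDual B T) := inferInstanceAs (AddCommGroup (T →ₗ[B] B))

instance [Module B T] : FunLike (LDual B T) T B := inferInstanceAs (FunLike (T →ₗ[B] B) T B)

instance [Module B T] : LinearMapClass (LDual B T) B T B :=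
  inferInstanceAs (LinearMapClass (T →ₗ[B] B) B T B)

/-- `(f b)(x) = f (b x)` -/
instance [Module Aᵐᵒᵖ T] [Module B T] [SMulCommClass B Aᵐᵒᵖ T] : Module Bᵐᵒᵖ (RDual A T) where
  smul b f := (LinearMap.comp f (lmulEnd A b.unop) : T →ₗ[Aᵐᵒᵖ] A)
  one_smul f := LinearMap.ext fun x => congrArg f (one_smul B x)
  mul_smul b b' f := LinearMap.ext fun x => congrArg f (mul_smul b'.unop b.unop x)
  smul_zero _ := rfl
  smul_add _ _ _ := rfl
  add_smul b b' f := LinearMap.ext fun x =>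
    (congrArg f (add_smul b.unop b'.unop x)).trans (map_add f _ _)
  zero_smul f := LinearMap.ext fun x => (congrArg f (zero_smul B x)).trans (map_zero f)

/-- `(a f)(x) = f (x a)` -/
instance [Module Aᵐᵒᵖ T] [Module B T] [SMulCommClass B Aᵐᵒᵖ T] : Module A (LDual B T) where
  smul a f := (LinearMap.comp f (rmulEnd B a) : T →ₗ[B] B)
  one_smul f := LinearMap.ext fun x => congrArg f (one_smul Aᵐᵒᵖ x)
  mul_smul a a' f := LinearMap.ext fun x => congrArg f (mul_smul (op a') (op a) x)
  smul_zero _ := rfl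
  smul_add _ _ _ := rfl
  add_smul a a' f := LinearMap.ext fun x =>
    (congrArg f (add_smul (op a) (op a') x)).trans (map_add f _ _)
  zero_smul f := LinearMap.ext fun x => (congrArg f (zero_smul Aᵐᵒᵖ x)).trans (map_zero f)

end Duals

set_option linter.unusedSectionVars false

section Galois

variable {A B S R : Type*} [Ring A] [Ring B] [Ring S] [Ring R] {T : Type*} [AddCommGroup T]
  [Module B T] [Module Aᵐᵒᵖ T]

namespace RightComodule

variable {C : Type*} [AddCommGroup C] [Module A C] [Module Aᵐᵒᵖ C] [SMulCommClass A Aᵐᵒᵖ C]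
  {K : Coring A C}

/-- `f` is an endomorphism of the right comodule `T`. -/
def IsColinear (ρ : RightComodule K T) (f : T →ₗ[Aᵐᵒᵖ] T) : Prop :=
  ∀ x, ρ.coact (f x) =
    mapL (φ := RingHom.id A) (RingHom.id A) f.toAddMonoidHom (fun a x => f.map_smul (op a) x) (ρ.coact x)

/-- `z ↦ Σ f(z₀) z₁` for `f ∈ T^*` and `z = Σ z₀ ⊗ z₁ ∈ T ⊗_A C`. -/
def evalAct (f : RDual A T) : BTensor (RingHom.id A) (RingHom.id A) T C →+ C :=
  (lact (RingHom.id A) (fun _ => rfl)).comp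
    (mapL (φ := RingHom.id A) (RingHom.id A) (f : T →ₗ[Aᵐᵒᵖ] A).toAddMonoidHom
      (fun a x => LinearMap.map_smul (f : T →ₗ[Aᵐᵒᵖ] A) (op a) x))

@[simp] theorem evalAct_tmul (f : RDual A T) (x : T) (c : C) :
    evalAct f (tmul (RingHom.id A) (RingHom.id A) x c) = f x • c := rfl

variable [SMulCommClass B Aᵐᵒᵖ T]

/-- The canonical map `T^* ⊗_S T → C`, `f ⊗ x ↦ Σ f(x₀) x₁`, where `S` acts on `T` by comodule
endomorphisms. -/
def can (ρ : RightComodule K T) (β : S →+* B) (h : ∀ s, ρ.IsColinear (lmulEnd A (β s))) :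
    BTensor β β (RDual A T) T →+ C :=
  lift
    (biadd (fun f x => evalAct f (ρ.coact x))
      (fun f g x => by
        generalize ρ.coact x = z
        induction z using induction_on with
        | zero => simp
        | tmul x c => exact add_smul (f x) (g x) c
        | add z w hz hw => simp only [map_add, hz, hw]; abel)
      (fun f x y => by simp only [map_add]))
    (fun s f x => by
      have := h s x
      change ρ.coact (β s • x) = _ at this
      simp only [biadd_apply, this]
      generalize ρ.coact x = z
      induction z using induction_on with
      | zero => simp only [map_zero]
      | tmul x c => rfl
      | add z w hz hw => simp only [map_add, hz, hw])

/-- `T` is a (finite) right Galois comodule with `S = End^C(T)`, the ring `S` acting on `T`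
through `β : S →+* B`. -/
structure IsGalois (ρ : RightComodule K T) (β : S →+* B) : Prop where
  finite : Module.Finite Aᵐᵒᵖ T
  projective : Module.Projective Aᵐᵒᵖ T
  colinear : ∀ s, ρ.IsColinear (lmulEnd A (β s))
  injective : ∀ s s' : S, (lmulEnd A (β s) : T →ₗ[Aᵐᵒᵖ] T) = lmulEnd A (β s') → s = s'
  full : ∀ f : T →ₗ[Aᵐᵒᵖ] T, ρ.IsColinear f → ∃ s, lmulEnd A (β s) = f
  can_bijective : Function.Bijective (ρ.can β colinear)

end RightComodule

namespace LeftComodule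

variable {D : Type*} [AddCommGroup D] [Module B D] [Module Bᵐᵒᵖ D] [SMulCommClass B Bᵐᵒᵖ D]
  {K : Coring B D}

/-- `f` is an endomorphism of the left comodule `T`. -/
def IsColinear (ρ : LeftComodule K T) (f : T →ₗ[B] T) : Prop :=
  ∀ x, ρ.coact (f x) =
    mapR (ψ := RingHom.id B) (RingHom.id B) f.toAddMonoidHom (fun b x => f.map_smul b x) (ρ.coact x)

/-- `z ↦ Σ z₋₁ f(z₀)` for `f ∈ ^*T` and `z = Σ z₋₁ ⊗ z₀ ∈ D ⊗_B T`. -/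
def evalAct (f : LDual B T) : BTensor (RingHom.id B) (RingHom.id B) D T →+ D :=
  (ract (RingHom.id B) (fun _ => rfl)).comp
    (mapR (ψ := RingHom.id B) (RingHom.id B) (f : T →ₗ[B] B).toAddMonoidHom
      (fun b x => LinearMap.map_smul (f : T →ₗ[B] B) b x))

@[simp] theorem evalAct_tmul (f : LDual B T) (d : D) (x : T) :
    evalAct f (tmul (RingHom.id B) (RingHom.id B) d x) = op (f x) • d := rfl

variable [SMulCommClass B Aᵐᵒᵖ T]

/-- The canonical map `T ⊗_R ^*T → D`, `x ⊗ f ↦ Σ x₋₁ f(x₀)`, where `R` acts on `T` (from the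
right) by comodule endomorphisms. -/
def can (ρ : LeftComodule K T) (α : R →+* A) (h : ∀ r, ρ.IsColinear (rmulEnd B (α r))) :
    BTensor α α T (LDual B T) →+ D :=
  lift
    (biadd (fun x f => evalAct f (ρ.coact x))
      (fun x y f => by simp only [map_add])
      (fun x f g => by
        generalize ρ.coact x = z
        induction z using induction_on with
        | zero => simp
        | tmul d x => exact add_smul (op (f x)) (op (g x)) d
        | add z w hz hw => simp only [map_add, hz, hw]; abel))
    (fun r x f => by
      have := h r x
      change ρ.coact (op (α r) • x) = _ at this
      simp only [biadd_apply, this]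
      generalize ρ.coact x = z
      induction z using induction_on with
      | zero => simp only [map_zero]
      | tmul d x => rfl
      | add z w hz hw => simp only [map_add, hz, hw])

/-- `T` is a (finite) left Galois comodule with `R = End^D(T)`, the ring `R` acting on `T` from
the right through `α : R →+* A`. -/
structure IsGalois (ρ : LeftComodule K T) (α : R →+* A) : Prop where
  finite : Module.Finite B T
  projective : Module.Projective B T
  colinear : ∀ r, ρ.IsColinear (rmulEnd B (α r))
  injective : ∀ r r' : R, (rmulEnd B (α r) : T →ₗ[B] T) = rmulEnd B (α r') → r = r'
  full : ∀ f : T →ₗ[B] T, ρ.IsColinear f → ∃ r, rmulEnd B (α r) = f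
  can_bijective : Function.Bijective (ρ.can α colinear)

end LeftComodule

end Galois

/-! ### Entwining structures -/

section Entwining

/-- A right entwining `ψ : C ⊗_R A → A ⊗_R C` over `R` of an `R`-ring `α : R →+* A` with an
`R`-coring `C`. -/
structure RightEntwining {R A C : Type*} [Ring R] [Ring A] [AddCommGroup C] [Module R C]
    [Module Rᵐᵒᵖ C] [SMulCommClass R Rᵐᵒᵖ C] (α : R →+* A) (K : Coring R C) where
  ψ : BTensor (RingHom.id R) α C A →+ BTensor α (RingHom.id R) A C
  ψ_lsmul : ∀ (r : R) z, ψ (r • z) = α r • ψ z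
  ψ_rsmul : ∀ (r : R) z, ψ (op (α r) • z) = op r • ψ z
  /-- `ψ ∘ (C ⊗ μ) = (μ ⊗ C) ∘ (A ⊗ ψ) ∘ (ψ ⊗ A)` -/
  ψ_mul : ∀ (c : C) (a a' : A), ψ (tmul _ _ c (a * a')) =
    lact (φ := α) (ψ := α) (RingHom.id A) (fun _ => rfl) (mapR (φ := α) (ψ := RingHom.id R) α ψ ψ_lsmul
      (assoc (tmul (RingHom.id R) α (ψ (tmul _ _ c a)) a')))
  /-- `ψ ∘ (C ⊗ 1) = 1 ⊗ C` -/
  ψ_one : ∀ c : C, ψ (tmul _ _ c 1) = tmul _ _ 1 c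
  /-- `(A ⊗ Δ) ∘ ψ = (ψ ⊗ C) ∘ (C ⊗ ψ) ∘ (Δ ⊗ A)` -/
  ψ_comul : ∀ z, mapR (RingHom.id R) K.comul K.comul_lsmul (ψ z) =
    assoc (mapL (φ := α) (ψ := RingHom.id R) (RingHom.id R) ψ ψ_rsmul (assoc.symm
      (mapR (φ := RingHom.id R) (ψ := RingHom.id R) α ψ ψ_lsmul
        (assoc (mapL (ψ := α) (RingHom.id R) K.comul K.comul_rsmul z)))))
  /-- `(A ⊗ ε) ∘ ψ = ε ⊗ A` -/
  ψ_counit : ∀ z,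
    ract (φ := α) (ψ := RingHom.id R) α (fun _ => rfl) (mapR (RingHom.id R) K.counit K.counit_lsmul (ψ z)) =
      lact (φ := RingHom.id R) (ψ := α) α (fun _ => rfl) (mapL (RingHom.id R) K.counit K.counit_rsmul z)

/-- A left entwining `χ : B ⊗_S D → D ⊗_S B` over `S` of an `S`-ring `β : S →+* B` with an
`S`-coring `D`. -/
structure LeftEntwining {S B D : Type*} [Ring S] [Ring B] [AddCommGroup D] [Module S D]
    [Module Sᵐᵒᵖ D] [SMulCommClass S Sᵐᵒᵖ D] (β : S →+* B) (K : Coring S D) where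
  χ : BTensor β (RingHom.id S) B D →+ BTensor (RingHom.id S) β D B
  χ_lsmul : ∀ (s : S) z, χ (β s • z) = s • χ z
  χ_rsmul : ∀ (s : S) z, χ (op s • z) = op (β s) • χ z
  /-- `χ ∘ (μ ⊗ D) = (D ⊗ μ) ∘ (χ ⊗ B) ∘ (B ⊗ χ)` -/
  χ_mul : ∀ (b b' : B) (d : D), χ (tmul _ _ (b * b') d) =
    ract (φ := β) (ψ := β) (RingHom.id B) (fun _ => rfl) (mapL (φ := RingHom.id S) (ψ := β) β χ χ_rsmul
      (assoc.symm (tmul β (RingHom.id S) b (χ (tmul _ _ b' d)))))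
  /-- `χ ∘ (1 ⊗ D) = D ⊗ 1` -/
  χ_one : ∀ d : D, χ (tmul _ _ 1 d) = tmul _ _ d 1
  /-- `(Δ ⊗ B) ∘ χ = (D ⊗ χ) ∘ (χ ⊗ D) ∘ (B ⊗ Δ)` -/
  χ_comul : ∀ z, mapL (RingHom.id S) K.comul K.comul_rsmul (χ z) =
    assoc.symm (mapR (φ := RingHom.id S) (ψ := β) (RingHom.id S) χ χ_lsmul (assoc
      (mapL (φ := RingHom.id S) (ψ := RingHom.id S) β χ χ_rsmul
        (assoc.symm (mapR (φ := β) (RingHom.id S) K.comul K.comul_lsmul z)))))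
  /-- `(ε ⊗ B) ∘ χ = B ⊗ ε` -/
  χ_counit : ∀ z,
    lact (φ := RingHom.id S) (ψ := β) β (fun _ => rfl) (mapL (RingHom.id S) K.counit K.counit_rsmul (χ z)) =
      ract (φ := β) (ψ := RingHom.id S) β (fun _ => rfl) (mapR (RingHom.id S) K.counit K.counit_lsmul z)

namespace RightEntwining

variable {R A C : Type*} [Ring R] [Ring A] [AddCommGroup C] [Module R C]
  [Module Rᵐᵒᵖ C] [SMulCommClass R Rᵐᵒᵖ C] {α : R →+* A} {K : Coring R C}

/-- The underlying set of the `A`-coring `A ⊗_R C`. -/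
def Cor (_ : RightEntwining α K) : Type _ := BTensor α (RingHom.id R) A C

variable (E : RightEntwining α K)

instance : AddCommGroup E.Cor := BTensor.addCommGroup α (RingHom.id R)

instance : Module A E.Cor := inferInstanceAs (Module A (BTensor α (RingHom.id R) A C))

instance : Module Rᵐᵒᵖ E.Cor := inferInstanceAs (Module Rᵐᵒᵖ (BTensor α (RingHom.id R) A C))

/-- The elements of `A ⊗_R C` as elements of the coring. -/
def of : BTensor α (RingHom.id R) A C ≃+ E.Cor := AddEquiv.refl _

/-- `a ⊗ c` as an element of the coring. -/
def mkCor (a : A) (c : C) : E.Cor := E.of (tmul α (RingHom.id R) a c)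

/-- `ψ` with values in the coring. -/
def ψ' : BTensor (RingHom.id R) α C A →+ E.Cor := E.of.toAddMonoidHom.comp E.ψ

/-- The right multiplication `(a ⊗ c) a' = a ψ(c ⊗ a')`. -/
def rmulHom (a' : A) : E.Cor →+ E.Cor :=
  lift (φ := α) (ψ := RingHom.id R)
    (biadd (fun a c => a • E.ψ' (tmul _ _ c a'))
      (fun a b c => add_smul a b _)
      (fun a c d => by rw [add_tmul, map_add, smul_add]))
    (fun r a c => by
      have := E.ψ_lsmul r (tmul _ _ c a')
      change (a * α r) • E.ψ (tmul _ _ c a') = a • E.ψ (tmul _ _ (r • c) a')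
      rw [← lsmul_tmul, this, mul_smul])

theorem rmulHom_mkCor (a a' : A) (c : C) :
    E.rmulHom a' (E.mkCor a c) = a • E.ψ' (tmul _ _ c a') := rfl

theorem mkCor_induction {p : E.Cor → Prop} (z : E.Cor) (zero : p 0)
    (mk : ∀ a c, p (E.mkCor a c)) (add : ∀ x y, p x → p y → p (x + y)) : p z :=
  induction_on (φ := α) (ψ := RingHom.id R) z zero mk add

theorem smul_mkCor (a b : A) (c : C) : a • E.mkCor b c = E.mkCor (a * b) c := rfl

theorem rmulHom_smul (a a' : A) (z : E.Cor) : E.rmulHom a' (a • z) = a • E.rmulHom a' z := by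
  induction z using E.mkCor_induction with
  | zero => simp
  | mk b c => rw [smul_mkCor, rmulHom_mkCor, rmulHom_mkCor, mul_smul]
  | add x y hx hy => simp only [smul_add, map_add, hx, hy]

theorem ψ'_mul (c : C) (a a' : A) :
    E.ψ' (tmul _ _ c (a * a')) = E.rmulHom a' (E.ψ' (tmul _ _ c a)) := by
  refine (E.ψ_mul c a a').trans ?_
  change _ = E.rmulHom a' (E.of (E.ψ (tmul _ _ c a)))
  generalize E.ψ (tmul _ _ c a) = z
  induction z using induction_on with
  | zero => rw [zero_tmul]; simp only [map_zero]; rfl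
  | tmul b c => rfl
  | add x y hx hy => rw [add_tmul]; simp only [map_add, hx, hy]; rfl

instance : Module Aᵐᵒᵖ E.Cor where
  smul a := E.rmulHom a.unop
  one_smul z := by
    change E.rmulHom 1 z = z
    induction z using E.mkCor_induction with
    | zero => simp
    | mk a c =>
      rw [rmulHom_mkCor]
      refine (congrArg (a • ·) (E.ψ_one c)).trans ?_
      change E.mkCor (a * 1) c = _
      rw [mul_one]
    | add x y hx hy => simp only [map_add, hx, hy]
  mul_smul a b z := by
    change E.rmulHom (b.unop * a.unop) z = E.rmulHom a.unop (E.rmulHom b.unop z)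
    induction z using E.mkCor_induction with
    | zero => simp
    | mk a c => rw [rmulHom_mkCor, rmulHom_mkCor, rmulHom_smul, ψ'_mul]
    | add x y hx hy => simp only [map_add, hx, hy]
  smul_zero a := map_zero _
  smul_add a := map_add _
  add_smul a b z := by
    change E.rmulHom (a.unop + b.unop) z = E.rmulHom a.unop z + E.rmulHom b.unop z
    induction z using E.mkCor_induction with
    | zero => simp
    | mk a c => simp only [rmulHom_mkCor, tmul_add, map_add, smul_add]
    | add x y hx hy => simp only [map_add, hx, hy]; abel
  zero_smul z := by
    change E.rmulHom 0 z = 0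
    induction z using E.mkCor_induction with
    | zero => simp
    | mk a c => simp only [rmulHom_mkCor, tmul_zero, map_zero, smul_zero]
    | add x y hx hy => simp only [map_add, hx, hy, add_zero]

theorem op_smul_mkCor (a a' : A) (c : C) :
    op a' • E.mkCor a c = a • E.ψ' (tmul _ _ c a') := rfl

instance : SMulCommClass A Aᵐᵒᵖ E.Cor where
  smul_comm a b z := (E.rmulHom_smul a b.unop z).symm

/-- The right action of `R` on `A ⊗_R C` is the restriction of the right action of `A`. -/
theorem op_α_smul_mkCor (r : R) (a : A) (c : C) :
    op (α r) • E.mkCor a c = E.mkCor a (op r • c) := by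
  rw [op_smul_mkCor]
  have h : tmul (RingHom.id R) α c (α r) = op (α r) • tmul (RingHom.id R) α c 1 := by
    rw [rsmul_tmul, op_smul_eq_mul, one_mul]
  have h2 : E.ψ (tmul (RingHom.id R) α c (α r)) = tmul _ _ 1 (op r • c) := by
    rw [h, E.ψ_rsmul, E.ψ_one]
    rfl
  refine (congrArg (a • ·) h2).trans ?_
  change E.mkCor (a * 1) (op r • c) = _
  rw [mul_one]

theorem op_α_smul (r : R) (z : E.Cor) : op (α r) • z = op r • z := by
  induction z using E.mkCor_induction with
  | zero => simp
  | mk a c => exact E.op_α_smul_mkCor r a c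
  | add x y hx hy => simp only [smul_add, hx, hy]

theorem mkCor_smul (r : R) (c : C) : E.mkCor 1 (r • c) = α r • E.mkCor 1 c := by
  rw [smul_mkCor, mul_one]
  have := (smul_tmul α (RingHom.id R) r (1 : A) c).symm
  rw [op_smul_eq_mul, one_mul] at this
  exact congrArg E.of this

theorem mkCor_add (a : A) (c d : C) : E.mkCor a (c + d) = E.mkCor a c + E.mkCor a d :=
  congrArg E.of (tmul_add α (RingHom.id R) a c d)

/-- `(a ⊗ c) ⊗ d ↦ (a ⊗ c) ⊗ (1 ⊗ d)` -/
def incl : BTensor (RingHom.id R) (RingHom.id R) (BTensor α (RingHom.id R) A C) C →+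
    BTensor (RingHom.id A) (RingHom.id A) E.Cor E.Cor :=
  lift
    (biadd (fun z d => tmul (RingHom.id A) (RingHom.id A) (E.of z) (E.mkCor 1 d))
      (fun z w d => by rw [map_add, add_tmul])
      (fun z d d' => by rw [mkCor_add, tmul_add]))
    (fun r z d => by
      simp only [biadd_apply, RingHom.id_apply]
      have h : E.of (op r • z) = op ((RingHom.id A) (α r)) • E.of z :=
        (E.op_α_smul r (E.of z)).symm
      rw [mkCor_smul, h, smul_tmul, RingHom.id_apply])

theorem incl_tmul (z : BTensor α (RingHom.id R) A C) (d : C) :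
    E.incl (tmul (RingHom.id R) (RingHom.id R) z d) =
      tmul (RingHom.id A) (RingHom.id A) (E.of z) (E.mkCor 1 d) := rfl

/-- The coproduct `a ⊗ c ↦ Σ (a ⊗ c₁) ⊗_A (1 ⊗ c₂)`. -/
def comul : E.Cor →+ BTensor (RingHom.id A) (RingHom.id A) E.Cor E.Cor :=
  E.incl.comp ((assoc (φ₁ := α) (ψ₁ := RingHom.id R) (φ₂ := RingHom.id R)
    (ψ₂ := RingHom.id R)).symm.toAddMonoidHom.comp
      ((mapR (φ := α) (ψ := RingHom.id R) (RingHom.id R) K.comul K.comul_lsmul).comp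
        E.of.symm.toAddMonoidHom))

/-- The counit `a ⊗ c ↦ a α(ε(c))`. -/
def counit : E.Cor →+ A :=
  (ract (φ := α) (ψ := RingHom.id R) α (fun _ => rfl)).comp
    ((mapR (φ := α) (ψ := RingHom.id R) (RingHom.id R) K.counit K.counit_lsmul).comp
      E.of.symm.toAddMonoidHom)

theorem counit_mkCor (a : A) (c : C) : E.counit (E.mkCor a c) = a * α (K.counit c) := rfl

/-- `c ⊗ d ↦ (a ⊗ c) ⊗_A (1 ⊗ d)` -/
def incl₂ (a : A) : BTensor (RingHom.id R) (RingHom.id R) C C →+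
    BTensor (RingHom.id A) (RingHom.id A) E.Cor E.Cor :=
  E.incl.comp ((assoc (φ₁ := α) (ψ₁ := RingHom.id R) (φ₂ := RingHom.id R)
    (ψ₂ := RingHom.id R)).symm.toAddMonoidHom.comp (BTensor.mk α (RingHom.id R) a))

theorem incl₂_tmul (a : A) (c d : C) : E.incl₂ a (tmul (RingHom.id R) (RingHom.id R) c d) =
    tmul (RingHom.id A) (RingHom.id A) (E.mkCor a c) (E.mkCor 1 d) := rfl

theorem comul_mkCor (a : A) (c : C) : E.comul (E.mkCor a c) = E.incl₂ a (K.comul c) := rfl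

theorem incl₂_mul (a b : A) (w : BTensor (RingHom.id R) (RingHom.id R) C C) :
    E.incl₂ (a * b) w = a • E.incl₂ b w := by
  induction w using induction_on with
  | zero => simp
  | tmul c d => rfl
  | add x y hx hy => simp only [map_add, smul_add, hx, hy]

theorem comul_lsmul (a : A) (z : E.Cor) : E.comul (a • z) = a • E.comul z := by
  induction z using E.mkCor_induction with
  | zero => simp
  | mk b c => rw [smul_mkCor, comul_mkCor, comul_mkCor, incl₂_mul]
  | add x y hx hy => simp only [map_add, smul_add, hx, hy]

theorem counit_lsmul (a : A) (z : E.Cor) : E.counit (a • z) = a • E.counit z := by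
  induction z using E.mkCor_induction with
  | zero => simp
  | mk b c => rw [smul_mkCor, counit_mkCor, counit_mkCor, smul_eq_mul, mul_assoc]
  | add x y hx hy => simp only [map_add, smul_add, hx, hy]

theorem comul_aux (c : C) (y : BTensor α (RingHom.id R) A C) :
    E.incl (mapL (φ := α) (ψ := RingHom.id R) (RingHom.id R) E.ψ E.ψ_rsmul
      (assoc.symm (tmul (RingHom.id R) α c y))) =
      tmul (RingHom.id A) (RingHom.id A) (E.mkCor 1 c) (E.of y) := by
  induction y using induction_on with
  | zero => simp only [tmul_zero, map_zero]
  | tmul b e =>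
    change tmul (RingHom.id A) (RingHom.id A) (E.ψ' (tmul _ _ c b)) (E.mkCor 1 e) =
      tmul (RingHom.id A) (RingHom.id A) (E.mkCor 1 c) (E.mkCor b e)
    have h1 : E.ψ' (tmul _ _ c b) = op ((RingHom.id A) b) • E.mkCor 1 c := by
      rw [RingHom.id_apply, op_smul_mkCor, one_smul]
    rw [h1, smul_tmul, RingHom.id_apply, smul_mkCor, mul_one]
  | add x y hx hy => simp only [tmul_add, map_add, hx, hy]

theorem comul_ψ (c : C) (a : A) :
    E.comul (E.ψ' (tmul _ _ c a)) = op a • E.incl₂ 1 (K.comul c) := by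
  have h := E.ψ_comul (tmul _ _ c a)
  change E.incl (assoc.symm (mapR _ K.comul K.comul_lsmul (E.ψ (tmul _ _ c a)))) = _
  rw [h, AddEquiv.symm_apply_apply, mapL_tmul]
  generalize K.comul c = w
  induction w using induction_on with
  | zero => rw [zero_tmul]; simp only [map_zero, smul_zero]
  | tmul c d =>
    rw [assoc_tmul, mapR_tmul, comul_aux, incl₂_tmul, rsmul_tmul, op_smul_mkCor, one_smul]
    rfl
  | add x y hx hy => rw [add_tmul]; simp only [map_add, smul_add, hx, hy]

theorem comul_rsmul (a : A) (z : E.Cor) : E.comul (op a • z) = op a • E.comul z := by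
  induction z using E.mkCor_induction with
  | zero => simp
  | mk b c =>
    rw [op_smul_mkCor, comul_lsmul, comul_ψ, comul_mkCor, ← mul_one b, incl₂_mul, mul_one,
      smul_comm]
  | add x y hx hy => simp only [map_add, smul_add, hx, hy]

theorem counit_rsmul (a : A) (z : E.Cor) : E.counit (op a • z) = op a • E.counit z := by
  induction z using E.mkCor_induction with
  | zero => simp
  | mk b c =>
    have h : E.counit (E.ψ' (tmul _ _ c a)) = α (K.counit c) * a := E.ψ_counit (tmul _ _ c a)
    rw [op_smul_mkCor, counit_lsmul, h, counit_mkCor, op_smul_eq_mul, smul_eq_mul, mul_assoc]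
  | add x y hx hy => simp only [map_add, smul_add, hx, hy]

/-- `c ⊗ (d ⊗ e) ↦ (a ⊗ c) ⊗ ((1 ⊗ d) ⊗ (1 ⊗ e))` -/
def incl₃ (a : A) : BTensor (RingHom.id R) (RingHom.id R) C
      (BTensor (RingHom.id R) (RingHom.id R) C C) →+
    BTensor (RingHom.id A) (RingHom.id A) E.Cor
      (BTensor (RingHom.id A) (RingHom.id A) E.Cor E.Cor) :=
  lift (biadd (fun c w => tmul _ _ (E.mkCor a c) (E.incl₂ 1 w))
      (fun c d w => by rw [mkCor_add, add_tmul])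
      (fun c w w' => by rw [map_add, tmul_add]))
    (fun r c w => by
      have h2 : E.incl₂ 1 (r • w) = α r • E.incl₂ 1 w := by
        rw [← incl₂_mul, mul_one]
        induction w using induction_on with
        | zero => simp
        | tmul d e => rw [lsmul_tmul, incl₂_tmul, incl₂_tmul, mkCor_smul, smul_mkCor, mul_one]
        | add x y hx hy => simp only [map_add, smul_add, hx, hy]
      simp only [biadd_apply, RingHom.id_apply]
      rw [h2, ← op_α_smul_mkCor]
      exact smul_tmul (RingHom.id A) (RingHom.id A) (α r) (E.mkCor a c) (E.incl₂ 1 w))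

theorem incl₃_tmul (a : A) (c : C) (w : BTensor (RingHom.id R) (RingHom.id R) C C) :
    E.incl₃ a (tmul (RingHom.id R) (RingHom.id R) c w) = tmul _ _ (E.mkCor a c) (E.incl₂ 1 w) := rfl

theorem coassoc (z : E.Cor) : assoc (mapL (φ := RingHom.id A) (ψ := RingHom.id A)
    (RingHom.id A) E.comul E.comul_rsmul (E.comul z)) =
      mapR (φ := RingHom.id A) (ψ := RingHom.id A) (RingHom.id A) E.comul E.comul_lsmul (E.comul z) := by
  induction z using E.mkCor_induction with
  | zero => simp
  | mk a c =>
    have h := congrArg (E.incl₃ a) (K.coassoc c)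
    rw [comul_mkCor]
    refine Eq.trans ?_ (h.trans ?_)
    · generalize K.comul c = w
      induction w using induction_on with
      | zero => simp only [map_zero]
      | tmul c d =>
        rw [incl₂_tmul, mapL_tmul, mapL_tmul, comul_mkCor]
        generalize K.comul c = w
        induction w using induction_on with
        | zero => simp only [zero_tmul, map_zero]
        | tmul c d => rfl
        | add x y hx hy => simp only [add_tmul, map_add, hx, hy]
      | add x y hx hy => simp only [map_add, hx, hy]
    · generalize K.comul c = w
      induction w using induction_on with
      | zero => simp only [map_zero]
      | tmul c d => rw [incl₂_tmul, mapR_tmul, mapR_tmul, comul_mkCor, incl₃_tmul]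
      | add x y hx hy => simp only [map_add, hx, hy]
  | add x y hx hy => simp only [map_add, hx, hy]

theorem lcounit (z : E.Cor) : lact (φ := RingHom.id A) (ψ := RingHom.id A) (RingHom.id A)
    (fun _ => rfl) (mapL (φ := RingHom.id A) (ψ := RingHom.id A) (RingHom.id A)
      E.counit E.counit_rsmul (E.comul z)) = z := by
  induction z using E.mkCor_induction with
  | zero => simp
  | mk a c =>
    have h := congrArg (BTensor.mk α (RingHom.id R) a) (K.lcounit c)
    refine Eq.trans ?_ h
    rw [comul_mkCor]
    generalize K.comul c = w
    induction w using induction_on with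
    | zero => simp only [map_zero]; rfl
    | tmul c d =>
      change E.mkCor (a * α (K.counit c) * 1) d = tmul _ _ a (K.counit c • d)
      rw [mul_one]
      exact smul_tmul α (RingHom.id R) (K.counit c) a d
    | add x y hx hy => simp only [map_add, hx, hy]; rfl
  | add x y hx hy => simp only [map_add, hx, hy]

theorem rcounit (z : E.Cor) : ract (φ := RingHom.id A) (ψ := RingHom.id A) (RingHom.id A)
    (fun _ => rfl) (mapR (φ := RingHom.id A) (ψ := RingHom.id A) (RingHom.id A)
      E.counit E.counit_lsmul (E.comul z)) = z := by
  induction z using E.mkCor_induction with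
  | zero => simp
  | mk a c =>
    have h := congrArg (BTensor.mk α (RingHom.id R) a) (K.rcounit c)
    refine Eq.trans ?_ h
    rw [comul_mkCor]
    generalize K.comul c = w
    induction w using induction_on with
    | zero => simp only [map_zero]; rfl
    | tmul c d =>
      change op (1 * α (K.counit d)) • E.mkCor a c = tmul _ _ a (op (K.counit d) • c)
      rw [one_mul, op_α_smul_mkCor]
      rfl
    | add x y hx hy => simp only [map_add, hx, hy]; rfl
  | add x y hx hy => simp only [map_add, hx, hy]

/-- The `A`-coring `A ⊗_R C` associated to the entwining. -/
def coring : Coring A E.Cor where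
  comul := E.comul
  comul_lsmul := E.comul_lsmul
  comul_rsmul := E.comul_rsmul
  counit := E.counit
  counit_lsmul := E.counit_lsmul
  counit_rsmul := E.counit_rsmul
  coassoc := E.coassoc
  lcounit := E.lcounit
  rcounit := E.rcounit

end RightEntwining

namespace LeftEntwining

variable {S B D : Type*} [Ring S] [Ring B] [AddCommGroup D] [Module S D]
  [Module Sᵐᵒᵖ D] [SMulCommClass S Sᵐᵒᵖ D] {β : S →+* B} {K : Coring S D}

/-- The underlying set of the `B`-coring `D ⊗_S B`. -/
def Cor (_ : LeftEntwining β K) : Type _ := BTensor (RingHom.id S) β D B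

variable (E : LeftEntwining β K)

instance : AddCommGroup E.Cor := BTensor.addCommGroup (RingHom.id S) β

instance : Module Bᵐᵒᵖ E.Cor := inferInstanceAs (Module Bᵐᵒᵖ (BTensor (RingHom.id S) β D B))

instance : Module S E.Cor := inferInstanceAs (Module S (BTensor (RingHom.id S) β D B))

/-- The elements of `D ⊗_S B` as elements of the coring. -/
def of : BTensor (RingHom.id S) β D B ≃+ E.Cor := AddEquiv.refl _

/-- `d ⊗ b` as an element of the coring. -/
def mkCor (d : D) (b : B) : E.Cor := E.of (tmul (RingHom.id S) β d b)

/-- `χ` with values in the coring. -/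
def χ' : BTensor β (RingHom.id S) B D →+ E.Cor := E.of.toAddMonoidHom.comp E.χ

/-- The left multiplication `b' (d ⊗ b) = χ(b' ⊗ d) b`. -/
def lmulHom (b' : B) : E.Cor →+ E.Cor :=
  lift (φ := RingHom.id S) (ψ := β)
    (biadd (fun d b => op b • E.χ' (tmul _ _ b' d))
      (fun d e b => by rw [tmul_add, map_add, smul_add])
      (fun d a b => add_smul (op a) (op b) _))
    (fun s d b => by
      have := E.χ_rsmul s (tmul _ _ b' d)
      change op b • E.χ (tmul _ _ b' (op s • d)) = op (β s * b) • E.χ (tmul _ _ b' d)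
      rw [← rsmul_tmul, this, op_mul, mul_smul])

theorem lmulHom_mkCor (b' b : B) (d : D) :
    E.lmulHom b' (E.mkCor d b) = op b • E.χ' (tmul _ _ b' d) := rfl

theorem mkCor_induction {p : E.Cor → Prop} (z : E.Cor) (zero : p 0)
    (mk : ∀ d b, p (E.mkCor d b)) (add : ∀ x y, p x → p y → p (x + y)) : p z :=
  induction_on (φ := RingHom.id S) (ψ := β) z zero mk add

theorem op_smul_mkCor (a b : B) (d : D) : op a • E.mkCor d b = E.mkCor d (b * a) := rfl

theorem lmulHom_smul (a b : B) (z : E.Cor) : E.lmulHom b (op a • z) = op a • E.lmulHom b z := by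
  induction z using E.mkCor_induction with
  | zero => simp
  | mk d c => rw [op_smul_mkCor, lmulHom_mkCor, lmulHom_mkCor, op_mul, mul_smul]
  | add x y hx hy => simp only [smul_add, map_add, hx, hy]

theorem χ'_mul (b b' : B) (d : D) :
    E.χ' (tmul _ _ (b * b') d) = E.lmulHom b (E.χ' (tmul _ _ b' d)) := by
  refine (E.χ_mul b b' d).trans ?_
  change _ = E.lmulHom b (E.of (E.χ (tmul _ _ b' d)))
  generalize E.χ (tmul _ _ b' d) = z
  induction z using induction_on with
  | zero => rw [tmul_zero]; simp only [map_zero]; rfl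
  | tmul b c => rfl
  | add x y hx hy => rw [tmul_add]; simp only [map_add, hx, hy]; rfl

instance : Module B E.Cor where
  smul b := E.lmulHom b
  one_smul z := by
    change E.lmulHom 1 z = z
    induction z using E.mkCor_induction with
    | zero => simp
    | mk d b =>
      rw [lmulHom_mkCor]
      refine (congrArg (op b • ·) (E.χ_one d)).trans ?_
      change E.mkCor d (1 * b) = _
      rw [one_mul]
    | add x y hx hy => simp only [map_add, hx, hy]
  mul_smul a b z := by
    change E.lmulHom (a * b) z = E.lmulHom a (E.lmulHom b z)
    induction z using E.mkCor_induction with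
    | zero => simp
    | mk d c => rw [lmulHom_mkCor, lmulHom_mkCor, lmulHom_smul, χ'_mul]
    | add x y hx hy => simp only [map_add, hx, hy]
  smul_zero a := map_zero _
  smul_add a := map_add _
  add_smul a b z := by
    change E.lmulHom (a + b) z = E.lmulHom a z + E.lmulHom b z
    induction z using E.mkCor_induction with
    | zero => simp
    | mk d c => simp only [lmulHom_mkCor, add_tmul, map_add, smul_add]
    | add x y hx hy => simp only [map_add, hx, hy]; abel
  zero_smul z := by
    change E.lmulHom 0 z = 0
    induction z using E.mkCor_induction with
    | zero => simp
    | mk d c => simp only [lmulHom_mkCor, zero_tmul, map_zero, smul_zero]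
    | add x y hx hy => simp only [map_add, hx, hy, add_zero]

theorem smul_mkCor (b' b : B) (d : D) :
    b' • E.mkCor d b = op b • E.χ' (tmul _ _ b' d) := rfl

instance : SMulCommClass B Bᵐᵒᵖ E.Cor where
  smul_comm b a z := E.lmulHom_smul a.unop b z

/-- The left action of `S` on `D ⊗_S B` is the restriction of the left action of `B`. -/
theorem β_smul_mkCor (s : S) (b : B) (d : D) :
    β s • E.mkCor d b = E.mkCor (s • d) b := by
  rw [smul_mkCor]
  have h : tmul β (RingHom.id S) (β s) d = β s • tmul β (RingHom.id S) 1 d := by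
    rw [lsmul_tmul, smul_eq_mul, mul_one]
  have h2 : E.χ (tmul β (RingHom.id S) (β s) d) = tmul _ _ (s • d) 1 := by
    rw [h, E.χ_lsmul, E.χ_one]
    rfl
  refine (congrArg (op b • ·) h2).trans ?_
  change E.mkCor (s • d) (1 * b) = _
  rw [one_mul]

theorem β_smul (s : S) (z : E.Cor) : β s • z = s • z := by
  induction z using E.mkCor_induction with
  | zero => simp
  | mk d b => exact E.β_smul_mkCor s b d
  | add x y hx hy => simp only [smul_add, hx, hy]

theorem mkCor_smul (s : S) (d : D) : E.mkCor (op s • d) 1 = op (β s) • E.mkCor d 1 := by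
  rw [op_smul_mkCor, one_mul]
  have := smul_tmul (RingHom.id S) β s d (1 : B)
  rw [smul_eq_mul, mul_one] at this
  exact congrArg E.of this

theorem mkCor_add (b : B) (c d : D) : E.mkCor (c + d) b = E.mkCor c b + E.mkCor d b :=
  congrArg E.of (add_tmul (RingHom.id S) β c d b)

/-- `d ⊗ (e ⊗ b) ↦ (d ⊗ 1) ⊗ (e ⊗ b)` -/
def incl : BTensor (RingHom.id S) (RingHom.id S) D (BTensor (RingHom.id S) β D B) →+
    BTensor (RingHom.id B) (RingHom.id B) E.Cor E.Cor :=
  lift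
    (biadd (fun d z => tmul (RingHom.id B) (RingHom.id B) (E.mkCor d 1) (E.of z))
      (fun d d' z => by rw [mkCor_add, add_tmul])
      (fun d z w => by rw [map_add, tmul_add]))
    (fun s d z => by
      simp only [biadd_apply, RingHom.id_apply]
      have h : E.of (s • z) = ((RingHom.id B) (β s)) • E.of z := (E.β_smul s (E.of z)).symm
      rw [mkCor_smul, h, ← smul_tmul, RingHom.id_apply])

theorem incl_tmul (d : D) (z : BTensor (RingHom.id S) β D B) :
    E.incl (tmul (RingHom.id S) (RingHom.id S) d z) =
      tmul (RingHom.id B) (RingHom.id B) (E.mkCor d 1) (E.of z) := rfl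

/-- The coproduct `d ⊗ b ↦ Σ (d₁ ⊗ 1) ⊗_B (d₂ ⊗ b)`. -/
def comul : E.Cor →+ BTensor (RingHom.id B) (RingHom.id B) E.Cor E.Cor :=
  E.incl.comp ((assoc (φ₁ := RingHom.id S) (ψ₁ := RingHom.id S) (φ₂ := RingHom.id S)
    (ψ₂ := β)).toAddMonoidHom.comp
      ((mapL (φ := RingHom.id S) (ψ := β) (RingHom.id S) K.comul K.comul_rsmul).comp
        E.of.symm.toAddMonoidHom))

/-- The counit `d ⊗ b ↦ β(ε(d)) b`. -/
def counit : E.Cor →+ B :=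
  (lact (φ := RingHom.id S) (ψ := β) β (fun _ => rfl)).comp
    ((mapL (φ := RingHom.id S) (ψ := β) (RingHom.id S) K.counit K.counit_rsmul).comp
      E.of.symm.toAddMonoidHom)

theorem counit_mkCor (d : D) (b : B) : E.counit (E.mkCor d b) = β (K.counit d) * b := rfl

/-- `c ⊗ d ↦ (c ⊗ 1) ⊗_B (d ⊗ b)` -/
def incl₂ (b : B) : BTensor (RingHom.id S) (RingHom.id S) D D →+
    BTensor (RingHom.id B) (RingHom.id B) E.Cor E.Cor :=
  E.incl.comp ((assoc (φ₁ := RingHom.id S) (ψ₁ := RingHom.id S) (φ₂ := RingHom.id S)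
    (ψ₂ := β)).toAddMonoidHom.comp ((BTensor.mk (RingHom.id S) β).flip b))

theorem incl₂_tmul (b : B) (c d : D) : E.incl₂ b (tmul (RingHom.id S) (RingHom.id S) c d) =
    tmul (RingHom.id B) (RingHom.id B) (E.mkCor c 1) (E.mkCor d b) := rfl

theorem comul_mkCor (d : D) (b : B) : E.comul (E.mkCor d b) = E.incl₂ b (K.comul d) := rfl

theorem incl₂_mul (a b : B) (w : BTensor (RingHom.id S) (RingHom.id S) D D) :
    E.incl₂ (b * a) w = op a • E.incl₂ b w := by
  induction w using induction_on with
  | zero => simp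
  | tmul c d => rfl
  | add x y hx hy => simp only [map_add, smul_add, hx, hy]

theorem comul_rsmul (a : B) (z : E.Cor) : E.comul (op a • z) = op a • E.comul z := by
  induction z using E.mkCor_induction with
  | zero => simp
  | mk b c => rw [op_smul_mkCor, comul_mkCor, comul_mkCor, incl₂_mul]
  | add x y hx hy => simp only [map_add, smul_add, hx, hy]

theorem counit_rsmul (a : B) (z : E.Cor) : E.counit (op a • z) = op a • E.counit z := by
  induction z using E.mkCor_induction with
  | zero => simp
  | mk b c => rw [op_smul_mkCor, counit_mkCor, counit_mkCor, op_smul_eq_mul, mul_assoc]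
  | add x y hx hy => simp only [map_add, smul_add, hx, hy]

theorem comul_aux (e : D) (y : BTensor (RingHom.id S) β D B) :
    E.incl (mapR (φ := RingHom.id S) (ψ := β) (RingHom.id S) E.χ E.χ_lsmul
      (assoc (tmul β (RingHom.id S) y e))) =
      tmul (RingHom.id B) (RingHom.id B) (E.of y) (E.mkCor e 1) := by
  induction y using induction_on with
  | zero => simp only [zero_tmul, map_zero]
  | tmul d b =>
    change tmul (RingHom.id B) (RingHom.id B) (E.mkCor d 1) (E.χ' (tmul _ _ b e)) =
      tmul (RingHom.id B) (RingHom.id B) (E.mkCor d b) (E.mkCor e 1)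
    have h1 : E.χ' (tmul _ _ b e) = (RingHom.id B) b • E.mkCor e 1 := by
      rw [RingHom.id_apply, smul_mkCor, op_one, one_smul]
    rw [h1, ← smul_tmul, RingHom.id_apply, op_smul_mkCor, one_mul]
  | add x y hx hy => simp only [add_tmul, map_add, hx, hy]

theorem comul_χ (b : B) (d : D) :
    E.comul (E.χ' (tmul _ _ b d)) = b • E.incl₂ 1 (K.comul d) := by
  have h := E.χ_comul (tmul _ _ b d)
  change E.incl (assoc (mapL _ K.comul K.comul_rsmul (E.χ (tmul _ _ b d)))) = _
  rw [h, AddEquiv.apply_symm_apply, mapR_tmul]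
  generalize K.comul d = w
  induction w using induction_on with
  | zero => rw [tmul_zero]; simp only [map_zero, smul_zero]
  | tmul c d =>
    rw [assoc_symm_tmul, mapL_tmul, comul_aux, incl₂_tmul, lsmul_tmul, smul_mkCor, op_one,
      one_smul]
    rfl
  | add x y hx hy => rw [tmul_add]; simp only [map_add, smul_add, hx, hy]

theorem comul_lsmul (b : B) (z : E.Cor) : E.comul (b • z) = b • E.comul z := by
  induction z using E.mkCor_induction with
  | zero => simp
  | mk d c =>
    rw [smul_mkCor, comul_rsmul, comul_χ, comul_mkCor, ← one_mul c, incl₂_mul, one_mul,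
      smul_comm b (op c)]
  | add x y hx hy => simp only [map_add, smul_add, hx, hy]

theorem counit_lsmul (b : B) (z : E.Cor) : E.counit (b • z) = b • E.counit z := by
  induction z using E.mkCor_induction with
  | zero => simp
  | mk d c =>
    have h : E.counit (E.χ' (tmul _ _ b d)) = b * β (K.counit d) := E.χ_counit (tmul _ _ b d)
    rw [smul_mkCor, counit_rsmul, h, counit_mkCor, op_smul_eq_mul, smul_eq_mul, mul_assoc]
  | add x y hx hy => simp only [map_add, smul_add, hx, hy]

/-- `(c ⊗ d) ⊗ e ↦ ((c ⊗ 1) ⊗ (d ⊗ 1)) ⊗ (e ⊗ b)` -/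
def incl₃ (b : B) : BTensor (RingHom.id S) (RingHom.id S)
      (BTensor (RingHom.id S) (RingHom.id S) D D) D →+
    BTensor (RingHom.id B) (RingHom.id B)
      (BTensor (RingHom.id B) (RingHom.id B) E.Cor E.Cor) E.Cor :=
  lift (biadd (fun w c => tmul _ _ (E.incl₂ 1 w) (E.mkCor c b))
      (fun w w' c => by rw [map_add, add_tmul])
      (fun w c d => by rw [mkCor_add, tmul_add]))
    (fun s w c => by
      have h2 : E.incl₂ 1 (op s • w) = op (β s) • E.incl₂ 1 w := by
        rw [← incl₂_mul, one_mul]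
        induction w using induction_on with
        | zero => simp
        | tmul d e => rw [rsmul_tmul, incl₂_tmul, incl₂_tmul, mkCor_smul, op_smul_mkCor, one_mul]
        | add x y hx hy => simp only [map_add, smul_add, hx, hy]
      simp only [biadd_apply, RingHom.id_apply]
      rw [h2, ← β_smul_mkCor]
      exact smul_tmul (RingHom.id B) (RingHom.id B) (β s) (E.incl₂ 1 w) (E.mkCor c b))

theorem incl₃_tmul (b : B) (c : D) (w : BTensor (RingHom.id S) (RingHom.id S) D D) :
    E.incl₃ b (tmul (RingHom.id S) (RingHom.id S) w c) =
      tmul _ _ (E.incl₂ 1 w) (E.mkCor c b) := rfl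

theorem coassoc (z : E.Cor) : assoc (mapL (φ := RingHom.id B) (ψ := RingHom.id B)
    (RingHom.id B) E.comul E.comul_rsmul (E.comul z)) =
      mapR (φ := RingHom.id B) (ψ := RingHom.id B) (RingHom.id B) E.comul E.comul_lsmul
        (E.comul z) := by
  rw [← AddEquiv.eq_symm_apply]
  induction z using E.mkCor_induction with
  | zero => simp
  | mk d b =>
    have h := congrArg (fun t => E.incl₃ b (assoc.symm t)) (K.coassoc d)
    simp only [AddEquiv.symm_apply_apply] at h
    rw [comul_mkCor]
    refine Eq.trans ?_ (h.trans ?_)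
    · generalize K.comul d = w
      induction w using induction_on with
      | zero => simp only [map_zero]
      | tmul c d => rw [incl₂_tmul, mapL_tmul, mapL_tmul, comul_mkCor, incl₃_tmul]
      | add x y hx hy => simp only [map_add, hx, hy]
    · generalize K.comul d = w
      induction w using induction_on with
      | zero => simp only [map_zero]
      | tmul c d =>
        rw [incl₂_tmul, mapR_tmul, mapR_tmul, comul_mkCor]
        generalize K.comul d = w
        induction w using induction_on with
        | zero => simp only [tmul_zero, map_zero]
        | tmul c d => rfl
        | add x y hx hy => simp only [tmul_add, map_add, hx, hy]
      | add x y hx hy => simp only [map_add, hx, hy]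
  | add x y hx hy => simp only [map_add, hx, hy]

theorem lcounit (z : E.Cor) : lact (φ := RingHom.id B) (ψ := RingHom.id B) (RingHom.id B)
    (fun _ => rfl) (mapL (φ := RingHom.id B) (ψ := RingHom.id B) (RingHom.id B)
      E.counit E.counit_rsmul (E.comul z)) = z := by
  induction z using E.mkCor_induction with
  | zero => simp
  | mk d b =>
    have h := congrArg ((BTensor.mk (RingHom.id S) β).flip b) (K.lcounit d)
    refine Eq.trans ?_ h
    rw [comul_mkCor]
    generalize K.comul d = w
    induction w using induction_on with
    | zero => simp only [map_zero]; rfl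
    | tmul c d =>
      change (β (K.counit c) * 1) • E.mkCor d b = tmul _ _ (K.counit c • d) b
      rw [mul_one, β_smul_mkCor]
      rfl
    | add x y hx hy => simp only [map_add, hx, hy]; rfl
  | add x y hx hy => simp only [map_add, hx, hy]

theorem rcounit (z : E.Cor) : ract (φ := RingHom.id B) (ψ := RingHom.id B) (RingHom.id B)
    (fun _ => rfl) (mapR (φ := RingHom.id B) (ψ := RingHom.id B) (RingHom.id B)
      E.counit E.counit_lsmul (E.comul z)) = z := by
  induction z using E.mkCor_induction with
  | zero => simp
  | mk d b =>
    have h := congrArg ((BTensor.mk (RingHom.id S) β).flip b) (K.rcounit d)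
    refine Eq.trans ?_ h
    rw [comul_mkCor]
    generalize K.comul d = w
    induction w using induction_on with
    | zero => simp only [map_zero]; rfl
    | tmul c d =>
      change E.mkCor c (1 * (β (K.counit d) * b)) = tmul _ _ (op (K.counit d) • c) b
      rw [one_mul]
      exact (smul_tmul (RingHom.id S) β (K.counit d) c b).symm
    | add x y hx hy => simp only [map_add, hx, hy]; rfl
  | add x y hx hy => simp only [map_add, hx, hy]

/-- The `B`-coring `D ⊗_S B` associated to the entwining. -/
def coring : Coring B E.Cor where
  comul := E.comul
  comul_lsmul := E.comul_lsmul
  comul_rsmul := E.comul_rsmul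
  counit := E.counit
  counit_lsmul := E.counit_lsmul
  counit_rsmul := E.counit_rsmul
  coassoc := E.coassoc
  lcounit := E.lcounit
  rcounit := E.rcounit

end LeftEntwining

end Entwining

/-! ### Formal duals, bimodule herds -/

section Herd

variable {R S A B : Type u} [Ring R] [Ring S] [Ring A] [Ring B] (α : R →+* A) (β : S →+* B)
  (T : Type u) [AddCommGroup T] [Module B T] [Module Aᵐᵒᵖ T] [SMulCommClass B Aᵐᵒᵖ T]

/-- The data making an `A`-`B` bimodule `P` a formal dual of the `B`-`A` bimodule `T`: an
`A`-bimodule map `ev : P ⊗_S T → A` and a `B`-bimodule map `coev : T ⊗_R P → B`. -/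
structure FormalDual (P : Type u) [AddCommGroup P] [Module A P] [Module Bᵐᵒᵖ P]
    [SMulCommClass A Bᵐᵒᵖ P] where
  ev : BTensor β β P T →+ A
  ev_lsmul : ∀ (a : A) z, ev (a • z) = a • ev z
  ev_rsmul : ∀ (a : A) z, ev (op a • z) = op a • ev z
  coev : BTensor α α T P →+ B
  coev_lsmul : ∀ (b : B) z, coev (b • z) = b • coev z
  coev_rsmul : ∀ (b : B) z, coev (op b • z) = op b • coev z
  coev_smul : ∀ (x : T) (p : P) (y : T), coev (tmul α α x p) • y = op (ev (tmul β β p y)) • x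
  smul_coev : ∀ (p : P) (x : T) (q : P), op (coev (tmul α α x q)) • p = ev (tmul β β p x) • q

variable {α β T}

/-- A shepherd: an `S`-`R` bimodule map `γ : T → T ⊗_R P ⊗_S T` that is unital and
coassociative, where `P` is the pen. -/
structure Shepherd {P : Type u} [AddCommGroup P] [Module A P] [Module Bᵐᵒᵖ P]
    [SMulCommClass A Bᵐᵒᵖ P] (d : FormalDual α β T P) where
  γ : T →+ BTensor α α T (BTensor β β P T)
  γ_lsmul : ∀ (s : S) (x : T), γ (β s • x) = β s • γ x
  γ_rsmul : ∀ (r : R) (x : T), γ (op (α r) • x) = op (α r) • γ x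
  /-- `(coev ⊗_S T) ∘ γ = β ⊗_S T` -/
  coev_γ : ∀ x : T,
    mapL (φ := β) (ψ := β) β d.coev (fun s z => d.coev_rsmul (β s) z) (assoc.symm (γ x)) =
      tmul β β 1 x
  /-- `(T ⊗_R ev) ∘ γ = T ⊗_R α` -/
  ev_γ : ∀ x : T,
    mapR (φ := α) (ψ := α) α d.ev (fun r z => d.ev_lsmul (α r) z) (γ x) = tmul α α x 1
  /-- `(γ ⊗_R P ⊗_S T) ∘ γ = (T ⊗_R P ⊗_S γ) ∘ γ` -/
  coassoc : ∀ x : T,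
    mapR (φ := α) (ψ := α) α (assoc (φ₁ := β) (ψ₁ := β) (φ₂ := α) (ψ₂ := α)).toAddMonoidHom
        (fun r z => by
          induction z using induction_on with
          | zero => simp
          | tmul z w =>
            induction z using induction_on with
            | zero => simp only [zero_tmul, smul_zero, map_zero]
            | tmul p y => rfl
            | add z z' hz hz' => simp only [add_tmul, smul_add, map_add, hz, hz']
          | add z z' hz hz' => simp only [smul_add, map_add, hz, hz'])
        (assoc (mapL (φ := α) (ψ := α) α γ γ_rsmul (γ x))) =
      mapR (φ := α) (ψ := α) α (mapR (φ := β) (ψ := β) β γ γ_lsmul)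
        (fun r z => by
          induction z using induction_on with
          | zero => simp
          | tmul p y => rfl
          | add z z' hz hz' => simp only [smul_add, map_add, hz, hz'])
        (γ x)

/-- The right `P`-module `M` is faithfully flat as a right `R`-module through `φ : R →+* P`:
the functor `M ⊗_R -` preserves and reflects exactness. -/
def RightFaithfullyFlat {P : Type u} [Ring P] (φ : R →+* P) (M : Type u) [AddCommGroup M]
    [Module Pᵐᵒᵖ M] : Prop :=
  ∀ (N₁ N₂ N₃ : Type u) [AddCommGroup N₁] [AddCommGroup N₂] [AddCommGroup N₃]
    [Module R N₁] [Module R N₂] [Module R N₃] (f : N₁ →ₗ[R] N₂) (g : N₂ →ₗ[R] N₃),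
    Function.Exact f g ↔ Function.Exact
      (mapR (φ := φ) (ψ := RingHom.id R) (M := M) (RingHom.id R) f.toAddMonoidHom f.map_smul)
      (mapR (φ := φ) (ψ := RingHom.id R) (M := M) (RingHom.id R) g.toAddMonoidHom g.map_smul)

/-- The left `Q`-module `M` is faithfully flat as a left `S`-module through `ψ : S →+* Q`:
the functor `- ⊗_S M` preserves and reflects exactness. -/
def LeftFaithfullyFlat {Q : Type u} [Ring Q] (ψ : S →+* Q) (M : Type u) [AddCommGroup M]
    [Module Q M] : Prop :=
  ∀ (N₁ N₂ N₃ : Type u) [AddCommGroup N₁] [AddCommGroup N₂] [AddCommGroup N₃]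
    [Module Sᵐᵒᵖ N₁] [Module Sᵐᵒᵖ N₂] [Module Sᵐᵒᵖ N₃] (f : N₁ →ₗ[Sᵐᵒᵖ] N₂)
    (g : N₂ →ₗ[Sᵐᵒᵖ] N₃),
    Function.Exact f g ↔ Function.Exact
      (mapL (φ := RingHom.id S) (ψ := ψ) (N := M) (RingHom.id S) f.toAddMonoidHom
        (fun s x => f.map_smul (op s) x))
      (mapL (φ := RingHom.id S) (ψ := ψ) (N := M) (RingHom.id S) g.toAddMonoidHom
        (fun s x => g.map_smul (op s) x))

/-- `α : R →+* A` is a split extension: it has a retraction that is an `R`-bimodule map. -/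
def IsSplitExtension (α : R →+* A) : Prop :=
  ∃ π : A →+ R, (∀ r a, π (α r * a) = r * π a) ∧ (∀ r a, π (a * α r) = π a * r) ∧
    ∀ r, π (α r) = r

/-- The right `A`-module `T` is a progenerator: a finitely generated projective generator. -/
structure IsProgenerator (A T : Type u) [Ring A] [AddCommGroup T] [Module Aᵐᵒᵖ T] : Prop where
  finite : Module.Finite Aᵐᵒᵖ T
  projective : Module.Projective Aᵐᵒᵖ T
  generator : ∀ (M N : Type u) [AddCommGroup M] [AddCommGroup N] [Module Aᵐᵒᵖ M]
    [Module Aᵐᵒᵖ N] (g : M →ₗ[Aᵐᵒᵖ] N), (∀ f : T →ₗ[Aᵐᵒᵖ] M, g.comp f = 0) → g = 0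

variable (α β T)

/-- `T` is a bimodule herd: it has a formal dual (the pen) and a shepherd. -/
def IsHerd : Prop :=
  ∃ (P : Type u) (_ : AddCommGroup P) (_ : Module A P) (_ : Module Bᵐᵒᵖ P)
    (_ : SMulCommClass A Bᵐᵒᵖ P) (d : FormalDual α β T P), Nonempty (Shepherd d)

/-- `T` is a tame bimodule herd: it is a herd, with a pen whose maps `ev` and `coev` are
surjective, and `T` is faithfully flat as a right `R`-module and as a left `S`-module. -/
def IsTameHerd : Prop :=
  (∃ (P : Type u) (_ : AddCommGroup P) (_ : Module A P) (_ : Module Bᵐᵒᵖ P)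
    (_ : SMulCommClass A Bᵐᵒᵖ P) (d : FormalDual α β T P),
      Nonempty (Shepherd d) ∧ Function.Surjective d.ev ∧ Function.Surjective d.coev) ∧
    RightFaithfullyFlat α T ∧ LeftFaithfullyFlat β T

/-- There are an `R`-coring `C` and a right entwining `C ⊗_R A → A ⊗_R C` over `R` such that `T`
is a right Galois comodule over the `A`-coring `A ⊗_R C`, with `S = End^{A ⊗_R C}(T)`. -/
def IsRightEntwinedGalois : Prop :=
  ∃ (C : Type u) (_ : AddCommGroup C) (_ : Module R C) (_ : Module Rᵐᵒᵖ C)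
    (_ : SMulCommClass R Rᵐᵒᵖ C) (K : Coring R C) (E : RightEntwining α K)
    (ρ : RightComodule E.coring T), ρ.IsGalois β

/-- There are an `S`-coring `D` and a left entwining `B ⊗_S D → D ⊗_S B` over `S` such that `T`
is a left Galois comodule over the `B`-coring `D ⊗_S B`, with `R = End^{D ⊗_S B}(T)`. -/
def IsLeftEntwinedGalois : Prop :=
  ∃ (D : Type u) (_ : AddCommGroup D) (_ : Module S D) (_ : Module Sᵐᵒᵖ D)
    (_ : SMulCommClass S Sᵐᵒᵖ D) (K : Coring S D) (E : LeftEntwining β K)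
    (ρ : LeftComodule E.coring T), ρ.IsGalois α

end Herd

end BimodHerd

/-! Let `P` be the pen and `γ : T → T ⊗_R P ⊗_S T` the shepherd. Evaluating the first two legs of `p
⊗ γ(x)` gives a left `A`-linear map `δ : P ⊗_S T → A ⊗_R (P ⊗_S T)`. Coassociativity of `γ` and the
unit law for `ev` make `δ` a descent datum along `α`, and the unit law for `coev` says that
multiplication is a left inverse of `δ`. If descent along `α` is effective, then `P ⊗_S T` is
isomorphic to `A ⊗_R C` with `C = {z | δ z = 1 ⊗ z}` (`Shepherd.descR_bijective`), and `γ` factors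
through a map `ρ : T → T ⊗_R C` (`Shepherd.mapR_inclR_coactR`).

The map `ρ` has a universal property: a left `R`-linear map `C → A ⊗_R N` is determined by the left
`S`-linear map `T → T ⊗_R N` that it induces through `ρ` (`Shepherd.coactR_hom_ext`), and a map `T →
T ⊗_R N` compatible with the descent data comes from a map `C → N` (`Shepherd.exists_coactR_hom`).
Hence the structure of `C` can be read off on `T`. The counit corresponds to `x ↦ x ⊗ 1`, the
coproduct to the iterated coaction, and `ψ(- ⊗ a)` to `x ↦ ρ(x a)`. Each axiom of a coring or an
entwining holds because both of its sides induce the same map on `T`.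

The canonical map of the resulting comodule is the descent isomorphism, up to `P ≅ Hom_A(T, A)`, so
it is bijective. If `b ∈ B` is colinear, then `1 ⊗ b = b ⊗ 1` in `B ⊗_S B`, and descent along `β`
puts `b` in the image of `S`.

Conversely, let `T` be a Galois comodule over `A ⊗_R C` and let `P = Hom_A(T, A)` be the standard
dual. The inverse of the canonical map sends `1 ⊗ c` to an element of `P ⊗_S T`; composing this
translation map with the coaction of `C` gives `γ`. The axioms of a shepherd are checked after
applying the canonical map, which is injective. This direction rests on bijectivity of the canonical
map alone, without descent (`RightGaloisCoaction.shepherd`).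

The hypotheses enter through `RightDescent` and `LeftDescent`: the units `N → A ⊗_R N` are
equalizers, and `A ⊗_R -` preserves the equalizers that define coinvariants. Faithful flatness gives
this because the Amitsur sequence is contractible after one more tensoring; a bimodule retraction
gives it because all the equalizers split.

Tameness is automatic under (i): `T` is a progenerator, so `ev` and `coev` hit `1`, and the Morita
context then transfers exactness between `A ⊗_R -` and `T ⊗_R -` (`FormalDual.exact_mapR_iff`). The
statement about left comodules is the mirror image, with `T ⊗_R P` in place of `P ⊗_S T`. -/

namespace BimodHerd

open BTensor

section AddHomClasses

variable {M N : Type*} [AddCommGroup M] [AddCommGroup N]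

instance : ZeroHomClass (M →+ N) M N := AddMonoidHomClass.toZeroHomClass

instance : AddHomClass (M →+ N) M N := AddMonoidHomClass.toAddHomClass

instance : ZeroHomClass (M ≃+ N) M N := AddMonoidHomClass.toZeroHomClass

instance : AddHomClass (M ≃+ N) M N := AddMonoidHomClass.toAddHomClass

end AddHomClasses

/-! ### Functoriality of the tensor product -/

namespace BTensor

section Maps

variable {R P Q P' Q' P'' Q'' : Type*} [Ring R] [Ring P] [Ring Q] [Ring P'] [Ring Q'] [Ring P'']
  [Ring Q''] {φ : R →+* P} {ψ : R →+* Q} {φ' : R →+* P'} {ψ' : R →+* Q'} {φ'' : R →+* P''}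
  {ψ'' : R →+* Q''} {M N M' N' M'' N'' : Type*}
  [AddCommGroup M] [Module Pᵐᵒᵖ M] [AddCommGroup N] [Module Q N]
  [AddCommGroup M'] [Module P'ᵐᵒᵖ M'] [AddCommGroup N'] [Module Q' N']
  [AddCommGroup M''] [Module P''ᵐᵒᵖ M''] [AddCommGroup N''] [Module Q'' N'']

theorem mapR_lsmul {L : Type*} [Ring L] [Module L M] [SMulCommClass L Pᵐᵒᵖ M] (g : N →+ N')
    (hg : ∀ r n, g (ψ r • n) = ψ' r • g n) (l : L) (z : BTensor φ ψ M N) :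
    mapR ψ' g hg (l • z) = l • mapR ψ' g hg z := by
  induction z using induction_on with
  | zero => simp
  | tmul m n => rfl
  | add x y hx hy => simp only [map_add, smul_add, hx, hy]

theorem mapL_rsmul {K : Type*} [Ring K] [Module Kᵐᵒᵖ N] [SMulCommClass Q Kᵐᵒᵖ N] (f : M →+ M')
    (hf : ∀ r m, f (op (φ r) • m) = op (φ' r) • f m) (k : K) (z : BTensor φ ψ M N) :
    mapL φ' f hf (op k • z) = op k • mapL φ' f hf z := by
  induction z using induction_on with
  | zero => simp
  | tmul m n => rfl
  | add x y hx hy => simp only [map_add, smul_add, hx, hy]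

theorem mapL_lsmul {L L' : Type*} [Ring L] [Module L M] [SMulCommClass L Pᵐᵒᵖ M] [Ring L']
    [Module L' M'] [SMulCommClass L' P'ᵐᵒᵖ M'] (f : M →+ M')
    (hf : ∀ r m, f (op (φ r) • m) = op (φ' r) • f m) (l : L) (l' : L')
    (h : ∀ m, f (l • m) = l' • f m) (z : BTensor φ ψ M N) :
    mapL φ' f hf (l • z) = l' • mapL φ' f hf z := by
  induction z using induction_on with
  | zero => simp
  | tmul m n => rw [lsmul_tmul, mapL_tmul, mapL_tmul, h, lsmul_tmul]
  | add x y hx hy => simp only [map_add, smul_add, hx, hy]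

theorem mapR_rsmul {K K' : Type*} [Ring K] [Module Kᵐᵒᵖ N] [SMulCommClass Q Kᵐᵒᵖ N] [Ring K']
    [Module K'ᵐᵒᵖ N'] [SMulCommClass Q' K'ᵐᵒᵖ N'] (g : N →+ N')
    (hg : ∀ r n, g (ψ r • n) = ψ' r • g n) (k : K) (k' : K')
    (h : ∀ n, g (op k • n) = op k' • g n) (z : BTensor φ ψ M N) :
    mapR ψ' g hg (op k • z) = op k' • mapR ψ' g hg z := by
  induction z using induction_on with
  | zero => simp
  | tmul m n => rw [rsmul_tmul, mapR_tmul, mapR_tmul, h, rsmul_tmul]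
  | add x y hx hy => simp only [map_add, smul_add, hx, hy]

/-- The composite is a separate variable `k` with its own linearity proof, so the lemma applies
whichever form the composite takes. -/
theorem mapR_mapR (g : N →+ N') (hg : ∀ r n, g (ψ r • n) = ψ' r • g n) (g' : N' →+ N'')
    (hg' : ∀ r n, g' (ψ' r • n) = ψ'' r • g' n) (k : N →+ N'')
    (hk : ∀ r n, k (ψ r • n) = ψ'' r • k n) (h : ∀ n, g' (g n) = k n)
    (z : BTensor φ ψ M N) :
    mapR ψ'' g' hg' (mapR ψ' g hg z) = mapR ψ'' k hk z := by
  induction z using induction_on with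
  | zero => simp
  | tmul m n => rw [mapR_tmul, mapR_tmul, h, mapR_tmul]
  | add x y hx hy => simp only [map_add, hx, hy]

theorem mapL_mapL (f : M →+ M') (hf : ∀ r m, f (op (φ r) • m) = op (φ' r) • f m) (f' : M' →+ M'')
    (hf' : ∀ r m, f' (op (φ' r) • m) = op (φ'' r) • f' m) (k : M →+ M'')
    (hk : ∀ r m, k (op (φ r) • m) = op (φ'' r) • k m) (h : ∀ m, f' (f m) = k m)
    (z : BTensor φ ψ M N) :
    mapL φ'' f' hf' (mapL φ' f hf z) = mapL φ'' k hk z := by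
  induction z using induction_on with
  | zero => simp
  | tmul m n => rw [mapL_tmul, mapL_tmul, h, mapL_tmul]
  | add x y hx hy => simp only [map_add, hx, hy]

theorem mapR_mapL (f : M →+ M') (hf : ∀ r m, f (op (φ r) • m) = op (φ' r) • f m)
    (g : N →+ N') (hg : ∀ r n, g (ψ r • n) = ψ' r • g n) (z : BTensor φ ψ M N) :
    mapR ψ' g hg (mapL φ' f hf z) = mapL φ' f hf (mapR ψ' g hg z) := by
  induction z using induction_on with
  | zero => simp
  | tmul m n => rfl
  | add x y hx hy => simp only [map_add, hx, hy]

theorem mapR_congr {g g' : N →+ N'} {hg : ∀ r n, g (ψ r • n) = ψ' r • g n}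
    {hg' : ∀ r n, g' (ψ r • n) = ψ' r • g' n} (h : ∀ n, g n = g' n) (z : BTensor φ ψ M N) :
    mapR ψ' g hg z = mapR ψ' g' hg' z := by
  obtain rfl : g = g' := AddMonoidHom.ext h
  rfl

theorem mapL_congr {f f' : M →+ M'} {hf : ∀ r m, f (op (φ r) • m) = op (φ' r) • f m}
    {hf' : ∀ r m, f' (op (φ r) • m) = op (φ' r) • f' m} (h : ∀ m, f m = f' m)
    (z : BTensor φ ψ M N) : mapL φ' f hf z = mapL φ' f' hf' z := by
  obtain rfl : f = f' := AddMonoidHom.ext h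
  rfl

/-- A linear retraction survives tensoring by functoriality, so no flatness is needed. -/
theorem mapR_injective_of_retraction (g : N →+ N') (hg : ∀ r n, g (ψ r • n) = ψ' r • g n)
    (e : N' →+ N) (he : ∀ r n, e (ψ' r • n) = ψ r • e n) (h : ∀ n, e (g n) = n) :
    Function.Injective (mapR (φ := φ) (M := M) ψ' g hg) :=
  Function.LeftInverse.injective (g := mapR ψ e he) fun z =>
    (mapR_mapR g hg e he (AddMonoidHom.id N) (fun _ _ => rfl) h z).trans (by
      induction z using induction_on with
      | zero => simp
      | tmul m n => rfl
      | add x y hx hy => simp only [map_add, hx, hy])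

theorem mapL_injective_of_retraction (f : M →+ M')
    (hf : ∀ r m, f (op (φ r) • m) = op (φ' r) • f m) (e : M' →+ M)
    (he : ∀ r m, e (op (φ' r) • m) = op (φ r) • e m) (h : ∀ m, e (f m) = m) :
    Function.Injective (mapL (ψ := ψ) (N := N) φ' f hf) :=
  Function.LeftInverse.injective (g := mapL φ e he) fun z =>
    (mapL_mapL f hf e he (AddMonoidHom.id M) (fun _ _ => rfl) h z).trans (by
      induction z using induction_on with
      | zero => simp
      | tmul m n => rfl
      | add x y hx hy => simp only [map_add, hx, hy])

end Maps

/-! ### Absorbing a ring factor and inserting a unit -/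

section Act

variable {R P Q : Type*} [Ring R] [Ring P] [Ring Q] {φ : R →+* P} {ψ : R →+* Q}
  {M N : Type*} [AddCommGroup M] [Module Pᵐᵒᵖ M] [AddCommGroup N] [Module Q N]

/-- `p ⊗ n ↦ m p ⊗ n` -/
def actL (m : M) : BTensor φ ψ P N →+ BTensor φ ψ M N :=
  mapL φ (AddMonoidHom.mk' (fun p : P => op p • m) (fun p p' => by rw [op_add, add_smul]))
    (fun r p => by simp [mul_smul])

/-- `m ⊗ q ↦ m ⊗ q n` -/
def actR (n : N) : BTensor φ ψ M Q →+ BTensor φ ψ M N :=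
  mapR ψ (AddMonoidHom.mk' (fun q : Q => q • n) (fun q q' => by rw [add_smul]))
    (fun r q => by simp [mul_smul])

@[simp] theorem actL_tmul (m : M) (p : P) (n : N) :
    actL m (tmul φ ψ p n) = tmul φ ψ (op p • m) n := rfl

@[simp] theorem actR_tmul (m : M) (q : Q) (n : N) :
    actR n (tmul φ ψ m q) = tmul φ ψ m (q • n) := rfl

theorem add_actL (m m' : M) (w : BTensor φ ψ P N) : actL (m + m') w = actL m w + actL m' w := by
  induction w using induction_on with
  | zero => simp
  | tmul p n => simp [add_tmul]
  | add x y hx hy => simp only [map_add, hx, hy]; abel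

theorem add_actR (n n' : N) (w : BTensor φ ψ M Q) : actR (n + n') w = actR n w + actR n' w := by
  induction w using induction_on with
  | zero => simp
  | tmul p n => simp [tmul_add]
  | add x y hx hy => simp only [map_add, hx, hy]; abel

/-- This is the balancedness that makes `absorbL` well defined. -/
theorem actL_smul (m : M) (p : P) (w : BTensor φ ψ P N) : actL m (p • w) = actL (op p • m) w := by
  induction w using induction_on with
  | zero => simp
  | tmul p' n => simp [mul_smul]
  | add x y hx hy => simp only [map_add, smul_add, hx, hy]

theorem actR_smul (n : N) (q : Q) (w : BTensor φ ψ M Q) : actR n (op q • w) = actR (q • n) w := by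
  induction w using induction_on with
  | zero => simp
  | tmul p' n => simp [mul_smul]
  | add x y hx hy => simp only [map_add, smul_add, hx, hy]

theorem smul_actL {L : Type*} [Ring L] [Module L M] [SMulCommClass L Pᵐᵒᵖ M] (l : L) (m : M)
    (w : BTensor φ ψ P N) : l • actL m w = actL (l • m) w := by
  induction w using induction_on with
  | zero => simp
  | tmul p' n => simp [smul_comm l]
  | add x y hx hy => simp only [map_add, smul_add, hx, hy]

theorem smul_actR {K : Type*} [Ring K] [Module Kᵐᵒᵖ N] [SMulCommClass Q Kᵐᵒᵖ N] (k : K) (n : N)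
    (w : BTensor φ ψ M Q) : op k • actR n w = actR (op k • n) w := by
  induction w using induction_on with
  | zero => simp
  | tmul p' n => simp [smul_comm _ (op k)]
  | add x y hx hy => simp only [map_add, smul_add, hx, hy]

theorem rsmul_actL {K : Type*} [Ring K] [Module Kᵐᵒᵖ N] [SMulCommClass Q Kᵐᵒᵖ N] (k : K) (m : M)
    (w : BTensor φ ψ P N) : actL m (op k • w) = op k • actL m w :=
  mapL_rsmul _ _ k w

theorem lsmul_actR {L : Type*} [Ring L] [Module L M] [SMulCommClass L Pᵐᵒᵖ M] (l : L) (n : N)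
    (w : BTensor φ ψ M Q) : actR n (l • w) = l • actR n w :=
  mapR_lsmul _ _ l w

theorem mapR_actL {Q' N' : Type*} [Ring Q'] {ψ' : R →+* Q'} [AddCommGroup N'] [Module Q' N']
    (g : N →+ N') (hg : ∀ r n, g (ψ r • n) = ψ' r • g n) (m : M) (w : BTensor φ ψ P N) :
    mapR ψ' g hg (actL m w) = actL m (mapR ψ' g hg w) :=
  mapR_mapL _ _ g hg w

theorem mapL_actR {P' M' : Type*} [Ring P'] {φ' : R →+* P'} [AddCommGroup M'] [Module P'ᵐᵒᵖ M']
    (f : M →+ M') (hf : ∀ r m, f (op (φ r) • m) = op (φ' r) • f m) (n : N)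
    (w : BTensor φ ψ M Q) :
    mapL φ' f hf (actR n w) = actR n (mapL φ' f hf w) :=
  (mapR_mapL f hf _ _ w).symm

theorem actL_one_tmul (m : M) (n : N) : actL m (tmul φ ψ 1 n) = tmul φ ψ m n := by
  rw [actL_tmul, op_one, one_smul]

theorem actR_tmul_one (m : M) (n : N) : actR n (tmul φ ψ m 1) = tmul φ ψ m n := by
  rw [actR_tmul, one_smul]

theorem actL_eq_smul (p : P) (w : BTensor φ ψ P N) : actL p w = p • w := by
  induction w using induction_on with
  | zero => simp
  | tmul p' n => simp
  | add x y hx hy => simp only [map_add, smul_add, hx, hy]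

theorem actR_eq_smul (q : Q) (w : BTensor φ ψ M Q) : actR q w = op q • w := by
  induction w using induction_on with
  | zero => simp
  | tmul p' n => simp
  | add x y hx hy => simp only [map_add, smul_add, hx, hy]

/-- `m ⊗ (p ⊗ n) ↦ m p ⊗ n` -/
def absorbL : BTensor φ φ M (BTensor φ ψ P N) →+ BTensor φ ψ M N :=
  lift (biadd (fun m w => actL m w) add_actL (fun _ w w' => map_add _ w w'))
    (fun r m w => (actL_smul m (φ r) w).symm)

/-- `(m ⊗ q) ⊗ n ↦ m ⊗ q n` -/
def absorbR : BTensor ψ ψ (BTensor φ ψ M Q) N →+ BTensor φ ψ M N :=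
  lift (φ := ψ) (ψ := ψ) (biadd (fun w n => actR n w) (fun w w' _ => map_add _ w w')
    (fun w n n' => add_actR n n' w)) (fun r w n => actR_smul n (ψ r) w)

@[simp] theorem absorbL_tmul (m : M) (w : BTensor φ ψ P N) :
    absorbL (tmul φ φ m w) = actL m w := rfl

@[simp] theorem absorbR_tmul (w : BTensor φ ψ M Q) (n : N) :
    absorbR (tmul ψ ψ w n) = actR n w := rfl

theorem absorbL_lsmul {L : Type*} [Ring L] [Module L M] [SMulCommClass L Pᵐᵒᵖ M] (l : L)
    (z : BTensor φ φ M (BTensor φ ψ P N)) : absorbL (l • z) = l • absorbL z := by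
  induction z using induction_on with
  | zero => simp
  | tmul m w => rw [lsmul_tmul, absorbL_tmul, absorbL_tmul, smul_actL]
  | add x y hx hy => simp only [map_add, smul_add, hx, hy]

theorem absorbR_rsmul {K : Type*} [Ring K] [Module Kᵐᵒᵖ N] [SMulCommClass Q Kᵐᵒᵖ N] (k : K)
    (z : BTensor ψ ψ (BTensor φ ψ M Q) N) : absorbR (op k • z) = op k • absorbR z := by
  induction z using induction_on with
  | zero => simp
  | tmul m w => rw [rsmul_tmul, absorbR_tmul, absorbR_tmul, smul_actR]
  | add x y hx hy => simp only [map_add, smul_add, hx, hy]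

theorem absorbL_rsmul {K : Type*} [Ring K] [Module Kᵐᵒᵖ N] [SMulCommClass Q Kᵐᵒᵖ N] (k : K)
    (z : BTensor φ φ M (BTensor φ ψ P N)) : absorbL (op k • z) = op k • absorbL z := by
  induction z using induction_on with
  | zero => simp
  | tmul m w => rw [rsmul_tmul, absorbL_tmul, absorbL_tmul, rsmul_actL]
  | add x y hx hy => simp only [map_add, smul_add, hx, hy]

theorem absorbR_lsmul {L : Type*} [Ring L] [Module L M] [SMulCommClass L Pᵐᵒᵖ M] (l : L)
    (z : BTensor ψ ψ (BTensor φ ψ M Q) N) : absorbR (l • z) = l • absorbR z := by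
  induction z using induction_on with
  | zero => simp
  | tmul m w => rw [lsmul_tmul, absorbR_tmul, absorbR_tmul, lsmul_actR]
  | add x y hx hy => simp only [map_add, smul_add, hx, hy]

variable (φ ψ) in
/-- `n ↦ 1 ⊗ n` -/
def unitL : N →+ BTensor φ ψ P N := mk φ ψ (1 : P)

variable (φ ψ) in
/-- `m ↦ m ⊗ 1` -/
def unitR : M →+ BTensor φ ψ M Q := (mk φ ψ).flip (1 : Q)

theorem unitL_apply (n : N) : unitL φ ψ n = tmul φ ψ 1 n := rfl

theorem unitR_apply (m : M) : unitR φ ψ m = tmul φ ψ m 1 := rfl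

/-- A scalar from `R` crosses the tensor sign next to `1`: `1 ⊗ ψ(r) n = φ(r) ⊗ n`. The unit is thus
left `R`-linear for the action on the first factor, and can itself be tensored. -/
theorem unitL_smul (r : R) (n : N) : unitL φ ψ (ψ r • n) = φ r • unitL φ ψ n := by
  rw [unitL_apply, unitL_apply, lsmul_tmul, ← smul_tmul, op_smul_eq_mul, one_mul, smul_eq_mul,
    mul_one]

theorem unitR_smul (r : R) (m : M) :
    unitR φ ψ (op (φ r) • m) = op (ψ r) • unitR φ ψ m := by
  rw [unitR_apply, unitR_apply, rsmul_tmul, smul_tmul, op_smul_eq_mul, one_mul, smul_eq_mul,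
    mul_one]

/-- Absorption splits the insertion of a unit. This is the contraction behind faithfully flat
descent. -/
theorem absorbL_unitL (z : BTensor φ ψ M N) :
    absorbL (mapR (φ := φ) (ψ := ψ) φ (unitL φ ψ) unitL_smul z) = z := by
  induction z using induction_on with
  | zero => simp only [map_zero]
  | tmul m n => rw [mapR_tmul, unitL_apply, absorbL_tmul, actL_one_tmul]
  | add x y hx hy => simp only [map_add, hx, hy]

theorem absorbR_unitR (z : BTensor φ ψ M N) :
    absorbR (mapL (φ := φ) (ψ := ψ) ψ (unitR φ ψ) unitR_smul z) = z := by
  induction z using induction_on with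
  | zero => simp only [map_zero]
  | tmul m n => rw [mapL_tmul, unitR_apply, absorbR_tmul, actR_tmul_one]
  | add x y hx hy => simp only [map_add, hx, hy]

end Act

end BTensor

/-! ### Descent data and their coinvariants -/

section Descent

variable {R S A B : Type u} [Ring R] [Ring S] [Ring A] [Ring B]

/-- A descent datum on a left `A`-module `M` along `α : R →+* A`. -/
structure RightDescentDatum (α : R →+* A) (M : Type u) [AddCommGroup M] [Module A M] where
  δ : M →+ BTensor α α A M
  δ_smul : ∀ (a : A) (m : M), δ (a • m) = a • δ m
  coassoc : ∀ m : M, mapR (φ := α) (ψ := α) α δ (fun r => δ_smul (α r)) (δ m) =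
    mapR (φ := α) (ψ := α) α (unitL α α) unitL_smul (δ m)

/-- A descent datum on a right `B`-module `M` along `β : S →+* B`. -/
structure LeftDescentDatum (β : S →+* B) (M : Type u) [AddCommGroup M] [Module Bᵐᵒᵖ M] where
  δ : M →+ BTensor β β M B
  δ_smul : ∀ (b : B) (m : M), δ (op b • m) = op b • δ m
  coassoc : ∀ m : M, mapL (φ := β) (ψ := β) β δ (fun r => δ_smul (β r)) (δ m) =
    mapL (φ := β) (ψ := β) β (unitR β β) unitR_smul (δ m)

namespace RightDescentDatum

variable {α : R →+* A} {M : Type u} [AddCommGroup M] [Module A M] (D : RightDescentDatum α M)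

/-- The coinvariants `{m | δ m = 1 ⊗ m}`. -/
def Coinv : Type u := (D.δ - unitL α α).ker

instance : AddCommGroup D.Coinv := inferInstanceAs (AddCommGroup (D.δ - unitL α α).ker)

/-- The inclusion of the coinvariants. -/
def incl : D.Coinv →+ M := (D.δ - unitL α α).ker.subtype

theorem incl_injective : Function.Injective D.incl := Subtype.val_injective

theorem δ_incl (c : D.Coinv) : D.δ (D.incl c) = unitL α α (D.incl c) :=
  sub_eq_zero.1 c.2

/-- A coinvariant element. -/
def toCoinv (m : M) (h : D.δ m = unitL α α m) : D.Coinv := ⟨m, sub_eq_zero.2 h⟩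

/-- Only `R` acts: `δ(α(r) m) = α(r) ⊗ m = 1 ⊗ α(r) m` for `m` coinvariant, while a general `a ∈ A`
does not cross the tensor sign. -/
instance : Module R D.Coinv where
  smul r c := D.toCoinv (α r • D.incl c) (by rw [D.δ_smul, δ_incl, unitL_smul])
  one_smul c := D.incl_injective ((congrArg (· • D.incl c) (map_one α)).trans (one_smul _ _))
  mul_smul r s c := D.incl_injective
    ((congrArg (· • D.incl c) (map_mul α r s)).trans (mul_smul _ _ _))
  smul_zero r := D.incl_injective
    ((congrArg (α r • ·) (map_zero D.incl)).trans ((smul_zero _).trans (map_zero D.incl).symm))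
  smul_add r c c' := D.incl_injective
    ((congrArg (α r • ·) (map_add D.incl c c')).trans (smul_add _ _ _))
  add_smul r s c := D.incl_injective
    ((congrArg (· • D.incl c) (map_add α r s)).trans (add_smul _ _ _))
  zero_smul c := D.incl_injective
    ((congrArg (· • D.incl c) (map_zero α)).trans ((zero_smul _ _).trans (map_zero D.incl).symm))

theorem incl_smul (r : R) (c : D.Coinv) : D.incl (r • c) = α r • D.incl c := rfl

end RightDescentDatum

namespace LeftDescentDatum

variable {β : S →+* B} {M : Type u} [AddCommGroup M] [Module Bᵐᵒᵖ M] (D : LeftDescentDatum β M)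

/-- The coinvariants `{m | δ m = m ⊗ 1}`. -/
def Coinv : Type u := (D.δ - unitR β β).ker

instance : AddCommGroup D.Coinv := inferInstanceAs (AddCommGroup (D.δ - unitR β β).ker)

/-- The inclusion of the coinvariants. -/
def incl : D.Coinv →+ M := (D.δ - unitR β β).ker.subtype

theorem incl_injective : Function.Injective D.incl := Subtype.val_injective

theorem δ_incl (c : D.Coinv) : D.δ (D.incl c) = unitR β β (D.incl c) :=
  sub_eq_zero.1 c.2

/-- A coinvariant element. -/
def toCoinv (m : M) (h : D.δ m = unitR β β m) : D.Coinv := ⟨m, sub_eq_zero.2 h⟩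

instance : Module Sᵐᵒᵖ D.Coinv where
  smul s c := D.toCoinv (op (β s.unop) • D.incl c) (by rw [D.δ_smul, δ_incl, unitR_smul])
  one_smul c := D.incl_injective
    ((congrArg (op · • D.incl c) (map_one β)).trans (one_smul _ _))
  mul_smul r s c := D.incl_injective
    ((congrArg (op · • D.incl c) (map_mul β s.unop r.unop)).trans (mul_smul _ _ _))
  smul_zero r := D.incl_injective ((congrArg (op (β r.unop) • ·) (map_zero D.incl)).trans
    ((smul_zero _).trans (map_zero D.incl).symm))
  smul_add r c c' := D.incl_injective
    ((congrArg (op (β r.unop) • ·) (map_add D.incl c c')).trans (smul_add _ _ _))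
  add_smul r s c := D.incl_injective
    ((congrArg (op · • D.incl c) (map_add β r.unop s.unop)).trans (add_smul _ _ _))
  zero_smul c := D.incl_injective ((congrArg (op · • D.incl c) (map_zero β)).trans
    ((zero_smul _ _).trans (map_zero D.incl).symm))

theorem incl_smul (s : S) (c : D.Coinv) : D.incl (op s • c) = op (β s) • D.incl c := rfl

end LeftDescentDatum

/-- Descent of left modules along `α : R →+* A` is effective. -/
structure RightDescent (α : R →+* A) : Prop where
  unit_injective : ∀ (N : Type u) [AddCommGroup N] [Module R N],
    Function.Injective (unitL α (RingHom.id R) : N →+ BTensor α (RingHom.id R) A N)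
  unit_exact : ∀ (N : Type u) [AddCommGroup N] [Module R N] (w : BTensor α (RingHom.id R) A N),
    mapR (φ := α) (ψ := RingHom.id R) α (unitL α (RingHom.id R)) unitL_smul w = unitL α α w →
      ∃ n, unitL α (RingHom.id R) n = w
  coinv_injective : ∀ (M : Type u) [AddCommGroup M] [Module A M] (D : RightDescentDatum α M),
    Function.Injective (mapR (φ := α) (ψ := RingHom.id R) (M := A) α D.incl D.incl_smul)
  coinv_exact : ∀ (M : Type u) [AddCommGroup M] [Module A M] (D : RightDescentDatum α M)
    (w : BTensor α α A M), mapR (φ := α) (ψ := α) α D.δ (fun r => D.δ_smul (α r)) w =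
      mapR (φ := α) (ψ := α) α (unitL α α) unitL_smul w →
    ∃ v, mapR (φ := α) (ψ := RingHom.id R) α D.incl D.incl_smul v = w

/-- Descent of right modules along `β : S →+* B` is effective. -/
structure LeftDescent (β : S →+* B) : Prop where
  unit_injective : ∀ (N : Type u) [AddCommGroup N] [Module Sᵐᵒᵖ N],
    Function.Injective (unitR (RingHom.id S) β : N →+ BTensor (RingHom.id S) β N B)
  unit_exact : ∀ (N : Type u) [AddCommGroup N] [Module Sᵐᵒᵖ N] (w : BTensor (RingHom.id S) β N B),
    mapL (φ := RingHom.id S) (ψ := β) β (unitR (RingHom.id S) β) unitR_smul w = unitR β β w →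
      ∃ n, unitR (RingHom.id S) β n = w
  coinv_injective : ∀ (M : Type u) [AddCommGroup M] [Module Bᵐᵒᵖ M] (D : LeftDescentDatum β M),
    Function.Injective (mapL (φ := RingHom.id S) (ψ := β) (N := B) β D.incl D.incl_smul)
  coinv_exact : ∀ (M : Type u) [AddCommGroup M] [Module Bᵐᵒᵖ M] (D : LeftDescentDatum β M)
    (w : BTensor β β M B), mapL (φ := β) (ψ := β) β D.δ (fun r => D.δ_smul (β r)) w =
      mapL (φ := β) (ψ := β) β (unitR β β) unitR_smul w →
    ∃ v, mapL (φ := RingHom.id S) (ψ := β) β D.incl D.incl_smul v = w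

/-! ### Split extensions -/

section Split

variable {α : R →+* A} (π : A →+ R) (hl : ∀ r a, π (α r * a) = r * π a)
  (hr : ∀ r a, π (a * α r) = π a * r)

/-- `a ⊗ n ↦ π(a) n` -/
def retractL {Q N : Type u} [Ring Q] (ψ : R →+* Q) [AddCommGroup N] [Module Q N] :
    BTensor α ψ A N →+ N :=
  lift (biadd (fun a n => ψ (π a) • n) (fun a a' n => by rw [map_add, map_add, add_smul])
    (fun a n n' => smul_add _ _ _)) (fun r a n => by simp [hr, mul_smul])

/-- `n ⊗ a ↦ n π(a)` -/
def retractR {Q N : Type u} [Ring Q] (ψ : R →+* Q) [AddCommGroup N] [Module Qᵐᵒᵖ N] :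
    BTensor ψ α N A →+ N :=
  lift (biadd (fun n a => op (ψ (π a)) • n) (fun n n' a => smul_add _ _ _)
    (fun n a a' => by rw [map_add, map_add, op_add, add_smul]))
    (fun r a n => by simp [hl, mul_smul])

@[simp] theorem retractL_tmul {Q N : Type u} [Ring Q] (ψ : R →+* Q) [AddCommGroup N] [Module Q N]
    (a : A) (n : N) : retractL π hr ψ (tmul α ψ a n) = ψ (π a) • n := rfl

@[simp] theorem retractR_tmul {Q N : Type u} [Ring Q] (ψ : R →+* Q) [AddCommGroup N]
    [Module Qᵐᵒᵖ N] (a : A) (n : N) : retractR π hl ψ (tmul ψ α n a) = op (ψ (π a)) • n := rfl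

theorem retractL_unitL {Q N : Type u} [Ring Q] (ψ : R →+* Q) [AddCommGroup N] [Module Q N]
    (h1 : ∀ r, π (α r) = r) (n : N) : retractL π hr ψ (unitL α ψ n) = n := by
  rw [unitL_apply, retractL_tmul, ← map_one α, h1, map_one, one_smul]

theorem retractR_unitR {Q N : Type u} [Ring Q] (ψ : R →+* Q) [AddCommGroup N] [Module Qᵐᵒᵖ N]
    (h1 : ∀ r, π (α r) = r) (n : N) : retractR π hl ψ (unitR ψ α n) = n := by
  rw [unitR_apply, retractR_tmul, ← map_one α, h1, map_one, op_one, one_smul]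

/-- Naturality of the retraction. It lets the retraction be moved past both `δ` and the unit, which
is all that the splitting of the equalizers uses. -/
theorem retractL_mapR {Q N Q' N' : Type u} [Ring Q] (ψ : R →+* Q) [AddCommGroup N] [Module Q N]
    [Ring Q'] (ψ' : R →+* Q') [AddCommGroup N'] [Module Q' N'] (g : N →+ N')
    (hg : ∀ r n, g (ψ r • n) = ψ' r • g n) (w : BTensor α ψ A N) :
    retractL π hr ψ' (mapR ψ' g hg w) = g (retractL π hr ψ w) := by
  induction w using induction_on with
  | zero => simp only [map_zero]
  | tmul a n => rw [mapR_tmul, retractL_tmul, retractL_tmul, hg]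
  | add x y hx hy => simp only [map_add, hx, hy]

theorem retractR_mapL {Q N Q' N' : Type u} [Ring Q] (ψ : R →+* Q) [AddCommGroup N] [Module Qᵐᵒᵖ N]
    [Ring Q'] (ψ' : R →+* Q') [AddCommGroup N'] [Module Q'ᵐᵒᵖ N'] (g : N →+ N')
    (hg : ∀ r n, g (op (ψ r) • n) = op (ψ' r) • g n) (w : BTensor ψ α N A) :
    retractR π hl ψ' (mapL ψ' g hg w) = g (retractR π hl ψ w) := by
  induction w using induction_on with
  | zero => simp only [map_zero]
  | tmul a n => rw [mapL_tmul, retractR_tmul, retractR_tmul, hg]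
  | add x y hx hy => simp only [map_add, hx, hy]

/-- Here `π` has to be left `R`-linear; the balancedness of `retractL` itself used right linearity.
Both halves of the bimodule condition are therefore needed. -/
theorem retractL_smul (hl : ∀ r a, π (α r * a) = r * π a) {M : Type u} [AddCommGroup M] [Module A M] (r : R) (w : BTensor α α A M) :
    retractL π hr α (α r • w) = α r • retractL π hr α w := by
  induction w using induction_on with
  | zero => simp only [map_zero, smul_zero]
  | tmul a n => rw [lsmul_tmul, retractL_tmul, retractL_tmul, smul_eq_mul, hl, map_mul, mul_smul]
  | add x y hx hy => simp only [map_add, smul_add, hx, hy]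

theorem retractR_smul (hr : ∀ r a, π (a * α r) = π a * r) {M : Type u} [AddCommGroup M] [Module Aᵐᵒᵖ M] (r : R)
    (w : BTensor α α M A) :
    retractR π hl α (op (α r) • w) = op (α r) • retractR π hl α w := by
  induction w using induction_on with
  | zero => simp only [map_zero, smul_zero]
  | tmul a n =>
    rw [rsmul_tmul, retractR_tmul, retractR_tmul, op_smul_eq_mul, hr, map_mul, op_mul, mul_smul]
  | add x y hx hy => simp only [map_add, smul_add, hx, hy]

namespace RightDescentDatum

variable {M : Type u} [AddCommGroup M] [Module A M] (D : RightDescentDatum α M)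

/-- The retraction `m ↦ Σ π(aᵢ) mᵢ` onto the coinvariants, where `δ m = Σ aᵢ ⊗ mᵢ`. -/
def retract : M →+ D.Coinv :=
  AddMonoidHom.mk' (fun m => D.toCoinv (retractL π hr α (D.δ m)) (by
      -- Applying `δ` to `Σ π(aᵢ) mᵢ` is the same as retracting `(A ⊗ δ)(δ m)`, which by
      -- coassociativity is `(A ⊗ 1 ⊗ -)(δ m)`; the result is `1 ⊗ Σ π(aᵢ) mᵢ`.
      rw [← retractL_mapR π hr α α D.δ (fun r => D.δ_smul (α r)), D.coassoc, retractL_mapR]))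
    (fun m m' => D.incl_injective
      ((congrArg (retractL π hr α) (map_add D.δ m m')).trans (map_add _ _ _)))

theorem incl_retract (m : M) :
    D.incl (D.retract π hr m) = retractL π hr α (D.δ m) := rfl

theorem retract_smul (hl : ∀ r a, π (α r * a) = r * π a) (r : R) (m : M) :
    D.retract π hr (α r • m) = r • D.retract π hr m :=
  D.incl_injective (by
    rw [incl_retract, D.δ_smul, retractL_smul π hr hl, incl_smul, incl_retract])

theorem retract_incl (h1 : ∀ r, π (α r) = r) (c : D.Coinv) : D.retract π hr (D.incl c) = c :=
  D.incl_injective (by rw [incl_retract, D.δ_incl, retractL_unitL π hr α h1])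

end RightDescentDatum

namespace LeftDescentDatum

variable {M : Type u} [AddCommGroup M] [Module Aᵐᵒᵖ M] (D : LeftDescentDatum α M)

/-- The retraction `m ↦ Σ mᵢ π(aᵢ)` onto the coinvariants, where `δ m = Σ mᵢ ⊗ aᵢ`. -/
def retract : M →+ D.Coinv :=
  AddMonoidHom.mk' (fun m => D.toCoinv (retractR π hl α (D.δ m)) (by
      rw [← retractR_mapL π hl α α D.δ (fun r => D.δ_smul (α r)), D.coassoc, retractR_mapL]))
    (fun m m' => D.incl_injective
      ((congrArg (retractR π hl α) (map_add D.δ m m')).trans (map_add _ _ _)))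

theorem incl_retract (m : M) :
    D.incl (D.retract π hl m) = retractR π hl α (D.δ m) := rfl

theorem retract_smul (hr : ∀ r a, π (a * α r) = π a * r) (r : R) (m : M) :
    D.retract π hl (op (α r) • m) = op r • D.retract π hl m :=
  D.incl_injective (by
    rw [incl_retract, D.δ_smul, retractR_smul π hl hr, incl_smul, incl_retract])

theorem retract_incl (h1 : ∀ r, π (α r) = r) (c : D.Coinv) : D.retract π hl (D.incl c) = c :=
  D.incl_injective (by rw [incl_retract, D.δ_incl, retractR_unitR π hl α h1])

end LeftDescentDatum

end Split

/-- The map `π` makes every equalizer in question a split one, and split equalizers are preserved by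
any functor, in particular by `A ⊗_R -`. -/
theorem IsSplitExtension.rightDescent {α : R →+* A} (h : IsSplitExtension α) :
    RightDescent α := by
  obtain ⟨π, hl, hr, h1⟩ := h
  refine ⟨fun N _ _ => ?_, fun N _ _ w hw => ?_, fun M _ _ D => ?_, fun M _ _ D w hw => ?_⟩
  · exact Function.LeftInverse.injective (g := retractL π hr (RingHom.id R))
      (retractL_unitL π hr _ h1)
  · refine ⟨retractL π hr (RingHom.id R) w, ?_⟩
    rw [← retractL_mapR π hr (RingHom.id R) α _ unitL_smul, hw, retractL_unitL π hr α h1]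
  · exact mapR_injective_of_retraction _ _ (D.retract π hr) (D.retract_smul π hr hl)
      (D.retract_incl π hr h1)
  · refine ⟨mapR (RingHom.id R) (D.retract π hr) (D.retract_smul π hr hl) w, ?_⟩
    -- On `M`, including the retracted element is `π` applied to `δ`. The hypothesis `hw` then
    -- replaces `δ` by the unit, and `π` cancels the unit.
    have key : ∀ v : BTensor α α A M, mapR α D.incl D.incl_smul
        (mapR (RingHom.id R) (D.retract π hr) (D.retract_smul π hr hl) v) =
        mapR α (retractL π hr α) (fun r w => retractL_smul π hr hl r w)
          (mapR (φ := α) (ψ := α) α D.δ (fun r => D.δ_smul (α r)) v) := fun v => by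
      induction v using induction_on with
      | zero => simp only [map_zero]
      | tmul a m => rfl
      | add x y hx hy => simp only [map_add, hx, hy]
    have key' : ∀ v : BTensor α α A M, mapR α (retractL π hr α)
        (fun r w => retractL_smul π hr hl r w)
          (mapR (φ := α) (ψ := α) α (unitL α α) unitL_smul v) = v := fun v => by
      induction v using induction_on with
      | zero => simp only [map_zero]
      | tmul a m => rw [mapR_tmul, mapR_tmul, retractL_unitL π hr α h1]
      | add x y hx hy => simp only [map_add, hx, hy]
    rw [key, hw, key']

theorem IsSplitExtension.leftDescent {α : R →+* A} (h : IsSplitExtension α) :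
    LeftDescent α := by
  obtain ⟨π, hl, hr, h1⟩ := h
  refine ⟨fun N _ _ => ?_, fun N _ _ w hw => ?_, fun M _ _ D => ?_, fun M _ _ D w hw => ?_⟩
  · exact Function.LeftInverse.injective (g := retractR π hl (RingHom.id R))
      (retractR_unitR π hl _ h1)
  · refine ⟨retractR π hl (RingHom.id R) w, ?_⟩
    rw [← retractR_mapL π hl (RingHom.id R) α _ unitR_smul, hw, retractR_unitR π hl α h1]
  · exact mapL_injective_of_retraction _ _ (D.retract π hl) (D.retract_smul π hl hr)
      (D.retract_incl π hl h1)
  · refine ⟨mapL (RingHom.id R) (D.retract π hl) (D.retract_smul π hl hr) w, ?_⟩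
    have key : ∀ v : BTensor α α M A, mapL α D.incl D.incl_smul
        (mapL (RingHom.id R) (D.retract π hl) (D.retract_smul π hl hr) v) =
        mapL α (retractR π hl α) (fun r w => retractR_smul π hl hr r w)
          (mapL (φ := α) (ψ := α) α D.δ (fun r => D.δ_smul (α r)) v) := fun v => by
      induction v using induction_on with
      | zero => simp only [map_zero]
      | tmul a m => rfl
      | add x y hx hy => simp only [map_add, hx, hy]
    have key' : ∀ v : BTensor α α M A, mapL α (retractR π hl α)
        (fun r w => retractR_smul π hl hr r w)
          (mapL (φ := α) (ψ := α) α (unitR α α) unitR_smul v) = v := fun v => by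
      induction v using induction_on with
      | zero => simp only [map_zero]
      | tmul a m => rw [mapL_tmul, mapL_tmul, retractR_unitR π hl α h1]
      | add x y hx hy => simp only [map_add, hx, hy]
    rw [key, hw, key']

end Descent

/-! ### Faithfully flat descent -/

section FaithfullyFlat

variable {R P : Type u} [Ring R] [Ring P] {φ : R →+* P}

/-- Isomorphic sequences are exact together. It serves to compare tensor products over `R` formed
through a ring map with those formed after restricting scalars. -/
theorem exact_of_ladder {M₁ M₂ M₃ N₁ N₂ N₃ : Type*} [AddCommGroup M₁] [AddCommGroup M₂]
    [AddCommGroup M₃] [AddCommGroup N₁] [AddCommGroup N₂] [AddCommGroup N₃] {f : M₁ →+ M₂}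
    {g : M₂ →+ M₃} {f' : N₁ →+ N₂} {g' : N₂ →+ N₃} (e₁ : M₁ ≃+ N₁) (e₂ : M₂ ≃+ N₂)
    (e₃ : M₃ ≃+ N₃) (hf : ∀ x, f' (e₁ x) = e₂ (f x)) (hg : ∀ x, g' (e₂ x) = e₃ (g x)) :
    Function.Exact f g ↔ Function.Exact f' g' := by
  constructor
  · intro h y
    obtain ⟨x, rfl⟩ := e₂.surjective y
    rw [hg, map_eq_zero_iff e₃ e₃.injective, h x]
    constructor
    · rintro ⟨z, rfl⟩
      exact ⟨e₁ z, hf z⟩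
    · rintro ⟨z, hz⟩
      obtain ⟨z, rfl⟩ := e₁.surjective z
      exact ⟨z, e₂.injective (by rw [← hf, hz])⟩
  · intro h y
    rw [← map_eq_zero_iff e₃ e₃.injective, ← hg, h (e₂ y)]
    constructor
    · rintro ⟨z, hz⟩
      obtain ⟨z, rfl⟩ := e₁.surjective z
      exact ⟨z, e₂.injective (by rw [← hf, hz])⟩
    · rintro ⟨z, rfl⟩
      exact ⟨e₁ z, hf z⟩

/-- Restriction of scalars of the second factor. -/
def restrictEquivR {Q Q' : Type*} [Ring Q] [Ring Q'] (ψ : R →+* Q) (ψ' : R →+* Q')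
    {M N : Type*} [AddCommGroup M] [Module Pᵐᵒᵖ M] [AddCommGroup N] [Module Q N] [Module Q' N]
    (h : ∀ r (n : N), ψ r • n = ψ' r • n) : BTensor φ ψ M N ≃+ BTensor φ ψ' M N :=
  AddMonoidHom.toAddEquiv (mapR ψ' (AddMonoidHom.id N) h) (mapR ψ (AddMonoidHom.id N)
    fun r n => (h r n).symm) (hom_ext fun _ _ => rfl) (hom_ext fun _ _ => rfl)

/-- Restriction of scalars of the first factor. -/
def restrictEquivL {Q Q' : Type*} [Ring Q] [Ring Q'] (ψ : R →+* Q) (ψ' : R →+* Q')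
    {M N : Type*} [AddCommGroup M] [Module P M] [AddCommGroup N] [Module Qᵐᵒᵖ N] [Module Q'ᵐᵒᵖ N]
    (h : ∀ r (n : N), op (ψ r) • n = op (ψ' r) • n) : BTensor ψ φ N M ≃+ BTensor ψ' φ N M :=
  AddMonoidHom.toAddEquiv (mapL ψ' (AddMonoidHom.id N) h) (mapL ψ (AddMonoidHom.id N)
    fun r n => (h r n).symm) (hom_ext fun _ _ => rfl) (hom_ext fun _ _ => rfl)

/-- The definition speaks of `R`-modules and `R`-linear maps. The sequences that occur mix
`R`-modules with `A`-modules, so each term is restricted to `R` along its own ring map. -/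
theorem RightFaithfullyFlat.exact_iff {M : Type u} [AddCommGroup M] [Module Pᵐᵒᵖ M]
    (h : RightFaithfullyFlat φ M) {Q₁ Q₂ Q₃ N₁ N₂ N₃ : Type u} [Ring Q₁] [Ring Q₂] [Ring Q₃]
    [AddCommGroup N₁] [AddCommGroup N₂] [AddCommGroup N₃] [Module Q₁ N₁] [Module Q₂ N₂]
    [Module Q₃ N₃] {ψ₁ : R →+* Q₁} {ψ₂ : R →+* Q₂} {ψ₃ : R →+* Q₃} (f : N₁ →+ N₂)
    (hf : ∀ r n, f (ψ₁ r • n) = ψ₂ r • f n) (g : N₂ →+ N₃)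
    (hg : ∀ r n, g (ψ₂ r • n) = ψ₃ r • g n) :
    Function.Exact f g ↔ Function.Exact (mapR (φ := φ) (M := M) ψ₂ f hf)
      (mapR (φ := φ) (M := M) ψ₃ g hg) := by
  let i₁ : Module R N₁ := Module.compHom N₁ ψ₁
  let i₂ : Module R N₂ := Module.compHom N₂ ψ₂
  let i₃ : Module R N₃ := Module.compHom N₃ ψ₃
  refine (h N₁ N₂ N₃ ⟨⟨f, f.map_add⟩, hf⟩ ⟨⟨g, g.map_add⟩, hg⟩).trans ?_
  refine exact_of_ladder (restrictEquivR _ _ fun _ _ => rfl) (restrictEquivR _ _ fun _ _ => rfl)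
    (restrictEquivR _ _ fun _ _ => rfl) (fun x => ?_) (fun x => ?_)
  all_goals
    induction x using induction_on with
    | zero => simp only [map_zero]
    | tmul m n => rfl
    | add x y hx hy => simp only [map_add, hx, hy]

theorem LeftFaithfullyFlat.exact_iff {M : Type u} [AddCommGroup M] [Module P M]
    (h : LeftFaithfullyFlat φ M) {Q₁ Q₂ Q₃ N₁ N₂ N₃ : Type u} [Ring Q₁] [Ring Q₂] [Ring Q₃]
    [AddCommGroup N₁] [AddCommGroup N₂] [AddCommGroup N₃] [Module Q₁ᵐᵒᵖ N₁] [Module Q₂ᵐᵒᵖ N₂]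
    [Module Q₃ᵐᵒᵖ N₃] {ψ₁ : R →+* Q₁} {ψ₂ : R →+* Q₂} {ψ₃ : R →+* Q₃} (f : N₁ →+ N₂)
    (hf : ∀ r n, f (op (ψ₁ r) • n) = op (ψ₂ r) • f n) (g : N₂ →+ N₃)
    (hg : ∀ r n, g (op (ψ₂ r) • n) = op (ψ₃ r) • g n) :
    Function.Exact f g ↔ Function.Exact (mapL (ψ := φ) (N := M) ψ₂ f hf)
      (mapL (ψ := φ) (N := M) ψ₃ g hg) := by
  let i₁ : Module Rᵐᵒᵖ N₁ := Module.compHom N₁ ψ₁.op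
  let i₂ : Module Rᵐᵒᵖ N₂ := Module.compHom N₂ ψ₂.op
  let i₃ : Module Rᵐᵒᵖ N₃ := Module.compHom N₃ ψ₃.op
  refine (h N₁ N₂ N₃ ⟨⟨f, f.map_add⟩, fun r => hf r.unop⟩
    ⟨⟨g, g.map_add⟩, fun r => hg r.unop⟩).trans ?_
  refine exact_of_ladder (restrictEquivL _ _ fun _ _ => rfl) (restrictEquivL _ _ fun _ _ => rfl)
    (restrictEquivL _ _ fun _ _ => rfl) (fun x => ?_) (fun x => ?_)
  all_goals
    induction x using induction_on with
    | zero => simp only [map_zero]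
    | tmul m n => rfl
    | add x y hx hy => simp only [map_add, hx, hy]

/-- Injectivity is exactness after a zero map, so criteria for exactness also cover injectivity. -/
theorem exact_zero_iff_injective {M N K : Type*} [AddCommGroup M] [AddCommGroup N] [AddCommGroup K]
    (z : K →+ M) (hz : ∀ x, z x = 0) (f : M →+ N) :
    Function.Exact z f ↔ Function.Injective f := by
  rw [injective_iff_map_eq_zero]
  constructor
  · intro h a ha
    obtain ⟨x, rfl⟩ := (h a).1 ha
    exact hz x
  · intro h a
    constructor
    · intro ha
      exact ⟨0, by rw [h a ha, map_zero]⟩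
    · rintro ⟨x, rfl⟩
      rw [hz, map_zero]

theorem mapR_eq_zero {Q Q' M N N' : Type*} [Ring Q] [Ring Q'] {ψ : R →+* Q} {ψ' : R →+* Q'}
    [AddCommGroup M] [Module Pᵐᵒᵖ M] [AddCommGroup N] [Module Q N] [AddCommGroup N'] [Module Q' N']
    {g : N →+ N'} {hg : ∀ r n, g (ψ r • n) = ψ' r • g n} (h : ∀ n, g n = 0)
    (z : BTensor φ ψ M N) : mapR ψ' g hg z = 0 := by
  induction z using induction_on with
  | zero => simp only [map_zero]
  | tmul m n => rw [mapR_tmul, h, tmul_zero]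
  | add x y hx hy => simp only [map_add, hx, hy, add_zero]

theorem mapL_eq_zero {Q Q' M N N' : Type*} [Ring Q] [Ring Q'] {ψ : R →+* Q} {ψ' : R →+* Q'}
    [AddCommGroup M] [Module P M] [AddCommGroup N] [Module Qᵐᵒᵖ N] [AddCommGroup N']
    [Module Q'ᵐᵒᵖ N'] {g : N →+ N'} {hg : ∀ r n, g (op (ψ r) • n) = op (ψ' r) • g n}
    (h : ∀ n, g n = 0) (z : BTensor ψ φ N M) : mapL ψ' g hg z = 0 := by
  induction z using induction_on with
  | zero => simp only [map_zero]
  | tmul m n => rw [mapL_tmul, h, zero_tmul]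
  | add x y hx hy => simp only [map_add, hx, hy, add_zero]

theorem mapR_sub {Q Q' M N N' : Type*} [Ring Q] [Ring Q'] {ψ : R →+* Q} {ψ' : R →+* Q'}
    [AddCommGroup M] [Module Pᵐᵒᵖ M] [AddCommGroup N] [Module Q N] [AddCommGroup N'] [Module Q' N']
    (g g' : N →+ N') (hg : ∀ r n, g (ψ r • n) = ψ' r • g n)
    (hg' : ∀ r n, g' (ψ r • n) = ψ' r • g' n)
    (h : ∀ r n, (g - g') (ψ r • n) = ψ' r • (g - g') n) (z : BTensor φ ψ M N) :
    mapR ψ' (g - g') h z = mapR ψ' g hg z - mapR ψ' g' hg' z := by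
  induction z using induction_on with
  | zero => simp only [map_zero, sub_zero]
  | tmul m n => rw [eq_sub_iff_add_eq]; simp only [mapR_tmul, ← tmul_add, AddMonoidHom.sub_apply, sub_add_cancel]
  | add x y hx hy => simp only [map_add, hx, hy]; abel

theorem mapL_sub {Q Q' M N N' : Type*} [Ring Q] [Ring Q'] {ψ : R →+* Q} {ψ' : R →+* Q'}
    [AddCommGroup M] [Module P M] [AddCommGroup N] [Module Qᵐᵒᵖ N] [AddCommGroup N']
    [Module Q'ᵐᵒᵖ N'] (g g' : N →+ N') (hg : ∀ r n, g (op (ψ r) • n) = op (ψ' r) • g n)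
    (hg' : ∀ r n, g' (op (ψ r) • n) = op (ψ' r) • g' n)
    (h : ∀ r n, (g - g') (op (ψ r) • n) = op (ψ' r) • (g - g') n) (z : BTensor ψ φ N M) :
    mapL ψ' (g - g') h z = mapL ψ' g hg z - mapL ψ' g' hg' z := by
  induction z using induction_on with
  | zero => simp only [map_zero, sub_zero]
  | tmul m n => rw [eq_sub_iff_add_eq]; simp only [mapL_tmul, ← add_tmul, AddMonoidHom.sub_apply, sub_add_cancel]
  | add x y hx hy => simp only [map_add, hx, hy]; abel

theorem absorbL_mapR_unitL_eq {Q X : Type*} [Ring Q] {ψ : R →+* Q} [AddCommGroup X] [Module Q X]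
    (z : BTensor φ φ P (BTensor φ ψ P X)) :
    absorbL (mapR (φ := φ) (ψ := φ) φ (mapR (φ := φ) (ψ := ψ) φ (unitL φ ψ) unitL_smul)
      (fun r w => mapR_lsmul _ _ (φ r) w) z) =
      mapR (φ := φ) (ψ := ψ) φ (unitL φ ψ) unitL_smul (absorbL z) := by
  induction z using induction_on with
  | zero => simp only [map_zero]
  | tmul m n => rw [mapR_tmul, absorbL_tmul, absorbL_tmul, mapR_actL]
  | add x y hx hy => simp only [map_add, hx, hy]

theorem absorbR_mapL_unitR_eq {Q X : Type*} [Ring Q] {ψ : R →+* Q} [AddCommGroup X]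
    [Module Qᵐᵒᵖ X] (z : BTensor φ φ (BTensor ψ φ X P) P) :
    absorbR (mapL (φ := φ) (ψ := φ) φ (mapL (φ := ψ) (ψ := φ) φ (unitR ψ φ) unitR_smul)
      (fun r w => mapL_rsmul _ _ (φ r) w) z) =
      mapL (φ := ψ) (ψ := φ) φ (unitR ψ φ) unitR_smul (absorbR z) := by
  induction z using induction_on with
  | zero => simp only [map_zero]
  | tmul m n => rw [mapL_tmul, absorbR_tmul, absorbR_tmul, mapL_actR]
  | add x y hx hy => simp only [map_add, hx, hy]

/-- The sequence `N → P ⊗ N → P ⊗ P ⊗ N` need not be split, but it becomes so after `P ⊗_R -`, and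
faithful flatness reflects exactness. Coinvariants are a kernel, so flatness alone preserves them.
-/
theorem RightFaithfullyFlat.rightDescent (h : RightFaithfullyFlat φ P) : RightDescent φ := by
  refine ⟨fun N _ _ => ?_, fun N _ _ w hw => ?_, fun M _ _ D => ?_, fun M _ _ D w hw => ?_⟩
  · have h0 := h.exact_iff (ψ₁ := RingHom.id R) (N₁ := PUnit.{u+1}) (0 : PUnit.{u+1} →+ N)
      (fun r n => (smul_zero r).symm) (unitL φ (RingHom.id R)) unitL_smul
    rw [exact_zero_iff_injective _ (fun _ => rfl),
      exact_zero_iff_injective _ (mapR_eq_zero fun _ => rfl)] at h0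
    rw [h0]
    exact Function.LeftInverse.injective (g := absorbL) absorbL_unitL
  · have hlin : ∀ (r : R) (v : BTensor φ (RingHom.id R) P N),
        (mapR (φ := φ) (ψ := RingHom.id R) φ (unitL φ (RingHom.id R)) unitL_smul - unitL φ φ :
          BTensor φ (RingHom.id R) P N →+ BTensor φ φ P (BTensor φ (RingHom.id R) P N))
          (φ r • v) = φ r •
        (mapR (φ := φ) (ψ := RingHom.id R) φ (unitL φ (RingHom.id R)) unitL_smul - unitL φ φ :
          BTensor φ (RingHom.id R) P N →+ BTensor φ φ P (BTensor φ (RingHom.id R) P N)) v := by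
      intro r v
      rw [AddMonoidHom.sub_apply, AddMonoidHom.sub_apply, smul_sub, unitL_smul, mapR_lsmul]
    have h0 := h.exact_iff (unitL φ (RingHom.id R) : N →+ _) unitL_smul
      (mapR (φ := φ) (ψ := RingHom.id R) φ (unitL φ (RingHom.id R)) unitL_smul - unitL φ φ) hlin
    refine (h0.2 ?_ w).1 (by rw [AddMonoidHom.sub_apply, hw, sub_self])
    intro z
    constructor
    · intro hz
      -- Contracting homotopy: after tensoring there is an outer factor `P` into which the next
      -- factor can be absorbed.
      refine ⟨absorbL z, ?_⟩
      rw [mapR_sub _ _ (fun r v => mapR_lsmul _ _ (φ r) v) unitL_smul, sub_eq_zero] at hz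
      rw [← absorbL_mapR_unitL_eq, hz, absorbL_unitL]
    · rintro ⟨y, rfl⟩
      rw [mapR_mapR (ψ'' := φ) _ _ _ _ 0 (fun _ _ => (smul_zero _).symm) (fun n => ?_),
        mapR_eq_zero fun _ => rfl]
      rw [AddMonoidHom.sub_apply, unitL_apply, mapR_tmul, unitL_apply, unitL_apply, sub_self]
      rfl
  · have h0 := h.exact_iff (ψ₁ := RingHom.id R) (ψ₂ := RingHom.id R) (ψ₃ := φ)
      (N₁ := PUnit.{u+1}) (0 : PUnit.{u+1} →+ D.Coinv)
      (fun r n => (smul_zero r).symm) D.incl D.incl_smul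
    rw [exact_zero_iff_injective _ (fun _ => rfl),
      exact_zero_iff_injective _ (mapR_eq_zero fun _ => rfl)] at h0
    exact h0.1 D.incl_injective
  · have h0 := h.exact_iff (ψ₁ := RingHom.id R) (ψ₂ := φ) (ψ₃ := φ) D.incl D.incl_smul
      (D.δ - unitL φ φ) (fun r m => by
      rw [AddMonoidHom.sub_apply, AddMonoidHom.sub_apply, smul_sub, unitL_smul, D.δ_smul])
    -- By definition the coinvariants are the kernel of `δ - unitL`, so this three-term sequence is
    -- exact before tensoring.
    refine (h0.1 (fun m => ⟨fun hm => ⟨⟨m, hm⟩, rfl⟩, ?_⟩) w).1 ?_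
    · rintro ⟨c, rfl⟩
      exact c.2
    · rw [mapR_sub _ _ (fun r m => D.δ_smul (φ r) m) unitL_smul, hw, sub_self]

theorem LeftFaithfullyFlat.leftDescent (h : LeftFaithfullyFlat φ P) : LeftDescent φ := by
  refine ⟨fun N _ _ => ?_, fun N _ _ w hw => ?_, fun M _ _ D => ?_, fun M _ _ D w hw => ?_⟩
  · have h0 := h.exact_iff (ψ₁ := RingHom.id R) (N₁ := PUnit.{u+1}) (0 : PUnit.{u+1} →+ N)
      (fun r n => (smul_zero (op r)).symm) (unitR (RingHom.id R) φ) unitR_smul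
    rw [exact_zero_iff_injective _ (fun _ => rfl),
      exact_zero_iff_injective _ (mapL_eq_zero fun _ => rfl)] at h0
    rw [h0]
    exact Function.LeftInverse.injective (g := absorbR) absorbR_unitR
  · have hlin : ∀ (r : R) (v : BTensor (RingHom.id R) φ N P),
        (mapL (φ := RingHom.id R) (ψ := φ) φ (unitR (RingHom.id R) φ) unitR_smul - unitR φ φ :
          BTensor (RingHom.id R) φ N P →+ BTensor φ φ (BTensor (RingHom.id R) φ N P) P)
          (op (φ r) • v) = op (φ r) •
        (mapL (φ := RingHom.id R) (ψ := φ) φ (unitR (RingHom.id R) φ) unitR_smul - unitR φ φ :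
          BTensor (RingHom.id R) φ N P →+ BTensor φ φ (BTensor (RingHom.id R) φ N P) P) v := by
      intro r v
      rw [AddMonoidHom.sub_apply, AddMonoidHom.sub_apply, smul_sub, unitR_smul, mapL_rsmul]
    have h0 := h.exact_iff (unitR (RingHom.id R) φ : N →+ _) unitR_smul
      (mapL (φ := RingHom.id R) (ψ := φ) φ (unitR (RingHom.id R) φ) unitR_smul - unitR φ φ) hlin
    refine (h0.2 ?_ w).1 (by rw [AddMonoidHom.sub_apply, hw, sub_self])
    intro z
    constructor
    · intro hz
      refine ⟨absorbR z, ?_⟩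
      rw [mapL_sub _ _ (fun r v => mapL_rsmul _ _ (φ r) v) unitR_smul, sub_eq_zero] at hz
      rw [← absorbR_mapL_unitR_eq, hz, absorbR_unitR]
    · rintro ⟨y, rfl⟩
      rw [mapL_mapL (φ'' := φ) _ _ _ _ 0 (fun _ _ => (smul_zero _).symm) (fun n => ?_),
        mapL_eq_zero fun _ => rfl]
      rw [AddMonoidHom.sub_apply, unitR_apply, mapL_tmul, unitR_apply, unitR_apply, sub_self]
      rfl
  · have h0 := h.exact_iff (ψ₁ := RingHom.id R) (ψ₂ := RingHom.id R) (ψ₃ := φ)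
      (N₁ := PUnit.{u+1}) (0 : PUnit.{u+1} →+ D.Coinv)
      (fun r n => (smul_zero (op r)).symm) D.incl D.incl_smul
    rw [exact_zero_iff_injective _ (fun _ => rfl),
      exact_zero_iff_injective _ (mapL_eq_zero fun _ => rfl)] at h0
    exact h0.1 D.incl_injective
  · have h0 := h.exact_iff (ψ₁ := RingHom.id R) (ψ₂ := φ) (ψ₃ := φ) D.incl D.incl_smul
      (D.δ - unitR φ φ) (fun r m => by
      rw [AddMonoidHom.sub_apply, AddMonoidHom.sub_apply, smul_sub, unitR_smul, D.δ_smul])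
    refine (h0.1 (fun m => ⟨fun hm => ⟨⟨m, hm⟩, rfl⟩, ?_⟩) w).1 ?_
    · rintro ⟨c, rfl⟩
      exact c.2
    · rw [mapL_sub _ _ (fun r m => D.δ_smul (φ r) m) unitR_smul, hw, sub_self]

end FaithfullyFlat

/-! ### The Morita context of `T` and a formal dual, acting on factors to the right -/

section Pen

variable {R S A B : Type u} [Ring R] [Ring S] [Ring A] [Ring B] {α : R →+* A} {β : S →+* B}
  {T : Type u} [AddCommGroup T] [Module B T] [Module Aᵐᵒᵖ T] [SMulCommClass B Aᵐᵒᵖ T]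
  {P : Type u} [AddCommGroup P] [Module A P] [Module Bᵐᵒᵖ P] [SMulCommClass A Bᵐᵒᵖ P]

namespace FormalDual

variable (d : FormalDual α β T P) {Q Q' : Type u} [Ring Q] [Ring Q'] {X X' : Type u}
  [AddCommGroup X] [AddCommGroup X']

section Right

variable [Module Q X] [Module Q' X'] {ξ : R →+* Q} {ξ' : R →+* Q'} {υ : S →+* Q} {υ' : S →+* Q'}

/-- `t ⊗ x ↦ ev(p ⊗ t) ⊗ x` -/
def evL (p : P) : BTensor α ξ T X →+ BTensor α ξ A X :=
  mapL α (d.ev.comp (BTensor.mk β β p)) (fun r t => d.ev_rsmul (α r) (tmul β β p t))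

/-- `p ⊗ x ↦ coev(t ⊗ p) ⊗ x` -/
def coevL (t : T) : BTensor β υ P X →+ BTensor β υ B X :=
  mapL β (d.coev.comp (BTensor.mk α α t)) (fun s p => d.coev_rsmul (β s) (tmul α α t p))

@[simp] theorem evL_tmul (p : P) (t : T) (x : X) :
    d.evL p (tmul α ξ t x) = tmul α ξ (d.ev (tmul β β p t)) x := rfl

@[simp] theorem coevL_tmul (t : T) (p : P) (x : X) :
    d.coevL t (tmul β υ p x) = tmul β υ (d.coev (tmul α α t p)) x := rfl

theorem add_evL (p p' : P) (w : BTensor α ξ T X) :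
    d.evL (p + p') w = d.evL p w + d.evL p' w := by
  induction w using induction_on with
  | zero => simp only [map_zero, add_zero]
  | tmul t x => simp only [evL_tmul, add_tmul, map_add]
  | add x y hx hy => simp only [map_add, hx, hy]; abel

theorem add_coevL (t t' : T) (w : BTensor β υ P X) :
    d.coevL (t + t') w = d.coevL t w + d.coevL t' w := by
  induction w using induction_on with
  | zero => simp only [map_zero, add_zero]
  | tmul p x => simp only [coevL_tmul, add_tmul, map_add]
  | add x y hx hy => simp only [map_add, hx, hy]; abel

theorem smul_evL (a : A) (p : P) (w : BTensor α ξ T X) : d.evL (a • p) w = a • d.evL p w := by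
  induction w using induction_on with
  | zero => simp only [map_zero, smul_zero]
  | tmul t x => rw [evL_tmul, evL_tmul, ← lsmul_tmul, d.ev_lsmul, lsmul_tmul]
  | add x y hx hy => simp only [map_add, smul_add, hx, hy]

theorem smul_coevL (b : B) (t : T) (w : BTensor β υ P X) :
    d.coevL (b • t) w = b • d.coevL t w := by
  induction w using induction_on with
  | zero => simp only [map_zero, smul_zero]
  | tmul p x => rw [coevL_tmul, coevL_tmul, ← lsmul_tmul, d.coev_lsmul, lsmul_tmul]
  | add x y hx hy => simp only [map_add, smul_add, hx, hy]

theorem evL_smul (s : S) (p : P) (w : BTensor α ξ T X) :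
    d.evL p (β s • w) = d.evL (op (β s) • p) w := by
  induction w using induction_on with
  | zero => simp only [map_zero, smul_zero]
  | tmul t x => rw [lsmul_tmul, evL_tmul, evL_tmul, smul_tmul]
  | add x y hx hy => simp only [map_add, smul_add, hx, hy]

theorem coevL_smul (r : R) (t : T) (w : BTensor β υ P X) :
    d.coevL t (α r • w) = d.coevL (op (α r) • t) w := by
  induction w using induction_on with
  | zero => simp only [map_zero, smul_zero]
  | tmul p x => rw [lsmul_tmul, coevL_tmul, coevL_tmul, smul_tmul]
  | add x y hx hy => simp only [map_add, smul_add, hx, hy]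

/-- The axiom `t ev(p ⊗ y) = coev(t ⊗ p) y` with a spectator `X`. Together with `evL_actL` it makes
`t` and `p` transport elements between `T ⊗_R X` and `A ⊗_R X`, the composites being multiplications
by values of `coev` and `ev`. -/
theorem actL_evL (t : T) (p : P) (w : BTensor α ξ T X) :
    actL t (d.evL p w) = d.coev (tmul α α t p) • w := by
  induction w using induction_on with
  | zero => simp only [map_zero, smul_zero]
  | tmul t' x => rw [evL_tmul, actL_tmul, lsmul_tmul, d.coev_smul]
  | add x y hx hy => simp only [map_add, smul_add, hx, hy]

theorem evL_actL (p : P) (t : T) (w : BTensor α ξ A X) :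
    d.evL p (actL t w) = d.ev (tmul β β p t) • w := by
  induction w using induction_on with
  | zero => simp only [map_zero, smul_zero]
  | tmul a x =>
    rw [actL_tmul, evL_tmul, lsmul_tmul, ← rsmul_tmul, d.ev_rsmul, smul_eq_mul, op_smul_eq_mul]
  | add x y hx hy => simp only [map_add, smul_add, hx, hy]

theorem coevL_actL (t : T) (p : P) (w : BTensor β υ B X) :
    d.coevL t (actL p w) = d.coev (tmul α α t p) • w := by
  induction w using induction_on with
  | zero => simp only [map_zero, smul_zero]
  | tmul b x =>
    rw [actL_tmul, coevL_tmul, lsmul_tmul, ← rsmul_tmul, d.coev_rsmul, smul_eq_mul,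
      op_smul_eq_mul]
  | add x y hx hy => simp only [map_add, smul_add, hx, hy]

theorem evL_mapR (p : P) (g : X →+ X') (hg : ∀ r x, g (ξ r • x) = ξ' r • g x)
    (w : BTensor α ξ T X) : d.evL p (mapR ξ' g hg w) = mapR ξ' g hg (d.evL p w) :=
  (mapR_mapL _ _ g hg w).symm

theorem evL_rsmul {K : Type u} [Ring K] [Module Kᵐᵒᵖ X] [SMulCommClass Q Kᵐᵒᵖ X] (p : P) (k : K)
    (w : BTensor α ξ T X) : d.evL p (op k • w) = op k • d.evL p w :=
  mapL_rsmul _ _ k w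

/-- The map `P ⊗_S (T ⊗_R X) → A ⊗_R X` induced by the evaluation. -/
def evMapL : BTensor β β P (BTensor α ξ T X) →+ BTensor α ξ A X :=
  lift (biadd (fun p w => d.evL p w) d.add_evL (fun _ w w' => map_add _ w w'))
    (fun s p w => (d.evL_smul s p w).symm)

@[simp] theorem evMapL_tmul (p : P) (w : BTensor α ξ T X) :
    d.evMapL (tmul β β p w) = d.evL p w := rfl

theorem evMapL_lsmul (a : A) (z : BTensor β β P (BTensor α ξ T X)) :
    d.evMapL (a • z) = a • d.evMapL z := by
  induction z using induction_on with
  | zero => simp only [map_zero, smul_zero]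
  | tmul p w => rw [lsmul_tmul, evMapL_tmul, evMapL_tmul, smul_evL]
  | add x y hx hy => simp only [map_add, smul_add, hx, hy]

/-- The map `T ⊗_R (P ⊗_S X) → B ⊗_S X` induced by the coevaluation. -/
def coevMapL : BTensor α α T (BTensor β υ P X) →+ BTensor β υ B X :=
  lift (biadd (fun t w => d.coevL t w) d.add_coevL (fun _ w w' => map_add _ w w'))
    (fun r t w => (d.coevL_smul r t w).symm)

@[simp] theorem coevMapL_tmul (t : T) (w : BTensor β υ P X) :
    d.coevMapL (tmul α α t w) = d.coevL t w := rfl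

theorem coevMapL_lsmul (b : B) (z : BTensor α α T (BTensor β υ P X)) :
    d.coevMapL (b • z) = b • d.coevMapL z := by
  induction z using induction_on with
  | zero => simp only [map_zero, smul_zero]
  | tmul p w => rw [lsmul_tmul, coevMapL_tmul, coevMapL_tmul, smul_coevL]
  | add x y hx hy => simp only [map_add, smul_add, hx, hy]

/-- If `1 = Σ coev(tᵢ ⊗ pᵢ)` then `w = Σ tᵢ (pᵢ w)`. -/
theorem eq_zero_of_evL (h : ∃ z, d.coev z = 1) (w : BTensor α ξ T X) (hw : ∀ p, d.evL p w = 0) :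
    w = 0 := by
  obtain ⟨z, hz⟩ := h
  have : ∀ z, d.coev z • w = 0 := fun z => by
    induction z using induction_on with
    | zero => rw [map_zero, zero_smul]
    | tmul t p => rw [← actL_evL, hw, map_zero]
    | add x y hx hy => rw [map_add, add_smul, hx, hy, add_zero]
  rw [← this z, hz, one_smul]

/-- If `1 = Σ coev(tᵢ ⊗ pᵢ)` then `w = Σ coev(tᵢ ⊗ pᵢ) w`, and each summand is computed from `pᵢ w`.
-/
theorem eq_zero_of_actL_right (h : ∃ z, d.coev z = 1) (w : BTensor β υ B X)
    (hw : ∀ p : P, actL p w = 0) : w = 0 := by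
  obtain ⟨z, hz⟩ := h
  have : ∀ z, d.coev z • w = 0 := fun z => by
    induction z using induction_on with
    | zero => rw [map_zero, zero_smul]
    | tmul t p => rw [← coevL_actL, hw, map_zero]
    | add x y hx hy => rw [map_add, add_smul, hx, hy, add_zero]
  rw [← this z, hz, one_smul]

/-- Multiplication by `p ∈ P` goes from `T ⊗_R N` to `A ⊗_R N` and multiplication by `t ∈ T` goes
back, both naturally in `N`. Since `1` is a sum of values `coev(t ⊗ p)`, and a sum of values `ev(p ⊗
t)`, preimages and vanishing can be tested on the other side. -/
theorem exact_mapR_iff (h1 : ∃ z, d.ev z = 1) (h2 : ∃ z, d.coev z = 1) {N₁ N₂ N₃ : Type u}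
    [AddCommGroup N₁] [AddCommGroup N₂] [AddCommGroup N₃] [Module R N₁] [Module R N₂] [Module R N₃]
    (f : N₁ →+ N₂) (hf : ∀ r n, f (RingHom.id R r • n) = RingHom.id R r • f n) (g : N₂ →+ N₃)
    (hg : ∀ r n, g (RingHom.id R r • n) = RingHom.id R r • g n) :
    Function.Exact (mapR (φ := α) (M := A) (RingHom.id R) f hf)
      (mapR (φ := α) (M := A) (RingHom.id R) g hg) ↔
    Function.Exact (mapR (φ := α) (M := T) (RingHom.id R) f hf)
      (mapR (φ := α) (M := T) (RingHom.id R) g hg) := by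
  obtain ⟨z, hz⟩ := h1
  obtain ⟨z', hz'⟩ := h2
  constructor
  · intro h w
    constructor
    · intro hw
      -- A preimage of `coev(t ⊗ p) w`: carry `w` to `A ⊗_R N` by `p`, lift it there, and return by
      -- `t`. The case of `coev z' = 1` follows by additivity in `z`.
      have : ∀ z, ∃ u, mapR (φ := α) (ψ := RingHom.id R) (M := T) (RingHom.id R) f
          hf u = d.coev z • w := fun z => by
        induction z using induction_on with
        | zero => exact ⟨0, by rw [map_zero, map_zero, zero_smul]⟩
        | tmul t p =>
          obtain ⟨u, hu⟩ := (h (d.evL p w)).1 (by rw [← evL_mapR, hw, map_zero])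
          exact ⟨actL t u, by rw [mapR_actL, hu, actL_evL]⟩
        | add x y hx hy =>
          obtain ⟨u, hu⟩ := hx
          obtain ⟨v, hv⟩ := hy
          exact ⟨u + v, by rw [map_add, hu, hv, map_add, add_smul]⟩
      obtain ⟨u, hu⟩ := this z'
      exact ⟨u, by rw [hu, hz', one_smul]⟩
    · rintro ⟨u, rfl⟩
      refine d.eq_zero_of_evL ⟨z', hz'⟩ _ fun p => ?_
      rw [evL_mapR, evL_mapR]
      exact (h _).2 ⟨_, rfl⟩
  · intro h w
    -- Here the round trip starts in `A ⊗_R N`: `t` carries `w` to `T ⊗_R N`, where a lift exists,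
    -- and `p` carries the lift back.
    have key : ∀ z, ∃ u, (mapR (φ := α) (ψ := RingHom.id R) (M := A) (RingHom.id R)
        g hg w = 0 → mapR (φ := α) (ψ := RingHom.id R) (M := A)
          (RingHom.id R) f hf u = d.ev z • w) := fun z => by
      induction z using induction_on with
      | zero => exact ⟨0, fun _ => by rw [map_zero, map_zero, zero_smul]⟩
      | tmul p t =>
        by_cases hw : mapR (φ := α) (ψ := RingHom.id R) (M := A) (RingHom.id R)
          g hg w = 0
        · obtain ⟨u, hu⟩ := (h (actL t w)).1 (by rw [mapR_actL, hw, map_zero])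
          exact ⟨d.evL p u, fun _ => by rw [← evL_mapR, hu, evL_actL]⟩
        · exact ⟨0, fun h => absurd h hw⟩
      | add x y hx hy =>
        obtain ⟨u, hu⟩ := hx
        obtain ⟨v, hv⟩ := hy
        exact ⟨u + v, fun h => by rw [map_add, hu h, hv h, map_add, add_smul]⟩
    constructor
    · intro hw
      obtain ⟨u, hu⟩ := key z
      exact ⟨u, by rw [hu hw, hz, one_smul]⟩
    · rintro ⟨u, rfl⟩
      have : ∀ z, d.ev z • mapR (φ := α) (ψ := RingHom.id R) (M := A) (RingHom.id R)
          g hg (mapR (φ := α) (ψ := RingHom.id R) (M := A) (RingHom.id R)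
            f hf u) = 0 := fun z => by
        induction z using induction_on with
        | zero => rw [map_zero, zero_smul]
        | tmul p t =>
          rw [← evL_actL, ← mapR_actL, ← mapR_actL, (h _).2 ⟨_, rfl⟩, map_zero]
        | add x y hx hy => rw [map_add, add_smul, hx, hy, add_zero]
      rw [← this z, hz, one_smul]

theorem rightFaithfullyFlat (h : RightFaithfullyFlat α A) (h1 : ∃ z, d.ev z = 1)
    (h2 : ∃ z, d.coev z = 1) : RightFaithfullyFlat α T := by
  intro N₁ N₂ N₃ _ _ _ _ _ _ f g
  exact (h N₁ N₂ N₃ f g).trans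
    (d.exact_mapR_iff h1 h2 f.toAddMonoidHom f.map_smul g.toAddMonoidHom g.map_smul)

end Right

/-! ### The same Morita context, acting on factors to the left -/

section Left

variable [Module Qᵐᵒᵖ X] [Module Q'ᵐᵒᵖ X'] {ξ : R →+* Q} {ξ' : R →+* Q'} {υ : S →+* Q}
  {υ' : S →+* Q'}

/-- `x ⊗ t ↦ x ⊗ coev(t ⊗ p)` -/
def coevR (p : P) : BTensor υ β X T →+ BTensor υ β X B :=
  mapR β (d.coev.comp ((BTensor.mk α α).flip p)) (fun s t => d.coev_lsmul (β s) (tmul α α t p))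

/-- `x ⊗ p ↦ x ⊗ ev(p ⊗ t)` -/
def evR (t : T) : BTensor ξ α X P →+ BTensor ξ α X A :=
  mapR α (d.ev.comp ((BTensor.mk β β).flip t)) (fun r p => d.ev_lsmul (α r) (tmul β β p t))

@[simp] theorem coevR_tmul (p : P) (t : T) (x : X) :
    d.coevR p (tmul υ β x t) = tmul υ β x (d.coev (tmul α α t p)) := rfl

@[simp] theorem evR_tmul (t : T) (p : P) (x : X) :
    d.evR t (tmul ξ α x p) = tmul ξ α x (d.ev (tmul β β p t)) := rfl

theorem add_coevR (p p' : P) (w : BTensor υ β X T) :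
    d.coevR (p + p') w = d.coevR p w + d.coevR p' w := by
  induction w using induction_on with
  | zero => simp only [map_zero, add_zero]
  | tmul t x => simp only [coevR_tmul, tmul_add, map_add]
  | add x y hx hy => simp only [map_add, hx, hy]; abel

theorem add_evR (t t' : T) (w : BTensor ξ α X P) :
    d.evR (t + t') w = d.evR t w + d.evR t' w := by
  induction w using induction_on with
  | zero => simp only [map_zero, add_zero]
  | tmul p x => simp only [evR_tmul, tmul_add, map_add]
  | add x y hx hy => simp only [map_add, hx, hy]; abel

theorem smul_coevR (b : B) (p : P) (w : BTensor υ β X T) :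
    d.coevR (op b • p) w = op b • d.coevR p w := by
  induction w using induction_on with
  | zero => simp only [map_zero, smul_zero]
  | tmul t x => rw [coevR_tmul, coevR_tmul, ← rsmul_tmul, d.coev_rsmul, rsmul_tmul]
  | add x y hx hy => simp only [map_add, smul_add, hx, hy]

theorem smul_evR (a : A) (t : T) (w : BTensor ξ α X P) :
    d.evR (op a • t) w = op a • d.evR t w := by
  induction w using induction_on with
  | zero => simp only [map_zero, smul_zero]
  | tmul p x => rw [evR_tmul, evR_tmul, ← rsmul_tmul, d.ev_rsmul, rsmul_tmul]
  | add x y hx hy => simp only [map_add, smul_add, hx, hy]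

theorem coevR_smul (r : R) (p : P) (w : BTensor υ β X T) :
    d.coevR p (op (α r) • w) = d.coevR (α r • p) w := by
  induction w using induction_on with
  | zero => simp only [map_zero, smul_zero]
  | tmul t x => rw [rsmul_tmul, coevR_tmul, coevR_tmul, smul_tmul]
  | add x y hx hy => simp only [map_add, smul_add, hx, hy]

theorem evR_smul (s : S) (t : T) (w : BTensor ξ α X P) :
    d.evR t (op (β s) • w) = d.evR (β s • t) w := by
  induction w using induction_on with
  | zero => simp only [map_zero, smul_zero]
  | tmul p x => rw [rsmul_tmul, evR_tmul, evR_tmul, smul_tmul]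
  | add x y hx hy => simp only [map_add, smul_add, hx, hy]

theorem actR_coevR (t : T) (p : P) (w : BTensor υ β X T) :
    actR t (d.coevR p w) = op (d.ev (tmul β β p t)) • w := by
  induction w using induction_on with
  | zero => simp only [map_zero, smul_zero]
  | tmul t' x => rw [coevR_tmul, actR_tmul, rsmul_tmul, d.coev_smul]
  | add x y hx hy => simp only [map_add, smul_add, hx, hy]

theorem coevR_actR (p : P) (t : T) (w : BTensor υ β X B) :
    d.coevR p (actR t w) = op (d.coev (tmul α α t p)) • w := by
  induction w using induction_on with
  | zero => simp only [map_zero, smul_zero]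
  | tmul a x =>
    rw [actR_tmul, coevR_tmul, rsmul_tmul, ← lsmul_tmul, d.coev_lsmul, smul_eq_mul,
      op_smul_eq_mul]
  | add x y hx hy => simp only [map_add, smul_add, hx, hy]

theorem evR_actR (t : T) (p : P) (w : BTensor ξ α X A) :
    d.evR t (actR p w) = op (d.ev (tmul β β p t)) • w := by
  induction w using induction_on with
  | zero => simp only [map_zero, smul_zero]
  | tmul b x =>
    rw [actR_tmul, evR_tmul, rsmul_tmul, ← lsmul_tmul, d.ev_lsmul, smul_eq_mul,
      op_smul_eq_mul]
  | add x y hx hy => simp only [map_add, smul_add, hx, hy]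

theorem coevR_mapL (p : P) (g : X →+ X') (hg : ∀ r x, g (op (υ r) • x) = op (υ' r) • g x)
    (w : BTensor υ β X T) : d.coevR p (mapL υ' g hg w) = mapL υ' g hg (d.coevR p w) :=
  mapR_mapL g hg _ _ w

theorem coevR_lsmul {K : Type u} [Ring K] [Module K X] [SMulCommClass K Qᵐᵒᵖ X] (p : P) (k : K)
    (w : BTensor υ β X T) : d.coevR p (k • w) = k • d.coevR p w :=
  mapR_lsmul _ _ k w

/-- The map `(X ⊗_S T) ⊗_R P → X ⊗_S B` induced by the coevaluation. -/
def coevMapR : BTensor α α (BTensor υ β X T) P →+ BTensor υ β X B :=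
  lift (biadd (fun w p => d.coevR p w) (fun w w' _ => map_add _ w w')
    (fun w p p' => d.add_coevR p p' w)) (fun s w p => d.coevR_smul s p w)

@[simp] theorem coevMapR_tmul (p : P) (w : BTensor υ β X T) :
    d.coevMapR (tmul α α w p) = d.coevR p w := rfl

theorem coevMapR_rsmul (b : B) (z : BTensor α α (BTensor υ β X T) P) :
    d.coevMapR (op b • z) = op b • d.coevMapR z := by
  induction z using induction_on with
  | zero => simp only [map_zero, smul_zero]
  | tmul p w => rw [rsmul_tmul, coevMapR_tmul, coevMapR_tmul, smul_coevR]
  | add x y hx hy => simp only [map_add, smul_add, hx, hy]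

/-- The map `(X ⊗_R P) ⊗_S T → X ⊗_R A` induced by the evaluation. -/
def evMapR : BTensor β β (BTensor ξ α X P) T →+ BTensor ξ α X A :=
  lift (biadd (fun w t => d.evR t w) (fun w w' _ => map_add _ w w')
    (fun w t t' => d.add_evR t t' w)) (fun s w t => d.evR_smul s t w)

@[simp] theorem evMapR_tmul (t : T) (w : BTensor ξ α X P) :
    d.evMapR (tmul β β w t) = d.evR t w := rfl

theorem evMapR_rsmul (a : A) (z : BTensor β β (BTensor ξ α X P) T) :
    d.evMapR (op a • z) = op a • d.evMapR z := by
  induction z using induction_on with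
  | zero => simp only [map_zero, smul_zero]
  | tmul p w => rw [rsmul_tmul, evMapR_tmul, evMapR_tmul, smul_evR]
  | add x y hx hy => simp only [map_add, smul_add, hx, hy]

theorem eq_zero_of_coevR (h : ∃ z, d.ev z = 1) (w : BTensor υ β X T)
    (hw : ∀ p, d.coevR p w = 0) : w = 0 := by
  obtain ⟨z, hz⟩ := h
  have : ∀ z, op (d.ev z) • w = 0 := fun z => by
    induction z using induction_on with
    | zero => rw [map_zero, op_zero, zero_smul]
    | tmul p t => rw [← actR_coevR, hw, map_zero]
    | add x y hx hy => rw [map_add, op_add, add_smul, hx, hy, add_zero]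
  rw [← this z, hz, op_one, one_smul]

theorem eq_zero_of_actR_left (h : ∃ z, d.ev z = 1) (w : BTensor ξ α X A)
    (hw : ∀ p : P, actR p w = 0) : w = 0 := by
  obtain ⟨z, hz⟩ := h
  have : ∀ z, op (d.ev z) • w = 0 := fun z => by
    induction z using induction_on with
    | zero => rw [map_zero, op_zero, zero_smul]
    | tmul p t => rw [← evR_actR, hw, map_zero]
    | add x y hx hy => rw [map_add, op_add, add_smul, hx, hy, add_zero]
  rw [← this z, hz, op_one, one_smul]

/-- As for `exact_mapR_iff`, with `ev` and `coev` exchanged: sums of values of `ev` recover elements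
of `N ⊗_S T`, sums of values of `coev` recover elements of `N ⊗_S B`. -/
theorem exact_mapL_iff (h1 : ∃ z, d.ev z = 1) (h2 : ∃ z, d.coev z = 1) {N₁ N₂ N₃ : Type u}
    [AddCommGroup N₁] [AddCommGroup N₂] [AddCommGroup N₃] [Module Sᵐᵒᵖ N₁] [Module Sᵐᵒᵖ N₂]
    [Module Sᵐᵒᵖ N₃] (f : N₁ →+ N₂)
    (hf : ∀ s n, f (op (RingHom.id S s) • n) = op (RingHom.id S s) • f n) (g : N₂ →+ N₃)
    (hg : ∀ s n, g (op (RingHom.id S s) • n) = op (RingHom.id S s) • g n) :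
    Function.Exact (mapL (ψ := β) (N := B) (RingHom.id S) f hf)
      (mapL (ψ := β) (N := B) (RingHom.id S) g hg) ↔
    Function.Exact (mapL (ψ := β) (N := T) (RingHom.id S) f hf)
      (mapL (ψ := β) (N := T) (RingHom.id S) g hg) := by
  obtain ⟨z, hz⟩ := h1
  obtain ⟨z', hz'⟩ := h2
  constructor
  · intro h w
    constructor
    · intro hw
      have : ∀ z, ∃ u, mapL (φ := RingHom.id S) (ψ := β) (N := T) (RingHom.id S) f
          hf u = op (d.ev z) • w := fun z => by
        induction z using induction_on with
        | zero => exact ⟨0, by rw [map_zero, map_zero, op_zero, zero_smul]⟩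
        | tmul p t =>
          obtain ⟨u, hu⟩ := (h (d.coevR p w)).1 (by rw [← coevR_mapL, hw, map_zero])
          exact ⟨actR t u, by rw [mapL_actR, hu, actR_coevR]⟩
        | add x y hx hy =>
          obtain ⟨u, hu⟩ := hx
          obtain ⟨v, hv⟩ := hy
          exact ⟨u + v, by rw [map_add, hu, hv, map_add, op_add, add_smul]⟩
      obtain ⟨u, hu⟩ := this z
      exact ⟨u, by rw [hu, hz, op_one, one_smul]⟩
    · rintro ⟨u, rfl⟩
      refine d.eq_zero_of_coevR ⟨z, hz⟩ _ fun p => ?_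
      rw [coevR_mapL, coevR_mapL]
      exact (h _).2 ⟨_, rfl⟩
  · intro h w
    have key : ∀ z, ∃ u, (mapL (φ := RingHom.id S) (ψ := β) (N := B) (RingHom.id S)
        g hg w = 0 →
          mapL (φ := RingHom.id S) (ψ := β) (N := B) (RingHom.id S) f
            hf u = op (d.coev z) • w) := fun z => by
      induction z using induction_on with
      | zero => exact ⟨0, fun _ => by rw [map_zero, map_zero, op_zero, zero_smul]⟩
      | tmul t p =>
        by_cases hw : mapL (φ := RingHom.id S) (ψ := β) (N := B) (RingHom.id S)
          g hg w = 0
        · obtain ⟨u, hu⟩ := (h (actR t w)).1 (by rw [mapL_actR, hw, map_zero])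
          exact ⟨d.coevR p u, fun _ => by rw [← coevR_mapL, hu, coevR_actR]⟩
        · exact ⟨0, fun h => absurd h hw⟩
      | add x y hx hy =>
        obtain ⟨u, hu⟩ := hx
        obtain ⟨v, hv⟩ := hy
        exact ⟨u + v, fun h => by rw [map_add, hu h, hv h, map_add, op_add, add_smul]⟩
    constructor
    · intro hw
      obtain ⟨u, hu⟩ := key z'
      exact ⟨u, by rw [hu hw, hz', op_one, one_smul]⟩
    · rintro ⟨u, rfl⟩
      have : ∀ z, op (d.coev z) • mapL (φ := RingHom.id S) (ψ := β) (N := B) (RingHom.id S)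
          g hg
            (mapL (φ := RingHom.id S) (ψ := β) (N := B) (RingHom.id S) f
              hf u) = 0 := fun z => by
        induction z using induction_on with
        | zero => rw [map_zero, op_zero, zero_smul]
        | tmul t p =>
          rw [← coevR_actR, ← mapL_actR, ← mapL_actR, (h _).2 ⟨_, rfl⟩, map_zero]
        | add x y hx hy => rw [map_add, op_add, add_smul, hx, hy, add_zero]
      rw [← this z', hz', op_one, one_smul]

theorem leftFaithfullyFlat (h : LeftFaithfullyFlat β B) (h1 : ∃ z, d.ev z = 1)
    (h2 : ∃ z, d.coev z = 1) : LeftFaithfullyFlat β T := by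
  intro N₁ N₂ N₃ _ _ _ _ _ _ f g
  exact (h N₁ N₂ N₃ f g).trans (d.exact_mapL_iff h1 h2 f.toAddMonoidHom
    (fun s x => f.map_smul (op s) x) g.toAddMonoidHom (fun s x => g.map_smul (op s) x))

end Left

end FormalDual

end Pen

namespace BTensor

section Absorb

variable {R P Q Q' : Type*} [Ring R] [Ring P] [Ring Q] [Ring Q'] {φ : R →+* P} {ψ : R →+* Q}
  {ψ' : R →+* Q'} {M N N' : Type*} [AddCommGroup M] [AddCommGroup N] [AddCommGroup N']

theorem absorbL_mapR [Module Pᵐᵒᵖ M] [Module Q N] [Module Q' N'] (g : N →+ N')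
    (hg : ∀ r n, g (ψ r • n) = ψ' r • g n) (z : BTensor φ φ M (BTensor φ ψ P N)) :
    absorbL (mapR (φ := φ) (ψ := φ) φ (mapR (φ := φ) (ψ := ψ) ψ' g hg)
      (fun r w => mapR_lsmul _ _ (φ r) w) z) = mapR ψ' g hg (absorbL z) := by
  induction z using induction_on with
  | zero => simp only [map_zero]
  | tmul m n => rw [mapR_tmul, absorbL_tmul, absorbL_tmul, mapR_actL]
  | add x y hx hy => simp only [map_add, hx, hy]

theorem absorbR_mapL [Module P M] [Module Qᵐᵒᵖ N] [Module Q'ᵐᵒᵖ N'] (g : N →+ N')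
    (hg : ∀ r n, g (op (ψ r) • n) = op (ψ' r) • g n) (z : BTensor φ φ (BTensor ψ φ N P) M) :
    absorbR (mapL (φ := φ) (ψ := φ) φ (mapL (φ := ψ) (ψ := φ) ψ' g hg)
      (fun r w => mapL_rsmul _ _ (φ r) w) z) = mapL ψ' g hg (absorbR z) := by
  induction z using induction_on with
  | zero => simp only [map_zero]
  | tmul m n => rw [mapL_tmul, absorbR_tmul, absorbR_tmul, mapL_actR]
  | add x y hx hy => simp only [map_add, hx, hy]

end Absorb

end BTensor

/-! ### Iterated right coactions -/

section Coaction

variable {R A : Type u} [Ring R] [Ring A] {α : R →+* A} {T : Type u} [AddCommGroup T]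
  [Module Aᵐᵒᵖ T] {C : Type u} [AddCommGroup C] [Module R C] [Module Rᵐᵒᵖ C]
  [SMulCommClass R Rᵐᵒᵖ C] (ρ : T →+ BTensor α (RingHom.id R) T C)
  (hρ : ∀ (r : R) x, ρ (op (α r) • x) = op r • ρ x)
  {Q Q' : Type u} [Ring Q] [Ring Q'] {ξ : R →+* Q} {ξ' : R →+* Q'} {X X' : Type u}
  [AddCommGroup X] [Module Q X] [AddCommGroup X'] [Module Q' X']

/-- `t ⊗ c ↦ t ⊗ (c ⊗ x)` -/
def insR (α : R →+* A) {M : Type u} [AddCommGroup M] [Module Aᵐᵒᵖ M] (ξ : R →+* Q) (x : X) :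
    BTensor α (RingHom.id R) M C →+
      BTensor α (RingHom.id R) M (BTensor (RingHom.id R) ξ C X) :=
  mapR (RingHom.id R) ((BTensor.mk (RingHom.id R) ξ).flip x) (fun _ _ => rfl)

@[simp] theorem insR_tmul {M : Type u} [AddCommGroup M] [Module Aᵐᵒᵖ M] (x : X) (t : M) (c : C) :
    insR α ξ x (tmul α (RingHom.id R) t c) = tmul _ _ t (tmul _ _ c x) := rfl

/-- The balancedness in `r` needed to extend a coaction from `T` to `T ⊗_R X`. -/
theorem insR_rsmul (x : X) (r : R) (z : BTensor α (RingHom.id R) T C) :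
    insR α ξ x (op r • z) = insR α ξ (ξ r • x) z := by
  induction z using induction_on with
  | zero => simp only [smul_zero, map_zero]
  | tmul t c =>
    rw [rsmul_tmul, insR_tmul, insR_tmul, ← smul_tmul, RingHom.id_apply]
  | add x y hx hy => simp only [smul_add, map_add, hx, hy]

theorem insR_add (x x' : X) (z : BTensor α (RingHom.id R) T C) :
    insR α ξ (x + x') z = insR α ξ x z + insR α ξ x' z := by
  induction z using induction_on with
  | zero => simp only [map_zero, add_zero]
  | tmul t c => rw [insR_tmul, insR_tmul, insR_tmul, tmul_add, tmul_add]
  | add x y hx hy => simp only [map_add, hx, hy]; abel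

/-- The map `ρ ⊗ X : T ⊗_R X → T ⊗_R (C ⊗_R X)` for a coaction `ρ : T → T ⊗_R C`. -/
def coactExtR (ξ : R →+* Q) : BTensor α ξ T X →+
    BTensor α (RingHom.id R) T (BTensor (RingHom.id R) ξ C X) :=
  lift (biadd (fun t x => insR α ξ x (ρ t)) (fun t t' x => by rw [map_add, map_add])
    (fun t x x' => insR_add x x' _)) (fun r t x => by
      rw [biadd_apply, biadd_apply, hρ, insR_rsmul])

@[simp] theorem coactExtR_tmul (t : T) (x : X) :
    coactExtR ρ hρ ξ (tmul α ξ t x) = insR α ξ x (ρ t) := rfl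

/-- Naturality in `X`: the coaction touches only the factor `T`. -/
theorem coactExtR_mapR (g : X →+ X') (hg : ∀ r x, g (ξ r • x) = ξ' r • g x)
    (w : BTensor α ξ T X) :
    coactExtR ρ hρ ξ' (mapR ξ' g hg w) =
      mapR (φ := α) (ψ := RingHom.id R) (RingHom.id R)
        (mapR (φ := RingHom.id R) (ψ := ξ) ξ' g hg)
        (fun r z => mapR_lsmul _ _ r z) (coactExtR ρ hρ ξ w) := by
  induction w using induction_on with
  | zero => simp only [map_zero]
  | tmul t x =>
    rw [mapR_tmul, coactExtR_tmul, coactExtR_tmul]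
    generalize ρ t = z
    induction z using induction_on with
    | zero => simp only [map_zero]
    | tmul t c => rfl
    | add x y hx hy => simp only [map_add, hx, hy]
  | add x y hx hy => simp only [map_add, hx, hy]

theorem coactExtR_rsmul {K : Type u} [Ring K] [Module Kᵐᵒᵖ X] [SMulCommClass Q Kᵐᵒᵖ X] (k : K)
    (w : BTensor α ξ T X) :
    coactExtR ρ hρ ξ (op k • w) = op k • coactExtR ρ hρ ξ w := by
  induction w using induction_on with
  | zero => simp only [map_zero, smul_zero]
  | tmul t x =>
    rw [rsmul_tmul, coactExtR_tmul, coactExtR_tmul]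
    generalize ρ t = z
    induction z using induction_on with
    | zero => simp only [map_zero, smul_zero]
    | tmul t c => rfl
    | add x y hx hy => simp only [map_add, smul_add, hx, hy]
  | add x y hx hy => simp only [map_add, smul_add, hx, hy]

theorem coactExtR_lsmul {B : Type u} [Ring B] [Module B T] [SMulCommClass B Aᵐᵒᵖ T] (b : B)
    (hb : ∀ x, ρ (b • x) = b • ρ x) (w : BTensor α ξ T X) :
    coactExtR ρ hρ ξ (b • w) = b • coactExtR ρ hρ ξ w := by
  induction w using induction_on with
  | zero => simp only [map_zero, smul_zero]
  | tmul t x =>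
    rw [lsmul_tmul, coactExtR_tmul, coactExtR_tmul, hb]
    generalize ρ t = z
    induction z using induction_on with
    | zero => simp only [map_zero, smul_zero]
    | tmul t c => rfl
    | add x y hx hy => simp only [map_add, smul_add, hx, hy]
  | add x y hx hy => simp only [map_add, smul_add, hx, hy]

/-- Coassociativity of iterated coactions: `(ρ ⊗ C ⊗ X) ∘ (ρ ⊗ X)` is obtained from `(ρ ⊗ C) ∘ ρ`
by reassociating. -/
theorem coactExtR_insR (x : X) (z : BTensor α (RingHom.id R) T C) :
    coactExtR ρ hρ (RingHom.id R) (insR α ξ x z) =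
      mapR (φ := α) (ψ := RingHom.id R) (RingHom.id R)
        (assocAux (RingHom.id R) (RingHom.id R) (RingHom.id R) ξ x)
        (fun r w => mapR_lsmul _ _ r w)
        (coactExtR ρ hρ (RingHom.id R) z) := by
  induction z using induction_on with
  | zero => simp only [map_zero]
  | tmul t c =>
    rw [insR_tmul, coactExtR_tmul, coactExtR_tmul]
    generalize ρ t = z
    induction z using induction_on with
    | zero => simp only [map_zero]
    | tmul t c => rfl
    | add x y hx hy => simp only [map_add, hx, hy]
  | add x y hx hy => simp only [map_add, hx, hy]

end Coaction

/-! ### The descent datum on `P ⊗_S T` defined by a shepherd -/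

section Herd

variable {R S A B : Type u} [Ring R] [Ring S] [Ring A] [Ring B] {α : R →+* A} {β : S →+* B}
  {T : Type u} [AddCommGroup T] [Module B T] [Module Aᵐᵒᵖ T] [SMulCommClass B Aᵐᵒᵖ T]
  {P : Type u} [AddCommGroup P] [Module A P] [Module Bᵐᵒᵖ P] [SMulCommClass A Bᵐᵒᵖ P]
  {d : FormalDual α β T P}

section Hat

variable {Q Q' : Type u} [Ring Q] [Ring Q'] {ξ : R →+* Q} {X : Type u} [AddCommGroup X] [Module Q X]
  {Z : Type u} [AddCommGroup Z] [Module B Z]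

theorem FormalDual.evL_absorbL (d : FormalDual α β T P) (p : P)
    (z : BTensor α α T (BTensor α ξ A X)) :
    d.evL p (absorbL z) = absorbL (d.evL p z) := by
  induction z using induction_on with
  | zero => simp only [map_zero]
  | tmul t w => rw [absorbL_tmul, d.evL_actL, d.evL_tmul, absorbL_tmul, actL_eq_smul]
  | add x y hx hy => simp only [map_add, hx, hy]

/-- `b ⊗ x ↦ b h(x)` -/
def smulExtL (h : T →+ Z) (hh : ∀ s x, h (β s • x) = β s • h x) : BTensor β β B T →+ Z :=
  lift (biadd (fun b x => b • h x) (fun b b' x => add_smul _ _ _)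
    (fun b x x' => by rw [map_add, smul_add])) (fun s b x => by simp [hh, mul_smul])

@[simp] theorem smulExtL_tmul (h : T →+ Z) (hh : ∀ s x, h (β s • x) = β s • h x) (b : B) (x : T) :
    smulExtL h hh (tmul β β b x) = b • h x := rfl

/-- The left `A`-linear map `P ⊗_S T → A ⊗_R X`, `p ⊗ x ↦ p h(x)` induced by
`h : T → T ⊗_R X`. -/
def FormalDual.hatL (d : FormalDual α β T P) (h : T →+ BTensor α ξ T X)
    (hh : ∀ s x, h (β s • x) = β s • h x) : BTensor β β P T →+ BTensor α ξ A X :=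
  d.evMapL.comp (mapR β h hh)

variable (h : T →+ BTensor α ξ T X) (hh : ∀ s x, h (β s • x) = β s • h x)

@[simp] theorem FormalDual.hatL_tmul (p : P) (x : T) :
    d.hatL h hh (tmul β β p x) = d.evL p (h x) := rfl

theorem FormalDual.hatL_lsmul (a : A) (z : BTensor β β P T) :
    d.hatL h hh (a • z) = a • d.hatL h hh z := by
  induction z using induction_on with
  | zero => simp only [map_zero, smul_zero]
  | tmul p x => rw [lsmul_tmul, hatL_tmul, hatL_tmul, d.smul_evL]
  | add x y hx hy => simp only [map_add, smul_add, hx, hy]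

theorem FormalDual.hatL_rsmul {K : Type u} [Ring K] [Module Kᵐᵒᵖ X] [SMulCommClass Q Kᵐᵒᵖ X]
    (k : K) (a : A) (hk : ∀ x, h (op a • x) = op k • h x) (z : BTensor β β P T) :
    d.hatL h hh (op a • z) = op k • d.hatL h hh z := by
  induction z using induction_on with
  | zero => simp only [map_zero, smul_zero]
  | tmul p x => rw [rsmul_tmul, hatL_tmul, hatL_tmul, hk, d.evL_rsmul]
  | add x y hx hy => simp only [map_add, smul_add, hx, hy]

/-- On pure tensors this is the identity `t (p h(x)) = coev(t ⊗ p) h(x)`. -/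
theorem FormalDual.absorbL_mapR_hatL (z : BTensor α α T (BTensor β β P T)) :
    absorbL (mapR (φ := α) (ψ := α) α (d.hatL h hh) (fun r => d.hatL_lsmul h hh (α r)) z) =
      smulExtL h hh (d.coevMapL z) := by
  induction z using induction_on with
  | zero => simp only [map_zero]
  | tmul t w =>
    rw [mapR_tmul, absorbL_tmul, d.coevMapL_tmul]
    induction w using induction_on with
    | zero => simp only [map_zero]
    | tmul p x => rw [FormalDual.hatL_tmul, d.actL_evL, d.coevL_tmul, smulExtL_tmul]
    | add x y hx hy => simp only [map_add, hx, hy]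
  | add x y hx hy => simp only [map_add, hx, hy]

end Hat

namespace Shepherd

variable (σ : Shepherd d)

/-- The unit law for `coev` in the bracketing `T ⊗ (P ⊗ T)`, which is the bracketing of `γ` itself.
-/
theorem coevMapL_γ (x : T) : d.coevMapL (σ.γ x) = tmul β β 1 x := by
  rw [← σ.coev_γ]
  generalize σ.γ x = z
  induction z using induction_on with
  | zero => simp only [map_zero]
  | tmul t w =>
    induction w using induction_on with
    | zero => simp only [map_zero, tmul_zero]
    | tmul p x => rfl
    | add x y hx hy => simp only [map_add, tmul_add, hx, hy]
  | add x y hx hy => simp only [map_add, hx, hy]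

section Ext

variable {Q Q' : Type u} [Ring Q] [Ring Q'] {ξ : R →+* Q} {ξ' : R →+* Q'} {X X' : Type u}
  [AddCommGroup X] [Module Q X] [AddCommGroup X'] [Module Q' X']

/-- The unit law `(coev ⊗ T) γ(x) = 1 ⊗ x` recovers any left `S`-linear `h` from the left `A`-linear
map that it induces on `P ⊗_S T`. This is the source of the universal property of the coaction. -/
theorem absorbL_mapR_hatL_γ (h : T →+ BTensor α ξ T X) (hh : ∀ s x, h (β s • x) = β s • h x)
    (x : T) :
    absorbL (mapR (φ := α) (ψ := α) α (d.hatL h hh) (fun r => d.hatL_lsmul h hh (α r)) (σ.γ x)) =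
      h x := by
  rw [d.absorbL_mapR_hatL, coevMapL_γ, smulExtL_tmul, one_smul]

/-- `t ⊗ (p ⊗ y) ↦ t ⊗ (p ⊗ (y ⊗ x))` -/
def insR₂ (α : R →+* A) (β : S →+* B) (T P : Type u) [AddCommGroup T] [Module B T] [Module Aᵐᵒᵖ T]
    [SMulCommClass B Aᵐᵒᵖ T] [AddCommGroup P] [Module A P] [Module Bᵐᵒᵖ P] [SMulCommClass A Bᵐᵒᵖ P]
    (ξ : R →+* Q) (x : X) : BTensor α α T (BTensor β β P T) →+
      BTensor α α T (BTensor β β P (BTensor α ξ T X)) :=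
  mapR α (mapR β ((BTensor.mk α ξ).flip x) (fun _ _ => rfl)) (fun r z => mapR_lsmul _ _ (α r) z)

theorem insR₂_rsmul (x : X) (r : R) (z : BTensor α α T (BTensor β β P T)) :
    insR₂ α β T P ξ x (op (α r) • z) = insR₂ α β T P ξ (ξ r • x) z := by
  induction z using induction_on with
  | zero => simp only [smul_zero, map_zero]
  | tmul t w =>
    induction w using induction_on with
    | zero => simp only [smul_zero, map_zero, tmul_zero]
    | tmul p y =>
      change tmul _ _ t (tmul _ _ p (tmul _ _ (op (α r) • y) x)) =
        tmul _ _ t (tmul _ _ p (tmul _ _ y (ξ r • x)))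
      rw [smul_tmul]
    | add x y hx hy => simp only [smul_add, map_add, tmul_add, hx, hy]
  | add x y hx hy => simp only [smul_add, map_add, hx, hy]

theorem insR₂_add (x x' : X) (z : BTensor α α T (BTensor β β P T)) :
    insR₂ α β T P ξ (x + x') z = insR₂ α β T P ξ x z + insR₂ α β T P ξ x' z := by
  induction z using induction_on with
  | zero => simp only [map_zero, add_zero]
  | tmul t w =>
    induction w using induction_on with
    | zero => simp only [map_zero, tmul_zero, add_zero]
    | tmul p y =>
      change tmul _ _ t (tmul _ _ p (tmul _ _ y (x + x'))) =
        tmul _ _ t (tmul _ _ p (tmul _ _ y x)) + tmul _ _ t (tmul _ _ p (tmul _ _ y x'))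
      rw [tmul_add, tmul_add, tmul_add]
    | add x y hx hy => simp only [map_add, tmul_add, hx, hy]; abel
  | add x y hx hy => simp only [map_add, hx, hy]; abel

/-- `γ ⊗ X : T ⊗_R X → T ⊗_R (P ⊗_S (T ⊗_R X))` -/
def extR (ξ : R →+* Q) : BTensor α ξ T X →+ BTensor α α T (BTensor β β P (BTensor α ξ T X)) :=
  lift (biadd (fun t x => insR₂ α β T P ξ x (σ.γ t)) (fun t t' x => by rw [map_add, map_add])
    (fun t x x' => insR₂_add x x' _)) (fun r t x => by
      rw [biadd_apply, biadd_apply, σ.γ_rsmul, insR₂_rsmul])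

@[simp] theorem extR_tmul (t : T) (x : X) :
    σ.extR ξ (tmul α ξ t x) = insR₂ α β T P ξ x (σ.γ t) := rfl

/-- Coassociativity of the shepherd, with `γ ⊗ P ⊗ T` written as an extension of `γ` to `T ⊗_R X` so
that it is natural in `X`. -/
theorem extR_γ (x : T) : σ.extR α (σ.γ x) =
    mapR (φ := α) (ψ := α) α (mapR (φ := β) (ψ := β) β σ.γ σ.γ_lsmul)
      (fun r z => mapR_lsmul _ _ (α r) z) (σ.γ x) := by
  refine Eq.trans ?_ (σ.coassoc x)
  generalize σ.γ x = z
  induction z using induction_on with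
  | zero => simp only [map_zero]
  | tmul t w =>
    rw [extR_tmul, mapL_tmul]
    generalize σ.γ t = z
    induction z using induction_on with
    | zero => simp only [map_zero, zero_tmul]
    | tmul t v =>
      induction v using induction_on with
      | zero => simp only [map_zero, zero_tmul, tmul_zero]
      | tmul p y => rfl
      | add x y hx hy => simp only [map_add, tmul_add, add_tmul, hx, hy]
    | add x y hx hy => simp only [map_add, add_tmul, hx, hy]
  | add x y hx hy => simp only [map_add, hx, hy]

theorem extR_mapR (g : X →+ X') (hg : ∀ r x, g (ξ r • x) = ξ' r • g x) (w : BTensor α ξ T X) :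
    σ.extR ξ' (mapR ξ' g hg w) = mapR (φ := α) (ψ := α) α
      (mapR (φ := β) (ψ := β) β (mapR (φ := α) (ψ := ξ) ξ' g hg)
        (fun s z => mapR_lsmul _ _ (β s) z)) (fun r z => mapR_lsmul _ _ (α r) z) (σ.extR ξ w) := by
  induction w using induction_on with
  | zero => simp only [map_zero]
  | tmul t x =>
    rw [mapR_tmul, extR_tmul, extR_tmul]
    generalize σ.γ t = z
    induction z using induction_on with
    | zero => simp only [map_zero]
    | tmul t w =>
      induction w using induction_on with
      | zero => simp only [map_zero, tmul_zero]
      | tmul p y => rfl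
      | add x y hx hy => simp only [map_add, tmul_add, hx, hy]
    | add x y hx hy => simp only [map_add, hx, hy]
  | add x y hx hy => simp only [map_add, hx, hy]

/-- The unit law `(T ⊗ ev) γ(t) = t ⊗ 1` with a spectator `x`. -/
theorem mapR_evMapL_extR (w : BTensor α ξ T X) :
    mapR (φ := α) (ψ := α) α (d.evMapL (ξ := ξ)) (fun r z => d.evMapL_lsmul (α r) z)
      (σ.extR ξ w) = mapR (φ := α) (ψ := ξ) α (unitL α ξ) unitL_smul w := by
  induction w using induction_on with
  | zero => simp only [map_zero]
  | tmul t x =>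
    rw [extR_tmul, mapR_tmul, unitL_apply]
    have h := congrArg (mapR (φ := α) (ψ := α) α ((BTensor.mk α ξ).flip x) (fun _ _ => rfl))
      (σ.ev_γ t)
    refine Eq.trans ?_ h
    generalize σ.γ t = z
    induction z using induction_on with
    | zero => simp only [map_zero]
    | tmul t w =>
      induction w using induction_on with
      | zero => simp only [map_zero, tmul_zero]
      | tmul p y => rfl
      | add x y hx hy => simp only [map_add, tmul_add, hx, hy]
    | add x y hx hy => simp only [map_add, hx, hy]
  | add x y hx hy => simp only [map_add, hx, hy]

end Ext

/-- The descent datum `p ⊗ x ↦ p γ(x)` on `P ⊗_S T`. -/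
def datumR : RightDescentDatum α (BTensor β β P T) where
  δ := d.hatL σ.γ σ.γ_lsmul
  δ_smul := d.hatL_lsmul σ.γ σ.γ_lsmul
  coassoc z := by
    -- Coassociativity turns `(T ⊗ P ⊗ γ) γ` into `(γ ⊗ P ⊗ T) γ`; evaluating the middle legs then
    -- gives `1` by the unit law for `ev`. Multiplying by `p` yields the cocycle condition.
    have key : ∀ y, mapR (φ := α) (ψ := α) α (d.hatL σ.γ σ.γ_lsmul)
        (fun r => d.hatL_lsmul σ.γ σ.γ_lsmul (α r)) (σ.γ y) =
        mapR (φ := α) (ψ := α) α (unitL α α) unitL_smul (σ.γ y) := fun y => by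
      rw [← σ.mapR_evMapL_extR (ξ := α) (σ.γ y), extR_γ]
      exact (mapR_mapR _ _ _ _ _ _ (fun _ => rfl) _).symm
    induction z using induction_on with
    | zero => simp only [map_zero]
    | tmul p y => rw [FormalDual.hatL_tmul, ← d.evL_mapR, key, d.evL_mapR]
    | add x y hx hy => simp only [map_add, hx, hy]

/-- Since `γ` is right `R`-linear, `δ` is too, and so the coinvariants are stable under the right
action of `R` and form an `R`-bimodule. -/
theorem datumR_δ_rsmul (r : R) (z : BTensor β β P T) :
    σ.datumR.δ (op (α r) • z) = op (α r) • σ.datumR.δ z :=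
  d.hatL_rsmul (K := A) σ.γ σ.γ_lsmul (α r) (α r) (σ.γ_rsmul r) z

/-- The `R`-coring of the herd, as the coinvariants in `P ⊗_S T`. -/
abbrev CoringR : Type u := σ.datumR.Coinv

instance : Module Rᵐᵒᵖ σ.CoringR where
  smul r c := σ.datumR.toCoinv (op (α r.unop) • σ.datumR.incl c) (by
    rw [datumR_δ_rsmul, σ.datumR.δ_incl, unitL_apply, unitL_apply, rsmul_tmul])
  one_smul c := σ.datumR.incl_injective
    ((congrArg (op · • σ.datumR.incl c) (map_one α)).trans (one_smul _ _))
  mul_smul r s c := σ.datumR.incl_injective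
    ((congrArg (op · • σ.datumR.incl c) (map_mul α s.unop r.unop)).trans (mul_smul _ _ _))
  smul_zero r := σ.datumR.incl_injective ((congrArg (op (α r.unop) • ·) (map_zero σ.datumR.incl)).trans
    ((smul_zero _).trans (map_zero σ.datumR.incl).symm))
  smul_add r c c' := σ.datumR.incl_injective
    ((congrArg (op (α r.unop) • ·) (map_add σ.datumR.incl c c')).trans (smul_add _ _ _))
  add_smul r s c := σ.datumR.incl_injective
    ((congrArg (op · • σ.datumR.incl c) (map_add α r.unop s.unop)).trans (add_smul _ _ _))
  zero_smul c := σ.datumR.incl_injective ((congrArg (op · • σ.datumR.incl c) (map_zero α)).trans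
    ((zero_smul _ _).trans (map_zero σ.datumR.incl).symm))

instance : SMulCommClass R Rᵐᵒᵖ σ.CoringR where
  smul_comm r s c := σ.datumR.incl_injective (smul_comm (α r) (op (α s.unop)) (σ.datumR.incl c))

end Shepherd

end Herd

/-! ### Descent of `P ⊗_S T` and the coaction of `C` on `T` -/

section Herd

variable {R S A B : Type u} [Ring R] [Ring S] [Ring A] [Ring B] {α : R →+* A} {β : S →+* B}
  {T : Type u} [AddCommGroup T] [Module B T] [Module Aᵐᵒᵖ T] [SMulCommClass B Aᵐᵒᵖ T]
  {P : Type u} [AddCommGroup P] [Module A P] [Module Bᵐᵒᵖ P] [SMulCommClass A Bᵐᵒᵖ P]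
  {d : FormalDual α β T P}

namespace Shepherd

variable (σ : Shepherd d) (hα : RightDescent α)

/-- The inclusion `C → P ⊗_S T`. -/
def inclR : σ.CoringR →+ BTensor β β P T := σ.datumR.incl

theorem inclR_smul (r : R) (c : σ.CoringR) :
    σ.inclR (RingHom.id R r • c) = α r • σ.inclR c := rfl

theorem inclR_rsmul (r : R) (c : σ.CoringR) :
    σ.inclR (op r • c) = op (α r) • σ.inclR c := rfl

theorem mapR_inclR_injective (hα : RightDescent α) : Function.Injective
    (mapR (φ := α) (ψ := RingHom.id R) (M := A) α σ.inclR σ.inclR_smul) :=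
  hα.coinv_injective _ σ.datumR

/-- Coassociativity of the datum is exactly the condition under which descent lifts `δ z` to `A ⊗_R
C`. -/
theorem exists_descR (hα : RightDescent α) (z : BTensor β β P T) :
    ∃ v, mapR (φ := α) (ψ := RingHom.id R) (M := A) α σ.inclR σ.inclR_smul v = σ.datumR.δ z :=
  hα.coinv_exact _ σ.datumR _ (σ.datumR.coassoc z)

/-- The inverse `P ⊗_S T → A ⊗_R C` of the multiplication `a ⊗ c ↦ a c`. -/
noncomputable def descR : BTensor β β P T →+ BTensor α (RingHom.id R) A σ.CoringR :=
  AddMonoidHom.mk' (fun z => (σ.exists_descR hα z).choose) (fun z z' =>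
    σ.mapR_inclR_injective hα ((σ.exists_descR hα (z + z')).choose_spec.trans
      ((map_add _ z z').trans ((congrArg₂ _ (σ.exists_descR hα z).choose_spec
        (σ.exists_descR hα z').choose_spec).symm.trans (map_add _ _ _).symm))))

theorem mapR_inclR_descR (z : BTensor β β P T) :
    mapR (φ := α) (ψ := RingHom.id R) (M := A) α σ.inclR σ.inclR_smul (σ.descR hα z) =
      d.hatL σ.γ σ.γ_lsmul z :=
  (σ.exists_descR hα z).choose_spec

theorem hatL_γ_inclR (c : σ.CoringR) : d.hatL σ.γ σ.γ_lsmul (σ.inclR c) = tmul α α 1 (σ.inclR c) :=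
  σ.datumR.δ_incl c

/-- Identities for `descR` are checked after the injection of `A ⊗_R C` into `A ⊗_R (P ⊗_S T)`,
where `descR` becomes `δ`. The same device gives the two linearity statements that follow. -/
theorem descR_inclR (c : σ.CoringR) : σ.descR hα (σ.inclR c) = unitL α (RingHom.id R) c :=
  σ.mapR_inclR_injective hα (by rw [mapR_inclR_descR, hatL_γ_inclR, unitL_apply, mapR_tmul])

theorem descR_lsmul (a : A) (z : BTensor β β P T) : σ.descR hα (a • z) = a • σ.descR hα z :=
  σ.mapR_inclR_injective hα (by
    rw [mapR_lsmul, mapR_inclR_descR, mapR_inclR_descR, d.hatL_lsmul])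

theorem descR_rsmul (r : R) (z : BTensor β β P T) :
    σ.descR hα (op (α r) • z) = op r • σ.descR hα z :=
  σ.mapR_inclR_injective hα (by
    rw [mapR_rsmul _ _ r (α r) (σ.inclR_rsmul r), mapR_inclR_descR, mapR_inclR_descR]
    exact σ.datumR_δ_rsmul r z)

/-- `t ⊗ z ↦ t z ∈ T ⊗_R C` -/
noncomputable def projR : BTensor α α T (BTensor β β P T) →+ BTensor α (RingHom.id R) T σ.CoringR :=
  absorbL.comp (mapR (φ := α) (ψ := α) α (σ.descR hα) (fun r => σ.descR_lsmul hα (α r)))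

theorem projR_tmul (t : T) (z : BTensor β β P T) :
    σ.projR hα (tmul α α t z) = actL t (σ.descR hα z) := rfl

theorem projR_lsmul (b : B) (z : BTensor α α T (BTensor β β P T)) :
    σ.projR hα (b • z) = b • σ.projR hα z := by
  rw [projR, AddMonoidHom.comp_apply, AddMonoidHom.comp_apply, mapR_lsmul, absorbL_lsmul]

theorem projR_rsmul (r : R) (z : BTensor α α T (BTensor β β P T)) :
    σ.projR hα (op (α r) • z) = op r • σ.projR hα z :=
  (congrArg absorbL (mapR_rsmul _ _ (α r) r (σ.descR_rsmul hα r) z)).trans (absorbL_rsmul r _)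

/-- A coinvariant `c` descends to `1 ⊗ c`, so `projR` retracts the inclusion of `T ⊗_R C`. -/
theorem projR_mapR_inclR (w : BTensor α (RingHom.id R) T σ.CoringR) :
    σ.projR hα (mapR (φ := α) (ψ := RingHom.id R) α σ.inclR σ.inclR_smul w) = w := by
  induction w using induction_on with
  | zero => simp only [map_zero]
  | tmul t c => rw [mapR_tmul, projR_tmul, descR_inclR, unitL_apply, actL_one_tmul]
  | add x y hx hy => simp only [map_add, hx, hy]

/-- The coaction `T → T ⊗_R C`. -/
noncomputable def coactR : T →+ BTensor α (RingHom.id R) T σ.CoringR := (σ.projR hα).comp σ.γ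

theorem coactR_lsmul (s : S) (x : T) : σ.coactR hα (β s • x) = β s • σ.coactR hα x :=
  (congrArg (σ.projR hα) (σ.γ_lsmul s x)).trans (σ.projR_lsmul hα (β s) _)

theorem coactR_rsmul (r : R) (x : T) : σ.coactR hα (op (α r) • x) = op r • σ.coactR hα x :=
  (congrArg (σ.projR hα) (σ.γ_rsmul r x)).trans (σ.projR_rsmul hα r _)

/-- `γ` takes its values in `T ⊗_R C`. Projecting and including again amounts to applying `T ⊗ δ`
and absorbing the factor `A`, and this fixes `γ(x)` by `absorbL_mapR_hatL_γ`. -/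
theorem mapR_inclR_coactR (x : T) :
    mapR (φ := α) (ψ := RingHom.id R) α σ.inclR σ.inclR_smul (σ.coactR hα x) = σ.γ x := by
  rw [← σ.absorbL_mapR_hatL_γ σ.γ σ.γ_lsmul x]
  refine (absorbL_mapR σ.inclR σ.inclR_smul _).symm.trans (congrArg absorbL ?_)
  exact mapR_mapR _ _ _ _ _ _ (σ.mapR_inclR_descR hα) _

/-- The canonical map `P ⊗_S T → A ⊗_R C` of the coaction is the descent map. The Galois property
will follow from this. -/
theorem evL_coactR (p : P) (x : T) :
    d.evL p (σ.coactR hα x) = σ.descR hα (tmul β β p x) :=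
  σ.mapR_inclR_injective hα (by
    rw [← d.evL_mapR, mapR_inclR_coactR, mapR_inclR_descR, d.hatL_tmul])

theorem mapR_descR_γ (x : T) :
    mapR (φ := α) (ψ := α) α (σ.descR hα) (fun r => σ.descR_lsmul hα (α r)) (σ.γ x) =
      mapR (φ := α) (ψ := RingHom.id R) α (unitL α (RingHom.id R)) unitL_smul (σ.coactR hα x) := by
  rw [← σ.mapR_inclR_coactR hα x]
  exact mapR_mapR _ _ _ _ _ _ (σ.descR_inclR hα) _

/-! ### The universal property of the coaction -/

section Universal

variable {N : Type u} [AddCommGroup N] [Module R N]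

/-- Extend `f` to `P ⊗_S T` through `descR`. On `p ⊗ x` this extension is `p h(x)`, by `evL_coactR`;
on `C` it is `f`, because `c` descends to `1 ⊗ c`. -/
theorem hatL_absorbL_inclR (f : σ.CoringR →+ BTensor α (RingHom.id R) A N)
    (hf : ∀ r c, f (RingHom.id R r • c) = α r • f c)
    (h : T →+ BTensor α (RingHom.id R) T N) (hh : ∀ s x, h (β s • x) = β s • h x)
    (hfh : ∀ x, absorbL (mapR (φ := α) (ψ := RingHom.id R) α f hf (σ.coactR hα x)) = h x)
    (c : σ.CoringR) : d.hatL h hh (σ.inclR c) = f c := by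
  have key : ∀ z, d.hatL h hh z =
      absorbL (mapR (φ := α) (ψ := RingHom.id R) α f hf (σ.descR hα z)) := fun z => by
    induction z using induction_on with
    | zero => simp only [map_zero]
    | tmul p x =>
      rw [d.hatL_tmul, ← hfh, d.evL_absorbL, d.evL_mapR, evL_coactR]
    | add x y hx hy => simp only [map_add, hx, hy]
  rw [key, descR_inclR, unitL_apply, mapR_tmul, absorbL_tmul, actL_eq_smul, one_smul]

/-- Left `R`-linear maps `C → A ⊗_R N` are determined by the induced maps `T → T ⊗_R N`. -/
theorem coactR_hom_ext {f g : σ.CoringR →+ BTensor α (RingHom.id R) A N}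
    (hf : ∀ r c, f (RingHom.id R r • c) = α r • f c)
    (hg : ∀ r c, g (RingHom.id R r • c) = α r • g c)
    (h : ∀ x, absorbL (mapR (φ := α) (ψ := RingHom.id R) α f hf (σ.coactR hα x)) =
      absorbL (mapR (φ := α) (ψ := RingHom.id R) α g hg (σ.coactR hα x))) (c : σ.CoringR) :
    f c = g c := by
  have hh : ∀ s x, (absorbL.comp ((mapR (φ := α) (ψ := RingHom.id R) α g hg).comp
      (σ.coactR hα))) (β s • x) = β s • (absorbL.comp ((mapR (φ := α) (ψ := RingHom.id R) α g
        hg).comp (σ.coactR hα))) x := fun s x => by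
    simp only [AddMonoidHom.comp_apply]
    rw [coactR_lsmul, mapR_lsmul, absorbL_lsmul]
  rw [← σ.hatL_absorbL_inclR hα f hf _ hh h, ← σ.hatL_absorbL_inclR hα g hg _ hh (fun _ => rfl)]

theorem absorbL_mapR_unitL_coactR (φ : σ.CoringR →+ N)
    (hφ : ∀ r c, φ (RingHom.id R r • c) = RingHom.id R r • φ c)
    (h : ∀ r c, ((unitL α (RingHom.id R)).comp φ) (RingHom.id R r • c) =
      α r • ((unitL α (RingHom.id R)).comp φ) c)
    (w : BTensor α (RingHom.id R) T σ.CoringR) :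
    absorbL (mapR (φ := α) (ψ := RingHom.id R) α ((unitL α (RingHom.id R)).comp φ) h w) =
      mapR (φ := α) (ψ := RingHom.id R) (RingHom.id R) φ hφ w := by
  induction w using induction_on with
  | zero => simp only [map_zero]
  | tmul t c =>
    rw [mapR_tmul, absorbL_tmul, AddMonoidHom.comp_apply, unitL_apply, actL_one_tmul, mapR_tmul]
  | add x y hx hy => simp only [map_add, hx, hy]

/-- Left `R`-linear maps `C → N` are determined by the induced maps `T → T ⊗_R N`. -/
theorem coactR_hom_ext' {f g : σ.CoringR →+ N}
    (hf : ∀ r c, f (RingHom.id R r • c) = RingHom.id R r • f c)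
    (hg : ∀ r c, g (RingHom.id R r • c) = RingHom.id R r • g c)
    (h : ∀ x, mapR (φ := α) (ψ := RingHom.id R) (RingHom.id R) f hf (σ.coactR hα x) =
      mapR (φ := α) (ψ := RingHom.id R) (RingHom.id R) g hg (σ.coactR hα x)) (c : σ.CoringR) :
    f c = g c := by
  have hf' : ∀ r c, ((unitL α (RingHom.id R)).comp f) (RingHom.id R r • c) =
      α r • ((unitL α (RingHom.id R)).comp f) c := fun r c => by
    rw [AddMonoidHom.comp_apply, AddMonoidHom.comp_apply, hf, unitL_smul]
  have hg' : ∀ r c, ((unitL α (RingHom.id R)).comp g) (RingHom.id R r • c) =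
      α r • ((unitL α (RingHom.id R)).comp g) c := fun r c => by
    rw [AddMonoidHom.comp_apply, AddMonoidHom.comp_apply, hg, unitL_smul]
  refine hα.unit_injective N (σ.coactR_hom_ext hα hf' hg' (fun x => ?_) c)
  rw [absorbL_mapR_unitL_coactR σ f hf, absorbL_mapR_unitL_coactR σ g hg, h]

/-- The existence half: restricting `p ⊗ x ↦ p h(x)` to `C` gives a map that induces `h`. -/
theorem absorbL_mapR_hatL_inclR (h : T →+ BTensor α (RingHom.id R) T N)
    (hh : ∀ s x, h (β s • x) = β s • h x)
    (hf : ∀ r c, ((d.hatL h hh).comp σ.inclR) (RingHom.id R r • c) =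
      α r • ((d.hatL h hh).comp σ.inclR) c) (x : T) :
    absorbL (mapR (φ := α) (ψ := RingHom.id R) α ((d.hatL h hh).comp σ.inclR) hf
      (σ.coactR hα x)) = h x := by
  rw [← σ.absorbL_mapR_hatL_γ h hh x, ← σ.mapR_inclR_coactR hα x]
  exact congrArg absorbL (mapR_mapR _ _ _ _ _ _ (fun _ => rfl) _).symm

/-- A left `S`-linear map `T → T ⊗_R N` that is compatible with the descent data is induced by
a left `R`-linear map `C → N`. -/
theorem exists_coactR_hom (h : T →+ BTensor α (RingHom.id R) T N)
    (hh : ∀ s x, h (β s • x) = β s • h x)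
    (hK : ∀ x, mapR (φ := α) (ψ := α) α (d.hatL h hh) (fun r => d.hatL_lsmul h hh (α r)) (σ.γ x) =
      mapR (φ := α) (ψ := RingHom.id R) α (unitL α (RingHom.id R)) unitL_smul (h x)) :
    ∃ (φ : σ.CoringR →+ N) (hφ : ∀ r c, φ (RingHom.id R r • c) = RingHom.id R r • φ c),
      ∀ x, mapR (φ := α) (ψ := RingHom.id R) (RingHom.id R) φ hφ (σ.coactR hα x) = h x := by
  -- The compatibility `hK` lives on `T`; multiplying by `p ∈ P` carries it over to `P ⊗_S T`.
  have key : ∀ z, mapR (φ := α) (ψ := RingHom.id R) α (unitL α (RingHom.id R)) unitL_smul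
      (d.hatL h hh z) = mapR (φ := α) (ψ := α) α (d.hatL h hh)
        (fun r => d.hatL_lsmul h hh (α r)) (d.hatL σ.γ σ.γ_lsmul z) := fun z => by
    induction z using induction_on with
    | zero => simp only [map_zero]
    | tmul p x => rw [d.hatL_tmul, d.hatL_tmul, ← d.evL_mapR, ← d.evL_mapR, hK]
    | add x y hx hy => simp only [map_add, hx, hy]
  -- For `c ∈ C` one has `δ c = 1 ⊗ c`, so `key` says that the value at `c` satisfies the Amitsur
  -- condition and comes from `N`.
  have ex : ∀ c, ∃ n, unitL α (RingHom.id R) n = d.hatL h hh (σ.inclR c) := fun c =>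
    hα.unit_exact N _ (by rw [key, hatL_γ_inclR, mapR_tmul, unitL_apply])
  choose f hf using ex
  have hadd : ∀ c c', f (c + c') = f c + f c' := fun c c' =>
    hα.unit_injective N (by rw [map_add, hf, hf, hf, map_add, map_add])
  obtain ⟨φ, hφ⟩ : ∃ φ : σ.CoringR →+ N, ∀ c, unitL α (RingHom.id R) (φ c) =
    d.hatL h hh (σ.inclR c) := ⟨AddMonoidHom.mk' f hadd, hf⟩
  have hsmul : ∀ r c, φ (RingHom.id R r • c) = RingHom.id R r • φ c := fun r c =>
    hα.unit_injective N (by rw [unitL_smul, hφ, hφ, inclR_smul, d.hatL_lsmul])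
  have hcomp : (unitL α (RingHom.id R)).comp φ = (d.hatL h hh).comp σ.inclR :=
    AddMonoidHom.ext hφ
  have hlin : ∀ r c, ((d.hatL h hh).comp σ.inclR) (RingHom.id R r • c) =
      α r • ((d.hatL h hh).comp σ.inclR) c := fun r c => by
    rw [AddMonoidHom.comp_apply, AddMonoidHom.comp_apply, inclR_smul, d.hatL_lsmul]
  refine ⟨φ, hsmul, fun x => ?_⟩
  rw [← σ.absorbL_mapR_hatL_inclR hα h hh hlin, ← absorbL_mapR_unitL_coactR σ φ hsmul
    (fun r c => by rw [hcomp, hlin])]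
  exact congrArg absorbL (mapR_congr hφ _)

end Universal

end Shepherd

end Herd

/-! ### Counit and coproduct of `C` -/

section Herd

variable {R S A B : Type u} [Ring R] [Ring S] [Ring A] [Ring B] {α : R →+* A} {β : S →+* B}
  {T : Type u} [AddCommGroup T] [Module B T] [Module Aᵐᵒᵖ T] [SMulCommClass B Aᵐᵒᵖ T]
  {P : Type u} [AddCommGroup P] [Module A P] [Module Bᵐᵒᵖ P] [SMulCommClass A Bᵐᵒᵖ P]
  {d : FormalDual α β T P}

namespace Shepherd

variable (σ : Shepherd d) (hα : RightDescent α)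

/-- The map on `T` is `x ↦ x ⊗ 1`. Its compatibility with the descent data is the unit law `(T ⊗ ev)
γ(x) = x ⊗ 1`. -/
theorem exists_counitR : ∃ (ε : σ.CoringR →+ R)
    (hε : ∀ r c, ε (RingHom.id R r • c) = RingHom.id R r • ε c),
      ∀ x, mapR (φ := α) (ψ := RingHom.id R) (RingHom.id R) ε hε (σ.coactR hα x) =
        tmul α (RingHom.id R) x 1 := by
  refine σ.exists_coactR_hom hα (N := R) (unitR α (RingHom.id R)) (fun s x => rfl) fun x => ?_
  have h := congrArg (mapR (φ := α) (ψ := α) (M := T) α (unitR α (RingHom.id R) : A →+ _)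
    (fun r a => rfl)) (σ.ev_γ x)
  refine Eq.trans ?_ h
  generalize σ.γ x = z
  induction z using induction_on with
  | zero => simp only [map_zero]
  | tmul t w =>
    induction w using induction_on with
    | zero => simp only [map_zero, tmul_zero]
    | tmul p y => rfl
    | add x y hx hy => simp only [map_add, tmul_add, hx, hy]
  | add x y hx hy => simp only [map_add, hx, hy]

/-- The projection cancels the inclusion of `C` in the last legs, so `γ ⊗ C` can be computed inside
`γ ⊗ P ⊗ T`. -/
theorem mapR_projR_extR (w : BTensor α (RingHom.id R) T σ.CoringR) :
    mapR (φ := α) (ψ := α) α (mapR (φ := β) (ψ := β) β (σ.projR hα)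
      (fun s => σ.projR_lsmul hα (β s))) (fun r z => mapR_lsmul _ _ (α r) z)
      (σ.extR α (mapR (φ := α) (ψ := RingHom.id R) α σ.inclR σ.inclR_smul w)) =
    σ.extR (RingHom.id R) w := by
  rw [extR_mapR]
  generalize σ.extR (RingHom.id R) w = z
  have key : ∀ v : BTensor β β P (BTensor α (RingHom.id R) T σ.CoringR),
      mapR (φ := β) (ψ := β) β (σ.projR hα) (fun s => σ.projR_lsmul hα (β s))
        (mapR (φ := β) (ψ := β) β (mapR (φ := α) (ψ := RingHom.id R) α σ.inclR σ.inclR_smul)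
          (fun s z => mapR_lsmul _ _ (β s) z) v) = v := fun v => by
    induction v using induction_on with
    | zero => rw [map_zero, map_zero]
    | tmul p y => rw [mapR_tmul, mapR_tmul, projR_mapR_inclR]
    | add x y hx hy => rw [map_add, map_add, hx, hy]
  induction z using induction_on with
  | zero => rw [map_zero, map_zero]
  | tmul t w => rw [mapR_tmul, mapR_tmul, key]
  | add x y hx hy => rw [map_add, map_add, hx, hy]

/-- Coassociativity of `γ`, projected on the last legs: `(γ ⊗ C) ρ = (T ⊗ P ⊗ ρ) γ`. -/
theorem extR_coactR (x : T) : σ.extR (RingHom.id R) (σ.coactR hα x) =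
    mapR (φ := α) (ψ := α) α (mapR (φ := β) (ψ := β) β (σ.coactR hα) (σ.coactR_lsmul hα))
      (fun r z => mapR_lsmul _ _ (α r) z) (σ.γ x) := by
  rw [← σ.mapR_projR_extR hα (σ.coactR hα x), mapR_inclR_coactR, extR_γ]
  exact mapR_mapR _ _ _ _ _ _ (fun z => mapR_mapR _ _ _ _ _ _ (fun _ => rfl) z) _

/-- The map `T ⊗_R X → T ⊗_R (C ⊗_R X)` induced by the coaction. -/
noncomputable def coactExtR {Q X : Type u} [Ring Q] [AddCommGroup X] [Module Q X] (ξ : R →+* Q) :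
    BTensor α ξ T X →+ BTensor α (RingHom.id R) T (BTensor (RingHom.id R) ξ σ.CoringR X) :=
  BimodHerd.coactExtR (σ.coactR hα) (σ.coactR_rsmul hα) ξ

theorem coactExtR_tmul {Q X : Type u} [Ring Q] [AddCommGroup X] [Module Q X] (ξ : R →+* Q)
    (t : T) (x : X) : σ.coactExtR hα ξ (tmul α ξ t x) = insR α ξ x (σ.coactR hα t) := rfl

theorem coactExtR_lsmul {Q X : Type u} [Ring Q] [AddCommGroup X] [Module Q X] (ξ : R →+* Q)
    (s : S) (z : BTensor α ξ T X) :
    σ.coactExtR hα ξ (β s • z) = β s • σ.coactExtR hα ξ z :=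
  BimodHerd.coactExtR_lsmul (B := B) (σ.coactR hα) (σ.coactR_rsmul hα) (β s)
    (fun x => σ.coactR_lsmul hα s x) z

/-- The map `P ⊗_S (T ⊗_R C) → A ⊗_R (C ⊗_R C)` induced by the coaction. -/
noncomputable def evCoactExtR : BTensor β β P (BTensor α (RingHom.id R) T σ.CoringR) →+
    BTensor α (RingHom.id R) A (BTensor (RingHom.id R) (RingHom.id R) σ.CoringR σ.CoringR) :=
  (d.evMapL (ξ := RingHom.id R)).comp (mapR (φ := β) (ψ := β) β (σ.coactExtR hα (RingHom.id R))
    (σ.coactExtR_lsmul hα (RingHom.id R)))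

theorem evCoactExtR_lsmul (a : A) (z : BTensor β β P (BTensor α (RingHom.id R) T σ.CoringR)) :
    σ.evCoactExtR hα (a • z) = a • σ.evCoactExtR hα z := by
  rw [evCoactExtR, AddMonoidHom.comp_apply, mapR_lsmul, d.evMapL_lsmul, AddMonoidHom.comp_apply]

/-- By `evL_coactR` the middle legs `p ⊗ y` become `descR (p ⊗ y)`, so this is `mapR_descR_γ` with a
spectator in `C`. -/
theorem mapR_evCoactExtR_extR (w : BTensor α (RingHom.id R) T σ.CoringR) :
    mapR (φ := α) (ψ := α) α (σ.evCoactExtR hα) (fun r => σ.evCoactExtR_lsmul hα (α r))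
      (σ.extR (RingHom.id R) w) =
    mapR (φ := α) (ψ := RingHom.id R) α (unitL α (RingHom.id R)) unitL_smul
      (σ.coactExtR hα (RingHom.id R) w) := by
  induction w using induction_on with
  | zero => simp only [map_zero]
  | tmul t c =>
    rw [extR_tmul, coactExtR_tmul]
    have h := congrArg (mapR (φ := α) (ψ := α) α (insR (M := A) α (RingHom.id R) c)
      (fun r z => mapR_lsmul _ _ (α r) z)) (σ.mapR_descR_γ hα t)
    refine Eq.trans ?_ (h.trans ?_)
    · generalize σ.γ t = z
      induction z using induction_on with
      | zero => simp only [map_zero]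
      | tmul t w =>
        induction w using induction_on with
        | zero => simp only [map_zero, tmul_zero]
        | tmul p y =>
          rw [mapR_tmul, ← evL_coactR]
          change tmul α α t (d.evL p (insR α (RingHom.id R) c (σ.coactR hα y))) = _
          exact congrArg (tmul α α t) (d.evL_mapR _ _ _ _)
        | add x y hx hy => simp only [map_add, tmul_add, hx, hy]
      | add x y hx hy => simp only [map_add, hx, hy]
    · generalize σ.coactR hα t = z
      induction z using induction_on with
      | zero => simp only [map_zero]
      | tmul t w => rfl
      | add x y hx hy => simp only [map_add, hx, hy]
  | add x y hx hy => simp only [map_add, hx, hy]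

/-- The map on `T` is `(ρ ⊗ C) ρ`. Its compatibility with the descent data combines `extR_coactR`
and `mapR_evCoactExtR_extR`. -/
theorem exists_comulR :
    ∃ (Δ : σ.CoringR →+ BTensor (RingHom.id R) (RingHom.id R) σ.CoringR σ.CoringR)
      (hΔ : ∀ r c, Δ (RingHom.id R r • c) = RingHom.id R r • Δ c),
      ∀ x, mapR (φ := α) (ψ := RingHom.id R) (RingHom.id R) Δ hΔ (σ.coactR hα x) =
        σ.coactExtR hα (RingHom.id R) (σ.coactR hα x) := by
  refine σ.exists_coactR_hom hα ((σ.coactExtR hα (RingHom.id R)).comp (σ.coactR hα))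
    (fun s x => ?_) fun x => ?_
  · exact (congrArg (σ.coactExtR hα (RingHom.id R)) (σ.coactR_lsmul hα s x)).trans
      (σ.coactExtR_lsmul hα (RingHom.id R) s _)
  · rw [AddMonoidHom.comp_apply, ← mapR_evCoactExtR_extR, extR_coactR]
    refine (mapR_mapR _ _ _ _ _ _ (fun z => ?_) _).symm
    exact congrArg d.evMapL (mapR_mapR _ _ _ _ _ _ (fun _ => rfl) z)

noncomputable def counitR : σ.CoringR →+ R := (σ.exists_counitR hα).choose

theorem counitR_lsmul (r : R) (c : σ.CoringR) :
    σ.counitR hα (r • c) = r • σ.counitR hα c :=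
  (σ.exists_counitR hα).choose_spec.choose r c

theorem mapR_counitR (x : T) : mapR (φ := α) (ψ := RingHom.id R) (RingHom.id R) (σ.counitR hα)
    (σ.counitR_lsmul hα) (σ.coactR hα x) = tmul α (RingHom.id R) x 1 :=
  (σ.exists_counitR hα).choose_spec.choose_spec x

noncomputable def comulR :
    σ.CoringR →+ BTensor (RingHom.id R) (RingHom.id R) σ.CoringR σ.CoringR :=
  (σ.exists_comulR hα).choose

theorem comulR_lsmul (r : R) (c : σ.CoringR) :
    σ.comulR hα (r • c) = r • σ.comulR hα c :=
  (σ.exists_comulR hα).choose_spec.choose r c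

theorem mapR_comulR (x : T) : mapR (φ := α) (ψ := RingHom.id R) (RingHom.id R) (σ.comulR hα)
    (σ.comulR_lsmul hα) (σ.coactR hα x) = σ.coactExtR hα (RingHom.id R) (σ.coactR hα x) :=
  (σ.exists_comulR hα).choose_spec.choose_spec x

/-- A map `C → N` that is right `R`-linear after the coaction of `T` is right `R`-linear. -/
theorem map_rsmul_of_coactR {N : Type u} [AddCommGroup N] [Module R N] [Module Rᵐᵒᵖ N]
    [SMulCommClass R Rᵐᵒᵖ N] {f : σ.CoringR →+ N}
    (hf : ∀ r c, f (RingHom.id R r • c) = RingHom.id R r • f c) (r : R)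
    (h : ∀ x, mapR (φ := α) (ψ := RingHom.id R) (RingHom.id R) f hf (σ.coactR hα (op (α r) • x)) =
      op r • mapR (φ := α) (ψ := RingHom.id R) (RingHom.id R) f hf (σ.coactR hα x))
    (c : σ.CoringR) : f (op r • c) = op r • f c := by
  -- Both `c ↦ f(c r)` and `c ↦ f(c) r` are left `R`-linear, so they can be compared on `T`.
  have hf1 : ∀ s c, (f.comp (DistribSMul.toAddMonoidHom σ.CoringR (op r))) (RingHom.id R s • c) =
      RingHom.id R s • (f.comp (DistribSMul.toAddMonoidHom σ.CoringR (op r))) c := fun s c =>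
    (congrArg f (smul_comm s (op r) c).symm).trans (hf s _)
  have hf2 : ∀ s c, ((DistribSMul.toAddMonoidHom N (op r)).comp f) (RingHom.id R s • c) =
      RingHom.id R s • ((DistribSMul.toAddMonoidHom N (op r)).comp f) c := fun s c =>
    (congrArg (op r • ·) (hf s c)).trans (smul_comm s (op r) _).symm
  refine σ.coactR_hom_ext' hα hf1 hf2 (fun x => ?_) c
  have h1 : ∀ w : BTensor α (RingHom.id R) T σ.CoringR, mapR (φ := α) (ψ := RingHom.id R)
      (RingHom.id R) (f.comp (DistribSMul.toAddMonoidHom σ.CoringR (op r))) hf1 w =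
        mapR (φ := α) (ψ := RingHom.id R) (RingHom.id R) f hf (op r • w) := fun w => by
    induction w using induction_on with
    | zero => rw [smul_zero, map_zero, map_zero]
    | tmul t c => rw [rsmul_tmul, mapR_tmul, mapR_tmul]; rfl
    | add x y hx hy => rw [smul_add, map_add, map_add, hx, hy]
  have h2 : ∀ w : BTensor α (RingHom.id R) T σ.CoringR, mapR (φ := α) (ψ := RingHom.id R)
      (RingHom.id R) ((DistribSMul.toAddMonoidHom N (op r)).comp f) hf2 w =
        op r • mapR (φ := α) (ψ := RingHom.id R) (RingHom.id R) f hf w := fun w => by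
    induction w using induction_on with
    | zero => rw [map_zero, map_zero, smul_zero]
    | tmul t c => rw [mapR_tmul, mapR_tmul, rsmul_tmul]; rfl
    | add x y hx hy => rw [map_add, map_add, smul_add, hx, hy]
  rw [h1, h2, ← h, coactR_rsmul]

theorem counitR_rsmul (r : R) (c : σ.CoringR) :
    σ.counitR hα (op r • c) = op r • σ.counitR hα c := by
  refine σ.map_rsmul_of_coactR hα (σ.counitR_lsmul hα) r (fun x => ?_) c
  have h := smul_tmul α (RingHom.id R) r x (1 : R)
  refine (σ.mapR_counitR hα _).trans (h.trans ?_)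
  rw [σ.mapR_counitR hα x, rsmul_tmul, smul_eq_mul, op_smul_eq_mul, mul_one, one_mul,
    RingHom.id_apply]

theorem comulR_rsmul (r : R) (c : σ.CoringR) :
    σ.comulR hα (op r • c) = op r • σ.comulR hα c := by
  refine σ.map_rsmul_of_coactR hα (σ.comulR_lsmul hα) r (fun x => ?_) c
  refine (σ.mapR_comulR hα _).trans ?_
  rw [σ.mapR_comulR hα x, coactR_rsmul]
  exact BimodHerd.coactExtR_rsmul (σ.coactR hα) (σ.coactR_rsmul hα) r _

end Shepherd

end Herd

/-! ### Absorbing twice -/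

namespace BTensor

section Absorb

variable {R P Q Q' : Type*} [Ring R] [Ring P] [Ring Q] [Ring Q'] {φ : R →+* P} {ψ : R →+* Q}
  {ψ' : R →+* Q'} {M N N' : Type*} [AddCommGroup M] [AddCommGroup N] [AddCommGroup N']
  [Module Pᵐᵒᵖ M] [Module Q N] [Module Q' N']

theorem absorbL_actL (m : M) (z : BTensor φ φ P (BTensor φ ψ P N)) :
    absorbL (actL m z) = actL m (absorbL z) := by
  induction z using induction_on with
  | zero => simp only [map_zero]
  | tmul p n => rw [absorbL_tmul, actL_tmul, absorbL_tmul, actL_eq_smul, actL_smul]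
  | add x y hx hy => simp only [map_add, hx, hy]

/-- Associativity of Kleisli composition for `A ⊗_R -`: linear maps `N → A ⊗_R N'` compose by
extending and absorbing. It computes the map that a composite of two entwining maps induces on `T`.
-/
theorem absorbL_mapR_absorbL (F : N →+ BTensor φ ψ' P N')
    (hF : ∀ r n, F (ψ r • n) = φ r • F n) (G : BTensor φ ψ P N →+ BTensor φ ψ' P N')
    (hG : ∀ r w, G (φ r • w) = φ r • G w)
    (h : ∀ w, absorbL (mapR (φ := φ) (ψ := ψ) φ F hF w) = G w)
    (z : BTensor φ φ M (BTensor φ ψ P N)) :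
    absorbL (mapR (φ := φ) (ψ := ψ) φ F hF (absorbL z)) =
      absorbL (mapR (φ := φ) (ψ := φ) φ G hG z) := by
  induction z using induction_on with
  | zero => simp only [map_zero]
  | tmul m w => rw [absorbL_tmul, mapR_actL, absorbL_actL, h, mapR_tmul, absorbL_tmul]
  | add x y hx hy => simp only [map_add, hx, hy]

theorem mapR_id (z : BTensor φ ψ M N) {h : ∀ (r : R) (n : N), AddMonoidHom.id N (ψ r • n) =
    ψ r • AddMonoidHom.id N n} : mapR (φ := φ) (ψ := ψ) ψ (AddMonoidHom.id N) h z = z := by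
  induction z using induction_on with
  | zero => rw [map_zero]
  | tmul m n => rfl
  | add x y hx hy => rw [map_add, hx, hy]

end Absorb

end BTensor

/-! ### The coring axioms for `C` -/

section Herd

variable {R S A B : Type u} [Ring R] [Ring S] [Ring A] [Ring B] {α : R →+* A} {β : S →+* B}
  {T : Type u} [AddCommGroup T] [Module B T] [Module Aᵐᵒᵖ T] [SMulCommClass B Aᵐᵒᵖ T]
  {P : Type u} [AddCommGroup P] [Module A P] [Module Bᵐᵒᵖ P] [SMulCommClass A Bᵐᵒᵖ P]
  {d : FormalDual α β T P}

namespace Shepherd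

variable (σ : Shepherd d) (hα : RightDescent α)

/-- `c ⊗ c' ↦ Δ(c) ⊗ c'` -/
noncomputable def comulExtR : BTensor (RingHom.id R) (RingHom.id R) σ.CoringR σ.CoringR →+
    BTensor (RingHom.id R) (RingHom.id R) σ.CoringR
      (BTensor (RingHom.id R) (RingHom.id R) σ.CoringR σ.CoringR) :=
  (assoc (φ₁ := RingHom.id R) (ψ₁ := RingHom.id R) (φ₂ := RingHom.id R)
    (ψ₂ := RingHom.id R)).toAddMonoidHom.comp
    (mapL (φ := RingHom.id R) (ψ := RingHom.id R) (RingHom.id R) (σ.comulR hα)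
      (σ.comulR_rsmul hα))

theorem comulExtR_tmul (c c' : σ.CoringR) : σ.comulExtR hα (tmul _ _ c c') =
    assocAux (RingHom.id R) (RingHom.id R) (RingHom.id R) (RingHom.id R) c' (σ.comulR hα c) := by
  rw [comulExtR, AddMonoidHom.comp_apply, mapL_tmul]
  generalize σ.comulR hα c = z
  induction z using induction_on with
  | zero => rw [zero_tmul, map_zero, map_zero]
  | tmul t w => rfl
  | add x y hx hy => rw [add_tmul, map_add, map_add, hx, hy]

theorem comulExtR_lsmul (r : R) (z : BTensor (RingHom.id R) (RingHom.id R) σ.CoringR σ.CoringR) :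
    σ.comulExtR hα (RingHom.id R r • z) = RingHom.id R r • σ.comulExtR hα z := by
  induction z using induction_on with
  | zero => rw [smul_zero, map_zero, smul_zero]
  | tmul c c' =>
    rw [lsmul_tmul, comulExtR_tmul, comulExtR_tmul, RingHom.id_apply, comulR_lsmul]
    exact mapR_lsmul _ _ r _
  | add x y hx hy => rw [smul_add, map_add, map_add, smul_add, hx, hy]

/-- Applying the coproduct to the first copy of `C` is coacting twice, since `Δ` was defined by that
property on `T`; the last leg is a spectator. -/
theorem mapR_comulExtR_coactExtR (w : BTensor α (RingHom.id R) T σ.CoringR) :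
    mapR (φ := α) (ψ := RingHom.id R) (RingHom.id R) (σ.comulExtR hα) (σ.comulExtR_lsmul hα)
      (σ.coactExtR hα (RingHom.id R) w) =
    σ.coactExtR hα (RingHom.id R) (σ.coactExtR hα (RingHom.id R) w) := by
  induction w using induction_on with
  | zero => rw [map_zero, map_zero, map_zero]
  | tmul t c =>
    rw [coactExtR_tmul]
    refine Eq.trans ?_ (BimodHerd.coactExtR_insR (σ.coactR hα) (σ.coactR_rsmul hα) c _).symm
    refine Eq.trans ?_ (congrArg _ (σ.mapR_comulR hα t))
    generalize σ.coactR hα t = z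
    induction z using induction_on with
    | zero => simp only [map_zero]
    | tmul t c' => exact congrArg (tmul _ _ t) (σ.comulExtR_tmul hα c' c)
    | add x y hx hy => simp only [map_add, hx, hy]
  | add x y hx hy => rw [map_add, map_add, map_add, hx, hy]

/-- Both sides are left `R`-linear maps out of `C`, and both induce on `T` the threefold iterated
coaction. -/
theorem coassocR (c : σ.CoringR) : assoc (mapL (φ := RingHom.id R) (ψ := RingHom.id R)
    (RingHom.id R) (σ.comulR hα) (σ.comulR_rsmul hα) (σ.comulR hα c)) =
      mapR (φ := RingHom.id R) (ψ := RingHom.id R) (RingHom.id R) (σ.comulR hα)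
        (σ.comulR_lsmul hα) (σ.comulR hα c) := by
  have hl : ∀ r c, ((σ.comulExtR hα).comp (σ.comulR hα)) (RingHom.id R r • c) =
      RingHom.id R r • ((σ.comulExtR hα).comp (σ.comulR hα)) c := fun r c =>
    (congrArg (σ.comulExtR hα) (σ.comulR_lsmul hα r c)).trans (σ.comulExtR_lsmul hα r _)
  have hm : ∀ r z, mapR (φ := RingHom.id R) (ψ := RingHom.id R) (M := σ.CoringR) (RingHom.id R)
      (σ.comulR hα) (σ.comulR_lsmul hα) (RingHom.id R r • z) = RingHom.id R r •
        mapR (φ := RingHom.id R) (ψ := RingHom.id R) (RingHom.id R)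
      (σ.comulR hα) (σ.comulR_lsmul hα) z := fun r z => mapR_lsmul _ _ r z
  have hr : ∀ r c, ((mapR (φ := RingHom.id R) (ψ := RingHom.id R) (RingHom.id R) (σ.comulR hα)
        (σ.comulR_lsmul hα)).comp (σ.comulR hα)) (RingHom.id R r • c) =
      RingHom.id R r • ((mapR (φ := RingHom.id R) (ψ := RingHom.id R) (RingHom.id R) (σ.comulR hα)
        (σ.comulR_lsmul hα)).comp (σ.comulR hα)) c := fun r c =>
    (congrArg _ (σ.comulR_lsmul hα r c)).trans (hm r _)
  refine σ.coactR_hom_ext' hα hl hr (fun x => ?_) c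
  rw [← mapR_mapR (σ.comulR hα) (σ.comulR_lsmul hα) (σ.comulExtR hα) (σ.comulExtR_lsmul hα) _ hl
    (fun _ => rfl), mapR_comulR, mapR_comulExtR_coactExtR]
  rw [← mapR_mapR (σ.comulR hα) (σ.comulR_lsmul hα) _ hm _ hr (fun _ => rfl), mapR_comulR]
  refine (congrArg (σ.coactExtR hα (RingHom.id R)) (σ.mapR_comulR hα x).symm).trans ?_
  exact BimodHerd.coactExtR_mapR (ξ := RingHom.id R) (ξ' := RingHom.id R) (σ.coactR hα)
    (σ.coactR_rsmul hα) (σ.comulR hα) (σ.comulR_lsmul hα) _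

/-- `c ⊗ c' ↦ ε(c) c'` -/
noncomputable def counitMulR : BTensor (RingHom.id R) (RingHom.id R) σ.CoringR σ.CoringR →+
    σ.CoringR :=
  (lact (φ := RingHom.id R) (ψ := RingHom.id R) (RingHom.id R) (fun _ => rfl)).comp
    (mapL (φ := RingHom.id R) (ψ := RingHom.id R) (RingHom.id R) (σ.counitR hα)
      (σ.counitR_rsmul hα))

theorem counitMulR_tmul (c c' : σ.CoringR) :
    σ.counitMulR hα (tmul _ _ c c') = σ.counitR hα c • c' := rfl

theorem counitMulR_lsmul (r : R) (z : BTensor (RingHom.id R) (RingHom.id R) σ.CoringR σ.CoringR) :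
    σ.counitMulR hα (RingHom.id R r • z) = RingHom.id R r • σ.counitMulR hα z := by
  induction z using induction_on with
  | zero => rw [smul_zero, map_zero, smul_zero]
  | tmul c c' =>
    rw [lsmul_tmul, counitMulR_tmul, counitMulR_tmul, RingHom.id_apply, counitR_lsmul,
      smul_eq_mul, mul_smul]
  | add x y hx hy => rw [smul_add, map_add, map_add, smul_add, hx, hy]

/-- `(T ⊗ ε) ρ(t) = t ⊗ 1` with a spectator in `C`. -/
theorem mapR_counitMulR_coactExtR (w : BTensor α (RingHom.id R) T σ.CoringR) :
    mapR (φ := α) (ψ := RingHom.id R) (RingHom.id R) (σ.counitMulR hα) (σ.counitMulR_lsmul hα)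
      (σ.coactExtR hα (RingHom.id R) w) = w := by
  induction w using induction_on with
  | zero => rw [map_zero, map_zero]
  | tmul t c =>
    rw [coactExtR_tmul, ← actR_tmul_one (φ := α) (ψ := RingHom.id R) t c, ← σ.mapR_counitR hα t]
    generalize σ.coactR hα t = z
    induction z using induction_on with
    | zero => simp only [map_zero]
    | tmul t c' => rfl
    | add x y hx hy => simp only [map_add, hx, hy]
  | add x y hx hy => rw [map_add, map_add, hx, hy]

/-- Both sides are maps `C → C` that induce `ρ` on `T`; the same holds for the right counit law
below. -/
theorem lcounitR (c : σ.CoringR) : lact (φ := RingHom.id R) (ψ := RingHom.id R) (RingHom.id R)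
    (fun _ => rfl) (mapL (φ := RingHom.id R) (ψ := RingHom.id R) (RingHom.id R) (σ.counitR hα)
      (σ.counitR_rsmul hα) (σ.comulR hα c)) = c := by
  have hl : ∀ r c, ((σ.counitMulR hα).comp (σ.comulR hα)) (RingHom.id R r • c) =
      RingHom.id R r • ((σ.counitMulR hα).comp (σ.comulR hα)) c := fun r c =>
    (congrArg (σ.counitMulR hα) (σ.comulR_lsmul hα r c)).trans (σ.counitMulR_lsmul hα r _)
  refine σ.coactR_hom_ext' hα (g := AddMonoidHom.id _) hl (fun _ _ => rfl) (fun x => ?_) c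
  rw [← mapR_mapR (σ.comulR hα) (σ.comulR_lsmul hα) (σ.counitMulR hα) (σ.counitMulR_lsmul hα) _ hl
    (fun _ => rfl), mapR_comulR, mapR_counitMulR_coactExtR]
  exact (mapR_id _).symm

theorem mapR_ract_insR (w : BTensor α (RingHom.id R) T σ.CoringR)
    (h : ∀ (r : R) (z : BTensor (RingHom.id R) (RingHom.id R) σ.CoringR R),
      ract (φ := RingHom.id R) (ψ := RingHom.id R) (RingHom.id R) (fun _ => rfl)
        (RingHom.id R r • z) = RingHom.id R r • ract (φ := RingHom.id R) (ψ := RingHom.id R)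
          (RingHom.id R) (fun _ => rfl) z) :
    mapR (φ := α) (ψ := RingHom.id R) (RingHom.id R) (ract (φ := RingHom.id R) (ψ := RingHom.id R)
      (RingHom.id R) (fun _ => rfl)) h (insR α (RingHom.id R) (1 : R) w) = w := by
  induction w using induction_on with
  | zero => rw [map_zero, map_zero]
  | tmul t c => rw [insR_tmul, mapR_tmul, ract_tmul, map_one, op_one, one_smul]
  | add x y hx hy => rw [map_add, map_add, hx, hy]

theorem rcounitR (c : σ.CoringR) : ract (φ := RingHom.id R) (ψ := RingHom.id R) (RingHom.id R)
    (fun _ => rfl) (mapR (φ := RingHom.id R) (ψ := RingHom.id R) (RingHom.id R) (σ.counitR hα)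
      (σ.counitR_lsmul hα) (σ.comulR hα c)) = c := by
  have hm : ∀ (r : R) (z : BTensor (RingHom.id R) (RingHom.id R) σ.CoringR R),
      ract (φ := RingHom.id R) (ψ := RingHom.id R) (RingHom.id R) (fun _ => rfl)
        (RingHom.id R r • z) = RingHom.id R r • ract (φ := RingHom.id R) (ψ := RingHom.id R)
          (RingHom.id R) (fun _ => rfl) z := fun r z => by
    induction z using induction_on with
    | zero => rw [smul_zero, map_zero, smul_zero]
    | tmul c s => rw [lsmul_tmul, ract_tmul, ract_tmul]; exact (smul_comm r (op s) c).symm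
    | add x y hx hy => rw [smul_add, map_add, map_add, smul_add, hx, hy]
  have hε : ∀ r z, mapR (φ := RingHom.id R) (ψ := RingHom.id R) (M := σ.CoringR) (RingHom.id R)
      (σ.counitR hα) (σ.counitR_lsmul hα) (RingHom.id R r • z) = RingHom.id R r •
        mapR (φ := RingHom.id R) (ψ := RingHom.id R) (RingHom.id R)
      (σ.counitR hα) (σ.counitR_lsmul hα) z := fun r z => mapR_lsmul _ _ r z
  have hε' : ∀ r c, ((mapR (φ := RingHom.id R) (ψ := RingHom.id R) (M := σ.CoringR) (RingHom.id R)
      (σ.counitR hα) (σ.counitR_lsmul hα)).comp (σ.comulR hα)) (RingHom.id R r • c) =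
      RingHom.id R r • ((mapR (φ := RingHom.id R) (ψ := RingHom.id R) (RingHom.id R)
      (σ.counitR hα) (σ.counitR_lsmul hα)).comp (σ.comulR hα)) c := fun r c =>
    (congrArg _ (σ.comulR_lsmul hα r c)).trans (hε r _)
  have hl : ∀ r c, ((ract (φ := RingHom.id R) (ψ := RingHom.id R) (RingHom.id R)
      (fun _ => rfl)).comp ((mapR (φ := RingHom.id R) (ψ := RingHom.id R) (M := σ.CoringR)
        (RingHom.id R) (σ.counitR hα) (σ.counitR_lsmul hα)).comp (σ.comulR hα)))
          (RingHom.id R r • c) = RingHom.id R r • ((ract (φ := RingHom.id R) (ψ := RingHom.id R)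
            (RingHom.id R) (fun _ => rfl)).comp ((mapR (φ := RingHom.id R) (ψ := RingHom.id R)
              (RingHom.id R) (σ.counitR hα) (σ.counitR_lsmul hα)).comp (σ.comulR hα))) c :=
    fun r c => (congrArg _ (hε' r c)).trans (hm r _)
  refine σ.coactR_hom_ext' hα (g := AddMonoidHom.id _) hl (fun _ _ => rfl) (fun x => ?_) c
  rw [← mapR_mapR _ hε' _ hm _ hl (fun _ => rfl), ← mapR_mapR _ (σ.comulR_lsmul hα) _ hε _ hε'
    (fun _ => rfl), mapR_comulR]
  refine Eq.trans ?_ ((σ.mapR_ract_insR (σ.coactR hα x) hm).trans (mapR_id _).symm)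
  refine congrArg _ ?_
  -- The counit acts on the second copy of `C`, which the outer coaction does not touch. By
  -- naturality it may be applied first, leaving `x ⊗ 1`.
  refine (BimodHerd.coactExtR_mapR (ξ := RingHom.id R) (ξ' := RingHom.id R) (σ.coactR hα)
    (σ.coactR_rsmul hα) (σ.counitR hα) (σ.counitR_lsmul hα) _).symm.trans ?_
  rw [mapR_counitR]
  rfl

/-- The coring of the herd. -/
noncomputable def coringR : Coring R σ.CoringR where
  comul := σ.comulR hα
  comul_lsmul := σ.comulR_lsmul hα
  comul_rsmul := σ.comulR_rsmul hα
  counit := σ.counitR hα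
  counit_lsmul := σ.counitR_lsmul hα
  counit_rsmul := σ.counitR_rsmul hα
  coassoc := σ.coassocR hα
  lcounit := σ.lcounitR hα
  rcounit := σ.rcounitR hα

end Shepherd

end Herd

theorem insR_lsmul {R A : Type u} [Ring R] [Ring A] {α : R →+* A} {C : Type u} [AddCommGroup C]
    [Module R C] [Module Rᵐᵒᵖ C] [SMulCommClass R Rᵐᵒᵖ C] {Q X : Type u} [Ring Q] {ξ : R →+* Q}
    [AddCommGroup X] [Module Q X] {M L : Type u} [AddCommGroup M] [Module Aᵐᵒᵖ M] [Ring L]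
    [Module L M] [SMulCommClass L Aᵐᵒᵖ M] (x : X) (l : L) (z : BTensor α (RingHom.id R) M C) :
    insR α ξ x (l • z) = l • insR α ξ x z :=
  mapR_lsmul _ _ l z

/-! ### The entwining of `A` with `C` -/

section Herd

variable {R S A B : Type u} [Ring R] [Ring S] [Ring A] [Ring B] {α : R →+* A} {β : S →+* B}
  {T : Type u} [AddCommGroup T] [Module B T] [Module Aᵐᵒᵖ T] [SMulCommClass B Aᵐᵒᵖ T]
  {P : Type u} [AddCommGroup P] [Module A P] [Module Bᵐᵒᵖ P] [SMulCommClass A Bᵐᵒᵖ P]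
  {d : FormalDual α β T P}

namespace Shepherd

variable (σ : Shepherd d) (hα : RightDescent α)

/-- The map `ψ(- ⊗ a) : C → A ⊗_R C`. -/
noncomputable def twistR (a : A) : σ.CoringR →+ BTensor α (RingHom.id R) A σ.CoringR :=
  (σ.descR hα).comp ((DistribSMul.toAddMonoidHom (BTensor β β P T) (op a)).comp σ.inclR)

theorem twistR_apply (a : A) (c : σ.CoringR) :
    σ.twistR hα a c = σ.descR hα (op a • σ.inclR c) := rfl

theorem twistR_smul (a : A) (r : R) (c : σ.CoringR) :
    σ.twistR hα a (RingHom.id R r • c) = α r • σ.twistR hα a c := by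
  rw [twistR_apply, twistR_apply, inclR_smul, ← smul_comm (α r) (op a), descR_lsmul]

/-- `ψ(- ⊗ a)` sends `c` to the descent of `c a`, and what it induces on `T` is `x ↦ ρ(x a)`. This
characterises it, and reduces every axiom of the entwining to the right action of `A` on `T`. -/
theorem absorbL_mapR_twistR (a : A) (x : T) :
    absorbL (mapR (φ := α) (ψ := RingHom.id R) α (σ.twistR hα a) (σ.twistR_smul hα a)
      (σ.coactR hα x)) = σ.coactR hα (op a • x) := by
  have hh : ∀ s x, ((σ.coactR hα).comp (DistribSMul.toAddMonoidHom T (op a))) (β s • x) =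
      β s • ((σ.coactR hα).comp (DistribSMul.toAddMonoidHom T (op a))) x := fun s x =>
    (congrArg (σ.coactR hα) (smul_comm (β s) (op a) x).symm).trans (σ.coactR_lsmul hα s _)
  -- On `p ⊗ x` both sides are `p ρ(x a)`, by `evL_coactR`.
  have key : ∀ z, d.hatL _ hh z = σ.descR hα (op a • z) := fun z => by
    induction z using induction_on with
    | zero => rw [map_zero, smul_zero, map_zero]
    | tmul p x =>
      rw [d.hatL_tmul, AddMonoidHom.comp_apply, rsmul_tmul, ← evL_coactR]
      rfl
    | add x y hx hy => rw [map_add, smul_add, map_add, hx, hy]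
  have hf : ∀ r c, ((d.hatL _ hh).comp σ.inclR) (RingHom.id R r • c) =
      α r • ((d.hatL _ hh).comp σ.inclR) c := fun r c => by
    rw [AddMonoidHom.comp_apply, AddMonoidHom.comp_apply, inclR_smul, d.hatL_lsmul]
  refine Eq.trans ?_ (σ.absorbL_mapR_hatL_inclR hα _ hh hf x)
  exact congrArg absorbL (mapR_congr (fun c => (key (σ.inclR c)).symm) _)

/-- The entwining map `ψ : C ⊗_R A → A ⊗_R C`. -/
noncomputable def entwR :
    BTensor (RingHom.id R) α σ.CoringR A →+ BTensor α (RingHom.id R) A σ.CoringR :=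
  lift (biadd (fun c a => σ.twistR hα a c) (fun c c' a => map_add _ c c')
    (fun c a a' => by rw [twistR_apply, op_add, add_smul, map_add]; rfl))
    (fun r c a => by
      rw [biadd_apply, biadd_apply, twistR_apply, twistR_apply, RingHom.id_apply, inclR_rsmul,
        smul_eq_mul, op_mul, mul_smul])

theorem entwR_tmul (c : σ.CoringR) (a : A) :
    σ.entwR hα (tmul (RingHom.id R) α c a) = σ.twistR hα a c := rfl

theorem entwR_lsmul (r : R) (z : BTensor (RingHom.id R) α σ.CoringR A) :
    σ.entwR hα (r • z) = α r • σ.entwR hα z := by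
  induction z using induction_on with
  | zero => rw [smul_zero, map_zero, smul_zero]
  | tmul c a => exact σ.twistR_smul hα a r c
  | add x y hx hy => rw [smul_add, map_add, map_add, smul_add, hx, hy]

theorem entwR_rsmul (r : R) (z : BTensor (RingHom.id R) α σ.CoringR A) :
    σ.entwR hα (op (α r) • z) = op r • σ.entwR hα z := by
  induction z using induction_on with
  | zero => rw [smul_zero, map_zero, smul_zero]
  | tmul c a =>
    rw [rsmul_tmul, entwR_tmul, entwR_tmul, twistR_apply, twistR_apply, ← descR_rsmul,
      op_smul_eq_mul, op_mul, mul_smul]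
  | add x y hx hy => rw [smul_add, map_add, map_add, smul_add, hx, hy]

theorem entwR_one (c : σ.CoringR) : σ.entwR hα (tmul _ _ c 1) = tmul _ _ 1 c := by
  rw [entwR_tmul, twistR_apply, op_one, one_smul, descR_inclR, unitL_apply]

/-- Both sides induce `x ↦ ρ(x a a')` on `T`. -/
theorem twistR_mul (a a' : A) (c : σ.CoringR) : σ.twistR hα (a * a') c =
    absorbL (mapR (φ := α) (ψ := RingHom.id R) α (σ.twistR hα a') (σ.twistR_smul hα a')
      (σ.twistR hα a c)) := by
  have hG : ∀ (r : R) (w : BTensor α (RingHom.id R) A σ.CoringR), (absorbL.comp (mapR (φ := α) (ψ := RingHom.id R) α (σ.twistR hα a')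
      (σ.twistR_smul hα a'))) (α r • w) = α r • (absorbL.comp (mapR (φ := α) (ψ := RingHom.id R) α
        (σ.twistR hα a') (σ.twistR_smul hα a'))) w := fun r w => by
    rw [AddMonoidHom.comp_apply, AddMonoidHom.comp_apply, mapR_lsmul, absorbL_lsmul]
  have hg : ∀ r c, ((absorbL.comp (mapR (φ := α) (ψ := RingHom.id R) α (σ.twistR hα a')
      (σ.twistR_smul hα a'))).comp (σ.twistR hα a)) (RingHom.id R r • c) = α r •
      ((absorbL.comp (mapR (φ := α) (ψ := RingHom.id R) α (σ.twistR hα a')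
      (σ.twistR_smul hα a'))).comp (σ.twistR hα a)) c := fun r c =>
    (congrArg _ (σ.twistR_smul hα a r c)).trans (hG r _)
  refine σ.coactR_hom_ext hα (σ.twistR_smul hα (a * a')) hg (fun x => ?_) c
  rw [absorbL_mapR_twistR, op_mul, mul_smul, ← absorbL_mapR_twistR, ← absorbL_mapR_twistR,
    absorbL_mapR_absorbL _ _ _ hG (fun w => rfl)]
  exact congrArg absorbL (mapR_mapR _ _ _ _ _ _ (fun _ => rfl) _)

theorem entwR_mul (c : σ.CoringR) (a a' : A) : σ.entwR hα (tmul _ _ c (a * a')) =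
    lact (φ := α) (ψ := α) (RingHom.id A) (fun _ => rfl)
      (mapR (φ := α) (ψ := RingHom.id R) α (σ.entwR hα) (σ.entwR_lsmul hα)
        (assoc (tmul (RingHom.id R) α (σ.entwR hα (tmul _ _ c a)) a'))) := by
  rw [entwR_tmul, entwR_tmul, twistR_mul]
  generalize σ.twistR hα a c = y
  induction y using induction_on with
  | zero => simp only [map_zero, zero_tmul]
  | tmul b c => rw [mapR_tmul, absorbL_tmul, assoc_tmul, mapR_tmul, lact_tmul, entwR_tmul,
      actL_eq_smul, RingHom.id_apply]
  | add x y hx hy => rw [map_add, map_add, hx, hy, add_tmul, map_add, map_add, map_add]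

/-- `ψ ⊗ C` -/
noncomputable def entwExtR :
    BTensor (RingHom.id R) α σ.CoringR (BTensor α (RingHom.id R) A σ.CoringR) →+
    BTensor α (RingHom.id R) A (BTensor (RingHom.id R) (RingHom.id R) σ.CoringR σ.CoringR) :=
  (assoc (φ₁ := α) (ψ₁ := RingHom.id R) (φ₂ := RingHom.id R)
    (ψ₂ := RingHom.id R)).toAddMonoidHom.comp
    ((mapL (φ := α) (ψ := RingHom.id R) (RingHom.id R) (σ.entwR hα) (σ.entwR_rsmul hα)).comp
      ((assoc (φ₁ := RingHom.id R) (ψ₁ := α) (φ₂ := α)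
        (ψ₂ := RingHom.id R)).symm.toAddMonoidHom))

/-- `c ↦ (ψ ⊗ C) (c ⊗ y)` -/
noncomputable def twistExtR (y : BTensor α (RingHom.id R) A σ.CoringR) : σ.CoringR →+
    BTensor α (RingHom.id R) A (BTensor (RingHom.id R) (RingHom.id R) σ.CoringR σ.CoringR) :=
  (σ.entwExtR hα).comp ((BTensor.mk (RingHom.id R) α).flip y)

theorem twistExtR_apply (y : BTensor α (RingHom.id R) A σ.CoringR) (c : σ.CoringR) :
    σ.twistExtR hα y c = σ.entwExtR hα (tmul (RingHom.id R) α c y) := rfl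

theorem twistExtR_tmul (a : A) (c c' : σ.CoringR) : σ.twistExtR hα (tmul _ _ a c') c =
    insR α (RingHom.id R) c' (σ.twistR hα a c) := by
  change assoc (tmul _ _ (σ.twistR hα a c) c') = _
  generalize σ.twistR hα a c = y
  induction y using induction_on with
  | zero => rw [zero_tmul, map_zero, map_zero]
  | tmul b c => rfl
  | add x y hx hy => rw [add_tmul, map_add, map_add, hx, hy]

theorem twistExtR_add (y y' : BTensor α (RingHom.id R) A σ.CoringR) (c : σ.CoringR) :
    σ.twistExtR hα (y + y') c = σ.twistExtR hα y c + σ.twistExtR hα y' c := by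
  rw [twistExtR_apply, tmul_add, map_add, ← twistExtR_apply, ← twistExtR_apply]

theorem twistExtR_zero (c : σ.CoringR) : σ.twistExtR hα 0 c = 0 := by
  rw [twistExtR_apply, tmul_zero, map_zero]

theorem twistExtR_smul (y : BTensor α (RingHom.id R) A σ.CoringR) (r : R) (c : σ.CoringR) :
    σ.twistExtR hα y (RingHom.id R r • c) = α r • σ.twistExtR hα y c := by
  induction y using induction_on with
  | zero => rw [twistExtR_zero, twistExtR_zero, smul_zero]
  | tmul b c' => rw [twistExtR_tmul, twistExtR_tmul, twistR_smul, insR_lsmul]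
  | add x y hx hy => rw [twistExtR_add, twistExtR_add, hx, hy, smul_add]

/-- For `y = a ⊗ c'` both sides are `ρ(t a) ⊗ c'`, by `absorbL_mapR_twistR`. The general case is
additivity in `y`, which needs `key` because `y` also occurs in the linearity proof. -/
theorem absorbL_mapR_twistExtR (y : BTensor α (RingHom.id R) A σ.CoringR) (t : T) :
    absorbL (mapR (φ := α) (ψ := RingHom.id R) α (σ.twistExtR hα y) (σ.twistExtR_smul hα y)
      (σ.coactR hα t)) = σ.coactExtR hα (RingHom.id R) (actL t y) := by
  have key : ∀ (y y' : BTensor α (RingHom.id R) A σ.CoringR)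
      (w : BTensor α (RingHom.id R) T σ.CoringR),
      mapR (φ := α) (ψ := RingHom.id R) α (σ.twistExtR hα (y + y')) (σ.twistExtR_smul hα _) w =
      mapR (φ := α) (ψ := RingHom.id R) α (σ.twistExtR hα y) (σ.twistExtR_smul hα _) w +
      mapR (φ := α) (ψ := RingHom.id R) α (σ.twistExtR hα y') (σ.twistExtR_smul hα _) w :=
    fun y y' w => by
      induction w using induction_on with
      | zero => simp only [map_zero, add_zero]
      | tmul t c => rw [mapR_tmul, mapR_tmul, mapR_tmul, twistExtR_add, tmul_add]
      | add x y hx hy => rw [map_add, map_add, map_add, hx, hy, add_add_add_comm]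
  induction y using induction_on with
  | zero =>
    rw [map_zero, map_zero]
    generalize σ.coactR hα t = w
    induction w using induction_on with
    | zero => simp only [map_zero]
    | tmul t c => rw [mapR_tmul, twistExtR_zero, tmul_zero, map_zero]
    | add x y hx hy => rw [map_add, map_add, hx, hy, add_zero]
  | tmul b c' =>
    rw [actL_tmul, coactExtR_tmul, ← absorbL_mapR_twistR]
    generalize σ.coactR hα t = w
    induction w using induction_on with
    | zero => simp only [map_zero]
    | tmul t c =>
      rw [mapR_tmul, mapR_tmul, absorbL_tmul, absorbL_tmul, twistExtR_tmul]
      exact (mapR_actL _ _ t _).symm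
    | add x y hx hy => rw [map_add, map_add, map_add, map_add, map_add, hx, hy]
  | add x y hx hy => rw [key, map_add, map_add, map_add, hx, hy]

/-- `(ψ ⊗ C) ∘ (C ⊗ ψ)` at `a` -/
noncomputable def twistTwistR (a : A) : BTensor (RingHom.id R) (RingHom.id R) σ.CoringR σ.CoringR →+
    BTensor α (RingHom.id R) A (BTensor (RingHom.id R) (RingHom.id R) σ.CoringR σ.CoringR) :=
  (σ.entwExtR hα).comp
    ((mapR (φ := RingHom.id R) (ψ := RingHom.id R) α (σ.entwR hα) (σ.entwR_lsmul hα)).comp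
      ((assoc (φ₁ := RingHom.id R) (ψ₁ := RingHom.id R) (φ₂ := RingHom.id R)
        (ψ₂ := α)).toAddMonoidHom.comp ((BTensor.mk (RingHom.id R) α).flip a)))

theorem twistTwistR_tmul (a : A) (c c' : σ.CoringR) : σ.twistTwistR hα a (tmul _ _ c c') =
    σ.twistExtR hα (σ.twistR hα a c') c := rfl

theorem twistTwistR_smul (a : A) (r : R)
    (z : BTensor (RingHom.id R) (RingHom.id R) σ.CoringR σ.CoringR) :
    σ.twistTwistR hα a (RingHom.id R r • z) = α r • σ.twistTwistR hα a z := by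
  induction z using induction_on with
  | zero => rw [smul_zero, map_zero, smul_zero]
  | tmul c c' => rw [lsmul_tmul, twistTwistR_tmul, twistTwistR_tmul, twistExtR_smul]
  | add x y hx hy => rw [smul_add, map_add, map_add, smul_add, hx, hy]

theorem absorbL_mapR_twistTwistR (a : A) (w : BTensor α (RingHom.id R) T σ.CoringR) :
    absorbL (mapR (φ := α) (ψ := RingHom.id R) α (σ.twistTwistR hα a) (σ.twistTwistR_smul hα a)
      (σ.coactExtR hα (RingHom.id R) w)) = σ.coactExtR hα (RingHom.id R)
        (absorbL (mapR (φ := α) (ψ := RingHom.id R) α (σ.twistR hα a) (σ.twistR_smul hα a) w)) := by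
  induction w using induction_on with
  | zero => simp only [map_zero]
  | tmul t c =>
    rw [coactExtR_tmul, mapR_tmul, absorbL_tmul, ← absorbL_mapR_twistExtR]
    generalize σ.coactR hα t = w
    induction w using induction_on with
    | zero => simp only [map_zero]
    | tmul t c' => rw [insR_tmul, mapR_tmul, twistTwistR_tmul, mapR_tmul]
    | add x y hx hy => rw [map_add, map_add, map_add, map_add, map_add, hx, hy]
  | add x y hx hy => rw [map_add, map_add, map_add, map_add, map_add, map_add, hx, hy]

/-- Both sides induce `x ↦ (ρ ⊗ C) ρ(x a)` on `T`. -/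
theorem mapR_comulR_twistR (a : A) (c : σ.CoringR) :
    mapR (φ := α) (ψ := RingHom.id R) (RingHom.id R) (σ.comulR hα) (σ.comulR_lsmul hα)
      (σ.twistR hα a c) = σ.twistTwistR hα a (σ.comulR hα c) := by
  have hm : ∀ (r : R) w, mapR (φ := α) (ψ := RingHom.id R) (M := A) (RingHom.id R) (σ.comulR hα)
      (σ.comulR_lsmul hα) (α r • w) = α r • mapR (φ := α) (ψ := RingHom.id R) (RingHom.id R)
        (σ.comulR hα) (σ.comulR_lsmul hα) w := fun r w => mapR_lsmul _ _ (α r) w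
  have hf : ∀ (r : R) c, ((mapR (φ := α) (ψ := RingHom.id R) (M := A) (RingHom.id R) (σ.comulR hα)
      (σ.comulR_lsmul hα)).comp (σ.twistR hα a)) (RingHom.id R r • c) = α r •
      ((mapR (φ := α) (ψ := RingHom.id R) (M := A) (RingHom.id R) (σ.comulR hα)
      (σ.comulR_lsmul hα)).comp (σ.twistR hα a)) c := fun r c =>
    (congrArg _ (σ.twistR_smul hα a r c)).trans (hm r _)
  have hg : ∀ (r : R) c, ((σ.twistTwistR hα a).comp (σ.comulR hα)) (RingHom.id R r • c) = α r •
      ((σ.twistTwistR hα a).comp (σ.comulR hα)) c := fun r c =>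
    (congrArg _ (σ.comulR_lsmul hα r c)).trans (σ.twistTwistR_smul hα a r _)
  refine σ.coactR_hom_ext hα hf hg (fun x => ?_) c
  rw [← mapR_mapR _ (σ.twistR_smul hα a) _ hm _ hf (fun _ => rfl),
    ← mapR_mapR _ (σ.comulR_lsmul hα) _ (σ.twistTwistR_smul hα a) _ hg (fun _ => rfl),
    mapR_comulR, absorbL_mapR_twistTwistR, absorbL_mapR_twistR, ← mapR_comulR,
    ← absorbL_mapR_twistR]
  exact absorbL_mapR _ _ _

theorem entwR_comul (z : BTensor (RingHom.id R) α σ.CoringR A) :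
    mapR (φ := α) (ψ := RingHom.id R) (RingHom.id R) (σ.comulR hα) (σ.comulR_lsmul hα)
      (σ.entwR hα z) =
    assoc (mapL (φ := α) (ψ := RingHom.id R) (RingHom.id R) (σ.entwR hα) (σ.entwR_rsmul hα)
      (assoc.symm (mapR (φ := RingHom.id R) (ψ := RingHom.id R) α (σ.entwR hα) (σ.entwR_lsmul hα)
        (assoc (mapL (ψ := α) (RingHom.id R) (σ.comulR hα) (σ.comulR_rsmul hα) z))))) := by
  induction z using induction_on with
  | zero => simp only [map_zero]
  | tmul c a => exact σ.mapR_comulR_twistR hα a c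
  | add x y hx hy => simp only [map_add, hx, hy]

/-- Both sides induce `x ↦ x a ⊗ 1` on `T`. -/
theorem mapR_counitR_twistR (a : A) (c : σ.CoringR) :
    mapR (φ := α) (ψ := RingHom.id R) (RingHom.id R) (σ.counitR hα) (σ.counitR_lsmul hα)
      (σ.twistR hα a c) = tmul α (RingHom.id R) (α (σ.counitR hα c) * a) 1 := by
  have hm : ∀ (r : R) w, mapR (φ := α) (ψ := RingHom.id R) (M := A) (RingHom.id R) (σ.counitR hα)
      (σ.counitR_lsmul hα) (α r • w) = α r • mapR (φ := α) (ψ := RingHom.id R) (RingHom.id R)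
        (σ.counitR hα) (σ.counitR_lsmul hα) w := fun r w => mapR_lsmul _ _ (α r) w
  have hf : ∀ (r : R) c, ((mapR (φ := α) (ψ := RingHom.id R) (M := A) (RingHom.id R) (σ.counitR hα)
      (σ.counitR_lsmul hα)).comp (σ.twistR hα a)) (RingHom.id R r • c) = α r •
      ((mapR (φ := α) (ψ := RingHom.id R) (M := A) (RingHom.id R) (σ.counitR hα)
      (σ.counitR_lsmul hα)).comp (σ.twistR hα a)) c := fun r c =>
    (congrArg _ (σ.twistR_smul hα a r c)).trans (hm r _)
  let g : σ.CoringR →+ BTensor α (RingHom.id R) A R :=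
    AddMonoidHom.mk' (fun c => tmul α (RingHom.id R) (α (σ.counitR hα c) * a) 1) (fun c c' => by
      rw [map_add, map_add, add_mul, add_tmul])
  have hg : ∀ (r : R) c, g (RingHom.id R r • c) = α r • g c := fun r c => by
    change tmul _ _ _ _ = α r • tmul _ _ _ _
    rw [RingHom.id_apply, counitR_lsmul, lsmul_tmul, smul_eq_mul, smul_eq_mul, map_mul, mul_assoc]
  refine σ.coactR_hom_ext hα hf hg (fun x => ?_) c
  rw [← mapR_mapR _ (σ.twistR_smul hα a) _ hm _ hf (fun _ => rfl)]
  refine (absorbL_mapR _ (σ.counitR_lsmul hα) _).trans ?_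
  rw [absorbL_mapR_twistR, mapR_counitR]
  -- Multiply out `(T ⊗ ε) ρ(x) = x ⊗ 1` to `Σ x₀ ε(x₁) = x` and then act by `a`.
  have h := congrArg (fun w => tmul α (RingHom.id R) (op a •
    ract (φ := α) (ψ := RingHom.id R) α (fun _ => rfl) w) (1 : R)) (σ.mapR_counitR hα x)
  refine Eq.trans ?_ (h.symm.trans ?_)
  · rw [ract_tmul, map_one, op_one, one_smul]
  · generalize σ.coactR hα x = w
    induction w using induction_on with
    | zero => simp only [map_zero, smul_zero, zero_tmul]
    | tmul t c =>
      rw [mapR_tmul, mapR_tmul, ract_tmul, absorbL_tmul]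
      change _ = actL t (tmul _ _ _ _)
      rw [actL_tmul, op_mul, mul_smul]
    | add x y hx hy => simp only [map_add, smul_add, add_tmul, hx, hy]

theorem entwR_counit (z : BTensor (RingHom.id R) α σ.CoringR A) :
    ract (φ := α) (ψ := RingHom.id R) α (fun _ => rfl) (mapR (φ := α) (ψ := RingHom.id R)
      (RingHom.id R) (σ.counitR hα) (σ.counitR_lsmul hα) (σ.entwR hα z)) =
    lact (φ := RingHom.id R) (ψ := α) α (fun _ => rfl) (mapL (φ := RingHom.id R) (RingHom.id R)
      (σ.counitR hα) (σ.counitR_rsmul hα) z) := by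
  induction z using induction_on with
  | zero => simp only [map_zero]
  | tmul c a =>
    rw [entwR_tmul, mapR_counitR_twistR, mapL_tmul, ract_tmul, lact_tmul, map_one, op_one, one_smul,
      smul_eq_mul]
  | add x y hx hy => simp only [map_add, hx, hy]

/-- The right entwining of `A` with the coring of the herd. -/
noncomputable def entwiningR : RightEntwining α (σ.coringR hα) where
  ψ := σ.entwR hα
  ψ_lsmul := σ.entwR_lsmul hα
  ψ_rsmul := σ.entwR_rsmul hα
  ψ_mul := σ.entwR_mul hα
  ψ_one := σ.entwR_one hα
  ψ_comul := σ.entwR_comul hα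
  ψ_counit := σ.entwR_counit hα

end Shepherd

end Herd

theorem BTensor.exists_sum_tmul {R P Q : Type*} [Ring R] [Ring P] [Ring Q] {φ : R →+* P}
    {ψ : R →+* Q} {M N : Type*} [AddCommGroup M] [Module Pᵐᵒᵖ M] [AddCommGroup N] [Module Q N]
    (z : BTensor φ ψ M N) :
    ∃ (n : ℕ) (m : Fin n → M) (k : Fin n → N), z = ∑ i, tmul φ ψ (m i) (k i) := by
  induction z using induction_on with
  | zero => exact ⟨0, 0, 0, by simp⟩
  | tmul m k => exact ⟨1, fun _ => m, fun _ => k, by simp⟩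
  | add x y hx hy =>
    obtain ⟨n, m, k, rfl⟩ := hx
    obtain ⟨n', m', k', rfl⟩ := hy
    refine ⟨n + n', Fin.append m m', Fin.append k k', ?_⟩
    rw [Fin.sum_univ_add]
    congr 1 <;> refine Finset.sum_congr rfl fun i _ => ?_ <;> simp

/-- The dual basis lemma: a finitely generated projective module is a retract of a finite free one,
and the coordinates of the section are the functionals. -/
theorem exists_dual_basis {A T : Type u} [Ring A] [AddCommGroup T] [Module Aᵐᵒᵖ T]
    [Module.Finite Aᵐᵒᵖ T] [Module.Projective Aᵐᵒᵖ T] :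
    ∃ (n : ℕ) (e : Fin n → T) (f : Fin n → RDual A T), ∀ x, ∑ i, op (f i x) • e i = x := by
  obtain ⟨n, f, g, -, -, h⟩ := Module.Finite.exists_comp_eq_id_of_projective Aᵐᵒᵖ T
  -- The free module is over `Aᵐᵒᵖ`, so the coordinates are brought back to `A` by `unop`.
  refine ⟨n, fun i => f (Pi.single i 1), fun i => ({
    toFun := fun x => (g x i).unop
    map_add' := fun x y => by simp
    map_smul' := fun a x => by simp } : T →ₗ[Aᵐᵒᵖ] A), fun x => ?_⟩
  have h' := LinearMap.congr_fun h x
  rw [LinearMap.comp_apply, LinearMap.id_apply] at h'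
  conv_rhs => rw [← h', ← Finset.univ_sum_single (g x), map_sum]
  refine Finset.sum_congr rfl fun i _ => ?_
  change op (g x i).unop • f (Pi.single i 1) = _
  rw [op_unop, ← map_smul, ← Pi.single_smul, smul_eq_mul, mul_one]

/-! ### Surjectivity of `ev` and `coev`, and the duals of `T` -/

section Pen

variable {R S A B : Type u} [Ring R] [Ring S] [Ring A] [Ring B] {α : R →+* A} {β : S →+* B}
  {T : Type u} [AddCommGroup T] [Module B T] [Module Aᵐᵒᵖ T] [SMulCommClass B Aᵐᵒᵖ T]
  {P : Type u} [AddCommGroup P] [Module A P] [Module Bᵐᵒᵖ P] [SMulCommClass A Bᵐᵒᵖ P]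

namespace FormalDual

variable (d : FormalDual α β T P)

theorem surjective_ev (h : ∃ z, d.ev z = 1) : Function.Surjective d.ev := fun a => by
  obtain ⟨z, hz⟩ := h
  exact ⟨a • z, by rw [d.ev_lsmul, hz, smul_eq_mul, mul_one]⟩

theorem surjective_coev (h : ∃ z, d.coev z = 1) : Function.Surjective d.coev := fun b => by
  obtain ⟨z, hz⟩ := h
  exact ⟨b • z, by rw [d.coev_lsmul, hz, smul_eq_mul, mul_one]⟩

/-- If the values of `ev` absorb every functional on the generator `T`, then `ev` is surjective. -/
theorem exists_ev_eq_one (hT : IsProgenerator A T)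
    (h : ∀ (f : T →ₗ[Aᵐᵒᵖ] A) x, ∃ z, d.ev z = f x) : ∃ z, d.ev z = 1 := by
  let I : Submodule Aᵐᵒᵖ A :=
    { carrier := Set.range d.ev
      zero_mem' := ⟨0, map_zero _⟩
      add_mem' := by
        rintro _ _ ⟨z, rfl⟩ ⟨w, rfl⟩
        exact ⟨z + w, map_add _ _ _⟩
      smul_mem' := by
        rintro a _ ⟨z, rfl⟩
        exact ⟨op a.unop • z, d.ev_rsmul _ _⟩ }
  -- The image `I` of `ev` is a right ideal that contains all values of functionals on `T`. The
  -- projection `A → A / I` thus kills every map `T → A`, and a generator detects that it is zero.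
  have h0 : I.mkQ = 0 := hT.generator A (A ⧸ I) I.mkQ fun f => by
    ext x
    obtain ⟨z, hz⟩ := h f x
    exact (Submodule.Quotient.mk_eq_zero I).2 ⟨z, hz⟩
  exact (Submodule.Quotient.mk_eq_zero I).1 (LinearMap.congr_fun h0 1)

/-- The identity of `T` is a finite sum of rank-one endomorphisms by the dual basis lemma, and every
rank-one endomorphism is a value of `coev` once the elements `coev(w) y` span `T`. -/
theorem exists_coev_eq_one (hT : IsProgenerator A T)
    (hB : Function.Bijective (Module.toModuleEnd Aᵐᵒᵖ T : B →+* Module.End Aᵐᵒᵖ T))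
    (h : ∀ x, x ∈ AddSubgroup.closure {x : T | ∃ w y, x = d.coev w • y}) :
    ∃ z, d.coev z = 1 := by
  have hinj : ∀ b b' : B, (∀ x : T, b • x = b' • x) → b = b' := fun b b' hb =>
    hB.1 (LinearMap.ext hb)
  have key : ∀ (f : RDual A T) (x : T), ∃ z, ∀ y : T, d.coev z • y = op (f y) • x := fun f x => by
    induction h x using AddSubgroup.closure_induction with
    | mem x hx =>
      obtain ⟨w, x, rfl⟩ := hx
      obtain ⟨b, hb⟩ := hB.2 ({
        toFun := fun y => op (f y) • x
        map_add' := fun y y' => by rw [map_add, op_add, add_smul]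
        map_smul' := fun a y => by
          induction a using MulOpposite.rec' with | _ a =>
          rw [map_smul, op_smul_eq_mul, op_mul, mul_smul, RingHom.id_apply] } : T →ₗ[Aᵐᵒᵖ] T)
      -- With `b` the endomorphism `y ↦ x f(y)`, the element `coev(w) b = coev(w b)` acts by `y ↦
      -- (coev(w) x) f(y)`.
      refine ⟨op b • w, fun y => ?_⟩
      have hb' : b • y = op (f y) • x := LinearMap.congr_fun hb y
      rw [d.coev_rsmul, op_smul_eq_mul, mul_smul, hb', smul_comm]
    | zero => exact ⟨0, fun y => by rw [map_zero, zero_smul, smul_zero]⟩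
    | add x y _ _ hx hy =>
      obtain ⟨z, hz⟩ := hx
      obtain ⟨w, hw⟩ := hy
      exact ⟨z + w, fun y => by rw [map_add, add_smul, hz, hw, smul_add]⟩
    | neg x _ hx =>
      obtain ⟨z, hz⟩ := hx
      exact ⟨-z, fun y => by rw [map_neg, neg_smul, hz, smul_neg]⟩
  have := hT.finite
  have := hT.projective
  obtain ⟨n, e, f, hef⟩ := exists_dual_basis (A := A) (T := T)
  choose z hz using fun i => key (f i) (e i)
  refine ⟨∑ i, z i, hinj _ _ fun x => ?_⟩
  rw [map_sum, Finset.sum_smul, one_smul, ← hef x]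
  exact Finset.sum_congr rfl fun i _ => by rw [hz, hef]

/-- The map `p ↦ ev(p ⊗ -)`. -/
def toRDual : P →+ RDual A T :=
  AddMonoidHom.mk' (fun p => ({
      toFun := fun x => d.ev (tmul β β p x)
      map_add' := fun x y => by rw [tmul_add, map_add]
      map_smul' := fun a x => by
        induction a using MulOpposite.rec' with | _ a =>
        rw [← rsmul_tmul, d.ev_rsmul, RingHom.id_apply] } : T →ₗ[Aᵐᵒᵖ] A))
    (fun p q => LinearMap.ext fun x => (congrArg d.ev (add_tmul β β p q x)).trans (map_add _ _ _))

theorem toRDual_apply (p : P) (x : T) : d.toRDual p x = d.ev (tmul β β p x) := rfl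

theorem toRDual_rsmul (s : S) (p : P) : d.toRDual (op (β s) • p) = op (β s) • d.toRDual p :=
  LinearMap.ext fun x => congrArg d.ev (smul_tmul β β s p x)

/-- The map `p ↦ coev(- ⊗ p)`. -/
def toLDual : P →+ LDual B T :=
  AddMonoidHom.mk' (fun p => ({
      toFun := fun x => d.coev (tmul α α x p)
      map_add' := fun x y => by rw [add_tmul, map_add]
      map_smul' := fun b x => by rw [← lsmul_tmul, d.coev_lsmul, RingHom.id_apply] } : T →ₗ[B] B))
    (fun p q => LinearMap.ext fun x => (congrArg d.coev (tmul_add α α x p q)).trans (map_add _ _ _))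

theorem toLDual_apply (p : P) (x : T) : d.toLDual p x = d.coev (tmul α α x p) := rfl

theorem toLDual_lsmul (r : R) (p : P) : d.toLDual (α r • p) = α r • d.toLDual p :=
  LinearMap.ext fun x => congrArg d.coev (smul_tmul α α r x p).symm

/-- If `1 = Σ coev(tᵢ ⊗ pᵢ)`, then `q = Σ ev(q ⊗ tᵢ) pᵢ` for `q ∈ P`, and a functional `f` is
represented by `Σ f(tᵢ) pᵢ`. -/
theorem toRDual_bijective (h : ∃ z, d.coev z = 1) : Function.Bijective d.toRDual := by
  obtain ⟨z, hz⟩ := h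
  obtain ⟨n, t, p, rfl⟩ := exists_sum_tmul z
  rw [map_sum] at hz
  constructor
  · refine (injective_iff_map_eq_zero _).2 fun q hq => ?_
    rw [← one_smul Bᵐᵒᵖ q, ← op_one, ← hz, Finset.op_sum, Finset.sum_smul]
    refine Finset.sum_eq_zero fun i _ => ?_
    rw [d.smul_coev, ← toRDual_apply, hq]
    exact zero_smul _ _
  · intro f
    refine ⟨∑ i, f (t i) • p i, LinearMap.ext fun x => ?_⟩
    change d.toRDual _ x = f x
    rw [toRDual_apply]
    conv_rhs => rw [← one_smul B x, ← hz, Finset.sum_smul, map_sum]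
    have : ∀ q : P, d.ev (tmul β β q x) = (d.ev.comp ((BTensor.mk β β).flip x)) q := fun _ => rfl
    rw [this, map_sum]
    refine Finset.sum_congr rfl fun i _ => ?_
    rw [← this, ← lsmul_tmul, d.ev_lsmul, d.coev_smul, map_smul, op_smul_eq_mul, smul_eq_mul]

/-- If `1 = Σ ev(pᵢ ⊗ tᵢ)`, then `q = Σ pᵢ coev(tᵢ ⊗ q)` for `q ∈ P`, and a functional `f` is
represented by `Σ pᵢ f(tᵢ)`. -/
theorem toLDual_bijective (h : ∃ z, d.ev z = 1) : Function.Bijective d.toLDual := by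
  obtain ⟨z, hz⟩ := h
  obtain ⟨n, p, t, rfl⟩ := exists_sum_tmul z
  rw [map_sum] at hz
  constructor
  · refine (injective_iff_map_eq_zero _).2 fun q hq => ?_
    rw [← one_smul A q, ← hz, Finset.sum_smul]
    refine Finset.sum_eq_zero fun i _ => ?_
    rw [← d.smul_coev, ← toLDual_apply, hq]
    exact zero_smul _ _
  · intro f
    refine ⟨∑ i, op (f (t i)) • p i, LinearMap.ext fun x => ?_⟩
    change d.toLDual _ x = f x
    rw [toLDual_apply]
    conv_rhs => rw [← one_smul Aᵐᵒᵖ x, ← op_one, ← hz, Finset.op_sum, Finset.sum_smul, map_sum]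
    have : ∀ q : P, d.coev (tmul α α x q) = (d.coev.comp (BTensor.mk α α x)) q := fun _ => rfl
    rw [this, map_sum]
    refine Finset.sum_congr rfl fun i _ => ?_
    rw [← this, ← rsmul_tmul, d.coev_rsmul, ← d.coev_smul, map_smul, op_smul_eq_mul, smul_eq_mul]

/-- If `1 = Σ ev(pᵢ ⊗ tᵢ)`, then `x = Σ coev(x ⊗ pᵢ) tᵢ`: a finite dual basis of `T` over `B`. -/
theorem left_finite_projective (h : ∃ z, d.ev z = 1) :
    Module.Finite B T ∧ Module.Projective B T := by
  obtain ⟨z, hz⟩ := h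
  obtain ⟨n, p, t, rfl⟩ := exists_sum_tmul z
  rw [map_sum] at hz
  let f : (Fin n → B) →ₗ[B] T := Fintype.linearCombination B t
  let g : T →ₗ[B] (Fin n → B) := LinearMap.pi fun i => d.toLDual (p i)
  have hfg : f.comp g = LinearMap.id := LinearMap.ext fun x => by
    rw [LinearMap.comp_apply, Fintype.linearCombination_apply, LinearMap.id_apply]
    conv_rhs => rw [← one_smul Aᵐᵒᵖ x, ← op_one, ← hz, Finset.op_sum, Finset.sum_smul]
    exact Finset.sum_congr rfl fun i _ => d.coev_smul x (p i) (t i)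
  exact ⟨Module.Finite.of_surjective f fun x => ⟨g x, LinearMap.congr_fun hfg x⟩,
    Module.Projective.of_split g f hfg⟩

end FormalDual

namespace Shepherd

variable {d : FormalDual α β T P}

/-- The unit law reads `x = Σ x₁ ev(x₂ ⊗ x₃)`. Applying a functional gives `f(x) = ev(Σ f(x₁) x₂ ⊗
x₃)`, so the image of `ev` contains every `f(x)`. -/
theorem exists_ev_eq_one (σ : Shepherd d) (hT : IsProgenerator A T) : ∃ z, d.ev z = 1 :=
  d.exists_ev_eq_one hT fun f x => by
    have h := congrArg (ract (φ := α) (ψ := α) (RingHom.id A) (fun _ => rfl)) (σ.ev_γ x)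
    rw [ract_tmul, RingHom.id_apply, op_one, one_smul] at h
    rw [← h]
    generalize σ.γ x = z
    induction z using induction_on with
    | zero => exact ⟨0, by simp only [map_zero]⟩
    | tmul t w =>
      refine ⟨f t • w, ?_⟩
      rw [mapR_tmul, ract_tmul, d.ev_lsmul]
      exact (f.map_smul (op (d.ev w)) t).symm
    | add x y hx hy =>
      obtain ⟨z, hz⟩ := hx
      obtain ⟨w, hw⟩ := hy
      exact ⟨z + w, by simp only [map_add, hz, hw]⟩

/-- The same unit law, rewritten as `x = Σ coev(x₁ ⊗ x₂) x₃`, shows that the values of `coev` span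
`T`. -/
theorem exists_coev_eq_one (σ : Shepherd d) (hT : IsProgenerator A T)
    (hB : Function.Bijective (Module.toModuleEnd Aᵐᵒᵖ T : B →+* Module.End Aᵐᵒᵖ T)) :
    ∃ z, d.coev z = 1 :=
  d.exists_coev_eq_one hT hB fun x => by
    have h := congrArg (ract (φ := α) (ψ := α) (RingHom.id A) (fun _ => rfl)) (σ.ev_γ x)
    rw [ract_tmul, RingHom.id_apply, op_one, one_smul] at h
    rw [← h]
    generalize σ.γ x = z
    induction z using induction_on with
    | zero => simp only [map_zero]; exact zero_mem _
    | tmul t w =>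
      induction w using induction_on with
      | zero => simp only [map_zero, tmul_zero]; exact zero_mem _
      | tmul p y => exact AddSubgroup.subset_closure ⟨tmul α α t p, y, (d.coev_smul t p y).symm⟩
      | add x y hx hy => simp only [map_add, tmul_add]; exact add_mem hx hy
    | add x y hx hy => simp only [map_add]; exact add_mem hx hy

end Shepherd

/-- `(a f)(x) = a f(x)` -/
instance RDual.leftModule : Module A (RDual A T) where
  smul a f := ({
    toFun := fun x => a * f x
    map_add' := fun x y => by rw [map_add, mul_add]
    map_smul' := fun a x => by
      rw [map_smul, RingHom.id_apply, mul_smul_comm] } : T →ₗ[Aᵐᵒᵖ] A)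
  one_smul f := LinearMap.ext fun x => one_mul (f x)
  mul_smul a b f := LinearMap.ext fun x => mul_assoc a b (f x)
  smul_zero a := LinearMap.ext fun x => mul_zero a
  smul_add a f g := LinearMap.ext fun x => mul_add a (f x) (g x)
  add_smul a b f := LinearMap.ext fun x => add_mul a b (f x)
  zero_smul f := LinearMap.ext fun x => zero_mul (f x)

theorem RDual.smul_apply (a : A) (f : RDual A T) (x : T) : (a • f) x = a * f x := rfl

theorem RDual.op_smul_apply (b : B) (f : RDual A T) (x : T) : (op b • f) x = f (b • x) := rfl

theorem RDual.add_apply (f g : RDual A T) (x : T) : (f + g) x = f x + g x := rfl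

instance RDual.smulCommClass : SMulCommClass A Bᵐᵒᵖ (RDual A T) where
  smul_comm _ _ _ := rfl

/-- The endomorphism `y ↦ x f(y)`. -/
def rankOne (x : T) (f : RDual A T) : Module.End Aᵐᵒᵖ T where
  toFun y := op (f y) • x
  map_add' y y' := by rw [map_add, op_add, add_smul]
  map_smul' a y := by
    induction a using MulOpposite.rec' with | _ a =>
    rw [map_smul, op_smul_eq_mul, op_mul, mul_smul, RingHom.id_apply]

/-- The element of `B = End_A(T)` given by `y ↦ x f(y)`. -/
noncomputable def rankOneElt
    (hB : Function.Bijective (Module.toModuleEnd Aᵐᵒᵖ T : B →+* Module.End Aᵐᵒᵖ T)) (x : T)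
    (f : RDual A T) : B := (hB.2 (rankOne x f)).choose

/-! ### The standard dual `Hom_A(T, A)` -/

section Standard

variable (hB : Function.Bijective (Module.toModuleEnd Aᵐᵒᵖ T : B →+* Module.End Aᵐᵒᵖ T))

theorem rankOneElt_smul (x : T) (f : RDual A T) (y : T) :
    rankOneElt hB x f • y = op (f y) • x :=
  LinearMap.congr_fun (hB.2 (rankOne x f)).choose_spec y

theorem eq_of_smul_eq (hB : Function.Bijective
    (Module.toModuleEnd Aᵐᵒᵖ T : B →+* Module.End Aᵐᵒᵖ T)) {b b' : B} (h : ∀ x : T, b • x = b' • x) : b = b' :=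
  hB.1 (LinearMap.ext h)

variable (α β) in
/-- The standard formal dual `Hom_A(T, A)` of `T`. -/
noncomputable def standardDual : FormalDual α β T (RDual A T) where
  ev := lift (biadd (fun f x => f x) (fun _ _ _ => rfl) (fun f x y => map_add f x y))
    (fun _ _ _ => rfl)
  ev_lsmul a z := by
    induction z using induction_on with
    | zero => rw [smul_zero, map_zero, smul_zero]
    | tmul f x => rfl
    | add x y hx hy => rw [smul_add, map_add, map_add, smul_add, hx, hy]
  ev_rsmul a z := by
    induction z using induction_on with
    | zero => rw [smul_zero, map_zero, smul_zero]
    | tmul f x => exact map_smul f (op a) x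
    | add x y hx hy => rw [smul_add, map_add, map_add, smul_add, hx, hy]
  coev := lift (biadd (fun x f => rankOneElt hB x f)
      (fun x x' f => eq_of_smul_eq hB fun y => by
        simp only [add_smul, rankOneElt_smul, smul_add])
      (fun x f g => eq_of_smul_eq hB fun y => by
        rw [add_smul, rankOneElt_smul, rankOneElt_smul, rankOneElt_smul, RDual.add_apply, op_add,
          add_smul]))
    (fun r x f => eq_of_smul_eq hB fun y => by
      rw [biadd_apply, biadd_apply, rankOneElt_smul, rankOneElt_smul, RDual.smul_apply, op_mul,
        mul_smul])
  coev_lsmul b z := by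
    induction z using induction_on with
    | zero => rw [smul_zero, map_zero, smul_zero]
    | tmul x f =>
      refine eq_of_smul_eq hB fun y => ?_
      rw [lsmul_tmul, lift_tmul, lift_tmul, biadd_apply, biadd_apply, smul_eq_mul, mul_smul,
        rankOneElt_smul, rankOneElt_smul]
      exact (smul_comm b (op (f y)) x).symm
    | add x y hx hy => rw [smul_add, map_add, map_add, smul_add, hx, hy]
  coev_rsmul b z := by
    induction z using induction_on with
    | zero => rw [smul_zero, map_zero, smul_zero]
    | tmul x f =>
      refine eq_of_smul_eq hB fun y => ?_
      rw [rsmul_tmul, lift_tmul, lift_tmul, biadd_apply, biadd_apply, op_smul_eq_mul, mul_smul,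
        rankOneElt_smul, rankOneElt_smul, RDual.op_smul_apply]
    | add x y hx hy => rw [smul_add, map_add, map_add, smul_add, hx, hy]
  coev_smul x f y := rankOneElt_smul hB x f y
  smul_coev f x g := LinearMap.ext fun y => by
    change f (rankOneElt hB x g • y) = f x * g y
    rw [rankOneElt_smul, map_smul, op_smul_eq_mul]

theorem standardDual_exists_ev_eq_one (hT : IsProgenerator A T) :
    ∃ z, (standardDual α β hB).ev z = 1 :=
  (standardDual α β hB).exists_ev_eq_one hT fun f x => ⟨tmul β β f x, rfl⟩

/-- A dual basis `(eᵢ, fᵢ)` of `T` over `A` writes the identity as `Σ eᵢ fᵢ(-)`. -/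
theorem standardDual_exists_coev_eq_one (hT : IsProgenerator A T) :
    ∃ z, (standardDual α β hB).coev z = 1 := by
  have := hT.finite
  have := hT.projective
  obtain ⟨n, e, f, hef⟩ := exists_dual_basis (A := A) (T := T)
  refine ⟨∑ i, tmul α α (e i) (f i), eq_of_smul_eq hB fun x => ?_⟩
  rw [map_sum, Finset.sum_smul, one_smul]
  conv_rhs => rw [← hef x]
  exact Finset.sum_congr rfl fun i _ => rankOneElt_smul hB (e i) (f i) x

end Standard

end Pen

/-! ### Coactions of `C` as comodule structures over `A ⊗_R C` -/

namespace RightEntwining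

variable {R A C : Type u} [Ring R] [Ring A] [AddCommGroup C] [Module R C]
  [Module Rᵐᵒᵖ C] [SMulCommClass R Rᵐᵒᵖ C] {α : R →+* A} {K : Coring R C} (E : RightEntwining α K)
  {M : Type u} [AddCommGroup M] [Module Aᵐᵒᵖ M]

/-- The map `ψ(- ⊗ a)`. -/
def twist (a : A) : C →+ BTensor α (RingHom.id R) A C :=
  E.ψ.comp ((BTensor.mk (RingHom.id R) α).flip a)

theorem twist_smul (a : A) (r : R) (c : C) :
    E.twist a (RingHom.id R r • c) = α r • E.twist a c :=
  E.ψ_lsmul r (tmul (RingHom.id R) α c a)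

/-- `t ⊗ c ↦ t ⊗ (1 ⊗ c)` -/
def expand : BTensor α (RingHom.id R) M C →+ BTensor (RingHom.id A) (RingHom.id A) M E.Cor :=
  lift (biadd (fun t c => tmul _ _ t (E.mkCor 1 c)) (fun t t' c => add_tmul _ _ _ _ _)
    (fun t c c' => by rw [mkCor_add, tmul_add])) (fun r t c => by
      rw [biadd_apply, biadd_apply, RingHom.id_apply, mkCor_smul]
      exact smul_tmul (RingHom.id A) (RingHom.id A) (α r) t _)

theorem expand_tmul (t : M) (c : C) :
    E.expand (tmul α (RingHom.id R) t c) = tmul _ _ t (E.mkCor 1 c) := rfl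

/-- `t ⊗ (a ⊗ c) ↦ t a ⊗ c` -/
def collapse : BTensor (RingHom.id A) (RingHom.id A) M E.Cor →+ BTensor α (RingHom.id R) M C :=
  lift (biadd (fun t z => actL t (E.of.symm z)) (fun t t' z => add_actL t t' _)
    (fun t z z' => by rw [map_add, map_add])) (fun a t z => (actL_smul t a (E.of.symm z)).symm)

theorem collapse_tmul (t : M) (z : E.Cor) :
    E.collapse (tmul _ _ t z) = actL t (E.of.symm z) := rfl

/-- `t a ⊗ (1 ⊗ c) = t ⊗ (a ⊗ c)`: this is what makes `expand` and `collapse` inverse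
identifications of `M ⊗_R C` with `M ⊗_A (A ⊗_R C)`. -/
theorem expand_actL (t : M) (y : BTensor α (RingHom.id R) A C) :
    E.expand (actL t y) = tmul _ _ t (E.of y) := by
  induction y using induction_on with
  | zero => rw [map_zero, map_zero, map_zero, tmul_zero]
  | tmul a c =>
    rw [actL_tmul, expand_tmul]
    refine (smul_tmul (RingHom.id A) (RingHom.id A) a t _).trans ?_
    rw [RingHom.id_apply, smul_mkCor, mul_one]
    rfl
  | add x y hx hy => rw [map_add, map_add, map_add, tmul_add, hx, hy]

theorem collapse_expand (w : BTensor α (RingHom.id R) M C) : E.collapse (E.expand w) = w := by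
  induction w using induction_on with
  | zero => rw [map_zero, map_zero]
  | tmul t c => exact actL_one_tmul t c
  | add x y hx hy => rw [map_add, map_add, hx, hy]

theorem expand_collapse (w : BTensor (RingHom.id A) (RingHom.id A) M E.Cor) :
    E.expand (E.collapse w) = w := by
  induction w using induction_on with
  | zero => rw [map_zero, map_zero]
  | tmul t z => rw [collapse_tmul, expand_actL, AddEquiv.apply_symm_apply]
  | add x y hx hy => rw [map_add, map_add, hx, hy]

theorem expand_lsmul {B : Type u} [Ring B] [Module B M] [SMulCommClass B Aᵐᵒᵖ M] (b : B)
    (w : BTensor α (RingHom.id R) M C) : E.expand (b • w) = b • E.expand w := by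
  induction w using induction_on with
  | zero => rw [smul_zero, map_zero, smul_zero]
  | tmul t c => rfl
  | add x y hx hy => rw [smul_add, map_add, map_add, smul_add, hx, hy]

/-- The right action of `A` on `M ⊗_A (A ⊗_R C)` is through `ψ`, so right linearity of a coaction
becomes a condition on `ψ(- ⊗ a)`. -/
theorem expand_twist (a : A) (w : BTensor α (RingHom.id R) M C) :
    E.expand (absorbL (mapR (φ := α) (ψ := RingHom.id R) α (E.twist a) (E.twist_smul a) w)) =
      op a • E.expand w := by
  induction w using induction_on with
  | zero => rw [map_zero, map_zero, map_zero, smul_zero]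
  | tmul t c =>
    rw [mapR_tmul, absorbL_tmul, expand_actL, expand_tmul, rsmul_tmul, op_smul_mkCor, one_smul]
    rfl
  | add x y hx hy => rw [map_add, map_add, map_add, map_add, smul_add, hx, hy]

theorem incl₂_one_smul (r : R) (w : BTensor (RingHom.id R) (RingHom.id R) C C) :
    E.incl₂ 1 (r • w) = α r • E.incl₂ 1 w := by
  induction w using induction_on with
  | zero => rw [smul_zero, map_zero, smul_zero]
  | tmul d e =>
    rw [lsmul_tmul, incl₂_tmul, incl₂_tmul, mkCor_smul, lsmul_tmul]
  | add x y hx hy => rw [smul_add, map_add, map_add, smul_add, hx, hy]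

/-- `t ⊗ (c ⊗ c') ↦ t ⊗ ((1 ⊗ c) ⊗ (1 ⊗ c'))` -/
def expand₂ : BTensor α (RingHom.id R) M (BTensor (RingHom.id R) (RingHom.id R) C C) →+
    BTensor (RingHom.id A) (RingHom.id A) M
      (BTensor (RingHom.id A) (RingHom.id A) E.Cor E.Cor) :=
  lift (biadd (fun t w => tmul _ _ t (E.incl₂ 1 w)) (fun t t' c => add_tmul _ _ _ _ _)
    (fun t c c' => by rw [map_add, tmul_add])) (fun r t c => by
      rw [biadd_apply, biadd_apply, RingHom.id_apply, incl₂_one_smul]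
      exact smul_tmul (RingHom.id A) (RingHom.id A) (α r) t _)

theorem expand₂_tmul (t : M) (w : BTensor (RingHom.id R) (RingHom.id R) C C) :
    E.expand₂ (tmul α (RingHom.id R) t w) = tmul _ _ t (E.incl₂ 1 w) := rfl

theorem mapR_comul_expand (w : BTensor α (RingHom.id R) M C) :
    mapR (φ := RingHom.id A) (ψ := RingHom.id A) (RingHom.id A) E.comul E.comul_lsmul
      (E.expand w) = E.expand₂ (mapR (φ := α) (ψ := RingHom.id R) (RingHom.id R) K.comul
        K.comul_lsmul w) := by
  induction w using induction_on with
  | zero => simp only [map_zero]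
  | tmul t c => rw [expand_tmul, mapR_tmul, mapR_tmul, expand₂_tmul, comul_mkCor]
  | add x y hx hy => simp only [map_add, hx, hy]

theorem ract_counit_expand (w : BTensor α (RingHom.id R) M C) :
    ract (φ := RingHom.id A) (ψ := RingHom.id A) (RingHom.id A) (fun _ => rfl)
      (mapR (φ := RingHom.id A) (ψ := RingHom.id A) (RingHom.id A) E.counit E.counit_lsmul
        (E.expand w)) =
      ract (φ := α) (ψ := RingHom.id R) α (fun _ => rfl)
        (mapR (φ := α) (ψ := RingHom.id R) (RingHom.id R) K.counit K.counit_lsmul w) := by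
  induction w using induction_on with
  | zero => simp only [map_zero]
  | tmul t c =>
    rw [expand_tmul, mapR_tmul, mapR_tmul, ract_tmul, ract_tmul, counit_mkCor, one_mul,
      RingHom.id_apply]
  | add x y hx hy => simp only [map_add, hx, hy]

variable (ρ : M →+ BTensor α (RingHom.id R) M C)
  (hρ : ∀ (r : R) x, ρ (op (α r) • x) = op r • ρ x)

/-- Iterating the coaction over `A` is the expansion of iterating it over `R`; with
`mapR_comul_expand` this translates coassociativity between the two settings. -/
theorem assoc_mapL_expand (h : ∀ (a : A) x, (E.expand.comp ρ) (op a • x) =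
    op a • (E.expand.comp ρ) x) (w : BTensor α (RingHom.id R) M C) :
    assoc (mapL (φ := RingHom.id A) (ψ := RingHom.id A) (RingHom.id A) (E.expand.comp ρ) h
      (E.expand w)) = E.expand₂ (coactExtR ρ hρ (RingHom.id R) w) := by
  induction w using induction_on with
  | zero => simp only [map_zero]
  | tmul t c =>
    rw [expand_tmul, mapL_tmul, coactExtR_tmul, AddMonoidHom.comp_apply]
    generalize ρ t = w
    induction w using induction_on with
    | zero => simp only [map_zero, zero_tmul]
    | tmul t c => rfl
    | add x y hx hy => simp only [map_add, add_tmul, hx, hy]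
  | add x y hx hy => simp only [map_add, hx, hy]

/-- A coaction of `C` on `M` compatible with the entwining makes `M` a comodule over `A ⊗_R C`. -/
def comodule
    (h_smul : ∀ a x, absorbL (mapR (φ := α) (ψ := RingHom.id R) α (E.twist a) (E.twist_smul a)
      (ρ x)) = ρ (op a • x))
    (h_comul : ∀ x, mapR (φ := α) (ψ := RingHom.id R) (RingHom.id R) K.comul K.comul_lsmul (ρ x) =
      coactExtR ρ hρ (RingHom.id R) (ρ x))
    (h_counit : ∀ x, mapR (φ := α) (ψ := RingHom.id R) (RingHom.id R) K.counit K.counit_lsmul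
      (ρ x) = tmul α (RingHom.id R) x 1) : RightComodule E.coring M where
  coact := E.expand.comp ρ
  coact_rsmul a x := by
    rw [AddMonoidHom.comp_apply, AddMonoidHom.comp_apply, ← h_smul, expand_twist]
  coassoc x := by
    refine (E.assoc_mapL_expand ρ hρ _ (ρ x)).trans ?_
    rw [← h_comul]
    exact (E.mapR_comul_expand (ρ x)).symm
  counit x := by
    refine (E.ract_counit_expand (ρ x)).trans ?_
    rw [h_counit, ract_tmul, map_one, op_one, one_smul]

end RightEntwining

/-! ### From a herd to a right Galois comodule -/

section Herd

variable {R S A B : Type u} [Ring R] [Ring S] [Ring A] [Ring B] {α : R →+* A} {β : S →+* B}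
  {T : Type u} [AddCommGroup T] [Module B T] [Module Aᵐᵒᵖ T] [SMulCommClass B Aᵐᵒᵖ T]
  {P : Type u} [AddCommGroup P] [Module A P] [Module Bᵐᵒᵖ P] [SMulCommClass A Bᵐᵒᵖ P]
  {d : FormalDual α β T P}

theorem LeftDescent.injective (hβ : LeftDescent β) : Function.Injective β := fun s s' h => by
  refine hβ.unit_injective S ?_
  have key : ∀ s : S, unitR (RingHom.id S) β s = tmul (RingHom.id S) β 1 (β s) := fun s => by
    have := smul_tmul (RingHom.id S) β s (1 : S) (1 : B)
    rwa [RingHom.id_apply, op_smul_eq_mul, one_mul, smul_eq_mul, mul_one] at this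
  rw [key, key, h]

/-- Exactness of the unit sequence for `N = S`, under the identification of `S ⊗_S B` with `B`. -/
theorem LeftDescent.exists_of_tmul_eq (hβ : LeftDescent β) (b : B)
    (h : tmul β β 1 b = tmul β β b 1) : ∃ s, β s = b := by
  obtain ⟨s, hs⟩ := hβ.unit_exact S (tmul (RingHom.id S) β 1 b) (by
    rw [mapL_tmul, unitR_apply]
    exact congrArg (mapL (φ := β) (ψ := β) (N := B) β (BTensor.mk (RingHom.id S) β (1 : S))
      (fun _ _ => rfl)) h)
  have := congrArg (lact (φ := RingHom.id S) (ψ := β) β (fun _ => rfl)) hs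
  refine ⟨s, ?_⟩
  rwa [unitR_apply, lact_tmul, lact_tmul, smul_eq_mul, smul_eq_mul, mul_one, map_one, one_mul] at this

namespace Shepherd

variable (σ : Shepherd d) (hα : RightDescent α)

/-- `T` as a comodule over the `A`-coring `A ⊗_R C`. -/
noncomputable def comoduleR : RightComodule (σ.entwiningR hα).coring T :=
  (σ.entwiningR hα).comodule (σ.coactR hα) (σ.coactR_rsmul hα) (σ.absorbL_mapR_twistR hα)
    (σ.mapR_comulR hα) (σ.mapR_counitR hα)

theorem comoduleR_coact (x : T) :
    (σ.comoduleR hα).coact x = (σ.entwiningR hα).expand (σ.coactR hα x) := rfl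

/-- The axiom `ev(p ⊗ t) q = p coev(t ⊗ q)` with a spectator in `T`. -/
theorem lact_evL (p : P) (z : BTensor α α T (BTensor β β P T)) :
    lact (φ := α) (ψ := α) (RingHom.id A) (fun _ => rfl) (d.evL p z) = actL p (d.coevMapL z) := by
  induction z using induction_on with
  | zero => simp only [map_zero]
  | tmul t w =>
    rw [d.evL_tmul, lact_tmul, d.coevMapL_tmul]
    induction w using induction_on with
    | zero => simp only [map_zero, smul_zero]
    | tmul q y => rw [lsmul_tmul, d.coevL_tmul, actL_tmul, d.smul_coev, RingHom.id_apply]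
    | add x y hx hy => simp only [map_add, smul_add, hx, hy]
  | add x y hx hy => simp only [map_add, hx, hy]

/-- Multiplication undoes `δ`, by the unit law for `coev`. This is the counit condition of a descent
datum, which its definition does not include. -/
theorem lact_hatL_γ (z : BTensor β β P T) :
    lact (φ := α) (ψ := α) (RingHom.id A) (fun _ => rfl) (d.hatL σ.γ σ.γ_lsmul z) = z := by
  induction z using induction_on with
  | zero => simp only [map_zero]
  | tmul p x => rw [d.hatL_tmul, lact_evL, coevMapL_γ, actL_one_tmul]
  | add x y hx hy => simp only [map_add, hx, hy]

/-- Injective because `δ`, which factors through `descR`, has multiplication as a left inverse.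
Surjective because `a c` descends to `a ⊗ c`. -/
theorem descR_bijective : Function.Bijective (σ.descR hα) := by
  refine ⟨fun z w h => ?_, fun y => ?_⟩
  · rw [← σ.lact_hatL_γ z, ← σ.lact_hatL_γ w, ← σ.mapR_inclR_descR hα, ← σ.mapR_inclR_descR hα, h]
  · induction y using induction_on with
    | zero => exact ⟨0, map_zero _⟩
    | tmul a c =>
      exact ⟨a • σ.inclR c, by
        rw [descR_lsmul, descR_inclR, unitL_apply, lsmul_tmul, smul_eq_mul, mul_one]⟩
    | add x y hx hy =>
      obtain ⟨z, rfl⟩ := hx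
      obtain ⟨w, rfl⟩ := hy
      exact ⟨z + w, map_add _ _ _⟩

/-- The canonical map at the functional `ev(p ⊗ -)`; it agrees with `descR` by `evL_coactR`. -/
theorem evalAct_comoduleR (p : P) (x : T) :
    RightComodule.evalAct (d.toRDual p) ((σ.comoduleR hα).coact x) =
      (σ.entwiningR hα).of (σ.descR hα (tmul β β p x)) := by
  rw [comoduleR_coact, ← evL_coactR]
  generalize σ.coactR hα x = w
  induction w using induction_on with
  | zero => simp only [map_zero]
  | tmul t c =>
    rw [RightEntwining.expand_tmul, RightComodule.evalAct_tmul, RightEntwining.smul_mkCor, mul_one,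
      d.evL_tmul]
    rfl
  | add x y hx hy => simp only [map_add, hx, hy]

/-- Applying `coev` to `γ(b x) = b γ(x)` gives `1 ⊗ b x = b ⊗ x` in `B ⊗_S T`. Pairing with `p`
gives `1 ⊗ b coev(w) = b ⊗ coev(w)`, and some value of `coev` is `1`. -/
theorem eq_smul_of_γ (h1 : ∃ z, d.coev z = 1) (b : B) (h : ∀ x, σ.γ (b • x) = b • σ.γ x) :
    tmul β β 1 b = tmul β β b 1 := by
  have key : ∀ x : T, tmul β β (1 : B) (b • x) = tmul β β b x := fun x => by
    rw [← σ.coevMapL_γ, h, d.coevMapL_lsmul, coevMapL_γ, lsmul_tmul, smul_eq_mul, mul_one]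
  have key' : ∀ w : BTensor α α T P, tmul β β (1 : B) (b * d.coev w) = tmul β β b (d.coev w) :=
    fun w => by
      induction w using induction_on with
      | zero => rw [map_zero, mul_zero, tmul_zero, tmul_zero]
      | tmul x p =>
        have h2 := congrArg (d.coevR p) (key x)
        rw [d.coevR_tmul, d.coevR_tmul, ← lsmul_tmul, d.coev_lsmul] at h2
        exact h2
      | add x y hx hy => rw [map_add, mul_add, tmul_add, tmul_add, hx, hy]
  obtain ⟨z, hz⟩ := h1
  have h3 := key' z
  rwa [hz, mul_one] at h3

/-- `expand` is injective and `B`-linear, so colinearity can be read on the coaction of `C`. -/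
theorem comoduleR_isColinear_iff (b : B) : (σ.comoduleR hα).IsColinear (lmulEnd A b) ↔
    ∀ x, σ.coactR hα (b • x) = b • σ.coactR hα x := by
  refine forall_congr' fun x => ?_
  have h2 : ∀ z : BTensor (RingHom.id A) (RingHom.id A) T (σ.entwiningR hα).Cor,
      mapL (φ := RingHom.id A) (ψ := RingHom.id A) (RingHom.id A)
        (lmulEnd A b : T →ₗ[Aᵐᵒᵖ] T).toAddMonoidHom
          (fun a x => (lmulEnd A b : T →ₗ[Aᵐᵒᵖ] T).map_smul (op a) x) z = b • z := fun z => by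
    induction z using induction_on with
    | zero => rw [map_zero, smul_zero]
    | tmul t c => rfl
    | add x y hx hy => rw [map_add, smul_add, hx, hy]
  rw [h2, comoduleR_coact, comoduleR_coact, ← RightEntwining.expand_lsmul]
  exact (Function.LeftInverse.injective (σ.entwiningR hα).collapse_expand).eq_iff

theorem comoduleR_isGalois (hβ : LeftDescent β) (hT : IsProgenerator A T)
    (hB : Function.Bijective (Module.toModuleEnd Aᵐᵒᵖ T : B →+* Module.End Aᵐᵒᵖ T)) :
    (σ.comoduleR hα).IsGalois β where
  finite := hT.finite
  projective := hT.projective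
  colinear s := (σ.comoduleR_isColinear_iff hα (β s)).2 (σ.coactR_lsmul hα s)
  injective s s' h := hβ.injective (hB.1 h)
  full f hf := by
    -- Every `A`-linear endomorphism is left multiplication by some `b ∈ B`. If it commutes with
    -- `ρ`, it commutes with `γ`, which is `ρ` followed by the inclusion of `C`.
    obtain ⟨b, rfl⟩ := hB.2 f
    obtain ⟨s, rfl⟩ := hβ.exists_of_tmul_eq b (σ.eq_smul_of_γ (σ.exists_coev_eq_one hT hB) b
      fun x => by
        rw [← σ.mapR_inclR_coactR hα, (σ.comoduleR_isColinear_iff hα b).1 hf, mapR_lsmul,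
          mapR_inclR_coactR])
    exact ⟨s, rfl⟩
  can_bijective := by
    -- The canonical map is defined on `T^* ⊗_S T`; the identification of the pen with `T^*` turns
    -- it into `descR`.
    have hθ := d.toRDual_bijective (σ.exists_coev_eq_one hT hB)
    let θ := AddEquiv.ofBijective d.toRDual hθ
    have hθ' : ∀ (s : S) f, θ.symm (op (β s) • f) = op (β s) • θ.symm f := fun s f => by
      rw [AddEquiv.symm_apply_eq]
      exact (congrArg (op (β s) • ·) (θ.apply_symm_apply f).symm).trans
        (d.toRDual_rsmul s _).symm
    let Θ : BTensor β β (RDual A T) T →+ BTensor β β P T :=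
      mapL (φ := β) (ψ := β) β θ.symm.toAddMonoidHom hθ'
    have hΘ : Function.Bijective Θ := by
      refine Function.bijective_iff_has_inverse.2
        ⟨mapL (φ := β) (ψ := β) β d.toRDual d.toRDual_rsmul, fun z => ?_, fun z => ?_⟩
      · induction z using induction_on with
        | zero => simp only [map_zero]
        | tmul f x => exact congrArg (tmul β β · x) (θ.apply_symm_apply f)
        | add x y hx hy => simp only [map_add, hx, hy]
      · induction z using induction_on with
        | zero => simp only [map_zero]
        | tmul f x => exact congrArg (tmul β β · x) (θ.symm_apply_apply f)
        | add x y hx hy => simp only [map_add, hx, hy]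
    have key : ∀ z, (σ.comoduleR hα).can β
        (fun s => (σ.comoduleR_isColinear_iff hα (β s)).2 (σ.coactR_lsmul hα s)) z =
          (σ.entwiningR hα).of (σ.descR hα (Θ z)) := fun z => by
      induction z using induction_on with
      | zero => simp only [map_zero]
      | tmul f x =>
        obtain ⟨p, rfl⟩ := hθ.2 f
        have h1 : Θ (tmul β β (d.toRDual p) x) = tmul β β p x :=
          congrArg (tmul β β · x) (θ.symm_apply_apply p)
        rw [h1]
        exact σ.evalAct_comoduleR hα p x
      | add x y hx hy => simp only [map_add, hx, hy]
    rw [show ⇑((σ.comoduleR hα).can β _) = _ from funext key]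
    exact ((σ.entwiningR hα).of.bijective.comp (σ.descR_bijective hα)).comp hΘ

end Shepherd

theorem IsHerd.isRightEntwinedGalois (hα : RightDescent α) (hβ : LeftDescent β)
    (hT : IsProgenerator A T)
    (hB : Function.Bijective (Module.toModuleEnd Aᵐᵒᵖ T : B →+* Module.End Aᵐᵒᵖ T))
    (h : IsHerd α β T) : IsRightEntwinedGalois α β T := by
  obtain ⟨P, _, _, _, _, d, ⟨σ⟩⟩ := h
  exact ⟨σ.CoringR, _, _, _, _, σ.coringR hα, σ.entwiningR hα, σ.comoduleR hα,
    σ.comoduleR_isGalois hα hβ hT hB⟩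

end Herd

theorem BTensor.assoc_lsmul {R₁ R₂ P₁ Q₁ P₂ Q₂ : Type*} [Ring R₁] [Ring R₂] [Ring P₁] [Ring Q₁]
    [Ring P₂] [Ring Q₂] {φ₁ : R₁ →+* P₁} {ψ₁ : R₁ →+* Q₁} {φ₂ : R₂ →+* P₂} {ψ₂ : R₂ →+* Q₂}
    {M N K : Type*} [AddCommGroup M] [Module P₁ᵐᵒᵖ M] [AddCommGroup N] [Module Q₁ N]
    [Module P₂ᵐᵒᵖ N] [SMulCommClass Q₁ P₂ᵐᵒᵖ N] [AddCommGroup K] [Module Q₂ K] {L : Type*} [Ring L]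
    [Module L M] [SMulCommClass L P₁ᵐᵒᵖ M] (l : L)
    (z : BTensor φ₂ ψ₂ (BTensor φ₁ ψ₁ M N) K) : assoc (l • z) = l • assoc z := by
  induction z using induction_on with
  | zero => rw [smul_zero, map_zero, smul_zero]
  | tmul z k =>
    induction z using induction_on with
    | zero => rw [zero_tmul, smul_zero, map_zero, smul_zero]
    | tmul m n => rfl
    | add x y hx hy => rw [add_tmul, smul_add, map_add, map_add, smul_add, hx, hy]
  | add x y hx hy => rw [smul_add, map_add, map_add, smul_add, hx, hy]

/-! ### From a right Galois coaction to a shepherd -/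

section Herd

variable {R S A B : Type u} [Ring R] [Ring S] [Ring A] [Ring B] {α : R →+* A} {β : S →+* B}
  {T : Type u} [AddCommGroup T] [Module B T] [Module Aᵐᵒᵖ T] [SMulCommClass B Aᵐᵒᵖ T]
  {P : Type u} [AddCommGroup P] [Module A P] [Module Bᵐᵒᵖ P] [SMulCommClass A Bᵐᵒᵖ P]
  {C : Type u} [AddCommGroup C] [Module R C] [Module Rᵐᵒᵖ C] [SMulCommClass R Rᵐᵒᵖ C]

/-- A coaction of an `R`-coring `C` on `T` whose canonical map `P ⊗_S T → A ⊗_R C` is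
bijective. -/
structure RightGaloisCoaction (d : FormalDual α β T P) (K : Coring R C) where
  coact : T →+ BTensor α (RingHom.id R) T C
  lsmul : ∀ s x, coact (β s • x) = β s • coact x
  rsmul : ∀ (r : R) x, coact (op (α r) • x) = op r • coact x
  comul : ∀ x, mapR (φ := α) (ψ := RingHom.id R) (RingHom.id R) K.comul K.comul_lsmul (coact x) =
    coactExtR coact rsmul (RingHom.id R) (coact x)
  counit : ∀ x, mapR (φ := α) (ψ := RingHom.id R) (RingHom.id R) K.counit K.counit_lsmul
    (coact x) = tmul α (RingHom.id R) x 1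
  bijective : Function.Bijective (d.hatL coact lsmul)

namespace RightGaloisCoaction

variable {d : FormalDual α β T P} {K : Coring R C} (G : RightGaloisCoaction d K)

/-- The canonical map `P ⊗_S T ≃ A ⊗_R C`. -/
noncomputable def equiv : BTensor β β P T ≃+ BTensor α (RingHom.id R) A C :=
  AddEquiv.ofBijective _ G.bijective

theorem equiv_tmul (p : P) (x : T) : G.equiv (tmul β β p x) = d.evL p (G.coact x) := rfl

theorem equiv_lsmul (a : A) (z : BTensor β β P T) : G.equiv (a • z) = a • G.equiv z :=
  d.hatL_lsmul G.coact G.lsmul a z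

theorem equiv_rsmul (r : R) (z : BTensor β β P T) :
    G.equiv (op (α r) • z) = op r • G.equiv z :=
  d.hatL_rsmul (K := R) G.coact G.lsmul r (α r) (G.rsmul r) z

theorem equiv_symm_lsmul (a : A) (y : BTensor α (RingHom.id R) A C) :
    G.equiv.symm (a • y) = a • G.equiv.symm y := by
  rw [AddEquiv.symm_apply_eq, equiv_lsmul, AddEquiv.apply_symm_apply]

theorem equiv_symm_rsmul (r : R) (y : BTensor α (RingHom.id R) A C) :
    G.equiv.symm (op r • y) = op (α r) • G.equiv.symm y := by
  rw [AddEquiv.symm_apply_eq, equiv_rsmul, AddEquiv.apply_symm_apply]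

/-- The map `C → P ⊗_S T` that corresponds to `c ↦ 1 ⊗ c`. -/
noncomputable def transl : C →+ BTensor β β P T :=
  G.equiv.symm.toAddMonoidHom.comp (unitL α (RingHom.id R))

theorem equiv_transl (c : C) : G.equiv (G.transl c) = unitL α (RingHom.id R) c :=
  G.equiv.apply_symm_apply _

theorem transl_lsmul (r : R) (c : C) : G.transl (RingHom.id R r • c) = α r • G.transl c :=
  G.equiv.injective (by rw [equiv_lsmul, equiv_transl, equiv_transl, unitL_smul])

theorem transl_rsmul (r : R) (c : C) : G.transl (op r • c) = op (α r) • G.transl c :=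
  G.equiv.injective (by rw [equiv_rsmul, equiv_transl, equiv_transl]; rfl)

/-- The map `T → T ⊗_R P ⊗_S T` induced by the coaction. -/
noncomputable def γ : T →+ BTensor α α T (BTensor β β P T) :=
  (mapR (φ := α) (ψ := RingHom.id R) α G.transl G.transl_lsmul).comp G.coact

theorem γ_lsmul (s : S) (x : T) : G.γ (β s • x) = β s • G.γ x := by
  rw [γ, AddMonoidHom.comp_apply, G.lsmul, mapR_lsmul, AddMonoidHom.comp_apply]

theorem γ_rsmul (r : R) (x : T) : G.γ (op (α r) • x) = op (α r) • G.γ x := by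
  rw [γ, AddMonoidHom.comp_apply, G.rsmul, mapR_rsmul _ _ r (α r) (G.transl_rsmul r),
    AddMonoidHom.comp_apply]

/-- The canonical map cancels the translation map, so it turns `γ` into `ρ` with a unit inserted.
All properties of `γ` below come from this. -/
theorem mapR_equiv_γ (x : T) : mapR (φ := α) (ψ := α) α G.equiv.toAddMonoidHom
    (fun r z => G.equiv_lsmul (α r) z) (G.γ x) =
      mapR (φ := α) (ψ := RingHom.id R) α (unitL α (RingHom.id R)) unitL_smul (G.coact x) :=
  mapR_mapR G.transl G.transl_lsmul _ _ _ _ G.equiv_transl _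

/-- Under the canonical map, `ev` corresponds to `A ⊗ ε`, since `(T ⊗ ε) ρ(x) = x ⊗ 1`. -/
theorem ract_mapR_counit (z : BTensor β β P T) :
    ract (φ := α) (ψ := RingHom.id R) α (fun _ => rfl) (mapR (φ := α) (ψ := RingHom.id R)
      (RingHom.id R) K.counit K.counit_lsmul (G.equiv z)) = d.ev z := by
  induction z using induction_on with
  | zero => simp only [map_zero]
  | tmul p x =>
    rw [equiv_tmul, ← d.evL_mapR, G.counit, d.evL_tmul, ract_tmul, map_one, op_one, one_smul]
  | add x y hx hy => simp only [map_add, hx, hy]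

theorem ev_transl (c : C) : d.ev (G.transl c) = α (K.counit c) := by
  rw [← G.ract_mapR_counit, equiv_transl, unitL_apply, mapR_tmul, ract_tmul, op_smul_eq_mul,
    one_mul]

theorem ev_γ (x : T) : mapR (φ := α) (ψ := α) α d.ev (fun r z => d.ev_lsmul (α r) z) (G.γ x) =
    tmul α α x 1 := by
  have h := congrArg (mapR (φ := α) (ψ := RingHom.id R) (M := T) α α.toAddMonoidHom
    (fun r s => map_mul α r s)) (G.counit x)
  refine Eq.trans ?_ (h.trans (congrArg (tmul α α x) (map_one α)))
  rw [γ, AddMonoidHom.comp_apply]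
  generalize G.coact x = w
  induction w using induction_on with
  | zero => simp only [map_zero]
  | tmul t c => rw [mapR_tmul, mapR_tmul, ev_transl]; rfl
  | add x y hx hy => simp only [map_add, hx, hy]

/-- Let `w = Σ bᵢ ⊗ xᵢ` with `Σ bᵢ ρ(xᵢ) = 0`. Pairing with `p` gives the canonical image of `Σ p bᵢ
⊗ xᵢ`, so this element vanishes for each `p`, and then so does `w` because `coev` reaches `1`. The
hypothesis `hd` says that `ev` is balanced over `B`; the axioms of a formal dual give balancedness
over `S` only. -/
theorem smulExtL_injective (hd : ∀ (p : P) (b : B) (x : T),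
      d.ev (tmul β β (op b • p) x) = d.ev (tmul β β p (b • x)))
    (h1 : ∃ z, d.coev z = 1) : Function.Injective (smulExtL G.coact G.lsmul) := by
  refine (injective_iff_map_eq_zero _).2 fun w hw => d.eq_zero_of_actL_right h1 w fun p => ?_
  have hevL : ∀ (p : P) (b : B) (w : BTensor α (RingHom.id R) T C),
      d.evL (op b • p) w = d.evL p (b • w) := fun p b w => by
    induction w using induction_on with
    | zero => simp only [smul_zero, map_zero]
    | tmul t c => rw [lsmul_tmul, d.evL_tmul, d.evL_tmul, hd]
    | add x y hx hy => rw [smul_add, map_add, map_add, hx, hy]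
  have key : G.equiv (actL p w) = d.evL p (smulExtL G.coact G.lsmul w) := by
    clear hw
    induction w using induction_on with
    | zero => simp only [map_zero]
    | tmul b x => rw [actL_tmul, equiv_tmul, smulExtL_tmul, hevL]
    | add x y hx hy => simp only [map_add, hx, hy]
  rw [hw, map_zero] at key
  exact (map_eq_zero_iff _ G.equiv.injective).1 key

/-- Both sides have the same image under `b ⊗ x ↦ b ρ(x)`: the left side because `Σ coev(x₁ ⊗ x₂)
ρ(x₃)` is the canonical map applied to the last legs of `γ(x)`, then absorbed. -/
theorem coevMapL_γ (hd : ∀ (p : P) (b : B) (x : T),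
      d.ev (tmul β β (op b • p) x) = d.ev (tmul β β p (b • x)))
    (h1 : ∃ z, d.coev z = 1) (x : T) : d.coevMapL (G.γ x) = tmul β β 1 x := by
  refine G.smulExtL_injective hd h1 ?_
  rw [← d.absorbL_mapR_hatL, smulExtL_tmul, one_smul]
  exact (congrArg absorbL (G.mapR_equiv_γ x)).trans (absorbL_unitL _)

section Ext

variable {Q X : Type u} [Ring Q] {ξ : R →+* Q} [AddCommGroup X] [Module Q X]

/-- The canonical map `P ⊗_S (T ⊗_R X) → A ⊗_R (C ⊗_R X)`. -/
noncomputable def canExt : BTensor β β P (BTensor α ξ T X) →+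
    BTensor α (RingHom.id R) A (BTensor (RingHom.id R) ξ C X) :=
  (d.evMapL (ξ := RingHom.id R)).comp (mapR (φ := β) (ψ := β) β (coactExtR G.coact G.rsmul ξ)
    (fun s w => coactExtR_lsmul (B := B) G.coact G.rsmul (β s) (fun x => G.lsmul s x) w))

theorem canExt_tmul (p : P) (w : BTensor α ξ T X) :
    G.canExt (tmul β β p w) = d.evL p (coactExtR G.coact G.rsmul ξ w) := rfl

theorem canExt_lsmul (a : A) (z : BTensor β β P (BTensor α ξ T X)) :
    G.canExt (a • z) = a • G.canExt z := by
  rw [canExt, AddMonoidHom.comp_apply, mapR_lsmul, d.evMapL_lsmul, AddMonoidHom.comp_apply]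

/-- The inverse of the canonical map. -/
noncomputable def canExtInv : BTensor α (RingHom.id R) A (BTensor (RingHom.id R) ξ C X) →+
    BTensor β β P (BTensor α ξ T X) :=
  (assoc (φ₁ := β) (ψ₁ := β) (φ₂ := α) (ψ₂ := ξ)).toAddMonoidHom.comp
    ((mapL (φ := RingHom.id R) (ψ := ξ) α G.equiv.symm.toAddMonoidHom G.equiv_symm_rsmul).comp
      (assoc (φ₁ := α) (ψ₁ := RingHom.id R) (φ₂ := RingHom.id R) (ψ₂ := ξ)).symm.toAddMonoidHom)

theorem canExtInv_tmul_tmul (a : A) (c : C) (x : X) :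
    G.canExtInv (ξ := ξ) (tmul _ _ a (tmul _ _ c x)) =
      assoc (tmul α ξ (G.equiv.symm (tmul _ _ a c)) x) := rfl

theorem canExtInv_lsmul (a : A)
    (z : BTensor α (RingHom.id R) A (BTensor (RingHom.id R) ξ C X)) :
    G.canExtInv (a • z) = a • G.canExtInv z := by
  induction z using induction_on with
  | zero => simp only [map_zero, smul_zero]
  | tmul a' v =>
    induction v using induction_on with
    | zero => simp only [map_zero, smul_zero, tmul_zero]
    | tmul c x =>
      rw [lsmul_tmul, canExtInv_tmul_tmul, canExtInv_tmul_tmul, ← lsmul_tmul, equiv_symm_lsmul,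
        ← lsmul_tmul, assoc_lsmul]
    | add x y hx hy => rw [tmul_add, smul_add, map_add, map_add, smul_add, hx, hy]
  | add x y hx hy => simp only [map_add, smul_add, hx, hy]

theorem canExtInv_insR (x : X) (y : BTensor α (RingHom.id R) A C) :
    G.canExtInv (insR α ξ x y) = assoc (tmul α ξ (G.equiv.symm y) x) := by
  induction y using induction_on with
  | zero => simp only [map_zero, zero_tmul]
  | tmul a c => rfl
  | add x y hx hy => simp only [map_add, add_tmul, hx, hy]

theorem canExtInv_canExt (z : BTensor β β P (BTensor α ξ T X)) : G.canExtInv (G.canExt z) = z := by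
  induction z using induction_on with
  | zero => simp only [map_zero]
  | tmul p w =>
    induction w using induction_on with
    | zero => simp only [map_zero, tmul_zero]
    | tmul t x =>
      have h : d.evL p (insR α ξ x (G.coact t)) = insR α ξ x (d.evL p (G.coact t)) :=
        d.evL_mapR _ _ _ _
      rw [canExt_tmul, coactExtR_tmul, h, ← equiv_tmul, canExtInv_insR, AddEquiv.symm_apply_apply,
        assoc_tmul]
    | add x y hx hy => rw [tmul_add, map_add, map_add, hx, hy]
  | add x y hx hy => simp only [map_add, hx, hy]

theorem mapR_canExt_assocAux (w : X) (z : BTensor α α T (BTensor β β P T)) :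
    mapR (φ := α) (ψ := α) α (G.canExt (ξ := ξ)) (fun r z => G.canExt_lsmul (α r) z)
      (mapR (φ := α) (ψ := α) α (assoc (φ₁ := β) (ψ₁ := β) (φ₂ := α) (ψ₂ := ξ)).toAddMonoidHom
        (fun r z => assoc_lsmul (α r) z) (assoc (tmul α ξ z w))) =
    mapR (φ := α) (ψ := α) α (insR α ξ w) (fun r z => insR_lsmul w (α r) z)
      (mapR (φ := α) (ψ := α) α G.equiv.toAddMonoidHom (fun r z => G.equiv_lsmul (α r) z) z) := by
  induction z using induction_on with
  | zero => simp only [map_zero, zero_tmul]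
  | tmul t v =>
    induction v using induction_on with
    | zero => simp only [map_zero, zero_tmul, tmul_zero]
    | tmul p y =>
      refine congrArg (tmul α α t) ?_
      change d.evL p (insR α ξ w (G.coact y)) = insR α ξ w (d.evL p (G.coact y))
      exact d.evL_mapR _ _ _ _
    | add x y hx hy => simp only [map_add, add_tmul, tmul_add, hx, hy]
  | add x y hx hy => simp only [map_add, add_tmul, hx, hy]

/-- After the extended canonical map, `γ ⊗ X` becomes `ρ ⊗ X` with a unit inserted. This handles one
side of coassociativity, where `X = P ⊗_S T`. -/
theorem mapR_canExt_mapL_γ (z : BTensor α ξ T X) :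
    mapR (φ := α) (ψ := α) α (G.canExt (ξ := ξ)) (fun r z => G.canExt_lsmul (α r) z)
      (mapR (φ := α) (ψ := α) α (assoc (φ₁ := β) (ψ₁ := β) (φ₂ := α) (ψ₂ := ξ)).toAddMonoidHom
        (fun r z => assoc_lsmul (α r) z)
          (assoc (mapL (φ := α) (ψ := ξ) α G.γ G.γ_rsmul z))) =
    mapR (φ := α) (ψ := RingHom.id R) α (unitL α (RingHom.id R)) unitL_smul
      (coactExtR G.coact G.rsmul ξ z) := by
  induction z using induction_on with
  | zero => simp only [map_zero]
  | tmul t w =>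
    rw [mapL_tmul, mapR_canExt_assocAux, mapR_equiv_γ, coactExtR_tmul]
    generalize G.coact t = w
    induction w using induction_on with
    | zero => simp only [map_zero]
    | tmul t c => rfl
    | add x y hx hy => simp only [map_add, hx, hy]
  | add x y hx hy => simp only [map_add, hx, hy]

end Ext

theorem mapR_transl_lsmul (r : R) (w : BTensor (RingHom.id R) (RingHom.id R) C C) :
    mapR (φ := RingHom.id R) (ψ := RingHom.id R) α G.transl G.transl_lsmul (RingHom.id R r • w) =
      RingHom.id R r • mapR (φ := RingHom.id R) (ψ := RingHom.id R) α G.transl G.transl_lsmul w :=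
  mapR_lsmul _ _ r w

/-- `(C ⊗ i) ∘ Δ`, where `i : C → P ⊗_S T` is the translation map. -/
noncomputable def comulTransl : C →+ BTensor (RingHom.id R) α C (BTensor β β P T) :=
  (mapR (φ := RingHom.id R) (ψ := RingHom.id R) α G.transl G.transl_lsmul).comp K.comul

theorem comulTransl_lsmul (r : R) (c : C) :
    G.comulTransl (RingHom.id R r • c) = RingHom.id R r • G.comulTransl c :=
  (congrArg _ (K.comul_lsmul r c)).trans (G.mapR_transl_lsmul r _)

/-- Coassociativity of `ρ` moves the outer coaction to a coproduct on `C`, ahead of the translation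
map. -/
theorem coactExtR_γ (x : T) : coactExtR G.coact G.rsmul α (G.γ x) =
    mapR (φ := α) (ψ := RingHom.id R) (RingHom.id R) G.comulTransl G.comulTransl_lsmul
      (G.coact x) := by
  refine (coactExtR_mapR (ξ := RingHom.id R) (ξ' := α) G.coact G.rsmul G.transl G.transl_lsmul
    (G.coact x)).trans ?_
  rw [← G.comul]
  exact mapR_mapR _ _ _ _ _ _ (fun _ => rfl) _

theorem canExt_mapR_γ (z : BTensor β β P T) :
    G.canExt (mapR (φ := β) (ψ := β) β G.γ G.γ_lsmul z) =
      mapR (φ := α) (ψ := RingHom.id R) (RingHom.id R) G.comulTransl G.comulTransl_lsmul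
        (G.equiv z) := by
  induction z using induction_on with
  | zero => simp only [map_zero]
  | tmul p x => rw [mapR_tmul, canExt_tmul, coactExtR_γ, d.evL_mapR, equiv_tmul]
  | add x y hx hy => simp only [map_add, hx, hy]

/-- The other side of coassociativity. The canonical map cancels the first translation map, so here
as well only `(ρ ⊗ P ⊗ T) γ(x)` with a unit inserted remains. -/
theorem mapR_canExt_mapR_mapR_γ (x : T) :
    mapR (φ := α) (ψ := α) α (G.canExt (ξ := α)) (fun r z => G.canExt_lsmul (α r) z)
      (mapR (φ := α) (ψ := α) α (mapR (φ := β) (ψ := β) β G.γ G.γ_lsmul)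
        (fun r z => mapR_lsmul _ _ (α r) z) (G.γ x)) =
    mapR (φ := α) (ψ := RingHom.id R) α (unitL α (RingHom.id R)) unitL_smul
      (coactExtR G.coact G.rsmul α (G.γ x)) := by
  rw [coactExtR_γ]
  generalize hz : G.coact x = z
  have hγ : G.γ x = mapR (φ := α) (ψ := RingHom.id R) α G.transl G.transl_lsmul z := by
    rw [← hz]; rfl
  rw [hγ]
  clear hγ hz
  induction z using induction_on with
  | zero => simp only [map_zero]
  | tmul t c =>
    rw [mapR_tmul, mapR_tmul, mapR_tmul, canExt_mapR_γ, equiv_transl, unitL_apply, mapR_tmul,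
      mapR_tmul, mapR_tmul, unitL_apply]
  | add x y hx hy => simp only [map_add, hx, hy]

/-- The shepherd given by a Galois coaction. -/
noncomputable def shepherd (hd : ∀ (p : P) (b : B) (x : T),
      d.ev (tmul β β (op b • p) x) = d.ev (tmul β β p (b • x)))
    (h1 : ∃ z, d.coev z = 1) : Shepherd d where
  γ := G.γ
  γ_lsmul := G.γ_lsmul
  γ_rsmul := G.γ_rsmul
  coev_γ x := by
    rw [← G.coevMapL_γ hd h1 x]
    generalize G.γ x = z
    induction z using induction_on with
    | zero => simp only [map_zero]
    | tmul t w =>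
      induction w using induction_on with
      | zero => simp only [map_zero, tmul_zero]
      | tmul p x => rfl
      | add x y hx hy => simp only [map_add, tmul_add, hx, hy]
    | add x y hx hy => simp only [map_add, hx, hy]
  ev_γ := G.ev_γ
  -- The extended canonical map has a left `A`-linear retraction, so `T ⊗_R -` keeps it injective,
  -- and the two sides may be compared after it.
  coassoc x := mapR_injective_of_retraction (G.canExt (ξ := α))
    (fun r z => G.canExt_lsmul (α r) z) G.canExtInv (fun r z => G.canExtInv_lsmul (α r) z)
    G.canExtInv_canExt ((G.mapR_canExt_mapL_γ (G.γ x)).trans (G.mapR_canExt_mapR_mapR_γ x).symm)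

end RightGaloisCoaction

end Herd

/-! ### Recovering the coaction of `C` from a comodule over `A ⊗_R C` -/

namespace RightEntwining

variable {R A C : Type u} [Ring R] [Ring A] [AddCommGroup C] [Module R C]
  [Module Rᵐᵒᵖ C] [SMulCommClass R Rᵐᵒᵖ C] {α : R →+* A} {K : Coring R C} (E : RightEntwining α K)
  {M : Type u} [AddCommGroup M] [Module Aᵐᵒᵖ M]

theorem of_symm_rsmul (r : R) (z : E.Cor) : E.of.symm (op (α r) • z) = op r • E.of.symm z :=
  E.op_α_smul r z

theorem collapse_rsmul (r : R) (z : BTensor (RingHom.id A) (RingHom.id A) M E.Cor) :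
    E.collapse (op (α r) • z) = op r • E.collapse z := by
  induction z using induction_on with
  | zero => simp only [smul_zero, map_zero]
  | tmul t z => rw [rsmul_tmul, collapse_tmul, collapse_tmul, of_symm_rsmul, rsmul_actL]
  | add x y hx hy => simp only [smul_add, map_add, hx, hy]

theorem collapse_lsmul {B : Type u} [Ring B] [Module B M] [SMulCommClass B Aᵐᵒᵖ M] (b : B)
    (z : BTensor (RingHom.id A) (RingHom.id A) M E.Cor) :
    E.collapse (b • z) = b • E.collapse z := by
  induction z using induction_on with
  | zero => simp only [smul_zero, map_zero]
  | tmul t z => rw [lsmul_tmul, collapse_tmul, collapse_tmul, smul_actL]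
  | add x y hx hy => simp only [smul_add, map_add, hx, hy]

/-- `(a ⊗ c) ⊗ (a' ⊗ c') ↦ a ψ(c ⊗ a') ⊗ c'` -/
def merge : BTensor (RingHom.id A) (RingHom.id A) E.Cor E.Cor →+
    BTensor α (RingHom.id R) A (BTensor (RingHom.id R) (RingHom.id R) C C) :=
  (assoc (φ₁ := α) (ψ₁ := RingHom.id R) (φ₂ := RingHom.id R)
    (ψ₂ := RingHom.id R)).toAddMonoidHom.comp
    ((mapL (φ := α) (ψ := RingHom.id R) (RingHom.id R) E.of.symm.toAddMonoidHom
      E.of_symm_rsmul).comp E.collapse)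

theorem merge_apply (z : BTensor (RingHom.id A) (RingHom.id A) E.Cor E.Cor) :
    E.merge z = assoc (mapL (φ := α) (ψ := RingHom.id R) (RingHom.id R) E.of.symm.toAddMonoidHom
      E.of_symm_rsmul (E.collapse z)) := rfl

theorem merge_lsmul (a : A) (z : BTensor (RingHom.id A) (RingHom.id A) E.Cor E.Cor) :
    E.merge (a • z) = a • E.merge z := by
  rw [merge_apply, merge_apply, collapse_lsmul]
  exact (congrArg assoc (mapL_lsmul E.of.symm.toAddMonoidHom E.of_symm_rsmul a a
    (fun _ => rfl) _)).trans (assoc_lsmul a _)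

theorem merge_incl₂ (w : BTensor (RingHom.id R) (RingHom.id R) C C) :
    E.merge (E.incl₂ 1 w) = tmul α (RingHom.id R) 1 w := by
  induction w using induction_on with
  | zero => rw [map_zero, map_zero, tmul_zero]
  | tmul c c' =>
    rw [incl₂_tmul, merge_apply, collapse_tmul]
    refine (congrArg (fun y => assoc (mapL (φ := α) (ψ := RingHom.id R) (RingHom.id R)
      E.of.symm.toAddMonoidHom E.of_symm_rsmul y)) (actL_one_tmul (E.mkCor 1 c) c')).trans ?_
    rfl
  | add x y hx hy => rw [map_add, map_add, tmul_add, hx, hy]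

/-- The inverse of `expand₂`. -/
def collapse₂ : BTensor (RingHom.id A) (RingHom.id A) M
      (BTensor (RingHom.id A) (RingHom.id A) E.Cor E.Cor) →+
    BTensor α (RingHom.id R) M (BTensor (RingHom.id R) (RingHom.id R) C C) :=
  lift (biadd (fun t w => actL t (E.merge w)) (fun t t' w => add_actL t t' _)
    (fun t w w' => by rw [map_add, map_add])) (fun a t w => by
      rw [biadd_apply, biadd_apply, RingHom.id_apply, merge_lsmul, actL_smul])

/-- This shows that `expand₂` is injective, which allows coassociativity over `A` to be pulled back
to `R`. -/
theorem collapse₂_expand₂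
    (z : BTensor α (RingHom.id R) M (BTensor (RingHom.id R) (RingHom.id R) C C)) :
    E.collapse₂ (E.expand₂ z) = z := by
  induction z using induction_on with
  | zero => rw [map_zero, map_zero]
  | tmul t w =>
    rw [expand₂_tmul]
    change actL t (E.merge (E.incl₂ 1 w)) = _
    rw [merge_incl₂, actL_one_tmul]
  | add x y hx hy => rw [map_add, map_add, hx, hy]

section Comodule

variable (ρ : RightComodule E.coring M)

/-- The coaction of `C` underlying a comodule over `A ⊗_R C`. -/
def coactC : M →+ BTensor α (RingHom.id R) M C := E.collapse.comp ρ.coact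

theorem expand_coactC (x : M) : E.expand (E.coactC ρ x) = ρ.coact x :=
  E.expand_collapse _

theorem coactC_rsmul (r : R) (x : M) : E.coactC ρ (op (α r) • x) = op r • E.coactC ρ x := by
  rw [coactC, AddMonoidHom.comp_apply, AddMonoidHom.comp_apply, ρ.coact_rsmul, collapse_rsmul]

/-- After the injection `expand₂` both sides become the two sides of coassociativity of the comodule
over `A`. -/
theorem mapR_comul_coactC (x : M) :
    mapR (φ := α) (ψ := RingHom.id R) (RingHom.id R) K.comul K.comul_lsmul (E.coactC ρ x) =
      coactExtR (E.coactC ρ) (E.coactC_rsmul ρ) (RingHom.id R) (E.coactC ρ x) := by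
  refine Function.LeftInverse.injective E.collapse₂_expand₂ ?_
  have hcomp : E.expand.comp (E.coactC ρ) = ρ.coact := AddMonoidHom.ext (E.expand_coactC ρ)
  have hl : ∀ (a : A) x, (E.expand.comp (E.coactC ρ)) (op a • x) =
      op a • (E.expand.comp (E.coactC ρ)) x := fun a x => by rw [hcomp, ρ.coact_rsmul]
  rw [← mapR_comul_expand, ← E.assoc_mapL_expand (E.coactC ρ) (E.coactC_rsmul ρ) hl, expand_coactC]
  refine (ρ.coassoc x).symm.trans (congrArg assoc ?_)
  exact mapL_congr (fun x => (E.expand_coactC ρ x).symm) _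

theorem mapR_counit_coactC (x : M) :
    mapR (φ := α) (ψ := RingHom.id R) (RingHom.id R) K.counit K.counit_lsmul (E.coactC ρ x) =
      tmul α (RingHom.id R) x 1 := by
  have h := (E.ract_counit_expand (E.coactC ρ x)).symm
  rw [expand_coactC] at h
  -- An element of `M ⊗_R R` is determined by its product, so the counit law over `A` suffices.
  have h2 : ∀ w : BTensor α (RingHom.id R) M R,
      w = tmul α (RingHom.id R) (ract (φ := α) (ψ := RingHom.id R) α (fun _ => rfl) w) 1 :=
    fun w => by
      induction w using induction_on with
      | zero => rw [map_zero, zero_tmul]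
      | tmul t r => rw [ract_tmul, smul_tmul, RingHom.id_apply, smul_eq_mul, mul_one]
      | add x y hx hy => rw [map_add, add_tmul, ← hx, ← hy]
  rw [h2 (mapR _ _ _ _), h]
  exact congrArg (tmul α (RingHom.id R) · 1) (ρ.counit x)

end Comodule

end RightEntwining

/-! ### From a right Galois comodule to a herd -/

section Herd

variable {R S A B : Type u} [Ring R] [Ring S] [Ring A] [Ring B] {α : R →+* A} {β : S →+* B}
  {T : Type u} [AddCommGroup T] [Module B T] [Module Aᵐᵒᵖ T] [SMulCommClass B Aᵐᵒᵖ T]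
  {C : Type u} [AddCommGroup C] [Module R C] [Module Rᵐᵒᵖ C] [SMulCommClass R Rᵐᵒᵖ C]
  {K : Coring R C}

theorem RightEntwining.coactC_lsmul (E : RightEntwining α K) (ρ : RightComodule E.coring T)
    (h : ∀ s, ρ.IsColinear (lmulEnd A (β s))) (s : S) (x : T) :
    E.coactC ρ (β s • x) = β s • E.coactC ρ x := by
  have h2 : ρ.coact (β s • x) = β s • ρ.coact x := h s x
  rw [coactC, AddMonoidHom.comp_apply, AddMonoidHom.comp_apply, h2, collapse_lsmul]

/-- A right Galois comodule over an entwined coring gives a Galois coaction. -/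
noncomputable def RightComodule.IsGalois.galoisCoaction {E : RightEntwining α K}
    {ρ : RightComodule E.coring T} (h : ρ.IsGalois β)
    (hB : Function.Bijective (Module.toModuleEnd Aᵐᵒᵖ T : B →+* Module.End Aᵐᵒᵖ T)) :
    RightGaloisCoaction (standardDual α β hB) K where
  coact := E.coactC ρ
  lsmul := E.coactC_lsmul ρ h.colinear
  rsmul := E.coactC_rsmul ρ
  comul := E.mapR_comul_coactC ρ
  counit := E.mapR_counit_coactC ρ
  bijective := by
    -- For the standard dual `P = T^*`, so the two canonical maps agree up to the identification of
    -- `T ⊗_A (A ⊗_R C)` with `T ⊗_R C`.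
    have key : ∀ z, E.of ((standardDual α β hB).hatL (E.coactC ρ)
        (E.coactC_lsmul ρ h.colinear) z) = ρ.can β h.colinear z := fun z => by
      induction z using induction_on with
      | zero => simp only [map_zero]
      | tmul f x =>
        change E.of ((standardDual α β hB).evL f (E.coactC ρ x)) =
          RightComodule.evalAct f (ρ.coact x)
        rw [← E.expand_coactC ρ x]
        generalize E.coactC ρ x = w
        induction w using induction_on with
        | zero => simp only [map_zero]
        | tmul t c =>
          rw [RightEntwining.expand_tmul, RightComodule.evalAct_tmul, RightEntwining.smul_mkCor,
            mul_one]
          rfl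
        | add x y hx hy => simp only [map_add, hx, hy]
      | add x y hx hy => simp only [map_add, hx, hy]
    have h2 := h.can_bijective
    rw [← show ⇑E.of ∘ _ = ⇑(ρ.can β h.colinear) from funext key] at h2
    exact (E.of.bijective.of_comp_iff' _).1 h2

theorem IsRightEntwinedGalois.isHerd (hT : IsProgenerator A T)
    (hB : Function.Bijective (Module.toModuleEnd Aᵐᵒᵖ T : B →+* Module.End Aᵐᵒᵖ T))
    (h : IsRightEntwinedGalois α β T) : IsHerd α β T := by
  obtain ⟨C, _, _, _, _, K, E, ρ, hρ⟩ := h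
  exact ⟨RDual A T, _, _, _, _, standardDual α β hB, ⟨(hρ.galoisCoaction hB).shepherd
    (fun _ _ _ => rfl) (standardDual_exists_coev_eq_one hB hT)⟩⟩

end Herd

namespace BTensor

variable {R₁ R₂ P₁ Q₁ P₂ Q₂ : Type*} [Ring R₁] [Ring R₂] [Ring P₁] [Ring Q₁] [Ring P₂] [Ring Q₂]
  {φ₁ : R₁ →+* P₁} {ψ₁ : R₁ →+* Q₁} {φ₂ : R₂ →+* P₂} {ψ₂ : R₂ →+* Q₂}
  {M N K : Type*} [AddCommGroup M] [Module P₁ᵐᵒᵖ M]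
  [AddCommGroup N] [Module Q₁ N] [Module P₂ᵐᵒᵖ N] [SMulCommClass Q₁ P₂ᵐᵒᵖ N]
  [AddCommGroup K] [Module Q₂ K]

theorem assoc_symm_rsmul {L : Type*} [Ring L] [Module Lᵐᵒᵖ K] [SMulCommClass Q₂ Lᵐᵒᵖ K] (l : L)
    (z : BTensor φ₁ ψ₁ M (BTensor φ₂ ψ₂ N K)) : assoc.symm (op l • z) = op l • assoc.symm z := by
  induction z using induction_on with
  | zero => simp only [smul_zero, map_zero]
  | tmul w k =>
    induction k using induction_on with
    | zero => simp only [tmul_zero, smul_zero, map_zero]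
    | tmul m n => rfl
    | add x y hx hy => simp only [tmul_add, smul_add, map_add, hx, hy]
  | add x y hx hy => simp only [smul_add, map_add, hx, hy]

end BTensor

/-! ### Iterated left coactions -/

section Coaction

variable {S B : Type u} [Ring S] [Ring B] {β : S →+* B} {T : Type u} [AddCommGroup T]
  [Module B T] {C : Type u} [AddCommGroup C] [Module Sᵐᵒᵖ C] [Module S C]
  [SMulCommClass S Sᵐᵒᵖ C] (ρ : T →+ BTensor (RingHom.id S) β C T)
  (hρ : ∀ (s : S) x, ρ (β s • x) = s • ρ x)
  {Q Q' : Type u} [Ring Q] [Ring Q'] {ξ : S →+* Q} {ξ' : S →+* Q'} {X X' : Type u}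
  [AddCommGroup X] [Module Qᵐᵒᵖ X] [AddCommGroup X'] [Module Q'ᵐᵒᵖ X']

/-- `c ⊗ t ↦ (x ⊗ c) ⊗ t` -/
def insL (β : S →+* B) {M : Type u} [AddCommGroup M] [Module B M] (ξ : S →+* Q) (x : X) :
    BTensor (RingHom.id S) β C M →+
      BTensor (RingHom.id S) β (BTensor ξ (RingHom.id S) X C) M :=
  mapL (RingHom.id S) (BTensor.mk ξ (RingHom.id S) x) (fun _ _ => rfl)

@[simp] theorem insL_tmul {M : Type u} [AddCommGroup M] [Module B M] (x : X) (t : M) (c : C) :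
    insL β ξ x (tmul (RingHom.id S) β c t) = tmul _ _ (tmul _ _ x c) t := rfl

theorem insL_lsmul (x : X) (s : S) (z : BTensor (RingHom.id S) β C T) :
    insL β ξ x (s • z) = insL β ξ (op (ξ s) • x) z := by
  induction z using induction_on with
  | zero => simp only [smul_zero, map_zero]
  | tmul c t =>
    rw [lsmul_tmul, insL_tmul, insL_tmul, smul_tmul, RingHom.id_apply]
  | add x y hx hy => simp only [smul_add, map_add, hx, hy]

theorem insL_add (x x' : X) (z : BTensor (RingHom.id S) β C T) :
    insL β ξ (x + x') z = insL β ξ x z + insL β ξ x' z := by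
  induction z using induction_on with
  | zero => simp only [map_zero, add_zero]
  | tmul c t => rw [insL_tmul, insL_tmul, insL_tmul, add_tmul, add_tmul]
  | add x y hx hy => simp only [map_add, hx, hy]; abel

/-- The map `X ⊗ ρ : X ⊗_S T → (X ⊗_S D) ⊗_S T` for a coaction `ρ : T → D ⊗_S T`. -/
def coactExtL (ξ : S →+* Q) : BTensor ξ β X T →+
    BTensor (RingHom.id S) β (BTensor ξ (RingHom.id S) X C) T :=
  lift (biadd (fun x t => insL β ξ x (ρ t)) (fun x x' t => insL_add x x' _)
    (fun x t t' => by rw [map_add, map_add])) (fun s x t => by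
      rw [biadd_apply, biadd_apply, hρ, insL_lsmul])

@[simp] theorem coactExtL_tmul (t : T) (x : X) :
    coactExtL ρ hρ ξ (tmul ξ β x t) = insL β ξ x (ρ t) := rfl

theorem coactExtL_mapL (g : X →+ X') (hg : ∀ s x, g (op (ξ s) • x) = op (ξ' s) • g x)
    (w : BTensor ξ β X T) :
    coactExtL ρ hρ ξ' (mapL ξ' g hg w) =
      mapL (ψ := β) (φ := RingHom.id S) (RingHom.id S)
        (mapL (ψ := RingHom.id S) (φ := ξ) ξ' g hg)
        (fun s z => mapL_rsmul _ _ s z) (coactExtL ρ hρ ξ w) := by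
  induction w using induction_on with
  | zero => simp only [map_zero]
  | tmul x t =>
    rw [mapL_tmul, coactExtL_tmul, coactExtL_tmul]
    generalize ρ t = z
    induction z using induction_on with
    | zero => simp only [map_zero]
    | tmul c t => rfl
    | add x y hx hy => simp only [map_add, hx, hy]
  | add x y hx hy => simp only [map_add, hx, hy]

theorem coactExtL_lsmul {K : Type u} [Ring K] [Module K X] [SMulCommClass K Qᵐᵒᵖ X] (k : K)
    (w : BTensor ξ β X T) :
    coactExtL ρ hρ ξ (k • w) = k • coactExtL ρ hρ ξ w := by
  induction w using induction_on with
  | zero => simp only [map_zero, smul_zero]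
  | tmul x t =>
    rw [lsmul_tmul, coactExtL_tmul, coactExtL_tmul]
    generalize ρ t = z
    induction z using induction_on with
    | zero => simp only [map_zero, smul_zero]
    | tmul c t => rfl
    | add x y hx hy => simp only [map_add, smul_add, hx, hy]
  | add x y hx hy => simp only [map_add, smul_add, hx, hy]

theorem coactExtL_rsmul {A : Type u} [Ring A] [Module Aᵐᵒᵖ T] [SMulCommClass B Aᵐᵒᵖ T] (a : A)
    (hb : ∀ x, ρ (op a • x) = op a • ρ x) (w : BTensor ξ β X T) :
    coactExtL ρ hρ ξ (op a • w) = op a • coactExtL ρ hρ ξ w := by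
  induction w using induction_on with
  | zero => simp only [map_zero, smul_zero]
  | tmul x t =>
    rw [rsmul_tmul, coactExtL_tmul, coactExtL_tmul, hb]
    generalize ρ t = z
    induction z using induction_on with
    | zero => simp only [map_zero, smul_zero]
    | tmul c t => rfl
    | add x y hx hy => simp only [map_add, smul_add, hx, hy]
  | add x y hx hy => simp only [map_add, smul_add, hx, hy]

/-- Coassociativity of iterated coactions: `(X ⊗ D ⊗ ρ) ∘ (X ⊗ ρ)` is obtained from `(D ⊗ ρ) ∘ ρ`
by reassociating. -/
theorem coactExtL_insL (x : X) (z : BTensor (RingHom.id S) β C T) :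
    coactExtL ρ hρ (RingHom.id S) (insL β ξ x z) =
      mapL (ψ := β) (φ := RingHom.id S) (RingHom.id S)
        (assocInvAux ξ (RingHom.id S) (RingHom.id S) (RingHom.id S) x)
        (fun s w => mapL_rsmul _ _ s w)
        (coactExtL ρ hρ (RingHom.id S) z) := by
  induction z using induction_on with
  | zero => simp only [map_zero]
  | tmul c t =>
    rw [insL_tmul, coactExtL_tmul, coactExtL_tmul]
    generalize ρ t = z
    induction z using induction_on with
    | zero => simp only [map_zero]
    | tmul c t => rfl
    | add x y hx hy => simp only [map_add, hx, hy]
  | add x y hx hy => simp only [map_add, hx, hy]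

end Coaction

/-! ### The descent datum on `T ⊗_R P` defined by a shepherd -/

section Herd

variable {R S A B : Type u} [Ring R] [Ring S] [Ring A] [Ring B] {α : R →+* A} {β : S →+* B}
  {T : Type u} [AddCommGroup T] [Module B T] [Module Aᵐᵒᵖ T] [SMulCommClass B Aᵐᵒᵖ T]
  {P : Type u} [AddCommGroup P] [Module A P] [Module Bᵐᵒᵖ P] [SMulCommClass A Bᵐᵒᵖ P]
  {d : FormalDual α β T P}

section Hat

variable {Q Q' : Type u} [Ring Q] [Ring Q'] {ξ : S →+* Q} {X : Type u} [AddCommGroup X] [Module Qᵐᵒᵖ X]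
  {Z : Type u} [AddCommGroup Z] [Module Aᵐᵒᵖ Z]

theorem FormalDual.coevR_absorbR (d : FormalDual α β T P) (p : P)
    (z : BTensor β β (BTensor ξ β X B) T) :
    d.coevR p (absorbR z) = absorbR (d.coevR p z) := by
  induction z using induction_on with
  | zero => simp only [map_zero]
  | tmul w t => rw [absorbR_tmul, d.coevR_actR, d.coevR_tmul, absorbR_tmul, actR_eq_smul]
  | add x y hx hy => simp only [map_add, hx, hy]

/-- `x ⊗ a ↦ h(x) a` -/
def smulExtR (h : T →+ Z) (hh : ∀ r x, h (op (α r) • x) = op (α r) • h x) : BTensor α α T A →+ Z :=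
  lift (biadd (fun x a => op a • h x) (fun x x' a => by rw [map_add, smul_add])
    (fun x a a' => add_smul _ _ _)) (fun r x a => by simp [hh, mul_smul])

@[simp] theorem smulExtR_tmul (h : T →+ Z) (hh : ∀ r x, h (op (α r) • x) = op (α r) • h x) (a : A) (x : T) :
    smulExtR h hh (tmul α α x a) = op a • h x := rfl

/-- The right `B`-linear map `T ⊗_R P → X ⊗_S B`, `x ⊗ p ↦ h(x) p` induced by
`h : T → X ⊗_S T`. -/
def FormalDual.hatR (d : FormalDual α β T P) (h : T →+ BTensor ξ β X T)
    (hh : ∀ r x, h (op (α r) • x) = op (α r) • h x) : BTensor α α T P →+ BTensor ξ β X B :=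
  d.coevMapR.comp (mapL α h hh)

variable (h : T →+ BTensor ξ β X T) (hh : ∀ r x, h (op (α r) • x) = op (α r) • h x)

@[simp] theorem FormalDual.hatR_tmul (p : P) (x : T) :
    d.hatR h hh (tmul α α x p) = d.coevR p (h x) := rfl

theorem FormalDual.hatR_rsmul (b : B) (z : BTensor α α T P) :
    d.hatR h hh (op b • z) = op b • d.hatR h hh z := by
  induction z using induction_on with
  | zero => simp only [map_zero, smul_zero]
  | tmul x p => rw [rsmul_tmul, hatR_tmul, hatR_tmul, d.smul_coevR]
  | add x y hx hy => simp only [map_add, smul_add, hx, hy]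

theorem FormalDual.hatR_lsmul {K : Type u} [Ring K] [Module K X] [SMulCommClass K Qᵐᵒᵖ X]
    (k : K) (b : B) (hk : ∀ x, h (b • x) = k • h x) (z : BTensor α α T P) :
    d.hatR h hh (b • z) = k • d.hatR h hh z := by
  induction z using induction_on with
  | zero => simp only [map_zero, smul_zero]
  | tmul x p => rw [lsmul_tmul, hatR_tmul, hatR_tmul, hk, d.coevR_lsmul]
  | add x y hx hy => simp only [map_add, smul_add, hx, hy]

theorem FormalDual.absorbR_mapL_hatR (z : BTensor β β (BTensor α α T P) T) :
    absorbR (mapL (ψ := β) (φ := β) β (d.hatR h hh) (fun s => d.hatR_rsmul h hh (β s)) z) =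
      smulExtR h hh (d.evMapR z) := by
  induction z using induction_on with
  | zero => simp only [map_zero]
  | tmul w t =>
    rw [mapL_tmul, absorbR_tmul, d.evMapR_tmul]
    induction w using induction_on with
    | zero => simp only [map_zero]
    | tmul x p => rw [FormalDual.hatR_tmul, d.actR_coevR, d.evR_tmul, smulExtR_tmul]
    | add x y hx hy => simp only [map_add, hx, hy]
  | add x y hx hy => simp only [map_add, hx, hy]

end Hat

namespace Shepherd

variable (σ : Shepherd d)

/-- The shepherd as a map `T → (T ⊗_R P) ⊗_S T`. -/
def γL : T →+ BTensor β β (BTensor α α T P) T := assoc.symm.toAddMonoidHom.comp σ.γ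

theorem assoc_γL (x : T) : assoc (σ.γL x) = σ.γ x := AddEquiv.apply_symm_apply _ _

theorem γL_lsmul (s : S) (x : T) : σ.γL (β s • x) = β s • σ.γL x := by
  change assoc.symm (σ.γ (β s • x)) = β s • assoc.symm (σ.γ x)
  rw [σ.γ_lsmul, AddEquiv.symm_apply_eq, assoc_lsmul, AddEquiv.apply_symm_apply]

theorem γL_rsmul (r : R) (x : T) : σ.γL (op (α r) • x) = op (α r) • σ.γL x := by
  change assoc.symm (σ.γ (op (α r) • x)) = op (α r) • assoc.symm (σ.γ x)
  rw [σ.γ_rsmul, assoc_symm_rsmul]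

theorem coev_γL (x : T) : mapL (φ := β) (ψ := β) β d.coev (fun s z => d.coev_rsmul (β s) z)
    (σ.γL x) = tmul β β 1 x :=
  σ.coev_γ x

/-- The unit law for `ev` in the bracketing `(T ⊗ P) ⊗ T`, in which the whole left-hand theory is
carried out. -/
theorem evMapR_γL (x : T) : d.evMapR (σ.γL x) = tmul α α x 1 := by
  rw [← σ.ev_γ, ← assoc_γL]
  generalize σ.γL x = z
  induction z using induction_on with
  | zero => simp only [map_zero]
  | tmul w t =>
    induction w using induction_on with
    | zero => simp only [map_zero, zero_tmul]
    | tmul x p => rfl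
    | add x y hx hy => simp only [map_add, add_tmul, hx, hy]
  | add x y hx hy => simp only [map_add, hx, hy]

section Ext

variable {Q Q' : Type u} [Ring Q] [Ring Q'] {ξ : S →+* Q} {ξ' : S →+* Q'} {X X' : Type u}
  [AddCommGroup X] [Module Qᵐᵒᵖ X] [AddCommGroup X'] [Module Q'ᵐᵒᵖ X']

/-- On this side a right `R`-linear `h` is recovered through the unit law for `ev`: `Σ h(x₁) ev(x₂ ⊗
x₃) = h(x)`. -/
theorem absorbR_mapL_hatR_γL (h : T →+ BTensor ξ β X T) (hh : ∀ r x, h (op (α r) • x) = op (α r) • h x)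
    (x : T) :
    absorbR (mapL (ψ := β) (φ := β) β (d.hatR h hh) (fun s => d.hatR_rsmul h hh (β s)) (σ.γL x)) =
      h x := by
  rw [d.absorbR_mapL_hatR, evMapR_γL, smulExtR_tmul, op_one, one_smul]

/-- `(y ⊗ p) ⊗ t ↦ ((x ⊗ y) ⊗ p) ⊗ t` -/
def insL₂ (β : S →+* B) (α : R →+* A) (T P : Type u) [AddCommGroup T] [Module Aᵐᵒᵖ T] [Module B T]
    [SMulCommClass B Aᵐᵒᵖ T] [AddCommGroup P] [Module Bᵐᵒᵖ P] [Module A P] [SMulCommClass A Bᵐᵒᵖ P]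
    (ξ : S →+* Q) (x : X) : BTensor β β (BTensor α α T P) T →+
      BTensor β β (BTensor α α (BTensor ξ β X T) P) T :=
  mapL β (mapL α (BTensor.mk ξ β x) (fun _ _ => rfl)) (fun s z => mapL_rsmul _ _ (β s) z)

theorem insL₂_lsmul (x : X) (s : S) (z : BTensor β β (BTensor α α T P) T) :
    insL₂ β α T P ξ x (β s • z) = insL₂ β α T P ξ (op (ξ s) • x) z := by
  induction z using induction_on with
  | zero => simp only [smul_zero, map_zero]
  | tmul w t =>
    induction w using induction_on with
    | zero => simp only [smul_zero, map_zero, zero_tmul]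
    | tmul y p =>
      change tmul _ _ (tmul _ _ (tmul _ _ x (β s • y)) p) t =
        tmul _ _ (tmul _ _ (tmul _ _ (op (ξ s) • x) y) p) t
      rw [← smul_tmul]
    | add x y hx hy => simp only [smul_add, map_add, add_tmul, hx, hy]
  | add x y hx hy => simp only [smul_add, map_add, hx, hy]

theorem insL₂_add (x x' : X) (z : BTensor β β (BTensor α α T P) T) :
    insL₂ β α T P ξ (x + x') z = insL₂ β α T P ξ x z + insL₂ β α T P ξ x' z := by
  induction z using induction_on with
  | zero => simp only [map_zero, add_zero]
  | tmul w t =>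
    induction w using induction_on with
    | zero => simp only [map_zero, zero_tmul, add_zero]
    | tmul y p =>
      change tmul _ _ (tmul _ _ (tmul _ _ (x + x') y) p) t =
        tmul _ _ (tmul _ _ (tmul _ _ x y) p) t + tmul _ _ (tmul _ _ (tmul _ _ x' y) p) t
      rw [add_tmul, add_tmul, add_tmul]
    | add x y hx hy => simp only [map_add, add_tmul, hx, hy]; abel
  | add x y hx hy => simp only [map_add, hx, hy]; abel

/-- `X ⊗ γ : X ⊗_S T → ((X ⊗_S T) ⊗_R P) ⊗_S T` -/
def extL (ξ : S →+* Q) : BTensor ξ β X T →+ BTensor β β (BTensor α α (BTensor ξ β X T) P) T :=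
  lift (biadd (fun x t => insL₂ β α T P ξ x (σ.γL t)) (fun x x' t => insL₂_add x x' _)
    (fun x t t' => by rw [map_add, map_add])) (fun s x t => by
      rw [biadd_apply, biadd_apply, σ.γL_lsmul, insL₂_lsmul])

@[simp] theorem extL_tmul (t : T) (x : X) :
    σ.extL ξ (tmul ξ β x t) = insL₂ β α T P ξ x (σ.γL t) := rfl

set_option maxHeartbeats 1000000 in
-- Coassociativity of the shepherd in the left-hand bracketing. On pure tensors both sides are
-- reassociations of the two sides of the original axiom.
theorem extL_γL (x : T) : σ.extL β (σ.γL x) =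
    mapL (ψ := β) (φ := β) β (mapL (ψ := α) (φ := α) α σ.γL σ.γL_rsmul)
      (fun s z => mapL_rsmul _ _ (β s) z) (σ.γL x) := by
  -- Three reassociations take `T ⊗ (P ⊗ (T ⊗ (P ⊗ T)))` to the bracketing with all parentheses on
  -- the left.
  have h := congrArg (fun z => assoc.symm (assoc.symm (assoc.symm z))) (σ.coassoc x)
  refine Eq.trans ?_ (h.symm.trans ?_)
  · rw [← assoc_γL]
    generalize σ.γL x = z
    induction z using induction_on with
    | zero => simp only [map_zero]
    | tmul w t =>
      rw [extL_tmul]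
      induction w using induction_on with
      | zero =>
        simp only [zero_tmul, map_zero]
        -- `insL₂` is not bundled as additive in its parameter, so the zero case is recognised as
        -- the extension of `0 ⊗ t`.
        rw [← extL_tmul, zero_tmul, map_zero]
      | tmul y p =>
        rw [assoc_tmul, mapR_tmul, mapR_tmul, ← assoc_γL]
        generalize σ.γL t = z
        induction z using induction_on with
        | zero => simp only [map_zero, tmul_zero]
        | tmul v t =>
          induction v using induction_on with
          | zero => simp only [map_zero, tmul_zero, zero_tmul]
          | tmul y p => rfl
          | add x y hx hy => simp only [map_add, add_tmul, tmul_add, hx, hy]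
        | add x y hx hy => simp only [map_add, tmul_add, hx, hy]
      | add x y hx hy => rw [insL₂_add, hx, hy]; simp only [add_tmul, map_add]
    | add x y hx hy => simp only [map_add, hx, hy]
  · rw [← assoc_γL]
    generalize σ.γL x = z
    induction z using induction_on with
    | zero => simp only [map_zero]
    | tmul w t =>
      rw [mapL_tmul]
      induction w using induction_on with
      | zero => simp only [zero_tmul, map_zero]
      | tmul y p =>
        rw [assoc_tmul, mapL_tmul, mapL_tmul, ← assoc_γL]
        generalize σ.γL y = z
        induction z using induction_on with
        | zero => simp only [map_zero, zero_tmul]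
        | tmul v t =>
          induction v using induction_on with
          | zero => simp only [map_zero, zero_tmul]
          | tmul y p => rfl
          | add x y hx hy => simp only [map_add, add_tmul, hx, hy]
        | add x y hx hy => simp only [map_add, add_tmul, hx, hy]
      | add x y hx hy => simp only [map_add, add_tmul, hx, hy]
    | add x y hx hy => simp only [map_add, hx, hy]

theorem extL_mapL (g : X →+ X') (hg : ∀ s x, g (op (ξ s) • x) = op (ξ' s) • g x) (w : BTensor ξ β X T) :
    σ.extL ξ' (mapL ξ' g hg w) = mapL (ψ := β) (φ := β) β
      (mapL (ψ := α) (φ := α) α (mapL (ψ := β) (φ := ξ) ξ' g hg)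
        (fun r z => mapL_rsmul _ _ (α r) z)) (fun s z => mapL_rsmul _ _ (β s) z) (σ.extL ξ w) := by
  induction w using induction_on with
  | zero => simp only [map_zero]
  | tmul x t =>
    rw [mapL_tmul, extL_tmul, extL_tmul]
    generalize σ.γL t = z
    induction z using induction_on with
    | zero => simp only [map_zero]
    | tmul w t =>
      induction w using induction_on with
      | zero => simp only [map_zero, zero_tmul]
      | tmul y p => rfl
      | add x y hx hy => simp only [map_add, add_tmul, hx, hy]
    | add x y hx hy => simp only [map_add, hx, hy]
  | add x y hx hy => simp only [map_add, hx, hy]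

/-- The unit law `(coev ⊗ T) γ(t) = 1 ⊗ t` with a spectator `x`. -/
theorem mapL_coevMapR_extL (w : BTensor ξ β X T) :
    mapL (ψ := β) (φ := β) β (d.coevMapR (υ := ξ)) (fun s z => d.coevMapR_rsmul (β s) z)
      (σ.extL ξ w) = mapL (ψ := β) (φ := ξ) β (unitR ξ β) unitR_smul w := by
  induction w using induction_on with
  | zero => simp only [map_zero]
  | tmul x t =>
    rw [extL_tmul, mapL_tmul, unitR_apply]
    have h := congrArg (mapL (ψ := β) (φ := β) β (BTensor.mk ξ β x) (fun _ _ => rfl))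
      (σ.coev_γL t)
    refine Eq.trans ?_ h
    generalize σ.γL t = z
    induction z using induction_on with
    | zero => simp only [map_zero]
    | tmul w t =>
      induction w using induction_on with
      | zero => simp only [map_zero, zero_tmul]
      | tmul y p => rfl
      | add x y hx hy => simp only [map_add, add_tmul, hx, hy]
    | add x y hx hy => simp only [map_add, hx, hy]
  | add x y hx hy => simp only [map_add, hx, hy]

end Ext

/-- The descent datum `x ⊗ p ↦ γ(x) p` on `T ⊗_R P`. -/
def datumL : LeftDescentDatum β (BTensor α α T P) where
  δ := d.hatR σ.γL σ.γL_rsmul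
  δ_smul := d.hatR_rsmul σ.γL σ.γL_rsmul
  coassoc z := by
    -- Coassociativity followed by the unit law for `coev` in the middle legs.
    have key : ∀ y, mapL (ψ := β) (φ := β) β (d.hatR σ.γL σ.γL_rsmul)
        (fun s => d.hatR_rsmul σ.γL σ.γL_rsmul (β s)) (σ.γL y) =
        mapL (ψ := β) (φ := β) β (unitR β β) unitR_smul (σ.γL y) := fun y => by
      rw [← σ.mapL_coevMapR_extL (ξ := β) (σ.γL y), extL_γL]
      exact (mapL_mapL _ _ _ _ _ _ (fun _ => rfl) _).symm
    induction z using induction_on with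
    | zero => simp only [map_zero]
    | tmul y p => rw [FormalDual.hatR_tmul, ← d.coevR_mapL, key, d.coevR_mapL]
    | add x y hx hy => simp only [map_add, hx, hy]

/-- The left `S`-linearity of `γ` makes the coinvariants an `S`-bimodule. -/
theorem datumL_δ_lsmul (s : S) (z : BTensor α α T P) :
    σ.datumL.δ (β s • z) = β s • σ.datumL.δ z :=
  d.hatR_lsmul (K := B) σ.γL σ.γL_rsmul (β s) (β s) (σ.γL_lsmul s) z

/-- The `S`-coring of the herd, as the coinvariants in `T ⊗_R P`. -/
abbrev CoringL : Type u := σ.datumL.Coinv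

instance : Module S σ.CoringL where
  smul s c := σ.datumL.toCoinv (β s • σ.datumL.incl c) (by
    rw [datumL_δ_lsmul, σ.datumL.δ_incl, unitR_apply, unitR_apply, lsmul_tmul])
  one_smul c := σ.datumL.incl_injective
    ((congrArg (· • σ.datumL.incl c) (map_one β)).trans (one_smul _ _))
  mul_smul s r c := σ.datumL.incl_injective
    ((congrArg (· • σ.datumL.incl c) (map_mul β s r)).trans (mul_smul _ _ _))
  smul_zero s := σ.datumL.incl_injective ((congrArg (β s • ·) (map_zero σ.datumL.incl)).trans
    ((smul_zero _).trans (map_zero σ.datumL.incl).symm))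
  smul_add s c c' := σ.datumL.incl_injective
    ((congrArg (β s • ·) (map_add σ.datumL.incl c c')).trans (smul_add _ _ _))
  add_smul s r c := σ.datumL.incl_injective
    ((congrArg (· • σ.datumL.incl c) (map_add β s r)).trans (add_smul _ _ _))
  zero_smul c := σ.datumL.incl_injective ((congrArg (· • σ.datumL.incl c) (map_zero β)).trans
    ((zero_smul _ _).trans (map_zero σ.datumL.incl).symm))

instance : SMulCommClass S Sᵐᵒᵖ σ.CoringL where
  smul_comm s r c := σ.datumL.incl_injective
    (smul_comm (β s) (op (β r.unop)) (σ.datumL.incl c))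

end Shepherd

end Herd

/-! ### Descent of `T ⊗_R P` and the coaction of `D` on `T` -/

section Herd

variable {R S A B : Type u} [Ring R] [Ring S] [Ring A] [Ring B] {α : R →+* A} {β : S →+* B}
  {T : Type u} [AddCommGroup T] [Module B T] [Module Aᵐᵒᵖ T] [SMulCommClass B Aᵐᵒᵖ T]
  {P : Type u} [AddCommGroup P] [Module A P] [Module Bᵐᵒᵖ P] [SMulCommClass A Bᵐᵒᵖ P]
  {d : FormalDual α β T P}

namespace Shepherd

variable (σ : Shepherd d) (hβ : LeftDescent β)

/-- The inclusion `D → T ⊗_R P`. -/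
def inclL : σ.CoringL →+ BTensor α α T P := σ.datumL.incl

theorem inclL_smul (s : S) (c : σ.CoringL) :
    σ.inclL (op (RingHom.id S s) • c) = op (β s) • σ.inclL c := rfl

theorem inclL_lsmul (s : S) (c : σ.CoringL) :
    σ.inclL (s • c) = β s • σ.inclL c := rfl

theorem mapL_inclL_injective (hβ : LeftDescent β) : Function.Injective
    (mapL (ψ := β) (φ := RingHom.id S) (N := B) β σ.inclL σ.inclL_smul) :=
  hβ.coinv_injective _ σ.datumL

theorem exists_descL (hβ : LeftDescent β) (z : BTensor α α T P) :
    ∃ v, mapL (ψ := β) (φ := RingHom.id S) (N := B) β σ.inclL σ.inclL_smul v = σ.datumL.δ z :=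
  hβ.coinv_exact _ σ.datumL _ (σ.datumL.coassoc z)

/-- The inverse `T ⊗_R P → D ⊗_S B` of the multiplication `c ⊗ b ↦ c b`. -/
noncomputable def descL : BTensor α α T P →+ BTensor (RingHom.id S) β σ.CoringL B :=
  AddMonoidHom.mk' (fun z => (σ.exists_descL hβ z).choose) (fun z z' =>
    σ.mapL_inclL_injective hβ ((σ.exists_descL hβ (z + z')).choose_spec.trans
      ((map_add _ z z').trans ((congrArg₂ _ (σ.exists_descL hβ z).choose_spec
        (σ.exists_descL hβ z').choose_spec).symm.trans (map_add _ _ _).symm))))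

theorem mapL_inclL_descL (z : BTensor α α T P) :
    mapL (ψ := β) (φ := RingHom.id S) (N := B) β σ.inclL σ.inclL_smul (σ.descL hβ z) =
      d.hatR σ.γL σ.γL_rsmul z :=
  (σ.exists_descL hβ z).choose_spec

theorem hatR_γL_inclL (c : σ.CoringL) : d.hatR σ.γL σ.γL_rsmul (σ.inclL c) = tmul β β (σ.inclL c) 1 :=
  σ.datumL.δ_incl c

theorem descL_inclL (c : σ.CoringL) : σ.descL hβ (σ.inclL c) = unitR (RingHom.id S) β c :=
  σ.mapL_inclL_injective hβ (by rw [mapL_inclL_descL, hatR_γL_inclL, unitR_apply, mapL_tmul])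

theorem descL_rsmul (b : B) (z : BTensor α α T P) : σ.descL hβ (op b • z) = op b • σ.descL hβ z :=
  σ.mapL_inclL_injective hβ (by
    rw [mapL_rsmul, mapL_inclL_descL, mapL_inclL_descL, d.hatR_rsmul])

theorem descL_lsmul (s : S) (z : BTensor α α T P) :
    σ.descL hβ (β s • z) = s • σ.descL hβ z :=
  σ.mapL_inclL_injective hβ (by
    rw [mapL_lsmul _ _ s (β s) (σ.inclL_lsmul s), mapL_inclL_descL, mapL_inclL_descL]
    exact σ.datumL_δ_lsmul s z)

/-- `z ⊗ t ↦ z t ∈ D ⊗_S T` -/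
noncomputable def projL : BTensor β β (BTensor α α T P) T →+ BTensor (RingHom.id S) β σ.CoringL T :=
  absorbR.comp (mapL (ψ := β) (φ := β) β (σ.descL hβ) (fun s => σ.descL_rsmul hβ (β s)))

theorem projL_tmul (t : T) (z : BTensor α α T P) :
    σ.projL hβ (tmul β β z t) = actR t (σ.descL hβ z) := rfl

theorem projL_rsmul (a : A) (z : BTensor β β (BTensor α α T P) T) :
    σ.projL hβ (op a • z) = op a • σ.projL hβ z := by
  rw [projL, AddMonoidHom.comp_apply, AddMonoidHom.comp_apply, mapL_rsmul, absorbR_rsmul]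

theorem projL_lsmul (s : S) (z : BTensor β β (BTensor α α T P) T) :
    σ.projL hβ (β s • z) = s • σ.projL hβ z :=
  (congrArg absorbR (mapL_lsmul _ _ (β s) s (σ.descL_lsmul hβ s) z)).trans (absorbR_lsmul s _)

theorem projL_mapL_inclL (w : BTensor (RingHom.id S) β σ.CoringL T) :
    σ.projL hβ (mapL (ψ := β) (φ := RingHom.id S) β σ.inclL σ.inclL_smul w) = w := by
  induction w using induction_on with
  | zero => simp only [map_zero]
  | tmul c t => rw [mapL_tmul, projL_tmul, descL_inclL, unitR_apply, actR_tmul_one]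
  | add x y hx hy => simp only [map_add, hx, hy]

/-- The coaction `T → D ⊗_S T`. -/
noncomputable def coactL : T →+ BTensor (RingHom.id S) β σ.CoringL T := (σ.projL hβ).comp σ.γL

theorem coactL_rsmul (r : R) (x : T) : σ.coactL hβ (op (α r) • x) = op (α r) • σ.coactL hβ x :=
  (congrArg (σ.projL hβ) (σ.γL_rsmul r x)).trans (σ.projL_rsmul hβ (α r) _)

theorem coactL_lsmul (s : S) (x : T) : σ.coactL hβ (β s • x) = s • σ.coactL hβ x :=
  (congrArg (σ.projL hβ) (σ.γL_lsmul s x)).trans (σ.projL_lsmul hβ s _)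

/-- `γ` takes its values in `D ⊗_S T`, because applying `δ ⊗ T` and absorbing the factor `B` fixes
it. -/
theorem mapL_inclL_coactL (x : T) :
    mapL (ψ := β) (φ := RingHom.id S) β σ.inclL σ.inclL_smul (σ.coactL hβ x) = σ.γL x := by
  rw [← σ.absorbR_mapL_hatR_γL σ.γL σ.γL_rsmul x]
  refine (absorbR_mapL σ.inclL σ.inclL_smul _).symm.trans (congrArg absorbR ?_)
  exact mapL_mapL _ _ _ _ _ _ (σ.mapL_inclL_descL hβ) _

/-- The canonical map `T ⊗_R P → D ⊗_S B` of the coaction is the descent map. -/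
theorem coevR_coactL (p : P) (x : T) :
    d.coevR p (σ.coactL hβ x) = σ.descL hβ (tmul α α x p) :=
  σ.mapL_inclL_injective hβ (by
    rw [← d.coevR_mapL, mapL_inclL_coactL, mapL_inclL_descL, d.hatR_tmul])

theorem mapL_descL_γL (x : T) :
    mapL (ψ := β) (φ := β) β (σ.descL hβ) (fun s => σ.descL_rsmul hβ (β s)) (σ.γL x) =
      mapL (ψ := β) (φ := RingHom.id S) β (unitR (RingHom.id S) β) unitR_smul (σ.coactL hβ x) := by
  rw [← σ.mapL_inclL_coactL hβ x]
  exact mapL_mapL _ _ _ _ _ _ (σ.descL_inclL hβ) _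

/-! ### The universal property of the left coaction -/

section Universal

variable {N : Type u} [AddCommGroup N] [Module Sᵐᵒᵖ N]

theorem hatR_absorbR_inclL (f : σ.CoringL →+ BTensor (RingHom.id S) β N B)
    (hf : ∀ s c, f (op (RingHom.id S s) • c) = op (β s) • f c)
    (h : T →+ BTensor (RingHom.id S) β N T) (hh : ∀ r x, h (op (α r) • x) = op (α r) • h x)
    (hfh : ∀ x, absorbR (mapL (ψ := β) (φ := RingHom.id S) β f hf (σ.coactL hβ x)) = h x)
    (c : σ.CoringL) : d.hatR h hh (σ.inclL c) = f c := by
  have key : ∀ z, d.hatR h hh z =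
      absorbR (mapL (ψ := β) (φ := RingHom.id S) β f hf (σ.descL hβ z)) := fun z => by
    induction z using induction_on with
    | zero => simp only [map_zero]
    | tmul x p =>
      rw [d.hatR_tmul, ← hfh, d.coevR_absorbR, d.coevR_mapL, coevR_coactL]
    | add x y hx hy => simp only [map_add, hx, hy]
  rw [key, descL_inclL, unitR_apply, mapL_tmul, absorbR_tmul, actR_eq_smul, op_one, one_smul]

/-- Right `S`-linear maps `D → N ⊗_S B` are determined by the induced maps `T → N ⊗_S T`. -/
theorem coactL_hom_ext {f g : σ.CoringL →+ BTensor (RingHom.id S) β N B}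
    (hf : ∀ s c, f (op (RingHom.id S s) • c) = op (β s) • f c)
    (hg : ∀ s c, g (op (RingHom.id S s) • c) = op (β s) • g c)
    (h : ∀ x, absorbR (mapL (ψ := β) (φ := RingHom.id S) β f hf (σ.coactL hβ x)) =
      absorbR (mapL (ψ := β) (φ := RingHom.id S) β g hg (σ.coactL hβ x))) (c : σ.CoringL) :
    f c = g c := by
  have hh : ∀ r x, (absorbR.comp ((mapL (ψ := β) (φ := RingHom.id S) β g hg).comp
      (σ.coactL hβ))) (op (α r) • x) = op (α r) • (absorbR.comp ((mapL (ψ := β) (φ := RingHom.id S) β g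
        hg).comp (σ.coactL hβ))) x := fun r x => by
    simp only [AddMonoidHom.comp_apply]
    rw [coactL_rsmul, mapL_rsmul, absorbR_rsmul]
  rw [← σ.hatR_absorbR_inclL hβ f hf _ hh h, ← σ.hatR_absorbR_inclL hβ g hg _ hh (fun _ => rfl)]

theorem absorbR_mapL_unitR_coactL (φ : σ.CoringL →+ N)
    (hφ : ∀ s c, φ (op (RingHom.id S s) • c) = op (RingHom.id S s) • φ c)
    (h : ∀ s c, ((unitR (RingHom.id S) β).comp φ) (op (RingHom.id S s) • c) =
      op (β s) • ((unitR (RingHom.id S) β).comp φ) c)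
    (w : BTensor (RingHom.id S) β σ.CoringL T) :
    absorbR (mapL (ψ := β) (φ := RingHom.id S) β ((unitR (RingHom.id S) β).comp φ) h w) =
      mapL (ψ := β) (φ := RingHom.id S) (RingHom.id S) φ hφ w := by
  induction w using induction_on with
  | zero => simp only [map_zero]
  | tmul c t =>
    rw [mapL_tmul, absorbR_tmul, AddMonoidHom.comp_apply, unitR_apply, actR_tmul_one, mapL_tmul]
  | add x y hx hy => simp only [map_add, hx, hy]

/-- Right `S`-linear maps `D → N` are determined by the induced maps `T → N ⊗_S T`. -/
theorem coactL_hom_ext' {f g : σ.CoringL →+ N}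
    (hf : ∀ s c, f (op (RingHom.id S s) • c) = op (RingHom.id S s) • f c)
    (hg : ∀ s c, g (op (RingHom.id S s) • c) = op (RingHom.id S s) • g c)
    (h : ∀ x, mapL (ψ := β) (φ := RingHom.id S) (RingHom.id S) f hf (σ.coactL hβ x) =
      mapL (ψ := β) (φ := RingHom.id S) (RingHom.id S) g hg (σ.coactL hβ x)) (c : σ.CoringL) :
    f c = g c := by
  have hf' : ∀ s c, ((unitR (RingHom.id S) β).comp f) (op (RingHom.id S s) • c) =
      op (β s) • ((unitR (RingHom.id S) β).comp f) c := fun s c => by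
    rw [AddMonoidHom.comp_apply, AddMonoidHom.comp_apply, hf, unitR_smul]
  have hg' : ∀ s c, ((unitR (RingHom.id S) β).comp g) (op (RingHom.id S s) • c) =
      op (β s) • ((unitR (RingHom.id S) β).comp g) c := fun s c => by
    rw [AddMonoidHom.comp_apply, AddMonoidHom.comp_apply, hg, unitR_smul]
  refine hβ.unit_injective N (σ.coactL_hom_ext hβ hf' hg' (fun x => ?_) c)
  rw [absorbR_mapL_unitR_coactL σ f hf, absorbR_mapL_unitR_coactL σ g hg, h]

theorem absorbR_mapL_hatR_inclL (h : T →+ BTensor (RingHom.id S) β N T)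
    (hh : ∀ r x, h (op (α r) • x) = op (α r) • h x)
    (hf : ∀ s c, ((d.hatR h hh).comp σ.inclL) (op (RingHom.id S s) • c) =
      op (β s) • ((d.hatR h hh).comp σ.inclL) c) (x : T) :
    absorbR (mapL (ψ := β) (φ := RingHom.id S) β ((d.hatR h hh).comp σ.inclL) hf
      (σ.coactL hβ x)) = h x := by
  rw [← σ.absorbR_mapL_hatR_γL h hh x, ← σ.mapL_inclL_coactL hβ x]
  exact congrArg absorbR (mapL_mapL _ _ _ _ _ _ (fun _ => rfl) _).symm

/-- A right `R`-linear map `T → N ⊗_S T` that is compatible with the descent data is induced by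
a right `S`-linear map `D → N`. -/
theorem exists_coactL_hom (h : T →+ BTensor (RingHom.id S) β N T)
    (hh : ∀ r x, h (op (α r) • x) = op (α r) • h x)
    (hK : ∀ x, mapL (ψ := β) (φ := β) β (d.hatR h hh) (fun s => d.hatR_rsmul h hh (β s)) (σ.γL x) =
      mapL (ψ := β) (φ := RingHom.id S) β (unitR (RingHom.id S) β) unitR_smul (h x)) :
    ∃ (φ : σ.CoringL →+ N) (hφ : ∀ s c, φ (op (RingHom.id S s) • c) = op (RingHom.id S s) • φ c),
      ∀ x, mapL (ψ := β) (φ := RingHom.id S) (RingHom.id S) φ hφ (σ.coactL hβ x) = h x := by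
  have key : ∀ z, mapL (ψ := β) (φ := RingHom.id S) β (unitR (RingHom.id S) β) unitR_smul
      (d.hatR h hh z) = mapL (ψ := β) (φ := β) β (d.hatR h hh)
        (fun s => d.hatR_rsmul h hh (β s)) (d.hatR σ.γL σ.γL_rsmul z) := fun z => by
    induction z using induction_on with
    | zero => simp only [map_zero]
    | tmul x p => rw [d.hatR_tmul, d.hatR_tmul, ← d.coevR_mapL, ← d.coevR_mapL, hK]
    | add x y hx hy => simp only [map_add, hx, hy]
  -- Since `δ c = c ⊗ 1`, the value at `c` satisfies the Amitsur condition for right modules and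
  -- comes from `N`.
  have ex : ∀ c, ∃ n, unitR (RingHom.id S) β n = d.hatR h hh (σ.inclL c) := fun c =>
    hβ.unit_exact N _ (by rw [key, hatR_γL_inclL, mapL_tmul, unitR_apply])
  choose f hf using ex
  have hadd : ∀ c c', f (c + c') = f c + f c' := fun c c' =>
    hβ.unit_injective N (by rw [map_add, hf, hf, hf, map_add, map_add])
  obtain ⟨φ, hφ⟩ : ∃ φ : σ.CoringL →+ N, ∀ c, unitR (RingHom.id S) β (φ c) =
    d.hatR h hh (σ.inclL c) := ⟨AddMonoidHom.mk' f hadd, hf⟩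
  have hsmul : ∀ s c, φ (op (RingHom.id S s) • c) = op (RingHom.id S s) • φ c := fun s c =>
    hβ.unit_injective N (by rw [unitR_smul, hφ, hφ, inclL_smul, d.hatR_rsmul])
  have hcomp : (unitR (RingHom.id S) β).comp φ = (d.hatR h hh).comp σ.inclL :=
    AddMonoidHom.ext hφ
  have hlin : ∀ s c, ((d.hatR h hh).comp σ.inclL) (op (RingHom.id S s) • c) =
      op (β s) • ((d.hatR h hh).comp σ.inclL) c := fun s c => by
    rw [AddMonoidHom.comp_apply, AddMonoidHom.comp_apply, inclL_smul, d.hatR_rsmul]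
  refine ⟨φ, hsmul, fun x => ?_⟩
  rw [← σ.absorbR_mapL_hatR_inclL hβ h hh hlin, ← absorbR_mapL_unitR_coactL σ φ hsmul
    (fun s c => by rw [hcomp, hlin])]
  exact congrArg absorbR (mapL_congr hφ _)

end Universal

end Shepherd

end Herd

/-! ### Counit and coproduct of `D` -/

section Herd

variable {R S A B : Type u} [Ring R] [Ring S] [Ring A] [Ring B] {α : R →+* A} {β : S →+* B}
  {T : Type u} [AddCommGroup T] [Module B T] [Module Aᵐᵒᵖ T] [SMulCommClass B Aᵐᵒᵖ T]
  {P : Type u} [AddCommGroup P] [Module A P] [Module Bᵐᵒᵖ P] [SMulCommClass A Bᵐᵒᵖ P]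
  {d : FormalDual α β T P}

namespace Shepherd

variable (σ : Shepherd d) (hβ : LeftDescent β)

/-- The map on `T` is `x ↦ 1 ⊗ x`, whose compatibility with the descent data is the unit law for
`coev`. -/
theorem exists_counitL : ∃ (ε : σ.CoringL →+ S)
    (hε : ∀ s c, ε (op (RingHom.id S s) • c) = op (RingHom.id S s) • ε c),
      ∀ x, mapL (ψ := β) (φ := RingHom.id S) (RingHom.id S) ε hε (σ.coactL hβ x) =
        tmul (RingHom.id S) β 1 x := by
  refine σ.exists_coactL_hom hβ (N := S) (unitL (RingHom.id S) β) (fun r x => rfl) fun x => ?_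
  have h := congrArg (mapL (ψ := β) (φ := β) (N := T) β (unitL (RingHom.id S) β : B →+ _)
    (fun s b => rfl)) (σ.coev_γL x)
  refine Eq.trans ?_ h
  generalize σ.γL x = z
  induction z using induction_on with
  | zero => simp only [map_zero]
  | tmul w t =>
    induction w using induction_on with
    | zero => simp only [map_zero, zero_tmul]
    | tmul y p => rfl
    | add x y hx hy => simp only [map_add, add_tmul, hx, hy]
  | add x y hx hy => simp only [map_add, hx, hy]

theorem mapL_projL_extL (w : BTensor (RingHom.id S) β σ.CoringL T) :
    mapL (ψ := β) (φ := β) β (mapL (ψ := α) (φ := α) α (σ.projL hβ)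
      (fun r => σ.projL_rsmul hβ (α r))) (fun s z => mapL_rsmul _ _ (β s) z)
      (σ.extL β (mapL (ψ := β) (φ := RingHom.id S) β σ.inclL σ.inclL_smul w)) =
    σ.extL (RingHom.id S) w := by
  rw [extL_mapL]
  generalize σ.extL (RingHom.id S) w = z
  have key : ∀ v : BTensor α α (BTensor (RingHom.id S) β σ.CoringL T) P,
      mapL (ψ := α) (φ := α) α (σ.projL hβ) (fun r => σ.projL_rsmul hβ (α r))
        (mapL (ψ := α) (φ := α) α (mapL (ψ := β) (φ := RingHom.id S) β σ.inclL σ.inclL_smul)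
          (fun r z => mapL_rsmul _ _ (α r) z) v) = v := fun v => by
    induction v using induction_on with
    | zero => rw [map_zero, map_zero]
    | tmul y p => rw [mapL_tmul, mapL_tmul, projL_mapL_inclL]
    | add x y hx hy => rw [map_add, map_add, hx, hy]
  induction z using induction_on with
  | zero => rw [map_zero, map_zero]
  | tmul w t => rw [mapL_tmul, mapL_tmul, key]
  | add x y hx hy => rw [map_add, map_add, hx, hy]

/-- Coassociativity of `γ`, projected on the first legs: `(D ⊗ γ) ρ = (ρ ⊗ P ⊗ T) γ`. -/
theorem extL_coactL (x : T) : σ.extL (RingHom.id S) (σ.coactL hβ x) =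
    mapL (ψ := β) (φ := β) β (mapL (ψ := α) (φ := α) α (σ.coactL hβ) (σ.coactL_rsmul hβ))
      (fun s z => mapL_rsmul _ _ (β s) z) (σ.γL x) := by
  rw [← σ.mapL_projL_extL hβ (σ.coactL hβ x), mapL_inclL_coactL, extL_γL]
  exact mapL_mapL _ _ _ _ _ _ (fun z => mapL_mapL _ _ _ _ _ _ (fun _ => rfl) z) _

/-- The map `X ⊗_S T → (X ⊗_S D) ⊗_S T` induced by the coaction. -/
noncomputable def coactExtL {Q X : Type u} [Ring Q] [AddCommGroup X] [Module Qᵐᵒᵖ X] (ξ : S →+* Q) :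
    BTensor ξ β X T →+ BTensor (RingHom.id S) β (BTensor ξ (RingHom.id S) X σ.CoringL) T :=
  BimodHerd.coactExtL (σ.coactL hβ) (σ.coactL_lsmul hβ) ξ

theorem coactExtL_tmul {Q X : Type u} [Ring Q] [AddCommGroup X] [Module Qᵐᵒᵖ X] (ξ : S →+* Q)
    (t : T) (x : X) : σ.coactExtL hβ ξ (tmul ξ β x t) = insL β ξ x (σ.coactL hβ t) := rfl

theorem coactExtL_rsmul {Q X : Type u} [Ring Q] [AddCommGroup X] [Module Qᵐᵒᵖ X] (ξ : S →+* Q)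
    (r : R) (z : BTensor ξ β X T) :
    σ.coactExtL hβ ξ (op (α r) • z) = op (α r) • σ.coactExtL hβ ξ z :=
  BimodHerd.coactExtL_rsmul (A := A) (σ.coactL hβ) (σ.coactL_lsmul hβ) (α r)
    (fun x => σ.coactL_rsmul hβ r x) z

/-- The map `(D ⊗_S T) ⊗_R P → (D ⊗_S D) ⊗_S B` induced by the coaction. -/
noncomputable def coevCoactExtL : BTensor α α (BTensor (RingHom.id S) β σ.CoringL T) P →+
    BTensor (RingHom.id S) β (BTensor (RingHom.id S) (RingHom.id S) σ.CoringL σ.CoringL) B :=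
  (d.coevMapR (υ := RingHom.id S)).comp (mapL (ψ := α) (φ := α) α (σ.coactExtL hβ (RingHom.id S))
    (σ.coactExtL_rsmul hβ (RingHom.id S)))

theorem coevCoactExtL_rsmul (b : B) (z : BTensor α α (BTensor (RingHom.id S) β σ.CoringL T) P) :
    σ.coevCoactExtL hβ (op b • z) = op b • σ.coevCoactExtL hβ z := by
  rw [coevCoactExtL, AddMonoidHom.comp_apply, mapL_rsmul, d.coevMapR_rsmul, AddMonoidHom.comp_apply]

theorem mapL_coevCoactExtL_extL (w : BTensor (RingHom.id S) β σ.CoringL T) :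
    mapL (ψ := β) (φ := β) β (σ.coevCoactExtL hβ) (fun s => σ.coevCoactExtL_rsmul hβ (β s))
      (σ.extL (RingHom.id S) w) =
    mapL (ψ := β) (φ := RingHom.id S) β (unitR (RingHom.id S) β) unitR_smul
      (σ.coactExtL hβ (RingHom.id S) w) := by
  induction w using induction_on with
  | zero => simp only [map_zero]
  | tmul c t =>
    rw [extL_tmul, coactExtL_tmul]
    have h := congrArg (mapL (ψ := β) (φ := β) β (insL (M := B) β (RingHom.id S) c)
      (fun s z => mapL_rsmul _ _ (β s) z)) (σ.mapL_descL_γL hβ t)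
    refine Eq.trans ?_ (h.trans ?_)
    · generalize σ.γL t = z
      induction z using induction_on with
      | zero => simp only [map_zero]
      | tmul w t =>
        induction w using induction_on with
        | zero => simp only [map_zero, zero_tmul]
        | tmul y p =>
          rw [mapL_tmul, ← coevR_coactL]
          change tmul β β (d.coevR p (insL β (RingHom.id S) c (σ.coactL hβ y))) t = _
          exact congrArg (tmul β β · t) (d.coevR_mapL _ _ _ _)
        | add x y hx hy => simp only [map_add, add_tmul, hx, hy]
      | add x y hx hy => simp only [map_add, hx, hy]
    · generalize σ.coactL hβ t = z
      induction z using induction_on with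
      | zero => simp only [map_zero]
      | tmul w t => rfl
      | add x y hx hy => simp only [map_add, hx, hy]
  | add x y hx hy => simp only [map_add, hx, hy]

/-- The map on `T` is the iterated coaction `(D ⊗ ρ) ρ`. -/
theorem exists_comulL :
    ∃ (Δ : σ.CoringL →+ BTensor (RingHom.id S) (RingHom.id S) σ.CoringL σ.CoringL)
      (hΔ : ∀ s c, Δ (op (RingHom.id S s) • c) = op (RingHom.id S s) • Δ c),
      ∀ x, mapL (ψ := β) (φ := RingHom.id S) (RingHom.id S) Δ hΔ (σ.coactL hβ x) =
        σ.coactExtL hβ (RingHom.id S) (σ.coactL hβ x) := by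
  refine σ.exists_coactL_hom hβ ((σ.coactExtL hβ (RingHom.id S)).comp (σ.coactL hβ))
    (fun r x => ?_) fun x => ?_
  · exact (congrArg (σ.coactExtL hβ (RingHom.id S)) (σ.coactL_rsmul hβ r x)).trans
      (σ.coactExtL_rsmul hβ (RingHom.id S) r _)
  · rw [AddMonoidHom.comp_apply, ← mapL_coevCoactExtL_extL, extL_coactL]
    refine (mapL_mapL _ _ _ _ _ _ (fun z => ?_) _).symm
    exact congrArg d.coevMapR (mapL_mapL _ _ _ _ _ _ (fun _ => rfl) z)

noncomputable def counitL : σ.CoringL →+ S := (σ.exists_counitL hβ).choose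

theorem counitL_rsmul (s : S) (c : σ.CoringL) :
    σ.counitL hβ (op s • c) = op s • σ.counitL hβ c :=
  (σ.exists_counitL hβ).choose_spec.choose s c

theorem mapL_counitL (x : T) : mapL (ψ := β) (φ := RingHom.id S) (RingHom.id S) (σ.counitL hβ)
    (σ.counitL_rsmul hβ) (σ.coactL hβ x) = tmul (RingHom.id S) β 1 x :=
  (σ.exists_counitL hβ).choose_spec.choose_spec x

noncomputable def comulL :
    σ.CoringL →+ BTensor (RingHom.id S) (RingHom.id S) σ.CoringL σ.CoringL :=
  (σ.exists_comulL hβ).choose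

theorem comulL_rsmul (s : S) (c : σ.CoringL) :
    σ.comulL hβ (op s • c) = op s • σ.comulL hβ c :=
  (σ.exists_comulL hβ).choose_spec.choose s c

theorem mapL_comulL (x : T) : mapL (ψ := β) (φ := RingHom.id S) (RingHom.id S) (σ.comulL hβ)
    (σ.comulL_rsmul hβ) (σ.coactL hβ x) = σ.coactExtL hβ (RingHom.id S) (σ.coactL hβ x) :=
  (σ.exists_comulL hβ).choose_spec.choose_spec x

/-- A map `D → N` that is left `S`-linear after the coaction of `T` is left `S`-linear. -/
theorem map_lsmul_of_coactL {N : Type u} [AddCommGroup N] [Module Sᵐᵒᵖ N] [Module S N]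
    [SMulCommClass S Sᵐᵒᵖ N] {f : σ.CoringL →+ N}
    (hf : ∀ s c, f (op (RingHom.id S s) • c) = op (RingHom.id S s) • f c) (s : S)
    (h : ∀ x, mapL (ψ := β) (φ := RingHom.id S) (RingHom.id S) f hf (σ.coactL hβ (β s • x)) =
      s • mapL (ψ := β) (φ := RingHom.id S) (RingHom.id S) f hf (σ.coactL hβ x))
    (c : σ.CoringL) : f (s • c) = s • f c := by
  have hf1 : ∀ r c, (f.comp (DistribSMul.toAddMonoidHom σ.CoringL s)) (op (RingHom.id S r) • c) =
      op (RingHom.id S r) • (f.comp (DistribSMul.toAddMonoidHom σ.CoringL s)) c := fun r c =>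
    (congrArg f (smul_comm s (op r) c)).trans (hf r _)
  have hf2 : ∀ r c, ((DistribSMul.toAddMonoidHom N s).comp f) (op (RingHom.id S r) • c) =
      op (RingHom.id S r) • ((DistribSMul.toAddMonoidHom N s).comp f) c := fun r c =>
    (congrArg (s • ·) (hf r c)).trans (smul_comm s (op r) _)
  refine σ.coactL_hom_ext' hβ hf1 hf2 (fun x => ?_) c
  have h1 : ∀ w : BTensor (RingHom.id S) β σ.CoringL T, mapL (ψ := β) (φ := RingHom.id S)
      (RingHom.id S) (f.comp (DistribSMul.toAddMonoidHom σ.CoringL s)) hf1 w =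
        mapL (ψ := β) (φ := RingHom.id S) (RingHom.id S) f hf (s • w) := fun w => by
    induction w using induction_on with
    | zero => rw [smul_zero, map_zero, map_zero]
    | tmul c t => rw [lsmul_tmul, mapL_tmul, mapL_tmul]; rfl
    | add x y hx hy => rw [smul_add, map_add, map_add, hx, hy]
  have h2 : ∀ w : BTensor (RingHom.id S) β σ.CoringL T, mapL (ψ := β) (φ := RingHom.id S)
      (RingHom.id S) ((DistribSMul.toAddMonoidHom N s).comp f) hf2 w =
        s • mapL (ψ := β) (φ := RingHom.id S) (RingHom.id S) f hf w := fun w => by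
    induction w using induction_on with
    | zero => rw [map_zero, map_zero, smul_zero]
    | tmul c t => rw [mapL_tmul, mapL_tmul, lsmul_tmul]; rfl
    | add x y hx hy => rw [map_add, map_add, smul_add, hx, hy]
  rw [h1, h2, ← h, coactL_lsmul]

theorem counitL_lsmul (s : S) (c : σ.CoringL) :
    σ.counitL hβ (s • c) = s • σ.counitL hβ c := by
  refine σ.map_lsmul_of_coactL hβ (σ.counitL_rsmul hβ) s (fun x => ?_) c
  have h := (smul_tmul (RingHom.id S) β s (1 : S) x).symm
  refine (σ.mapL_counitL hβ _).trans (h.trans ?_)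
  rw [σ.mapL_counitL hβ x, lsmul_tmul, op_smul_eq_mul, smul_eq_mul, one_mul, mul_one,
    RingHom.id_apply]

theorem comulL_lsmul (s : S) (c : σ.CoringL) :
    σ.comulL hβ (s • c) = s • σ.comulL hβ c := by
  refine σ.map_lsmul_of_coactL hβ (σ.comulL_rsmul hβ) s (fun x => ?_) c
  refine (σ.mapL_comulL hβ _).trans ?_
  rw [σ.mapL_comulL hβ x, coactL_lsmul]
  exact BimodHerd.coactExtL_lsmul (σ.coactL hβ) (σ.coactL_lsmul hβ) s _

end Shepherd

end Herd

namespace BTensor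

section Absorb

variable {S P Q Q' : Type*} [Ring S] [Ring P] [Ring Q] [Ring Q'] {φ : S →+* P} {ψ : S →+* Q}
  {ψ' : S →+* Q'} {M N N' : Type*} [AddCommGroup M] [AddCommGroup N] [AddCommGroup N']
  [Module P M] [Module Qᵐᵒᵖ N] [Module Q'ᵐᵒᵖ N']

theorem absorbR_actR (m : M) (z : BTensor φ φ (BTensor ψ φ N P) P) :
    absorbR (actR m z) = actR m (absorbR z) := by
  induction z using induction_on with
  | zero => simp only [map_zero]
  | tmul n p => rw [absorbR_tmul, actR_tmul, absorbR_tmul, actR_eq_smul, actR_smul]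
  | add x y hx hy => simp only [map_add, hx, hy]

theorem absorbR_mapL_absorbR (F : N →+ BTensor ψ' φ N' P)
    (hF : ∀ s n, F (op (ψ s) • n) = op (φ s) • F n) (G : BTensor ψ φ N P →+ BTensor ψ' φ N' P)
    (hG : ∀ s w, G (op (φ s) • w) = op (φ s) • G w)
    (h : ∀ w, absorbR (mapL (ψ := φ) (φ := ψ) φ F hF w) = G w)
    (z : BTensor φ φ (BTensor ψ φ N P) M) :
    absorbR (mapL (ψ := φ) (φ := ψ) φ F hF (absorbR z)) =
      absorbR (mapL (ψ := φ) (φ := φ) φ G hG z) := by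
  induction z using induction_on with
  | zero => simp only [map_zero]
  | tmul w m => rw [absorbR_tmul, mapL_actR, absorbR_actR, h, mapL_tmul, absorbR_tmul]
  | add x y hx hy => simp only [map_add, hx, hy]

theorem mapL_id (z : BTensor ψ φ N M) {h : ∀ (s : S) (n : N), AddMonoidHom.id N (op (ψ s) • n) =
    op (ψ s) • AddMonoidHom.id N n} : mapL (ψ := φ) (φ := ψ) ψ (AddMonoidHom.id N) h z = z := by
  induction z using induction_on with
  | zero => rw [map_zero]
  | tmul n m => rfl
  | add x y hx hy => rw [map_add, hx, hy]

end Absorb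

end BTensor

/-! ### The coring axioms for `D` -/

section Herd

variable {R S A B : Type u} [Ring R] [Ring S] [Ring A] [Ring B] {α : R →+* A} {β : S →+* B}
  {T : Type u} [AddCommGroup T] [Module B T] [Module Aᵐᵒᵖ T] [SMulCommClass B Aᵐᵒᵖ T]
  {P : Type u} [AddCommGroup P] [Module A P] [Module Bᵐᵒᵖ P] [SMulCommClass A Bᵐᵒᵖ P]
  {d : FormalDual α β T P}

namespace Shepherd

variable (σ : Shepherd d) (hβ : LeftDescent β)

/-- `c' ⊗ c ↦ c' ⊗ Δ(c)` -/
noncomputable def comulExtL : BTensor (RingHom.id S) (RingHom.id S) σ.CoringL σ.CoringL →+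
    BTensor (RingHom.id S) (RingHom.id S) (BTensor (RingHom.id S) (RingHom.id S) σ.CoringL σ.CoringL)
      σ.CoringL :=
  (assoc (ψ₂ := RingHom.id S) (φ₂ := RingHom.id S) (ψ₁ := RingHom.id S)
    (φ₁ := RingHom.id S)).symm.toAddMonoidHom.comp
    (mapR (ψ := RingHom.id S) (φ := RingHom.id S) (RingHom.id S) (σ.comulL hβ)
      (σ.comulL_lsmul hβ))

theorem comulExtL_tmul (c c' : σ.CoringL) : σ.comulExtL hβ (tmul _ _ c' c) =
    assocInvAux (RingHom.id S) (RingHom.id S) (RingHom.id S) (RingHom.id S) c' (σ.comulL hβ c) := by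
  rw [comulExtL, AddMonoidHom.comp_apply, mapR_tmul]
  generalize σ.comulL hβ c = z
  induction z using induction_on with
  | zero => rw [tmul_zero, map_zero, map_zero]
  | tmul w t => rfl
  | add x y hx hy => rw [tmul_add, map_add, map_add, hx, hy]

theorem comulExtL_rsmul (s : S) (z : BTensor (RingHom.id S) (RingHom.id S) σ.CoringL σ.CoringL) :
    σ.comulExtL hβ (op (RingHom.id S s) • z) = op (RingHom.id S s) • σ.comulExtL hβ z := by
  induction z using induction_on with
  | zero => rw [smul_zero, map_zero, smul_zero]
  | tmul c' c =>
    rw [rsmul_tmul, comulExtL_tmul, comulExtL_tmul, RingHom.id_apply, comulL_rsmul]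
    exact mapL_rsmul _ _ s _
  | add x y hx hy => rw [smul_add, map_add, map_add, smul_add, hx, hy]

theorem mapL_comulExtL_coactExtL (w : BTensor (RingHom.id S) β σ.CoringL T) :
    mapL (ψ := β) (φ := RingHom.id S) (RingHom.id S) (σ.comulExtL hβ) (σ.comulExtL_rsmul hβ)
      (σ.coactExtL hβ (RingHom.id S) w) =
    σ.coactExtL hβ (RingHom.id S) (σ.coactExtL hβ (RingHom.id S) w) := by
  induction w using induction_on with
  | zero => rw [map_zero, map_zero, map_zero]
  | tmul c t =>
    rw [coactExtL_tmul]
    refine Eq.trans ?_ (BimodHerd.coactExtL_insL (σ.coactL hβ) (σ.coactL_lsmul hβ) c _).symm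
    refine Eq.trans ?_ (congrArg _ (σ.mapL_comulL hβ t))
    generalize σ.coactL hβ t = z
    induction z using induction_on with
    | zero => simp only [map_zero]
    | tmul c' t => exact congrArg (tmul _ _ · t) (σ.comulExtL_tmul hβ c' c)
    | add x y hx hy => simp only [map_add, hx, hy]
  | add x y hx hy => rw [map_add, map_add, map_add, hx, hy]

/-- Stated with the inverse reassociation: iterated left coactions have the form `(N ⊗ D) ⊗ T`, and
in that bracketing both sides induce the threefold coaction. -/
theorem coassocL (c : σ.CoringL) : assoc.symm (mapR (ψ := RingHom.id S) (φ := RingHom.id S)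
    (RingHom.id S) (σ.comulL hβ) (σ.comulL_lsmul hβ) (σ.comulL hβ c)) =
      mapL (ψ := RingHom.id S) (φ := RingHom.id S) (RingHom.id S) (σ.comulL hβ)
        (σ.comulL_rsmul hβ) (σ.comulL hβ c) := by
  have hl : ∀ s c, ((σ.comulExtL hβ).comp (σ.comulL hβ)) (op (RingHom.id S s) • c) =
      op (RingHom.id S s) • ((σ.comulExtL hβ).comp (σ.comulL hβ)) c := fun s c =>
    (congrArg (σ.comulExtL hβ) (σ.comulL_rsmul hβ s c)).trans (σ.comulExtL_rsmul hβ s _)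
  have hm : ∀ s z, mapL (ψ := RingHom.id S) (φ := RingHom.id S) (N := σ.CoringL) (RingHom.id S)
      (σ.comulL hβ) (σ.comulL_rsmul hβ) (op (RingHom.id S s) • z) = op (RingHom.id S s) •
        mapL (ψ := RingHom.id S) (φ := RingHom.id S) (RingHom.id S)
      (σ.comulL hβ) (σ.comulL_rsmul hβ) z := fun s z => mapL_rsmul _ _ s z
  have hr : ∀ s c, ((mapL (ψ := RingHom.id S) (φ := RingHom.id S) (RingHom.id S) (σ.comulL hβ)
        (σ.comulL_rsmul hβ)).comp (σ.comulL hβ)) (op (RingHom.id S s) • c) =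
      op (RingHom.id S s) • ((mapL (ψ := RingHom.id S) (φ := RingHom.id S) (RingHom.id S) (σ.comulL hβ)
        (σ.comulL_rsmul hβ)).comp (σ.comulL hβ)) c := fun s c =>
    (congrArg _ (σ.comulL_rsmul hβ s c)).trans (hm s _)
  refine σ.coactL_hom_ext' hβ hl hr (fun x => ?_) c
  rw [← mapL_mapL (σ.comulL hβ) (σ.comulL_rsmul hβ) (σ.comulExtL hβ) (σ.comulExtL_rsmul hβ) _ hl
    (fun _ => rfl), mapL_comulL, mapL_comulExtL_coactExtL]
  rw [← mapL_mapL (σ.comulL hβ) (σ.comulL_rsmul hβ) _ hm _ hr (fun _ => rfl), mapL_comulL]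
  refine (congrArg (σ.coactExtL hβ (RingHom.id S)) (σ.mapL_comulL hβ x).symm).trans ?_
  exact BimodHerd.coactExtL_mapL (ξ := RingHom.id S) (ξ' := RingHom.id S) (σ.coactL hβ)
    (σ.coactL_lsmul hβ) (σ.comulL hβ) (σ.comulL_rsmul hβ) _

/-- `c' ⊗ c ↦ c' ε(c)` -/
noncomputable def counitMulL : BTensor (RingHom.id S) (RingHom.id S) σ.CoringL σ.CoringL →+
    σ.CoringL :=
  (ract (ψ := RingHom.id S) (φ := RingHom.id S) (RingHom.id S) (fun _ => rfl)).comp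
    (mapR (ψ := RingHom.id S) (φ := RingHom.id S) (RingHom.id S) (σ.counitL hβ)
      (σ.counitL_lsmul hβ))

theorem counitMulL_tmul (c c' : σ.CoringL) :
    σ.counitMulL hβ (tmul _ _ c' c) = op (σ.counitL hβ c) • c' := rfl

theorem counitMulL_rsmul (s : S) (z : BTensor (RingHom.id S) (RingHom.id S) σ.CoringL σ.CoringL) :
    σ.counitMulL hβ (op (RingHom.id S s) • z) = op (RingHom.id S s) • σ.counitMulL hβ z := by
  induction z using induction_on with
  | zero => rw [smul_zero, map_zero, smul_zero]
  | tmul c' c =>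
    rw [rsmul_tmul, counitMulL_tmul, counitMulL_tmul, RingHom.id_apply, counitL_rsmul,
      op_smul_eq_mul, op_mul, mul_smul]
  | add x y hx hy => rw [smul_add, map_add, map_add, smul_add, hx, hy]

theorem mapL_counitMulL_coactExtL (w : BTensor (RingHom.id S) β σ.CoringL T) :
    mapL (ψ := β) (φ := RingHom.id S) (RingHom.id S) (σ.counitMulL hβ) (σ.counitMulL_rsmul hβ)
      (σ.coactExtL hβ (RingHom.id S) w) = w := by
  induction w using induction_on with
  | zero => rw [map_zero, map_zero]
  | tmul c t =>
    rw [coactExtL_tmul, ← actL_one_tmul (ψ := β) (φ := RingHom.id S) c t, ← σ.mapL_counitL hβ t]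
    generalize σ.coactL hβ t = z
    induction z using induction_on with
    | zero => simp only [map_zero]
    | tmul c' t => rfl
    | add x y hx hy => simp only [map_add, hx, hy]
  | add x y hx hy => rw [map_add, map_add, hx, hy]

/-- The iterated coaction puts the new copy of `D` on the right, so on this side it is the right
counit law that needs only `(ε ⊗ T) ρ(t) = 1 ⊗ t` with a spectator. -/
theorem rcounitL (c : σ.CoringL) : ract (ψ := RingHom.id S) (φ := RingHom.id S) (RingHom.id S)
    (fun _ => rfl) (mapR (ψ := RingHom.id S) (φ := RingHom.id S) (RingHom.id S) (σ.counitL hβ)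
      (σ.counitL_lsmul hβ) (σ.comulL hβ c)) = c := by
  have hl : ∀ s c, ((σ.counitMulL hβ).comp (σ.comulL hβ)) (op (RingHom.id S s) • c) =
      op (RingHom.id S s) • ((σ.counitMulL hβ).comp (σ.comulL hβ)) c := fun s c =>
    (congrArg (σ.counitMulL hβ) (σ.comulL_rsmul hβ s c)).trans (σ.counitMulL_rsmul hβ s _)
  refine σ.coactL_hom_ext' hβ (g := AddMonoidHom.id _) hl (fun _ _ => rfl) (fun x => ?_) c
  rw [← mapL_mapL (σ.comulL hβ) (σ.comulL_rsmul hβ) (σ.counitMulL hβ) (σ.counitMulL_rsmul hβ) _ hl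
    (fun _ => rfl), mapL_comulL, mapL_counitMulL_coactExtL]
  exact (mapL_id _).symm

theorem mapL_lact_insL (w : BTensor (RingHom.id S) β σ.CoringL T)
    (h : ∀ (s : S) (z : BTensor (RingHom.id S) (RingHom.id S) S σ.CoringL),
      lact (ψ := RingHom.id S) (φ := RingHom.id S) (RingHom.id S) (fun _ => rfl)
        (op (RingHom.id S s) • z) = op (RingHom.id S s) • lact (ψ := RingHom.id S) (φ := RingHom.id S)
          (RingHom.id S) (fun _ => rfl) z) :
    mapL (ψ := β) (φ := RingHom.id S) (RingHom.id S) (lact (ψ := RingHom.id S) (φ := RingHom.id S)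
      (RingHom.id S) (fun _ => rfl)) h (insL β (RingHom.id S) (1 : S) w) = w := by
  induction w using induction_on with
  | zero => rw [map_zero, map_zero]
  | tmul c t => rw [insL_tmul, mapL_tmul, lact_tmul, map_one, one_smul]
  | add x y hx hy => rw [map_add, map_add, hx, hy]

theorem lcounitL (c : σ.CoringL) : lact (ψ := RingHom.id S) (φ := RingHom.id S) (RingHom.id S)
    (fun _ => rfl) (mapL (ψ := RingHom.id S) (φ := RingHom.id S) (RingHom.id S) (σ.counitL hβ)
      (σ.counitL_rsmul hβ) (σ.comulL hβ c)) = c := by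
  have hm : ∀ (s : S) (z : BTensor (RingHom.id S) (RingHom.id S) S σ.CoringL),
      lact (ψ := RingHom.id S) (φ := RingHom.id S) (RingHom.id S) (fun _ => rfl)
        (op (RingHom.id S s) • z) = op (RingHom.id S s) • lact (ψ := RingHom.id S) (φ := RingHom.id S)
          (RingHom.id S) (fun _ => rfl) z := fun s z => by
    induction z using induction_on with
    | zero => rw [smul_zero, map_zero, smul_zero]
    | tmul r c => rw [rsmul_tmul, lact_tmul, lact_tmul]; exact smul_comm r (op s) c
    | add x y hx hy => rw [smul_add, map_add, map_add, smul_add, hx, hy]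
  have hε : ∀ s z, mapL (ψ := RingHom.id S) (φ := RingHom.id S) (N := σ.CoringL) (RingHom.id S)
      (σ.counitL hβ) (σ.counitL_rsmul hβ) (op (RingHom.id S s) • z) = op (RingHom.id S s) •
        mapL (ψ := RingHom.id S) (φ := RingHom.id S) (RingHom.id S)
      (σ.counitL hβ) (σ.counitL_rsmul hβ) z := fun s z => mapL_rsmul _ _ s z
  have hε' : ∀ s c, ((mapL (ψ := RingHom.id S) (φ := RingHom.id S) (N := σ.CoringL) (RingHom.id S)
      (σ.counitL hβ) (σ.counitL_rsmul hβ)).comp (σ.comulL hβ)) (op (RingHom.id S s) • c) =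
      op (RingHom.id S s) • ((mapL (ψ := RingHom.id S) (φ := RingHom.id S) (RingHom.id S)
      (σ.counitL hβ) (σ.counitL_rsmul hβ)).comp (σ.comulL hβ)) c := fun s c =>
    (congrArg _ (σ.comulL_rsmul hβ s c)).trans (hε s _)
  have hl : ∀ s c, ((lact (ψ := RingHom.id S) (φ := RingHom.id S) (RingHom.id S)
      (fun _ => rfl)).comp ((mapL (ψ := RingHom.id S) (φ := RingHom.id S) (N := σ.CoringL)
        (RingHom.id S) (σ.counitL hβ) (σ.counitL_rsmul hβ)).comp (σ.comulL hβ)))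
          (op (RingHom.id S s) • c) = op (RingHom.id S s) • ((lact (ψ := RingHom.id S) (φ := RingHom.id S)
            (RingHom.id S) (fun _ => rfl)).comp ((mapL (ψ := RingHom.id S) (φ := RingHom.id S)
              (RingHom.id S) (σ.counitL hβ) (σ.counitL_rsmul hβ)).comp (σ.comulL hβ))) c :=
    fun s c => (congrArg _ (hε' s c)).trans (hm s _)
  refine σ.coactL_hom_ext' hβ (g := AddMonoidHom.id _) hl (fun _ _ => rfl) (fun x => ?_) c
  rw [← mapL_mapL _ hε' _ hm _ hl (fun _ => rfl), ← mapL_mapL _ (σ.comulL_rsmul hβ) _ hε _ hε'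
    (fun _ => rfl), mapL_comulL]
  refine Eq.trans ?_ ((σ.mapL_lact_insL (σ.coactL hβ x) hm).trans (mapL_id _).symm)
  refine congrArg _ ?_
  refine (BimodHerd.coactExtL_mapL (ξ := RingHom.id S) (ξ' := RingHom.id S) (σ.coactL hβ)
    (σ.coactL_lsmul hβ) (σ.counitL hβ) (σ.counitL_rsmul hβ) _).symm.trans ?_
  rw [mapL_counitL]
  rfl

/-- The coring of the herd. -/
noncomputable def coringL : Coring S σ.CoringL where
  comul := σ.comulL hβ
  comul_rsmul := σ.comulL_rsmul hβ
  comul_lsmul := σ.comulL_lsmul hβ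
  counit := σ.counitL hβ
  counit_rsmul := σ.counitL_rsmul hβ
  counit_lsmul := σ.counitL_lsmul hβ
  coassoc c := ((AddEquiv.symm_apply_eq _).1 (σ.coassocL hβ c)).symm
  rcounit := σ.rcounitL hβ
  lcounit := σ.lcounitL hβ

end Shepherd

end Herd

theorem insL_rsmul {S B : Type u} [Ring S] [Ring B] {β : S →+* B} {C : Type u} [AddCommGroup C]
    [Module Sᵐᵒᵖ C] [Module S C] [SMulCommClass S Sᵐᵒᵖ C] {Q X : Type u} [Ring Q] {ξ : S →+* Q}
    [AddCommGroup X] [Module Qᵐᵒᵖ X] {M L : Type u} [AddCommGroup M] [Module B M] [Ring L]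
    [Module Lᵐᵒᵖ M] [SMulCommClass B Lᵐᵒᵖ M] (x : X) (l : L) (z : BTensor (RingHom.id S) β C M) :
    insL β ξ x (op l • z) = op l • insL β ξ x z :=
  mapL_rsmul _ _ l z

/-! ### The entwining of `B` with `D` -/

section Herd

variable {R S A B : Type u} [Ring R] [Ring S] [Ring A] [Ring B] {α : R →+* A} {β : S →+* B}
  {T : Type u} [AddCommGroup T] [Module B T] [Module Aᵐᵒᵖ T] [SMulCommClass B Aᵐᵒᵖ T]
  {P : Type u} [AddCommGroup P] [Module A P] [Module Bᵐᵒᵖ P] [SMulCommClass A Bᵐᵒᵖ P]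
  {d : FormalDual α β T P}

namespace Shepherd

variable (σ : Shepherd d) (hβ : LeftDescent β)

/-- The map `χ(b ⊗ -) : D → D ⊗_S B`. -/
noncomputable def twistL (b : B) : σ.CoringL →+ BTensor (RingHom.id S) β σ.CoringL B :=
  (σ.descL hβ).comp ((DistribSMul.toAddMonoidHom (BTensor α α T P) b).comp σ.inclL)

theorem twistL_apply (b : B) (c : σ.CoringL) :
    σ.twistL hβ b c = σ.descL hβ (b • σ.inclL c) := rfl

theorem twistL_smul (b : B) (s : S) (c : σ.CoringL) :
    σ.twistL hβ b (op (RingHom.id S s) • c) = op (β s) • σ.twistL hβ b c := by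
  rw [twistL_apply, twistL_apply, inclL_smul, smul_comm b (op (β s)), descL_rsmul]

/-- `χ(b ⊗ -)` sends `c` to the descent of `b c`, and what it induces on `T` is `x ↦ ρ(b x)`. The
axioms of the left entwining are checked on `T` by means of it. -/
theorem absorbR_mapL_twistL (b : B) (x : T) :
    absorbR (mapL (ψ := β) (φ := RingHom.id S) β (σ.twistL hβ b) (σ.twistL_smul hβ b)
      (σ.coactL hβ x)) = σ.coactL hβ (b • x) := by
  have hh : ∀ r x, ((σ.coactL hβ).comp (DistribSMul.toAddMonoidHom T b)) (op (α r) • x) =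
      op (α r) • ((σ.coactL hβ).comp (DistribSMul.toAddMonoidHom T b)) x := fun r x =>
    (congrArg (σ.coactL hβ) (smul_comm b (op (α r)) x)).trans (σ.coactL_rsmul hβ r _)
  have key : ∀ z, d.hatR _ hh z = σ.descL hβ (b • z) := fun z => by
    induction z using induction_on with
    | zero => rw [map_zero, smul_zero, map_zero]
    | tmul x p =>
      rw [d.hatR_tmul, AddMonoidHom.comp_apply, lsmul_tmul, ← coevR_coactL]
      rfl
    | add x y hx hy => rw [map_add, smul_add, map_add, hx, hy]
  have hf : ∀ s c, ((d.hatR _ hh).comp σ.inclL) (op (RingHom.id S s) • c) =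
      op (β s) • ((d.hatR _ hh).comp σ.inclL) c := fun s c => by
    rw [AddMonoidHom.comp_apply, AddMonoidHom.comp_apply, inclL_smul, d.hatR_rsmul]
  refine Eq.trans ?_ (σ.absorbR_mapL_hatR_inclL hβ _ hh hf x)
  exact congrArg absorbR (mapL_congr (fun c => (key (σ.inclL c)).symm) _)

/-- The entwining map `χ : B ⊗_S D → D ⊗_S B`. -/
noncomputable def entwL :
    BTensor β (RingHom.id S) B σ.CoringL →+ BTensor (RingHom.id S) β σ.CoringL B :=
  lift (biadd (fun b c => σ.twistL hβ b c) (fun b b' c => by rw [twistL_apply, add_smul, map_add]; rfl)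
    (fun b c c' => map_add _ c c'))
    (fun s b c => by
      rw [biadd_apply, biadd_apply, twistL_apply, twistL_apply, RingHom.id_apply, inclL_lsmul,
        op_smul_eq_mul, mul_smul])

theorem entwL_tmul (c : σ.CoringL) (b : B) :
    σ.entwL hβ (tmul β (RingHom.id S) b c) = σ.twistL hβ b c := rfl

theorem entwL_rsmul (s : S) (z : BTensor β (RingHom.id S) B σ.CoringL) :
    σ.entwL hβ (op s • z) = op (β s) • σ.entwL hβ z := by
  induction z using induction_on with
  | zero => rw [smul_zero, map_zero, smul_zero]
  | tmul b c => exact σ.twistL_smul hβ b s c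
  | add x y hx hy => rw [smul_add, map_add, map_add, smul_add, hx, hy]

theorem entwL_lsmul (s : S) (z : BTensor β (RingHom.id S) B σ.CoringL) :
    σ.entwL hβ (β s • z) = s • σ.entwL hβ z := by
  induction z using induction_on with
  | zero => rw [smul_zero, map_zero, smul_zero]
  | tmul b c =>
    rw [lsmul_tmul, entwL_tmul, entwL_tmul, twistL_apply, twistL_apply, ← descL_lsmul,
      smul_eq_mul, mul_smul]
  | add x y hx hy => rw [smul_add, map_add, map_add, smul_add, hx, hy]

theorem entwL_one (c : σ.CoringL) : σ.entwL hβ (tmul _ _ 1 c) = tmul _ _ c 1 := by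
  rw [entwL_tmul, twistL_apply, one_smul, descL_inclL, unitR_apply]

/-- Both sides induce `x ↦ ρ(b' b x)` on `T`. -/
theorem twistL_mul (b b' : B) (c : σ.CoringL) : σ.twistL hβ (b' * b) c =
    absorbR (mapL (ψ := β) (φ := RingHom.id S) β (σ.twistL hβ b') (σ.twistL_smul hβ b')
      (σ.twistL hβ b c)) := by
  have hG : ∀ (s : S) (w : BTensor (RingHom.id S) β σ.CoringL B), (absorbR.comp (mapL (ψ := β) (φ := RingHom.id S) β (σ.twistL hβ b')
      (σ.twistL_smul hβ b'))) (op (β s) • w) = op (β s) • (absorbR.comp (mapL (ψ := β) (φ := RingHom.id S) β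
        (σ.twistL hβ b') (σ.twistL_smul hβ b'))) w := fun s w => by
    rw [AddMonoidHom.comp_apply, AddMonoidHom.comp_apply, mapL_rsmul, absorbR_rsmul]
  have hg : ∀ s c, ((absorbR.comp (mapL (ψ := β) (φ := RingHom.id S) β (σ.twistL hβ b')
      (σ.twistL_smul hβ b'))).comp (σ.twistL hβ b)) (op (RingHom.id S s) • c) = op (β s) •
      ((absorbR.comp (mapL (ψ := β) (φ := RingHom.id S) β (σ.twistL hβ b')
      (σ.twistL_smul hβ b'))).comp (σ.twistL hβ b)) c := fun s c =>
    (congrArg _ (σ.twistL_smul hβ b s c)).trans (hG s _)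
  refine σ.coactL_hom_ext hβ (σ.twistL_smul hβ (b' * b)) hg (fun x => ?_) c
  rw [absorbR_mapL_twistL, mul_smul, ← absorbR_mapL_twistL, ← absorbR_mapL_twistL,
    absorbR_mapL_absorbR _ _ _ hG (fun w => rfl)]
  exact congrArg absorbR (mapL_mapL _ _ _ _ _ _ (fun _ => rfl) _)

theorem entwL_mul (c : σ.CoringL) (b b' : B) : σ.entwL hβ (tmul _ _ (b' * b) c) =
    ract (ψ := β) (φ := β) (RingHom.id B) (fun _ => rfl)
      (mapL (ψ := β) (φ := RingHom.id S) β (σ.entwL hβ) (σ.entwL_rsmul hβ)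
        (assoc.symm (tmul β (RingHom.id S) b' (σ.entwL hβ (tmul _ _ b c))))) := by
  rw [entwL_tmul, entwL_tmul, twistL_mul]
  generalize σ.twistL hβ b c = y
  induction y using induction_on with
  | zero => simp only [map_zero, tmul_zero]
  | tmul c a => rw [mapL_tmul, absorbR_tmul, assoc_symm_tmul, mapL_tmul, ract_tmul, entwL_tmul,
      actR_eq_smul, RingHom.id_apply]
  | add x y hx hy => rw [map_add, map_add, hx, hy, tmul_add, map_add, map_add, map_add]

/-- `D ⊗ χ` -/
noncomputable def entwExtL :
    BTensor β (RingHom.id S) (BTensor (RingHom.id S) β σ.CoringL B) σ.CoringL →+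
    BTensor (RingHom.id S) β (BTensor (RingHom.id S) (RingHom.id S) σ.CoringL σ.CoringL) B :=
  (assoc (ψ₂ := β) (φ₂ := RingHom.id S) (ψ₁ := RingHom.id S)
    (φ₁ := RingHom.id S)).symm.toAddMonoidHom.comp
    ((mapR (ψ := β) (φ := RingHom.id S) (RingHom.id S) (σ.entwL hβ) (σ.entwL_lsmul hβ)).comp
      ((assoc (ψ₂ := RingHom.id S) (φ₂ := β) (ψ₁ := β)
        (φ₁ := RingHom.id S)).toAddMonoidHom))

/-- `c ↦ (y ⊗ c) (D ⊗ χ)` -/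
noncomputable def twistExtL (y : BTensor (RingHom.id S) β σ.CoringL B) : σ.CoringL →+
    BTensor (RingHom.id S) β (BTensor (RingHom.id S) (RingHom.id S) σ.CoringL σ.CoringL) B :=
  (σ.entwExtL hβ).comp (BTensor.mk β (RingHom.id S) y)

theorem twistExtL_apply (y : BTensor (RingHom.id S) β σ.CoringL B) (c : σ.CoringL) :
    σ.twistExtL hβ y c = σ.entwExtL hβ (tmul β (RingHom.id S) y c) := rfl

theorem twistExtL_tmul (b : B) (c c' : σ.CoringL) : σ.twistExtL hβ (tmul _ _ c' b) c =
    insL β (RingHom.id S) c' (σ.twistL hβ b c) := by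
  change assoc.symm (tmul _ _ c' (σ.twistL hβ b c)) = _
  generalize σ.twistL hβ b c = y
  induction y using induction_on with
  | zero => rw [tmul_zero, map_zero, map_zero]
  | tmul c a => rfl
  | add x y hx hy => rw [tmul_add, map_add, map_add, hx, hy]

theorem twistExtL_add (y y' : BTensor (RingHom.id S) β σ.CoringL B) (c : σ.CoringL) :
    σ.twistExtL hβ (y + y') c = σ.twistExtL hβ y c + σ.twistExtL hβ y' c := by
  rw [twistExtL_apply, add_tmul, map_add, ← twistExtL_apply, ← twistExtL_apply]

theorem twistExtL_zero (c : σ.CoringL) : σ.twistExtL hβ 0 c = 0 := by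
  rw [twistExtL_apply, zero_tmul, map_zero]

theorem twistExtL_smul (y : BTensor (RingHom.id S) β σ.CoringL B) (s : S) (c : σ.CoringL) :
    σ.twistExtL hβ y (op (RingHom.id S s) • c) = op (β s) • σ.twistExtL hβ y c := by
  induction y using induction_on with
  | zero => rw [twistExtL_zero, twistExtL_zero, smul_zero]
  | tmul c' a => rw [twistExtL_tmul, twistExtL_tmul, twistL_smul, insL_rsmul]
  | add x y hx hy => rw [twistExtL_add, twistExtL_add, hx, hy, smul_add]

theorem absorbR_mapL_twistExtL (y : BTensor (RingHom.id S) β σ.CoringL B) (t : T) :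
    absorbR (mapL (ψ := β) (φ := RingHom.id S) β (σ.twistExtL hβ y) (σ.twistExtL_smul hβ y)
      (σ.coactL hβ t)) = σ.coactExtL hβ (RingHom.id S) (actR t y) := by
  have key : ∀ (y y' : BTensor (RingHom.id S) β σ.CoringL B)
      (w : BTensor (RingHom.id S) β σ.CoringL T),
      mapL (ψ := β) (φ := RingHom.id S) β (σ.twistExtL hβ (y + y')) (σ.twistExtL_smul hβ _) w =
      mapL (ψ := β) (φ := RingHom.id S) β (σ.twistExtL hβ y) (σ.twistExtL_smul hβ _) w +
      mapL (ψ := β) (φ := RingHom.id S) β (σ.twistExtL hβ y') (σ.twistExtL_smul hβ _) w :=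
    fun y y' w => by
      induction w using induction_on with
      | zero => simp only [map_zero, add_zero]
      | tmul c t => rw [mapL_tmul, mapL_tmul, mapL_tmul, twistExtL_add, add_tmul]
      | add x y hx hy => rw [map_add, map_add, map_add, hx, hy, add_add_add_comm]
  induction y using induction_on with
  | zero =>
    rw [map_zero, map_zero]
    generalize σ.coactL hβ t = w
    induction w using induction_on with
    | zero => simp only [map_zero]
    | tmul c t => rw [mapL_tmul, twistExtL_zero, zero_tmul, map_zero]
    | add x y hx hy => rw [map_add, map_add, hx, hy, add_zero]
  | tmul c' a =>
    rw [actR_tmul, coactExtL_tmul, ← absorbR_mapL_twistL]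
    generalize σ.coactL hβ t = w
    induction w using induction_on with
    | zero => simp only [map_zero]
    | tmul c t =>
      rw [mapL_tmul, mapL_tmul, absorbR_tmul, absorbR_tmul, twistExtL_tmul]
      exact (mapL_actR _ _ t _).symm
    | add x y hx hy => rw [map_add, map_add, map_add, map_add, map_add, hx, hy]
  | add x y hx hy => rw [key, map_add, map_add, map_add, hx, hy]

/-- `(D ⊗ χ) ∘ (χ ⊗ D)` at `b` -/
noncomputable def twistTwistL (b : B) : BTensor (RingHom.id S) (RingHom.id S) σ.CoringL σ.CoringL →+
    BTensor (RingHom.id S) β (BTensor (RingHom.id S) (RingHom.id S) σ.CoringL σ.CoringL) B :=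
  (σ.entwExtL hβ).comp
    ((mapL (ψ := RingHom.id S) (φ := RingHom.id S) β (σ.entwL hβ) (σ.entwL_rsmul hβ)).comp
      ((assoc (ψ₂ := RingHom.id S) (φ₂ := RingHom.id S) (ψ₁ := RingHom.id S)
        (φ₁ := β)).symm.toAddMonoidHom.comp (BTensor.mk β (RingHom.id S) b)))

theorem twistTwistL_tmul (b : B) (c c' : σ.CoringL) : σ.twistTwistL hβ b (tmul _ _ c' c) =
    σ.twistExtL hβ (σ.twistL hβ b c') c := rfl

theorem twistTwistL_smul (b : B) (s : S)
    (z : BTensor (RingHom.id S) (RingHom.id S) σ.CoringL σ.CoringL) :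
    σ.twistTwistL hβ b (op (RingHom.id S s) • z) = op (β s) • σ.twistTwistL hβ b z := by
  induction z using induction_on with
  | zero => rw [smul_zero, map_zero, smul_zero]
  | tmul c' c => rw [rsmul_tmul, twistTwistL_tmul, twistTwistL_tmul, twistExtL_smul]
  | add x y hx hy => rw [smul_add, map_add, map_add, smul_add, hx, hy]

theorem absorbR_mapL_twistTwistL (b : B) (w : BTensor (RingHom.id S) β σ.CoringL T) :
    absorbR (mapL (ψ := β) (φ := RingHom.id S) β (σ.twistTwistL hβ b) (σ.twistTwistL_smul hβ b)
      (σ.coactExtL hβ (RingHom.id S) w)) = σ.coactExtL hβ (RingHom.id S)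
        (absorbR (mapL (ψ := β) (φ := RingHom.id S) β (σ.twistL hβ b) (σ.twistL_smul hβ b) w)) := by
  induction w using induction_on with
  | zero => simp only [map_zero]
  | tmul c t =>
    rw [coactExtL_tmul, mapL_tmul, absorbR_tmul, ← absorbR_mapL_twistExtL]
    generalize σ.coactL hβ t = w
    induction w using induction_on with
    | zero => simp only [map_zero]
    | tmul c' t => rw [insL_tmul, mapL_tmul, twistTwistL_tmul, mapL_tmul]
    | add x y hx hy => rw [map_add, map_add, map_add, map_add, map_add, hx, hy]
  | add x y hx hy => rw [map_add, map_add, map_add, map_add, map_add, map_add, hx, hy]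

/-- Both sides induce `x ↦ (D ⊗ ρ) ρ(b x)` on `T`. -/
theorem mapL_comulL_twistL (b : B) (c : σ.CoringL) :
    mapL (ψ := β) (φ := RingHom.id S) (RingHom.id S) (σ.comulL hβ) (σ.comulL_rsmul hβ)
      (σ.twistL hβ b c) = σ.twistTwistL hβ b (σ.comulL hβ c) := by
  have hm : ∀ (s : S) w, mapL (ψ := β) (φ := RingHom.id S) (N := B) (RingHom.id S) (σ.comulL hβ)
      (σ.comulL_rsmul hβ) (op (β s) • w) = op (β s) • mapL (ψ := β) (φ := RingHom.id S) (RingHom.id S)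
        (σ.comulL hβ) (σ.comulL_rsmul hβ) w := fun s w => mapL_rsmul _ _ (β s) w
  have hf : ∀ (s : S) c, ((mapL (ψ := β) (φ := RingHom.id S) (N := B) (RingHom.id S) (σ.comulL hβ)
      (σ.comulL_rsmul hβ)).comp (σ.twistL hβ b)) (op (RingHom.id S s) • c) = op (β s) •
      ((mapL (ψ := β) (φ := RingHom.id S) (N := B) (RingHom.id S) (σ.comulL hβ)
      (σ.comulL_rsmul hβ)).comp (σ.twistL hβ b)) c := fun s c =>
    (congrArg _ (σ.twistL_smul hβ b s c)).trans (hm s _)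
  have hg : ∀ (s : S) c, ((σ.twistTwistL hβ b).comp (σ.comulL hβ)) (op (RingHom.id S s) • c) = op (β s) •
      ((σ.twistTwistL hβ b).comp (σ.comulL hβ)) c := fun s c =>
    (congrArg _ (σ.comulL_rsmul hβ s c)).trans (σ.twistTwistL_smul hβ b s _)
  refine σ.coactL_hom_ext hβ hf hg (fun x => ?_) c
  rw [← mapL_mapL _ (σ.twistL_smul hβ b) _ hm _ hf (fun _ => rfl),
    ← mapL_mapL _ (σ.comulL_rsmul hβ) _ (σ.twistTwistL_smul hβ b) _ hg (fun _ => rfl),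
    mapL_comulL, absorbR_mapL_twistTwistL, absorbR_mapL_twistL, ← mapL_comulL,
    ← absorbR_mapL_twistL]
  exact absorbR_mapL _ _ _

theorem entwL_comul (z : BTensor β (RingHom.id S) B σ.CoringL) :
    mapL (ψ := β) (φ := RingHom.id S) (RingHom.id S) (σ.comulL hβ) (σ.comulL_rsmul hβ)
      (σ.entwL hβ z) =
    assoc.symm (mapR (ψ := β) (φ := RingHom.id S) (RingHom.id S) (σ.entwL hβ) (σ.entwL_lsmul hβ)
      (assoc (mapL (ψ := RingHom.id S) (φ := RingHom.id S) β (σ.entwL hβ) (σ.entwL_rsmul hβ)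
        (assoc.symm (mapR (φ := β) (RingHom.id S) (σ.comulL hβ) (σ.comulL_lsmul hβ) z))))) := by
  induction z using induction_on with
  | zero => simp only [map_zero]
  | tmul b c => exact σ.mapL_comulL_twistL hβ b c
  | add x y hx hy => simp only [map_add, hx, hy]

/-- Both sides induce `x ↦ 1 ⊗ b x` on `T`. -/
theorem mapL_counitL_twistL (b : B) (c : σ.CoringL) :
    mapL (ψ := β) (φ := RingHom.id S) (RingHom.id S) (σ.counitL hβ) (σ.counitL_rsmul hβ)
      (σ.twistL hβ b c) = tmul (RingHom.id S) β 1 (b * β (σ.counitL hβ c)) := by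
  have hm : ∀ (s : S) w, mapL (ψ := β) (φ := RingHom.id S) (N := B) (RingHom.id S) (σ.counitL hβ)
      (σ.counitL_rsmul hβ) (op (β s) • w) = op (β s) • mapL (ψ := β) (φ := RingHom.id S) (RingHom.id S)
        (σ.counitL hβ) (σ.counitL_rsmul hβ) w := fun s w => mapL_rsmul _ _ (β s) w
  have hf : ∀ (s : S) c, ((mapL (ψ := β) (φ := RingHom.id S) (N := B) (RingHom.id S) (σ.counitL hβ)
      (σ.counitL_rsmul hβ)).comp (σ.twistL hβ b)) (op (RingHom.id S s) • c) = op (β s) •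
      ((mapL (ψ := β) (φ := RingHom.id S) (N := B) (RingHom.id S) (σ.counitL hβ)
      (σ.counitL_rsmul hβ)).comp (σ.twistL hβ b)) c := fun s c =>
    (congrArg _ (σ.twistL_smul hβ b s c)).trans (hm s _)
  let g : σ.CoringL →+ BTensor (RingHom.id S) β S B :=
    AddMonoidHom.mk' (fun c => tmul (RingHom.id S) β 1 (b * β (σ.counitL hβ c))) (fun c c' => by
      rw [map_add, map_add, mul_add, tmul_add])
  have hg : ∀ (s : S) c, g (op (RingHom.id S s) • c) = op (β s) • g c := fun s c => by
    change tmul _ _ _ _ = op (β s) • tmul _ _ _ _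
    rw [RingHom.id_apply, counitL_rsmul, rsmul_tmul, op_smul_eq_mul, op_smul_eq_mul, map_mul, mul_assoc]
  refine σ.coactL_hom_ext hβ hf hg (fun x => ?_) c
  rw [← mapL_mapL _ (σ.twistL_smul hβ b) _ hm _ hf (fun _ => rfl)]
  refine (absorbR_mapL _ (σ.counitL_rsmul hβ) _).trans ?_
  rw [absorbR_mapL_twistL, mapL_counitL]
  have h := congrArg (fun w => tmul (RingHom.id S) β (1 : S) (b •
    lact (ψ := β) (φ := RingHom.id S) β (fun _ => rfl) w)) (σ.mapL_counitL hβ x)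
  refine Eq.trans ?_ (h.symm.trans ?_)
  · rw [lact_tmul, map_one, one_smul]
  · generalize σ.coactL hβ x = w
    induction w using induction_on with
    | zero => simp only [map_zero, smul_zero, tmul_zero]
    | tmul c t =>
      rw [mapL_tmul, mapL_tmul, lact_tmul, absorbR_tmul]
      change _ = actR t (tmul _ _ _ _)
      rw [actR_tmul, mul_smul]
    | add x y hx hy => simp only [map_add, smul_add, tmul_add, hx, hy]

theorem entwL_counit (z : BTensor β (RingHom.id S) B σ.CoringL) :
    lact (ψ := β) (φ := RingHom.id S) β (fun _ => rfl) (mapL (ψ := β) (φ := RingHom.id S)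
      (RingHom.id S) (σ.counitL hβ) (σ.counitL_rsmul hβ) (σ.entwL hβ z)) =
    ract (ψ := RingHom.id S) (φ := β) β (fun _ => rfl) (mapR (ψ := RingHom.id S) (RingHom.id S)
      (σ.counitL hβ) (σ.counitL_lsmul hβ) z) := by
  induction z using induction_on with
  | zero => simp only [map_zero]
  | tmul b c =>
    rw [entwL_tmul, mapL_counitL_twistL, mapR_tmul, lact_tmul, ract_tmul, map_one, one_smul,
      op_smul_eq_mul]
  | add x y hx hy => simp only [map_add, hx, hy]

/-- The left entwining of `B` with the coring of the herd. -/
noncomputable def entwiningL : LeftEntwining β (σ.coringL hβ) where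
  χ := σ.entwL hβ
  χ_rsmul := σ.entwL_rsmul hβ
  χ_lsmul := σ.entwL_lsmul hβ
  χ_mul b b' c := σ.entwL_mul hβ c b' b
  χ_one := σ.entwL_one hβ
  χ_comul := σ.entwL_comul hβ
  χ_counit := σ.entwL_counit hβ

end Shepherd

end Herd

/-! ### Coactions of `D` as comodule structures over `D ⊗_S B` -/

namespace LeftEntwining

variable {S B C : Type u} [Ring S] [Ring B] [AddCommGroup C] [Module Sᵐᵒᵖ C]
  [Module S C] [SMulCommClass S Sᵐᵒᵖ C] {β : S →+* B} {K : Coring S C} (E : LeftEntwining β K)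
  {M : Type u} [AddCommGroup M] [Module B M]

/-- The map `χ(b ⊗ -)`. -/
def twist (b : B) : C →+ BTensor (RingHom.id S) β C B :=
  E.χ.comp (BTensor.mk β (RingHom.id S) b)

theorem twist_smul (b : B) (s : S) (c : C) :
    E.twist b (op (RingHom.id S s) • c) = op (β s) • E.twist b c :=
  E.χ_rsmul s (tmul β (RingHom.id S) b c)

/-- `c ⊗ t ↦ (c ⊗ 1) ⊗ t` -/
def expand : BTensor (RingHom.id S) β C M →+ BTensor (RingHom.id B) (RingHom.id B) E.Cor M :=
  lift (biadd (fun c t => tmul _ _ (E.mkCor c 1) t) (fun c c' t => by rw [mkCor_add, add_tmul])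
    (fun c t t' => tmul_add _ _ _ _ _)) (fun s c t => by
      rw [biadd_apply, biadd_apply, RingHom.id_apply, mkCor_smul]
      exact smul_tmul (RingHom.id B) (RingHom.id B) (β s) _ t)

theorem expand_tmul (t : M) (c : C) :
    E.expand (tmul (RingHom.id S) β c t) = tmul _ _ (E.mkCor c 1) t := rfl

/-- `(c ⊗ b) ⊗ t ↦ c ⊗ b t` -/
def collapse : BTensor (RingHom.id B) (RingHom.id B) E.Cor M →+ BTensor (RingHom.id S) β C M :=
  lift (biadd (fun z t => actR t (E.of.symm z)) (fun z z' t => by rw [map_add, map_add])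
    (fun z t t' => add_actR t t' _)) (fun b z t => actR_smul t b (E.of.symm z))

theorem collapse_tmul (t : M) (z : E.Cor) :
    E.collapse (tmul _ _ z t) = actR t (E.of.symm z) := rfl

/-- `(c ⊗ 1) ⊗ b t = (c ⊗ b) ⊗ t`, which identifies `D ⊗_S M` with `(D ⊗_S B) ⊗_B M`. -/
theorem expand_actR (t : M) (y : BTensor (RingHom.id S) β C B) :
    E.expand (actR t y) = tmul _ _ (E.of y) t := by
  induction y using induction_on with
  | zero => rw [map_zero, map_zero, map_zero, zero_tmul]
  | tmul c b =>
    rw [actR_tmul, expand_tmul]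
    refine (smul_tmul (RingHom.id B) (RingHom.id B) b _ t).symm.trans ?_
    rw [RingHom.id_apply, op_smul_mkCor, one_mul]
    rfl
  | add x y hx hy => rw [map_add, map_add, map_add, add_tmul, hx, hy]

theorem collapse_expand (w : BTensor (RingHom.id S) β C M) : E.collapse (E.expand w) = w := by
  induction w using induction_on with
  | zero => rw [map_zero, map_zero]
  | tmul c t => rw [expand_tmul, collapse_tmul]; exact actR_tmul_one c t
  | add x y hx hy => rw [map_add, map_add, hx, hy]

theorem expand_collapse (w : BTensor (RingHom.id B) (RingHom.id B) E.Cor M) :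
    E.expand (E.collapse w) = w := by
  induction w using induction_on with
  | zero => rw [map_zero, map_zero]
  | tmul z t => rw [collapse_tmul, expand_actR, AddEquiv.apply_symm_apply]
  | add x y hx hy => rw [map_add, map_add, hx, hy]

theorem expand_rsmul {A : Type u} [Ring A] [Module Aᵐᵒᵖ M] [SMulCommClass B Aᵐᵒᵖ M] (a : A)
    (w : BTensor (RingHom.id S) β C M) : E.expand (op a • w) = op a • E.expand w := by
  induction w using induction_on with
  | zero => rw [smul_zero, map_zero, smul_zero]
  | tmul c t => rfl
  | add x y hx hy => rw [smul_add, map_add, map_add, smul_add, hx, hy]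

theorem expand_twist (b : B) (w : BTensor (RingHom.id S) β C M) :
    E.expand (absorbR (mapL (ψ := β) (φ := RingHom.id S) β (E.twist b) (E.twist_smul b) w)) =
      b • E.expand w := by
  induction w using induction_on with
  | zero => rw [map_zero, map_zero, map_zero, smul_zero]
  | tmul c t =>
    rw [mapL_tmul, absorbR_tmul, expand_actR, expand_tmul, lsmul_tmul, smul_mkCor, op_one, one_smul]
    rfl
  | add x y hx hy => rw [map_add, map_add, map_add, map_add, smul_add, hx, hy]

theorem incl₂_one_smul (s : S) (w : BTensor (RingHom.id S) (RingHom.id S) C C) :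
    E.incl₂ 1 (op s • w) = op (β s) • E.incl₂ 1 w := by
  induction w using induction_on with
  | zero => rw [smul_zero, map_zero, smul_zero]
  | tmul e d =>
    rw [rsmul_tmul, incl₂_tmul, incl₂_tmul, mkCor_smul, rsmul_tmul]
  | add x y hx hy => rw [smul_add, map_add, map_add, smul_add, hx, hy]

/-- `(c' ⊗ c) ⊗ t ↦ ((c' ⊗ 1) ⊗ (c ⊗ 1)) ⊗ t` -/
def expand₂ : BTensor (RingHom.id S) β (BTensor (RingHom.id S) (RingHom.id S) C C) M →+
    BTensor (RingHom.id B) (RingHom.id B) (BTensor (RingHom.id B) (RingHom.id B) E.Cor E.Cor)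
      M :=
  lift (biadd (fun w t => tmul _ _ (E.incl₂ 1 w) t) (fun c c' t => by rw [map_add, add_tmul])
    (fun c t t' => tmul_add _ _ _ _ _)) (fun s c t => by
      rw [biadd_apply, biadd_apply, RingHom.id_apply, incl₂_one_smul]
      exact smul_tmul (RingHom.id B) (RingHom.id B) (β s) _ t)

theorem expand₂_tmul (t : M) (w : BTensor (RingHom.id S) (RingHom.id S) C C) :
    E.expand₂ (tmul (RingHom.id S) β w t) = tmul _ _ (E.incl₂ 1 w) t := rfl

theorem mapL_comul_expand (w : BTensor (RingHom.id S) β C M) :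
    mapL (ψ := RingHom.id B) (φ := RingHom.id B) (RingHom.id B) E.comul E.comul_rsmul
      (E.expand w) = E.expand₂ (mapL (ψ := β) (φ := RingHom.id S) (RingHom.id S) K.comul
        K.comul_rsmul w) := by
  induction w using induction_on with
  | zero => simp only [map_zero]
  | tmul c t => rw [expand_tmul, mapL_tmul, mapL_tmul, expand₂_tmul, comul_mkCor]
  | add x y hx hy => simp only [map_add, hx, hy]

theorem lact_counit_expand (w : BTensor (RingHom.id S) β C M) :
    lact (ψ := RingHom.id B) (φ := RingHom.id B) (RingHom.id B) (fun _ => rfl)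
      (mapL (ψ := RingHom.id B) (φ := RingHom.id B) (RingHom.id B) E.counit E.counit_rsmul
        (E.expand w)) =
      lact (ψ := β) (φ := RingHom.id S) β (fun _ => rfl)
        (mapL (ψ := β) (φ := RingHom.id S) (RingHom.id S) K.counit K.counit_rsmul w) := by
  induction w using induction_on with
  | zero => simp only [map_zero]
  | tmul c t =>
    rw [expand_tmul, mapL_tmul, mapL_tmul, lact_tmul, lact_tmul, counit_mkCor, mul_one,
      RingHom.id_apply]
  | add x y hx hy => simp only [map_add, hx, hy]

variable (ρ : M →+ BTensor (RingHom.id S) β C M)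
  (hρ : ∀ (s : S) x, ρ (β s • x) = s • ρ x)

theorem assoc_mapR_expand (h : ∀ (b : B) x, (E.expand.comp ρ) (b • x) =
    b • (E.expand.comp ρ) x) (w : BTensor (RingHom.id S) β C M) :
    assoc.symm (mapR (ψ := RingHom.id B) (φ := RingHom.id B) (RingHom.id B) (E.expand.comp ρ) h
      (E.expand w)) = E.expand₂ (coactExtL ρ hρ (RingHom.id S) w) := by
  induction w using induction_on with
  | zero => simp only [map_zero]
  | tmul c t =>
    rw [expand_tmul, mapR_tmul, coactExtL_tmul, AddMonoidHom.comp_apply]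
    generalize ρ t = w
    induction w using induction_on with
    | zero => simp only [map_zero, tmul_zero]
    | tmul c t => rfl
    | add x y hx hy => simp only [map_add, tmul_add, hx, hy]
  | add x y hx hy => simp only [map_add, hx, hy]

/-- A coaction of `D` on `M` compatible with the entwining makes `M` a comodule over `D ⊗_S B`. -/
def comodule
    (h_smul : ∀ b x, absorbR (mapL (ψ := β) (φ := RingHom.id S) β (E.twist b) (E.twist_smul b)
      (ρ x)) = ρ (b • x))
    (h_comul : ∀ x, mapL (ψ := β) (φ := RingHom.id S) (RingHom.id S) K.comul K.comul_rsmul (ρ x) =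
      coactExtL ρ hρ (RingHom.id S) (ρ x))
    (h_counit : ∀ x, mapL (ψ := β) (φ := RingHom.id S) (RingHom.id S) K.counit K.counit_rsmul
      (ρ x) = tmul (RingHom.id S) β 1 x) : LeftComodule E.coring M where
  coact := E.expand.comp ρ
  coact_lsmul b x := by
    rw [AddMonoidHom.comp_apply, AddMonoidHom.comp_apply, ← h_smul, expand_twist]
  coassoc x := by
    refine ((AddEquiv.symm_apply_eq _).1 ((E.assoc_mapR_expand ρ hρ _ (ρ x)).trans ?_)).symm
    rw [← h_comul]
    exact (E.mapL_comul_expand (ρ x)).symm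
  counit x := by
    refine (E.lact_counit_expand (ρ x)).trans ?_
    rw [h_counit, lact_tmul, map_one, one_smul]

end LeftEntwining

/-! ### From a herd to a left Galois comodule -/

section Herd

variable {R S A B : Type u} [Ring R] [Ring S] [Ring A] [Ring B] {α : R →+* A} {β : S →+* B}
  {T : Type u} [AddCommGroup T] [Module B T] [Module Aᵐᵒᵖ T] [SMulCommClass B Aᵐᵒᵖ T]
  {P : Type u} [AddCommGroup P] [Module A P] [Module Bᵐᵒᵖ P] [SMulCommClass A Bᵐᵒᵖ P]
  {d : FormalDual α β T P}

theorem RightDescent.injective (hα : RightDescent α) : Function.Injective α := fun r s' h => by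
  refine hα.unit_injective R ?_
  have key : ∀ r : R, unitL α (RingHom.id R) r = tmul α (RingHom.id R) (α r) 1 := fun r => by
    have := (smul_tmul α (RingHom.id R) r (1 : A) (1 : R)).symm
    rwa [RingHom.id_apply, op_smul_eq_mul, one_mul, smul_eq_mul, mul_one] at this
  rw [key, key, h]

/-- Exactness of the unit sequence for `N = R`, under the identification of `A ⊗_R R` with `A`. -/
theorem RightDescent.exists_of_tmul_eq (hα : RightDescent α) (a : A)
    (h : tmul α α a 1 = tmul α α 1 a) : ∃ r, α r = a := by
  obtain ⟨r, hs⟩ := hα.unit_exact R (tmul α (RingHom.id R) a 1) (by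
    rw [mapR_tmul, unitL_apply]
    exact congrArg (mapR (ψ := α) (φ := α) (M := A) α ((BTensor.mk α (RingHom.id R)).flip (1 : R))
      (fun _ _ => rfl)) h)
  have := congrArg (ract (ψ := RingHom.id R) (φ := α) α (fun _ => rfl)) hs
  refine ⟨r, ?_⟩
  rwa [unitL_apply, ract_tmul, ract_tmul, op_smul_eq_mul, op_smul_eq_mul, map_one, mul_one, one_mul] at this

namespace FormalDual

/-- `A` acts faithfully on `T`: two elements that act alike also agree after left multiplication by
every value of `ev`, and `1` is such a value. -/
theorem eq_of_op_smul_eq (d : FormalDual α β T P) (h1 : ∃ z, d.ev z = 1) {a a' : A}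
    (h : ∀ x : T, op a • x = op a' • x) : a = a' := by
  have key : ∀ z, op a • d.ev z = op a' • d.ev z := fun z => by
    induction z using induction_on with
    | zero => rw [map_zero, smul_zero, smul_zero]
    | tmul p x => rw [← d.ev_rsmul, ← d.ev_rsmul, rsmul_tmul, rsmul_tmul, h]
    | add x y hx hy => rw [map_add, smul_add, smul_add, hx, hy]
  obtain ⟨z, hz⟩ := h1
  have h2 := key z
  rwa [hz, op_smul_eq_mul, op_smul_eq_mul, one_mul, one_mul] at h2

/-- The double centralizer property `End_B(T) = A`. If `1 = Σ ev(pᵢ ⊗ yᵢ)`, then `f(x) = f(Σ coev(x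
⊗ pᵢ) yᵢ) = Σ coev(x ⊗ pᵢ) f(yᵢ) = x Σ ev(pᵢ ⊗ f(yᵢ))`, so `f` is right multiplication by `Σ ev(pᵢ ⊗
f(yᵢ))`. -/
theorem exists_rmulEnd_eq (d : FormalDual α β T P) (h1 : ∃ z, d.ev z = 1) (f : T →ₗ[B] T) :
    ∃ a : A, rmulEnd B a = f := by
  obtain ⟨z, hz⟩ := h1
  have hf : ∀ (s : S) x, f.toAddMonoidHom (β s • x) = β s • f.toAddMonoidHom x :=
    fun s x => f.map_smul (β s) x
  have key : ∀ (z : BTensor β β P T) (x : T),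
      op (d.ev (mapR (φ := β) (ψ := β) β f.toAddMonoidHom hf z)) • x = f (op (d.ev z) • x) :=
    fun z x => by
      induction z using induction_on with
      | zero => rw [map_zero, map_zero, op_zero, zero_smul, map_zero]
      | tmul p y =>
        rw [mapR_tmul, ← d.coev_smul, ← d.coev_smul, map_smul]
        rfl
      | add z w hz hw =>
        rw [map_add, map_add, map_add, op_add, op_add, add_smul, add_smul, map_add, hz, hw]
  refine ⟨d.ev (mapR (φ := β) (ψ := β) β f.toAddMonoidHom hf z), LinearMap.ext fun x => ?_⟩
  refine (key z x).trans ?_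
  rw [hz, op_one, one_smul]

end FormalDual

namespace Shepherd

variable (σ : Shepherd d) (hβ : LeftDescent β)

/-- `T` as a comodule over the `B`-coring `D ⊗_S B`. -/
noncomputable def comoduleL : LeftComodule (σ.entwiningL hβ).coring T :=
  (σ.entwiningL hβ).comodule (σ.coactL hβ) (σ.coactL_lsmul hβ) (σ.absorbR_mapL_twistL hβ)
    (σ.mapL_comulL hβ) (σ.mapL_counitL hβ)

theorem comoduleL_coact (x : T) :
    (σ.comoduleL hβ).coact x = (σ.entwiningL hβ).expand (σ.coactL hβ x) := rfl

theorem ract_coevR (p : P) (z : BTensor β β (BTensor α α T P) T) :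
    ract (ψ := β) (φ := β) (RingHom.id B) (fun _ => rfl) (d.coevR p z) = actR p (d.evMapR z) := by
  induction z using induction_on with
  | zero => simp only [map_zero]
  | tmul w t =>
    rw [d.coevR_tmul, ract_tmul, d.evMapR_tmul]
    induction w using induction_on with
    | zero => simp only [map_zero, smul_zero]
    | tmul y q => rw [rsmul_tmul, d.evR_tmul, actR_tmul, RingHom.id_apply, d.smul_coev]
    | add x y hx hy => simp only [map_add, smul_add, hx, hy]
  | add x y hx hy => simp only [map_add, hx, hy]

theorem ract_hatR_γL (z : BTensor α α T P) :
    ract (ψ := β) (φ := β) (RingHom.id B) (fun _ => rfl) (d.hatR σ.γL σ.γL_rsmul z) = z := by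
  induction z using induction_on with
  | zero => simp only [map_zero]
  | tmul x p => rw [d.hatR_tmul, ract_coevR, evMapR_γL, actR_tmul_one]
  | add x y hx hy => simp only [map_add, hx, hy]

/-- Injective because `δ` has multiplication as a left inverse, by the unit law for `ev`; surjective
because `c b` descends to `c ⊗ b`. -/
theorem descL_bijective : Function.Bijective (σ.descL hβ) := by
  refine ⟨fun z w h => ?_, fun y => ?_⟩
  · rw [← σ.ract_hatR_γL z, ← σ.ract_hatR_γL w, ← σ.mapL_inclL_descL hβ, ← σ.mapL_inclL_descL hβ, h]
  · induction y using induction_on with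
    | zero => exact ⟨0, map_zero _⟩
    | tmul c b =>
      exact ⟨op b • σ.inclL c, by
        rw [descL_rsmul, descL_inclL, unitR_apply, rsmul_tmul, op_smul_eq_mul, one_mul]⟩
    | add x y hx hy =>
      obtain ⟨z, rfl⟩ := hx
      obtain ⟨w, rfl⟩ := hy
      exact ⟨z + w, map_add _ _ _⟩

theorem evalAct_comoduleL (p : P) (x : T) :
    LeftComodule.evalAct (d.toLDual p) ((σ.comoduleL hβ).coact x) =
      (σ.entwiningL hβ).of (σ.descL hβ (tmul α α x p)) := by
  rw [comoduleL_coact, ← coevR_coactL]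
  generalize σ.coactL hβ x = w
  induction w using induction_on with
  | zero => simp only [map_zero]
  | tmul c t =>
    rw [LeftEntwining.expand_tmul, LeftComodule.evalAct_tmul, LeftEntwining.op_smul_mkCor, one_mul,
      d.coevR_tmul]
    rfl
  | add x y hx hy => simp only [map_add, hx, hy]

/-- Applying `ev` to `γ(x a) = γ(x) a` gives `x a ⊗ 1 = x ⊗ a` in `T ⊗_R A`. Pairing with `p`
replaces `x` by values of `ev`, one of which is `1`. -/
theorem eq_smul_of_γL (h1 : ∃ z, d.ev z = 1) (a : A) (h : ∀ x, σ.γL (op a • x) = op a • σ.γL x) :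
    tmul α α a 1 = tmul α α 1 a := by
  have key : ∀ x : T, tmul α α (op a • x) (1 : A) = tmul α α x a := fun x => by
    rw [← σ.evMapR_γL, h, d.evMapR_rsmul, evMapR_γL, rsmul_tmul, op_smul_eq_mul, one_mul]
  have key' : ∀ w : BTensor β β P T, tmul α α (d.ev w * a) (1 : A) = tmul α α (d.ev w) a :=
    fun w => by
      induction w using induction_on with
      | zero => rw [map_zero, zero_mul, zero_tmul, zero_tmul]
      | tmul p x =>
        have h2 := congrArg (d.evL p) (key x)
        rw [d.evL_tmul, d.evL_tmul, ← rsmul_tmul, d.ev_rsmul] at h2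
        exact h2
      | add x y hx hy => rw [map_add, add_mul, add_tmul, add_tmul, hx, hy]
  obtain ⟨z, hz⟩ := h1
  have h3 := key' z
  rwa [hz, one_mul] at h3

theorem comoduleL_isColinear_iff (a : A) : (σ.comoduleL hβ).IsColinear (rmulEnd B a) ↔
    ∀ x, σ.coactL hβ (op a • x) = op a • σ.coactL hβ x := by
  refine forall_congr' fun x => ?_
  have h2 : ∀ z : BTensor (RingHom.id B) (RingHom.id B) (σ.entwiningL hβ).Cor T,
      mapR (ψ := RingHom.id B) (φ := RingHom.id B) (RingHom.id B)
        (rmulEnd B a : T →ₗ[B] T).toAddMonoidHom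
          (fun b x => (rmulEnd B a : T →ₗ[B] T).map_smul b x) z = op a • z := fun z => by
    induction z using induction_on with
    | zero => rw [map_zero, smul_zero]
    | tmul c t => rfl
    | add x y hx hy => rw [map_add, smul_add, hx, hy]
  rw [h2, comoduleL_coact, comoduleL_coact, ← LeftEntwining.expand_rsmul]
  exact (Function.LeftInverse.injective (σ.entwiningL hβ).collapse_expand).eq_iff

theorem comoduleL_isGalois (hα : RightDescent α) (hT : IsProgenerator A T) :
    (σ.comoduleL hβ).IsGalois α where
  finite := (d.left_finite_projective (σ.exists_ev_eq_one hT)).1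
  projective := (d.left_finite_projective (σ.exists_ev_eq_one hT)).2
  colinear r := (σ.comoduleL_isColinear_iff hβ (α r)).2 (σ.coactL_rsmul hβ r)
  injective r r' h := hα.injective (d.eq_of_op_smul_eq (σ.exists_ev_eq_one hT)
    fun x => LinearMap.congr_fun h x)
  full f hf := by
    -- On this side there is no hypothesis on `End_B(T)`; the Morita context supplies the element
    -- `a`.
    obtain ⟨a, rfl⟩ := d.exists_rmulEnd_eq (σ.exists_ev_eq_one hT) f
    obtain ⟨r, rfl⟩ := hα.exists_of_tmul_eq a (σ.eq_smul_of_γL (σ.exists_ev_eq_one hT) a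
      fun x => by
        rw [← σ.mapL_inclL_coactL hβ, (σ.comoduleL_isColinear_iff hβ a).1 hf, mapL_rsmul,
          mapL_inclL_coactL])
    exact ⟨r, rfl⟩
  can_bijective := by
    have hθ := d.toLDual_bijective (σ.exists_ev_eq_one hT)
    let θ := AddEquiv.ofBijective d.toLDual hθ
    have hθ' : ∀ (r : R) f, θ.symm (α r • f) = α r • θ.symm f := fun r f => by
      rw [AddEquiv.symm_apply_eq]
      exact (congrArg (α r • ·) (θ.apply_symm_apply f).symm).trans
        (d.toLDual_lsmul r _).symm
    let Θ : BTensor α α T (LDual B T) →+ BTensor α α T P :=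
      mapR (ψ := α) (φ := α) α θ.symm.toAddMonoidHom hθ'
    have hΘ : Function.Bijective Θ := by
      refine Function.bijective_iff_has_inverse.2
        ⟨mapR (ψ := α) (φ := α) α d.toLDual d.toLDual_lsmul, fun z => ?_, fun z => ?_⟩
      · induction z using induction_on with
        | zero => simp only [map_zero]
        | tmul x f => exact congrArg (tmul α α x ·) (θ.apply_symm_apply f)
        | add x y hx hy => simp only [map_add, hx, hy]
      · induction z using induction_on with
        | zero => simp only [map_zero]
        | tmul x f => exact congrArg (tmul α α x ·) (θ.symm_apply_apply f)
        | add x y hx hy => simp only [map_add, hx, hy]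
    have key : ∀ z, (σ.comoduleL hβ).can α
        (fun r => (σ.comoduleL_isColinear_iff hβ (α r)).2 (σ.coactL_rsmul hβ r)) z =
          (σ.entwiningL hβ).of (σ.descL hβ (Θ z)) := fun z => by
      induction z using induction_on with
      | zero => simp only [map_zero]
      | tmul x f =>
        obtain ⟨p, rfl⟩ := hθ.2 f
        have h1 : Θ (tmul α α x (d.toLDual p)) = tmul α α x p :=
          congrArg (tmul α α x ·) (θ.symm_apply_apply p)
        rw [h1]
        exact σ.evalAct_comoduleL hβ p x
      | add x y hx hy => simp only [map_add, hx, hy]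
    rw [show ⇑((σ.comoduleL hβ).can α _) = _ from funext key]
    exact ((σ.entwiningL hβ).of.bijective.comp (σ.descL_bijective hβ)).comp hΘ

end Shepherd

theorem IsHerd.isLeftEntwinedGalois (hα : RightDescent α) (hβ : LeftDescent β)
    (hT : IsProgenerator A T) (h : IsHerd α β T) : IsLeftEntwinedGalois α β T := by
  obtain ⟨P, _, _, _, _, d, ⟨σ⟩⟩ := h
  exact ⟨σ.CoringL, _, _, _, _, σ.coringL hβ, σ.entwiningL hβ, σ.comoduleL hβ,
    σ.comoduleL_isGalois hβ hα hT⟩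

end Herd

/-! ### From a left Galois coaction to a shepherd -/

section Herd

variable {R S A B : Type u} [Ring R] [Ring S] [Ring A] [Ring B] {α : R →+* A} {β : S →+* B}
  {T : Type u} [AddCommGroup T] [Module B T] [Module Aᵐᵒᵖ T] [SMulCommClass B Aᵐᵒᵖ T]
  {P : Type u} [AddCommGroup P] [Module A P] [Module Bᵐᵒᵖ P] [SMulCommClass A Bᵐᵒᵖ P]
  {C : Type u} [AddCommGroup C] [Module Sᵐᵒᵖ C] [Module S C] [SMulCommClass S Sᵐᵒᵖ C]

/-- A coaction of an `S`-coring `D` on `T` whose canonical map `T ⊗_R P → D ⊗_S B` is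
bijective. -/
structure LeftGaloisCoaction (d : FormalDual α β T P) (K : Coring S C) where
  coact : T →+ BTensor (RingHom.id S) β C T
  rsmul : ∀ r x, coact (op (α r) • x) = op (α r) • coact x
  lsmul : ∀ (s : S) x, coact (β s • x) = s • coact x
  comul : ∀ x, mapL (ψ := β) (φ := RingHom.id S) (RingHom.id S) K.comul K.comul_rsmul (coact x) =
    coactExtL coact lsmul (RingHom.id S) (coact x)
  counit : ∀ x, mapL (ψ := β) (φ := RingHom.id S) (RingHom.id S) K.counit K.counit_rsmul
    (coact x) = tmul (RingHom.id S) β 1 x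
  bijective : Function.Bijective (d.hatR coact rsmul)

namespace LeftGaloisCoaction

variable {d : FormalDual α β T P} {K : Coring S C} (G : LeftGaloisCoaction d K)

/-- The canonical map `T ⊗_R P ≃ D ⊗_S B`. -/
noncomputable def equiv : BTensor α α T P ≃+ BTensor (RingHom.id S) β C B :=
  AddEquiv.ofBijective _ G.bijective

theorem equiv_tmul (p : P) (x : T) : G.equiv (tmul α α x p) = d.coevR p (G.coact x) := rfl

theorem equiv_rsmul (b : B) (z : BTensor α α T P) : G.equiv (op b • z) = op b • G.equiv z :=
  d.hatR_rsmul G.coact G.rsmul b z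

theorem equiv_lsmul (s : S) (z : BTensor α α T P) :
    G.equiv (β s • z) = s • G.equiv z :=
  d.hatR_lsmul (K := S) G.coact G.rsmul s (β s) (G.lsmul s) z

theorem equiv_symm_rsmul (b : B) (y : BTensor (RingHom.id S) β C B) :
    G.equiv.symm (op b • y) = op b • G.equiv.symm y := by
  rw [AddEquiv.symm_apply_eq, equiv_rsmul, AddEquiv.apply_symm_apply]

theorem equiv_symm_lsmul (s : S) (y : BTensor (RingHom.id S) β C B) :
    G.equiv.symm (s • y) = β s • G.equiv.symm y := by
  rw [AddEquiv.symm_apply_eq, equiv_lsmul, AddEquiv.apply_symm_apply]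

/-- The map `D → T ⊗_R P` that corresponds to `c ↦ c ⊗ 1`. -/
noncomputable def transl : C →+ BTensor α α T P :=
  G.equiv.symm.toAddMonoidHom.comp (unitR (RingHom.id S) β)

theorem equiv_transl (c : C) : G.equiv (G.transl c) = unitR (RingHom.id S) β c :=
  G.equiv.apply_symm_apply _

theorem transl_rsmul (s : S) (c : C) : G.transl (op (RingHom.id S s) • c) = op (β s) • G.transl c :=
  G.equiv.injective (by rw [equiv_rsmul, equiv_transl, equiv_transl, unitR_smul])

theorem transl_lsmul (s : S) (c : C) : G.transl (s • c) = β s • G.transl c :=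
  G.equiv.injective (by rw [equiv_lsmul, equiv_transl, equiv_transl]; rfl)

/-- The map `T → T ⊗_R P ⊗_S T` induced by the coaction. -/
noncomputable def γL : T →+ BTensor β β (BTensor α α T P) T :=
  (mapL (ψ := β) (φ := RingHom.id S) β G.transl G.transl_rsmul).comp G.coact

theorem γL_rsmul (r : R) (x : T) : G.γL (op (α r) • x) = op (α r) • G.γL x := by
  rw [γL, AddMonoidHom.comp_apply, G.rsmul, mapL_rsmul, AddMonoidHom.comp_apply]

theorem γL_lsmul (s : S) (x : T) : G.γL (β s • x) = β s • G.γL x := by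
  rw [γL, AddMonoidHom.comp_apply, G.lsmul, mapL_lsmul _ _ s (β s) (G.transl_lsmul s),
    AddMonoidHom.comp_apply]

theorem mapL_equiv_γL (x : T) : mapL (ψ := β) (φ := β) β G.equiv.toAddMonoidHom
    (fun s z => G.equiv_rsmul (β s) z) (G.γL x) =
      mapL (ψ := β) (φ := RingHom.id S) β (unitR (RingHom.id S) β) unitR_smul (G.coact x) :=
  mapL_mapL G.transl G.transl_rsmul _ _ _ _ G.equiv_transl _

/-- Under the canonical map, `coev` corresponds to `ε ⊗ B`. -/
theorem lact_mapL_counit (z : BTensor α α T P) :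
    lact (ψ := β) (φ := RingHom.id S) β (fun _ => rfl) (mapL (ψ := β) (φ := RingHom.id S)
      (RingHom.id S) K.counit K.counit_rsmul (G.equiv z)) = d.coev z := by
  induction z using induction_on with
  | zero => simp only [map_zero]
  | tmul x p =>
    rw [equiv_tmul, ← d.coevR_mapL, G.counit, d.coevR_tmul, lact_tmul, map_one, one_smul]
  | add x y hx hy => simp only [map_add, hx, hy]

theorem coev_transl (c : C) : d.coev (G.transl c) = β (K.counit c) := by
  rw [← G.lact_mapL_counit, equiv_transl, unitR_apply, mapL_tmul, lact_tmul, smul_eq_mul,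
    mul_one]

theorem coev_γL (x : T) : mapL (ψ := β) (φ := β) β d.coev (fun s z => d.coev_rsmul (β s) z) (G.γL x) =
    tmul β β 1 x := by
  have h := congrArg (mapL (ψ := β) (φ := RingHom.id S) (N := T) β β.toAddMonoidHom
    (fun s r => map_mul β r s)) (G.counit x)
  refine Eq.trans ?_ (h.trans (congrArg (tmul β β · x) (map_one β)))
  rw [γL, AddMonoidHom.comp_apply]
  generalize G.coact x = w
  induction w using induction_on with
  | zero => simp only [map_zero]
  | tmul c t => rw [mapL_tmul, mapL_tmul, coev_transl]; rfl
  | add x y hx hy => simp only [map_add, hx, hy]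

/-- Mirror of `RightGaloisCoaction.smulExtL_injective`: if `Σ ρ(xᵢ) aᵢ = 0`, then for each `p` the
canonical image of `Σ xᵢ ⊗ aᵢ p` vanishes. Here `hd` asks that `coev` be balanced over `A`. -/
theorem smulExtR_injective (hd : ∀ (p : P) (a : A) (x : T),
      d.coev (tmul α α x (a • p)) = d.coev (tmul α α (op a • x) p))
    (h1 : ∃ z, d.ev z = 1) : Function.Injective (smulExtR G.coact G.rsmul) := by
  refine (injective_iff_map_eq_zero _).2 fun w hw => d.eq_zero_of_actR_left h1 w fun p => ?_
  have hevR : ∀ (p : P) (a : A) (w : BTensor (RingHom.id S) β C T),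
      d.coevR (a • p) w = d.coevR p (op a • w) := fun p a w => by
    induction w using induction_on with
    | zero => simp only [smul_zero, map_zero]
    | tmul c t => rw [rsmul_tmul, d.coevR_tmul, d.coevR_tmul, hd]
    | add x y hx hy => rw [smul_add, map_add, map_add, hx, hy]
  have key : G.equiv (actR p w) = d.coevR p (smulExtR G.coact G.rsmul w) := by
    clear hw
    induction w using induction_on with
    | zero => simp only [map_zero]
    | tmul x a => rw [actR_tmul, equiv_tmul, smulExtR_tmul, hevR]
    | add x y hx hy => simp only [map_add, hx, hy]
  rw [hw, map_zero] at key
  exact (map_eq_zero_iff _ G.equiv.injective).1 key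

/-- Compare both sides under the injection `x ⊗ a ↦ ρ(x) a`, where `mapL_equiv_γL` computes the left
one. -/
theorem evMapR_γL (hd : ∀ (p : P) (a : A) (x : T),
      d.coev (tmul α α x (a • p)) = d.coev (tmul α α (op a • x) p))
    (h1 : ∃ z, d.ev z = 1) (x : T) : d.evMapR (G.γL x) = tmul α α x 1 := by
  refine G.smulExtR_injective hd h1 ?_
  rw [← d.absorbR_mapL_hatR, smulExtR_tmul, op_one, one_smul]
  exact (congrArg absorbR (G.mapL_equiv_γL x)).trans (absorbR_unitR _)

section Ext

variable {Q X : Type u} [Ring Q] {ξ : S →+* Q} [AddCommGroup X] [Module Qᵐᵒᵖ X]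

/-- The canonical map `(X ⊗_S T) ⊗_R P → (X ⊗_S D) ⊗_S B`. -/
noncomputable def canExt : BTensor α α (BTensor ξ β X T) P →+
    BTensor (RingHom.id S) β (BTensor ξ (RingHom.id S) X C) B :=
  (d.coevMapR (υ := RingHom.id S)).comp (mapL (ψ := α) (φ := α) α (coactExtL G.coact G.lsmul ξ)
    (fun r w => coactExtL_rsmul (A := A) G.coact G.lsmul (α r) (fun x => G.rsmul r x) w))

theorem canExt_tmul (p : P) (w : BTensor ξ β X T) :
    G.canExt (tmul α α w p) = d.coevR p (coactExtL G.coact G.lsmul ξ w) := rfl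

theorem canExt_rsmul (b : B) (z : BTensor α α (BTensor ξ β X T) P) :
    G.canExt (op b • z) = op b • G.canExt z := by
  rw [canExt, AddMonoidHom.comp_apply, mapL_rsmul, d.coevMapR_rsmul, AddMonoidHom.comp_apply]

/-- The inverse of the canonical map. -/
noncomputable def canExtInv : BTensor (RingHom.id S) β (BTensor ξ (RingHom.id S) X C) B →+
    BTensor α α (BTensor ξ β X T) P :=
  (assoc (ψ₂ := α) (φ₂ := α) (ψ₁ := β) (φ₁ := ξ)).symm.toAddMonoidHom.comp
    ((mapR (ψ := RingHom.id S) (φ := ξ) β G.equiv.symm.toAddMonoidHom G.equiv_symm_lsmul).comp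
      (assoc (ψ₂ := β) (φ₂ := RingHom.id S) (ψ₁ := RingHom.id S) (φ₁ := ξ)).toAddMonoidHom)

theorem canExtInv_tmul_tmul (b : B) (c : C) (x : X) :
    G.canExtInv (ξ := ξ) (tmul _ _ (tmul _ _ x c) b) =
      assoc.symm (tmul ξ β x (G.equiv.symm (tmul _ _ c b))) := rfl

theorem canExtInv_rsmul (b : B)
    (z : BTensor (RingHom.id S) β (BTensor ξ (RingHom.id S) X C) B) :
    G.canExtInv (op b • z) = op b • G.canExtInv z := by
  induction z using induction_on with
  | zero => simp only [map_zero, smul_zero]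
  | tmul v b' =>
    induction v using induction_on with
    | zero => simp only [map_zero, smul_zero, zero_tmul]
    | tmul x c =>
      rw [rsmul_tmul, canExtInv_tmul_tmul, canExtInv_tmul_tmul, ← rsmul_tmul, equiv_symm_rsmul,
        ← rsmul_tmul, assoc_symm_rsmul]
    | add x y hx hy => rw [add_tmul, smul_add, map_add, map_add, smul_add, hx, hy]
  | add x y hx hy => simp only [map_add, smul_add, hx, hy]

theorem canExtInv_insL (x : X) (y : BTensor (RingHom.id S) β C B) :
    G.canExtInv (insL β ξ x y) = assoc.symm (tmul ξ β x (G.equiv.symm y)) := by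
  induction y using induction_on with
  | zero => simp only [map_zero, tmul_zero]
  | tmul c b => rfl
  | add x y hx hy => simp only [map_add, tmul_add, hx, hy]

theorem canExtInv_canExt (z : BTensor α α (BTensor ξ β X T) P) : G.canExtInv (G.canExt z) = z := by
  induction z using induction_on with
  | zero => simp only [map_zero]
  | tmul w p =>
    induction w using induction_on with
    | zero => simp only [map_zero, zero_tmul]
    | tmul x t =>
      have h : d.coevR p (insL β ξ x (G.coact t)) = insL β ξ x (d.coevR p (G.coact t)) :=
        d.coevR_mapL _ _ _ _
      rw [canExt_tmul, coactExtL_tmul, h, ← equiv_tmul, canExtInv_insL, AddEquiv.symm_apply_apply,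
        assoc_symm_tmul]
    | add x y hx hy => rw [add_tmul, map_add, map_add, hx, hy]
  | add x y hx hy => simp only [map_add, hx, hy]

theorem mapL_canExt_assocInvAux (w : X) (z : BTensor β β (BTensor α α T P) T) :
    mapL (ψ := β) (φ := β) β (G.canExt (ξ := ξ)) (fun s z => G.canExt_rsmul (β s) z)
      (mapL (ψ := β) (φ := β) β (assoc (ψ₂ := α) (φ₂ := α) (ψ₁ := β) (φ₁ := ξ)).symm.toAddMonoidHom
        (fun s z => assoc_symm_rsmul (β s) z) (assoc.symm (tmul ξ β w z))) =
    mapL (ψ := β) (φ := β) β (insL β ξ w) (fun s z => insL_rsmul w (β s) z)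
      (mapL (ψ := β) (φ := β) β G.equiv.toAddMonoidHom (fun s z => G.equiv_rsmul (β s) z) z) := by
  induction z using induction_on with
  | zero => simp only [map_zero, tmul_zero]
  | tmul v t =>
    induction v using induction_on with
    | zero => simp only [map_zero, tmul_zero, zero_tmul]
    | tmul y p =>
      refine congrArg (tmul β β · t) ?_
      change d.coevR p (insL β ξ w (G.coact y)) = insL β ξ w (d.coevR p (G.coact y))
      exact d.coevR_mapL _ _ _ _
    | add x y hx hy => simp only [map_add, tmul_add, add_tmul, hx, hy]
  | add x y hx hy => simp only [map_add, tmul_add, hx, hy]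

theorem mapL_canExt_mapR_γL (z : BTensor ξ β X T) :
    mapL (ψ := β) (φ := β) β (G.canExt (ξ := ξ)) (fun s z => G.canExt_rsmul (β s) z)
      (mapL (ψ := β) (φ := β) β (assoc (ψ₂ := α) (φ₂ := α) (ψ₁ := β) (φ₁ := ξ)).symm.toAddMonoidHom
        (fun s z => assoc_symm_rsmul (β s) z)
          (assoc.symm (mapR (ψ := β) (φ := ξ) β G.γL G.γL_lsmul z))) =
    mapL (ψ := β) (φ := RingHom.id S) β (unitR (RingHom.id S) β) unitR_smul
      (coactExtL G.coact G.lsmul ξ z) := by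
  induction z using induction_on with
  | zero => simp only [map_zero]
  | tmul w t =>
    rw [mapR_tmul, mapL_canExt_assocInvAux, mapL_equiv_γL, coactExtL_tmul]
    generalize G.coact t = w
    induction w using induction_on with
    | zero => simp only [map_zero]
    | tmul c t => rfl
    | add x y hx hy => simp only [map_add, hx, hy]
  | add x y hx hy => simp only [map_add, hx, hy]

end Ext

theorem mapL_transl_rsmul (s : S) (w : BTensor (RingHom.id S) (RingHom.id S) C C) :
    mapL (ψ := RingHom.id S) (φ := RingHom.id S) β G.transl G.transl_rsmul (op (RingHom.id S s) • w) =
      op (RingHom.id S s) • mapL (ψ := RingHom.id S) (φ := RingHom.id S) β G.transl G.transl_rsmul w :=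
  mapL_rsmul _ _ s w

/-- `(i ⊗ D) ∘ Δ`, where `i : D → T ⊗_R P` is the translation map. -/
noncomputable def comulTransl : C →+ BTensor β (RingHom.id S) (BTensor α α T P) C :=
  (mapL (ψ := RingHom.id S) (φ := RingHom.id S) β G.transl G.transl_rsmul).comp K.comul

theorem comulTransl_rsmul (s : S) (c : C) :
    G.comulTransl (op (RingHom.id S s) • c) = op (RingHom.id S s) • G.comulTransl c :=
  (congrArg _ (K.comul_rsmul s c)).trans (G.mapL_transl_rsmul s _)

theorem coactExtL_γL (x : T) : coactExtL G.coact G.lsmul β (G.γL x) =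
    mapL (ψ := β) (φ := RingHom.id S) (RingHom.id S) G.comulTransl G.comulTransl_rsmul
      (G.coact x) := by
  refine (coactExtL_mapL (ξ := RingHom.id S) (ξ' := β) G.coact G.lsmul G.transl G.transl_rsmul
    (G.coact x)).trans ?_
  rw [← G.comul]
  exact mapL_mapL _ _ _ _ _ _ (fun _ => rfl) _

theorem canExt_mapL_γL (z : BTensor α α T P) :
    G.canExt (mapL (ψ := α) (φ := α) α G.γL G.γL_rsmul z) =
      mapL (ψ := β) (φ := RingHom.id S) (RingHom.id S) G.comulTransl G.comulTransl_rsmul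
        (G.equiv z) := by
  induction z using induction_on with
  | zero => simp only [map_zero]
  | tmul x p => rw [mapL_tmul, canExt_tmul, coactExtL_γL, d.coevR_mapL, equiv_tmul]
  | add x y hx hy => simp only [map_add, hx, hy]

theorem mapL_canExt_mapL_mapL_γL (x : T) :
    mapL (ψ := β) (φ := β) β (G.canExt (ξ := β)) (fun s z => G.canExt_rsmul (β s) z)
      (mapL (ψ := β) (φ := β) β (mapL (ψ := α) (φ := α) α G.γL G.γL_rsmul)
        (fun s z => mapL_rsmul _ _ (β s) z) (G.γL x)) =
    mapL (ψ := β) (φ := RingHom.id S) β (unitR (RingHom.id S) β) unitR_smul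
      (coactExtL G.coact G.lsmul β (G.γL x)) := by
  rw [coactExtL_γL]
  generalize hz : G.coact x = z
  have hγ : G.γL x = mapL (ψ := β) (φ := RingHom.id S) β G.transl G.transl_rsmul z := by
    rw [← hz]; rfl
  rw [hγ]
  clear hγ hz
  induction z using induction_on with
  | zero => simp only [map_zero]
  | tmul c t =>
    rw [mapL_tmul, mapL_tmul, mapL_tmul, canExt_mapL_γL, equiv_transl, unitR_apply, mapL_tmul,
      mapL_tmul, mapL_tmul, unitR_apply]
  | add x y hx hy => simp only [map_add, hx, hy]

/-- After the extended canonical map, which is injective with a right `B`-linear retraction, both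
sides become `(T ⊗ P ⊗ ρ) γ(x)` with a unit inserted. -/
theorem coassoc_γL (x : T) :
    mapL (ψ := β) (φ := β) β (assoc (ψ₂ := α) (φ₂ := α) (ψ₁ := β) (φ₁ := β)).symm.toAddMonoidHom
        (fun s z => assoc_symm_rsmul (β s) z)
        (assoc.symm (mapR (ψ := β) (φ := β) β G.γL G.γL_lsmul (G.γL x))) =
      mapL (ψ := β) (φ := β) β (mapL (ψ := α) (φ := α) α G.γL G.γL_rsmul)
        (fun s z => mapL_rsmul _ _ (β s) z) (G.γL x) :=
  mapL_injective_of_retraction (G.canExt (ξ := β))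
    (fun s z => G.canExt_rsmul (β s) z) G.canExtInv (fun s z => G.canExtInv_rsmul (β s) z)
    G.canExtInv_canExt ((G.mapL_canExt_mapR_γL (G.γL x)).trans (G.mapL_canExt_mapL_mapL_γL x).symm)

/-- The map `T → T ⊗_R (P ⊗_S T)` induced by the coaction. -/
noncomputable def γ : T →+ BTensor α α T (BTensor β β P T) := assoc.toAddMonoidHom.comp G.γL

theorem γ_apply (x : T) : G.γ x = assoc (G.γL x) := rfl

theorem γ_lsmul (s : S) (x : T) : G.γ (β s • x) = β s • G.γ x := by
  rw [γ_apply, γ_apply, γL_lsmul, assoc_lsmul]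

theorem γ_rsmul (r : R) (x : T) : G.γ (op (α r) • x) = op (α r) • G.γ x := by
  rw [γ_apply, γ_apply, γL_rsmul]
  exact ((AddEquiv.symm_apply_eq _).1 (by rw [assoc_symm_rsmul, AddEquiv.symm_apply_apply])).symm

set_option maxHeartbeats 1000000 in
/-- The shepherd given by a Galois coaction. -/
noncomputable def shepherd (hd : ∀ (p : P) (a : A) (x : T),
      d.coev (tmul α α x (a • p)) = d.coev (tmul α α (op a • x) p))
    (h1 : ∃ z, d.ev z = 1) : Shepherd d where
  γ := G.γ
  γ_rsmul := G.γ_rsmul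
  γ_lsmul := G.γ_lsmul
  coev_γ x := by rw [γ_apply, AddEquiv.symm_apply_apply, coev_γL]
  ev_γ x := by
    rw [← G.evMapR_γL hd h1 x, γ_apply]
    generalize G.γL x = z
    induction z using induction_on with
    | zero => simp only [map_zero]
    | tmul w t =>
      induction w using induction_on with
      | zero => simp only [map_zero, zero_tmul]
      | tmul x p => rfl
      | add x y hx hy => simp only [map_add, add_tmul, hx, hy]
    | add x y hx hy => simp only [map_add, hx, hy]
  coassoc x := by
    -- Coassociativity was proved with all parentheses on the left; three reassociations bring it to
    -- the bracketing of the axiom, where the two sides appear in the opposite order.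
    have h := congrArg (fun z => assoc (assoc (assoc z))) (G.coassoc_γL x)
    refine Eq.trans ?_ (h.symm.trans ?_)
    · rw [γ_apply]
      generalize G.γL x = z
      induction z using induction_on with
      | zero => simp only [map_zero]
      | tmul w t =>
        rw [mapL_tmul]
        induction w using induction_on with
        | zero => simp only [zero_tmul, map_zero]
        | tmul y p =>
          rw [assoc_tmul, mapL_tmul, mapL_tmul, γ_apply]
          generalize G.γL y = z
          induction z using induction_on with
          | zero => simp only [map_zero, zero_tmul]
          | tmul v t =>
            induction v using induction_on with
            | zero => simp only [map_zero, zero_tmul]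
            | tmul y p => rfl
            | add x y hx hy => simp only [map_add, add_tmul, hx, hy]
          | add x y hx hy => simp only [map_add, add_tmul, hx, hy]
        | add x y hx hy => simp only [map_add, add_tmul, hx, hy]
      | add x y hx hy => simp only [map_add, hx, hy]
    · rw [γ_apply]
      generalize G.γL x = z
      induction z using induction_on with
      | zero => simp only [map_zero]
      | tmul w t =>
        rw [mapR_tmul]
        induction w using induction_on with
        | zero => simp only [zero_tmul, map_zero]
        | tmul y p =>
          rw [assoc_tmul, mapR_tmul, mapR_tmul, γ_apply]
          generalize G.γL t = z
          induction z using induction_on with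
          | zero => simp only [map_zero, tmul_zero]
          | tmul v t =>
            induction v using induction_on with
            | zero => simp only [map_zero, tmul_zero, zero_tmul]
            | tmul y p => rfl
            | add x y hx hy => simp only [map_add, add_tmul, tmul_add, hx, hy]
          | add x y hx hy => simp only [map_add, tmul_add, hx, hy]
        | add x y hx hy => simp only [add_tmul, map_add, hx, hy]
      | add x y hx hy => simp only [map_add, hx, hy]

end LeftGaloisCoaction

end Herd

/-! ### Recovering the coaction of `D` from a comodule over `D ⊗_S B` -/

namespace LeftEntwining

variable {S B C : Type u} [Ring S] [Ring B] [AddCommGroup C] [Module Sᵐᵒᵖ C]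
  [Module S C] [SMulCommClass S Sᵐᵒᵖ C] {β : S →+* B} {K : Coring S C} (E : LeftEntwining β K)
  {M : Type u} [AddCommGroup M] [Module B M]

theorem of_symm_lsmul (s : S) (z : E.Cor) : E.of.symm (β s • z) = s • E.of.symm z :=
  E.β_smul s z

theorem collapse_lsmul (s : S) (z : BTensor (RingHom.id B) (RingHom.id B) E.Cor M) :
    E.collapse (β s • z) = s • E.collapse z := by
  induction z using induction_on with
  | zero => simp only [smul_zero, map_zero]
  | tmul z t => rw [lsmul_tmul, collapse_tmul, collapse_tmul, of_symm_lsmul, lsmul_actR]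
  | add x y hx hy => simp only [smul_add, map_add, hx, hy]

theorem collapse_rsmul {A : Type u} [Ring A] [Module Aᵐᵒᵖ M] [SMulCommClass B Aᵐᵒᵖ M] (a : A)
    (z : BTensor (RingHom.id B) (RingHom.id B) E.Cor M) :
    E.collapse (op a • z) = op a • E.collapse z := by
  induction z using induction_on with
  | zero => simp only [smul_zero, map_zero]
  | tmul z t => rw [rsmul_tmul, collapse_tmul, collapse_tmul, smul_actR]
  | add x y hx hy => simp only [smul_add, map_add, hx, hy]

/-- `(c' ⊗ b') ⊗ (c ⊗ b) ↦ c' ⊗ χ(b' ⊗ c) b` -/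
def merge : BTensor (RingHom.id B) (RingHom.id B) E.Cor E.Cor →+
    BTensor (RingHom.id S) β (BTensor (RingHom.id S) (RingHom.id S) C C) B :=
  (assoc (ψ₂ := β) (φ₂ := RingHom.id S) (ψ₁ := RingHom.id S)
    (φ₁ := RingHom.id S)).symm.toAddMonoidHom.comp
    ((mapR (ψ := β) (φ := RingHom.id S) (RingHom.id S) E.of.symm.toAddMonoidHom
      E.of_symm_lsmul).comp E.collapse)

theorem merge_apply (z : BTensor (RingHom.id B) (RingHom.id B) E.Cor E.Cor) :
    E.merge z = assoc.symm (mapR (ψ := β) (φ := RingHom.id S) (RingHom.id S) E.of.symm.toAddMonoidHom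
      E.of_symm_lsmul (E.collapse z)) := rfl

theorem merge_rsmul (b : B) (z : BTensor (RingHom.id B) (RingHom.id B) E.Cor E.Cor) :
    E.merge (op b • z) = op b • E.merge z := by
  rw [merge_apply, merge_apply, collapse_rsmul]
  exact (congrArg assoc.symm (mapR_rsmul E.of.symm.toAddMonoidHom E.of_symm_lsmul b b
    (fun _ => rfl) _)).trans (assoc_symm_rsmul b _)

theorem merge_incl₂ (w : BTensor (RingHom.id S) (RingHom.id S) C C) :
    E.merge (E.incl₂ 1 w) = tmul (RingHom.id S) β w 1 := by
  induction w using induction_on with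
  | zero => rw [map_zero, map_zero, zero_tmul]
  | tmul c' c =>
    rw [incl₂_tmul, merge_apply, collapse_tmul]
    refine (congrArg (fun y => assoc.symm (mapR (ψ := β) (φ := RingHom.id S) (RingHom.id S)
      E.of.symm.toAddMonoidHom E.of_symm_lsmul y)) (actR_tmul_one c' (E.mkCor c 1))).trans ?_
    rfl
  | add x y hx hy => rw [map_add, map_add, add_tmul, hx, hy]

/-- The inverse of `expand₂`. -/
def collapse₂ : BTensor (RingHom.id B) (RingHom.id B) (BTensor (RingHom.id B) (RingHom.id B) E.Cor E.Cor)
      M →+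
    BTensor (RingHom.id S) β (BTensor (RingHom.id S) (RingHom.id S) C C) M :=
  lift (biadd (fun w t => actR t (E.merge w)) (fun w w' t => by rw [map_add, map_add])
    (fun w t t' => add_actR t t' _)) (fun b w t => by
      rw [biadd_apply, biadd_apply, RingHom.id_apply, merge_rsmul, actR_smul])

theorem collapse₂_expand₂
    (z : BTensor (RingHom.id S) β (BTensor (RingHom.id S) (RingHom.id S) C C) M) :
    E.collapse₂ (E.expand₂ z) = z := by
  induction z using induction_on with
  | zero => rw [map_zero, map_zero]
  | tmul w t =>
    rw [expand₂_tmul]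
    change actR t (E.merge (E.incl₂ 1 w)) = _
    rw [merge_incl₂, actR_tmul_one]
  | add x y hx hy => rw [map_add, map_add, hx, hy]

section Comodule

variable (ρ : LeftComodule E.coring M)

/-- The coaction of `D` underlying a comodule over `D ⊗_S B`. -/
def coactC : M →+ BTensor (RingHom.id S) β C M := E.collapse.comp ρ.coact

theorem expand_coactC (x : M) : E.expand (E.coactC ρ x) = ρ.coact x :=
  E.expand_collapse _

theorem coactC_lsmul (s : S) (x : M) : E.coactC ρ (β s • x) = s • E.coactC ρ x := by
  rw [coactC, AddMonoidHom.comp_apply, AddMonoidHom.comp_apply, ρ.coact_lsmul, collapse_lsmul]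

/-- After the injection `expand₂` both sides become the two sides of coassociativity of the comodule
over `B`. -/
theorem mapL_comul_coactC (x : M) :
    mapL (ψ := β) (φ := RingHom.id S) (RingHom.id S) K.comul K.comul_rsmul (E.coactC ρ x) =
      coactExtL (E.coactC ρ) (E.coactC_lsmul ρ) (RingHom.id S) (E.coactC ρ x) := by
  refine Function.LeftInverse.injective E.collapse₂_expand₂ ?_
  have hcomp : E.expand.comp (E.coactC ρ) = ρ.coact := AddMonoidHom.ext (E.expand_coactC ρ)
  have hl : ∀ (b : B) x, (E.expand.comp (E.coactC ρ)) (b • x) =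
      b • (E.expand.comp (E.coactC ρ)) x := fun b x => by rw [hcomp, ρ.coact_lsmul]
  rw [← mapL_comul_expand, ← E.assoc_mapR_expand (E.coactC ρ) (E.coactC_lsmul ρ) hl, expand_coactC]
  refine ((AddEquiv.eq_symm_apply _).2 (ρ.coassoc x)).trans (congrArg assoc.symm ?_)
  exact mapR_congr (fun x => (E.expand_coactC ρ x).symm) _

theorem mapL_counit_coactC (x : M) :
    mapL (ψ := β) (φ := RingHom.id S) (RingHom.id S) K.counit K.counit_rsmul (E.coactC ρ x) =
      tmul (RingHom.id S) β 1 x := by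
  have h := (E.lact_counit_expand (E.coactC ρ x)).symm
  rw [expand_coactC] at h
  have h2 : ∀ w : BTensor (RingHom.id S) β S M,
      w = tmul (RingHom.id S) β 1 (lact (ψ := β) (φ := RingHom.id S) β (fun _ => rfl) w) :=
    fun w => by
      induction w using induction_on with
      | zero => rw [map_zero, tmul_zero]
      | tmul s t => rw [lact_tmul, ← smul_tmul, RingHom.id_apply, op_smul_eq_mul, one_mul]
      | add x y hx hy => rw [map_add, tmul_add, ← hx, ← hy]
  rw [h2 (mapL _ _ _ _), h]
  exact congrArg (tmul (RingHom.id S) β 1 ·) (ρ.counit x)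

end Comodule

end LeftEntwining

/-! ### From a left Galois comodule to a herd -/

section Herd

variable {R S A B : Type u} [Ring R] [Ring S] [Ring A] [Ring B] {α : R →+* A} {β : S →+* B}
  {T : Type u} [AddCommGroup T] [Module B T] [Module Aᵐᵒᵖ T] [SMulCommClass B Aᵐᵒᵖ T]
  {P : Type u} [AddCommGroup P] [Module A P] [Module Bᵐᵒᵖ P] [SMulCommClass A Bᵐᵒᵖ P]
  {C : Type u} [AddCommGroup C] [Module Sᵐᵒᵖ C] [Module S C] [SMulCommClass S Sᵐᵒᵖ C]
  {K : Coring S C}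

theorem LeftEntwining.coactC_rsmul (E : LeftEntwining β K) (ρ : LeftComodule E.coring T)
    (h : ∀ r, ρ.IsColinear (rmulEnd B (α r))) (r : R) (x : T) :
    E.coactC ρ (op (α r) • x) = op (α r) • E.coactC ρ x := by
  have h2 : ρ.coact (op (α r) • x) = op (α r) • ρ.coact x := h r x
  rw [coactC, AddMonoidHom.comp_apply, AddMonoidHom.comp_apply, h2, collapse_rsmul]

/-- Both endomorphisms are `y ↦ x a p(y)`. This is the balancedness over `A` that the construction
of the shepherd asks for. -/
theorem standardDual_coev_tmul_smul
    (hB : Function.Bijective (Module.toModuleEnd Aᵐᵒᵖ T : B →+* Module.End Aᵐᵒᵖ T))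
    (p : RDual A T) (a : A) (x : T) : (standardDual α β hB).coev (tmul α α x (a • p)) =
      (standardDual α β hB).coev (tmul α α (op a • x) p) :=
  eq_of_smul_eq hB fun y => by
    rw [FormalDual.coev_smul, FormalDual.coev_smul, ← lsmul_tmul, FormalDual.ev_lsmul,
      smul_eq_mul, op_mul, mul_smul]

/-- A left Galois comodule over an entwined coring gives a Galois coaction. -/
noncomputable def LeftComodule.IsGalois.galoisCoaction {E : LeftEntwining β K}
    {ρ : LeftComodule E.coring T} (h : ρ.IsGalois α) (d : FormalDual α β T P)
    (hd : ∃ z, d.ev z = 1) : LeftGaloisCoaction d K where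
  coact := E.coactC ρ
  rsmul := E.coactC_rsmul ρ h.colinear
  lsmul := E.coactC_lsmul ρ
  comul := E.mapL_comul_coactC ρ
  counit := E.mapL_counit_coactC ρ
  bijective := by
    have hθ := d.toLDual_bijective hd
    let θ := AddEquiv.ofBijective d.toLDual hθ
    have hθ' : ∀ (r : R) f, θ.symm (α r • f) = α r • θ.symm f := fun r f => by
      rw [AddEquiv.symm_apply_eq]
      exact (congrArg (α r • ·) (θ.apply_symm_apply f).symm).trans
        (d.toLDual_lsmul r _).symm
    -- The pen is `Hom_A(T, A)`, whereas the canonical map involves `Hom_B(T, B)`. The two are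
    -- identified by `p ↦ coev(- ⊗ p)`, which is bijective because `ev` reaches `1`.
    have hΘ : Function.Bijective (mapR (ψ := α) (φ := α) (M := T) α d.toLDual d.toLDual_lsmul) := by
      refine Function.bijective_iff_has_inverse.2
        ⟨mapR (ψ := α) (φ := α) α θ.symm.toAddMonoidHom hθ', fun z => ?_, fun z => ?_⟩
      · induction z using induction_on with
        | zero => simp only [map_zero]
        | tmul x f => exact congrArg (tmul α α x ·) (θ.symm_apply_apply f)
        | add x y hx hy => simp only [map_add, hx, hy]
      · induction z using induction_on with
        | zero => simp only [map_zero]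
        | tmul x f => exact congrArg (tmul α α x ·) (θ.apply_symm_apply f)
        | add x y hx hy => simp only [map_add, hx, hy]
    have key : ∀ z, E.of (d.hatR (E.coactC ρ) (E.coactC_rsmul ρ h.colinear) z) =
        ρ.can α h.colinear (mapR (ψ := α) (φ := α) α d.toLDual d.toLDual_lsmul z) := fun z => by
      induction z using induction_on with
      | zero => simp only [map_zero]
      | tmul x p =>
        change E.of (d.coevR p (E.coactC ρ x)) =
          LeftComodule.evalAct (d.toLDual p) (ρ.coact x)
        rw [← E.expand_coactC ρ x]
        generalize E.coactC ρ x = w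
        induction w using induction_on with
        | zero => simp only [map_zero]
        | tmul c t =>
          rw [LeftEntwining.expand_tmul, LeftComodule.evalAct_tmul, LeftEntwining.op_smul_mkCor,
            one_mul]
          rfl
        | add x y hx hy => simp only [map_add, hx, hy]
      | add x y hx hy => simp only [map_add, hx, hy]
    refine (E.of.bijective.of_comp_iff' _).1 ?_
    exact (funext key : ⇑E.of ∘ _ = ⇑(ρ.can α h.colinear) ∘ _) ▸ h.can_bijective.comp hΘ

theorem IsLeftEntwinedGalois.isHerd (hT : IsProgenerator A T)
    (hB : Function.Bijective (Module.toModuleEnd Aᵐᵒᵖ T : B →+* Module.End Aᵐᵒᵖ T))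
    (h : IsLeftEntwinedGalois α β T) : IsHerd α β T := by
  obtain ⟨C, _, _, _, _, K, E, ρ, hρ⟩ := h
  exact ⟨RDual A T, _, _, _, _, standardDual α β hB,
    ⟨(hρ.galoisCoaction _ (standardDual_exists_ev_eq_one hB hT)).shepherd
      (standardDual_coev_tmul_smul hB) (standardDual_exists_ev_eq_one hB hT)⟩⟩

end Herd

end BimodHerd

/-! ### The equivalences -/

theorem mainTheorem1 {R S A B : Type u} [Ring R] [Ring S] [Ring A] [Ring B]
    (α : R →+* A) (β : S →+* B)
    (T : Type u) [AddCommGroup T] [Module B T] [Module Aᵐᵒᵖ T] [SMulCommClass B Aᵐᵒᵖ T]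
    (hT : BimodHerd.IsProgenerator A T)
    (hB : Function.Bijective (Module.toModuleEnd Aᵐᵒᵖ T : B →+* Module.End Aᵐᵒᵖ T)) :
    (BimodHerd.RightFaithfullyFlat α A ∧ BimodHerd.LeftFaithfullyFlat β B →
      List.TFAE [BimodHerd.IsHerd α β T, BimodHerd.IsTameHerd α β T,
        BimodHerd.IsRightEntwinedGalois α β T, BimodHerd.IsLeftEntwinedGalois α β T]) ∧
    (BimodHerd.IsSplitExtension α ∧ BimodHerd.IsSplitExtension β →
      List.TFAE [BimodHerd.IsHerd α β T,
        BimodHerd.IsRightEntwinedGalois α β T, BimodHerd.IsLeftEntwinedGalois α β T]) := by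
  refine ⟨fun ⟨hα, hβ⟩ => ?_, fun ⟨hα, hβ⟩ => ?_⟩
  -- Any pen of a herd already witnesses tameness, so the formal dual and the shepherd are kept.
  · tfae_have 1 → 2 := fun ⟨P, i₁, i₂, i₃, i₄, d, ⟨σ⟩⟩ => by
      have h1 := σ.exists_ev_eq_one hT
      have h2 := σ.exists_coev_eq_one hT hB
      exact ⟨⟨P, i₁, i₂, i₃, i₄, d, ⟨σ⟩, d.surjective_ev h1, d.surjective_coev h2⟩,
        d.rightFaithfullyFlat hα h1 h2, d.leftFaithfullyFlat hβ h1 h2⟩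
    tfae_have 2 → 1 := fun ⟨⟨P, i₁, i₂, i₃, i₄, d, hσ, _⟩, _⟩ => ⟨P, i₁, i₂, i₃, i₄, d, hσ⟩
    tfae_have 1 → 3 :=
      fun h => h.isRightEntwinedGalois hα.rightDescent hβ.leftDescent hT hB
    tfae_have 3 → 1 := fun h => h.isHerd hT hB
    tfae_have 1 → 4 := fun h => h.isLeftEntwinedGalois hα.rightDescent hβ.leftDescent hT
    tfae_have 4 → 1 := fun h => h.isHerd hT hB
    tfae_finish
  · tfae_have 1 → 2 :=
      fun h => h.isRightEntwinedGalois hα.rightDescent hβ.leftDescent hT hB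
    tfae_have 2 → 1 := fun h => h.isHerd hT hB
    tfae_have 1 → 3 := fun h => h.isLeftEntwinedGalois hα.rightDescent hβ.leftDescent hT
    tfae_have 3 → 1 := fun h => h.isHerd hT hB
    tfae_finish
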